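/- Let $\mathfrak g$ be a complex simple Lie algebra of type $A_{2n-1}$ ($n\ge 2$), $A_{2n}$ ($n\ge 1$) or $D_{n+1}$ ($n\ge 2$, with $D_3=A_3$), realized as traceless matrices $\mathfrak{sl}_N$, $N=2n$ or $2n+1$, or as the orthogonal algebra $\mathfrak{so}_{2n+2}$ of the symmetric form with ones on the antidiagonal. Let $\mathfrak h$ and $\mathfrak n^+$ be the diagonal and the strictly upper triangular matrices in $\mathfrak g$, and let $\sigma$ be the diagram automorphism of order two: $\sigma(x)=-Sx^{T}S^{-1}$ in type $A$, where $S$ is the antidiagonal matrix with entries $1,-1,1,\dots$, and conjugation by the permutation matrix swapping the two middle coordinates in type $D$. For $\epsilon\in\{0,1\}$ put $\mathfrak g_\epsilon=\{x:\sigma(x)=(-1)^\epsilon x\}$, $\mathfrak h_\epsilon=\mathfrak h\cap\mathfrak g_\epsilon$, $\mathfrak n^+_\epsilon=\mathfrak n^+\cap\mathfrak g_\epsilon$. Then $\mathfrak g_0$ is of type $C_n$, $B_n$, $B_n$ respectively; let $I_0=\{1,\dots,n\}$ index its simple roots $\alpha_i$ and fundamental weights $\omega_i$ (with respect to $\mathfrak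 h_0$, Bourbaki numbering), put $\omega_0=0$, and let $P_0^+=\bigoplus_i\mathbb Z_{\ge0}\,\omega_i$. For $\mu=\sum_i\mu_i\omega_i\in P_0^+$ let $V(\mu)$ be the irreducible finite-dimensional $\mathfrak g_0$-module of highest weight $\mu$, i.e. the module generated by $v_\mu$ with defining relations $\mathfrak n_0^+v_\mu=0$, $hv_\mu=\mu(h)v_\mu$ $(h\in\mathfrak h_0)$, $(x^-_{\alpha_i})^{\mu_i+1}v_\mu=0$ $(i\in I_0)$. Here $x^-_{\alpha_i}$ is a nonzero element of weight $-\alpha_i$ in $\mathfrak g_0$; let $y^-_{\alpha_i}$ be a nonzero element of weight $-\alpha_i$ in $\mathfrak g_1$ if there is one, and $y^-_{\alpha_i}=0$ otherwise. Let $\mathfrak g[t]^\sigma=\mathfrak g_0\otimes\mathbb C[t^2]\oplus\mathfrak g_1\otimes t\,\mathbb C[t^2]$ be the Lie algebra of fixed points of $x\otimes t^r\mapsto\sigma(x)\otimes(-t)^r$ on $\mathfrak g\otimes\mathbb C[t]$, and $\mathfrak n^+[t]^\sigma=\mathfrak n^+_0\otimes\mathbb C[t^2]\oplus\mathfrak n^+_1\otimes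 t\,\mathbb C[t^2]$. For $i\in I_0$ and an integer $m\ge0$ let $KR^\sigma(m\omega_i)$ be the $\mathfrak g[t]^\sigma$-module generated by an element $v$ with defining relations $$\mathfrak n^+[t]^\sigma v=0,\quad hv=m\omega_i(h)v\ (h\in\mathfrak h_0),\quad (h\otimes t^{2r-\epsilon})v=0\ (\epsilon\in\{0,1\},\ h\in\mathfrak h_\epsilon,\ r\ge1),$$ $$x^-_{\alpha_j}v=0\ (j\ne i),\quad (x^-_{\alpha_i})^{m+1}v=0,\quad (x^-_{\alpha_i}\otimes t^2)v=(y^-_{\alpha_i}\otimes t)v=0 .$$ It is a $\mathfrak g_0$-module through $\mathfrak g_0=\mathfrak g_0\otimes1$. Set $d_i^\sigma=1$ if $\mathfrak g$ is of type $A_{2n-1}$ or $D_{n+1}$; in type $A_{2n}$ set $d_i^\sigma=2$ for $i<n$ and $d_n^\sigma=4$. Define finite sets $P_0^+(i,m)^\sigma\subset P_0^+$ by $P_0^+(i,m)^\sigma=\{m\omega_i\}$ for $0\le m<d_i^\sigma$, by $$P_0^+(i,d_i^\sigma)^\sigma=\begin{cases}\{\omega_j:0\le j\le i,\ j\equiv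 i \bmod 2\}& A_{2n-1},\\ \{2\omega_j:0\le j\le i\}& A_{2n},\ i<n,\\ \{4\omega_n\}\cup\{2\omega_j:0\le j<n\}& A_{2n},\ i=n,\\ \{\omega_j:0\le j\le i\}& D_{n+1},\ i<n,\\ \{\omega_n\}& D_{n+1},\ i=n,\end{cases}$$ and by $P_0^+(i,m)^\sigma=P_0^+(i,d_i^\sigma)^\sigma+P_0^+(i,m-d_i^\sigma)^\sigma$ for $m>d_i^\sigma$. **Proposition.** For all $i\in I_0$ and all integers $m\ge0$ there are $m_\mu\in\{0,1\}$ such that $$KR^\sigma(m\omega_i)\;\cong\;\bigoplus_{\mu\in P_0^+(i,m)^\sigma}V(\mu)^{m_\mu}$$ as $\mathfrak g_0$-modules. In particular $KR^\sigma(m\omega_i)$ is finite-dimensional. -/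

import Mathlib

open scoped TensorProduct Polynomial DirectSum

attribute [local instance 100] LieRing.ofAssociativeRing

noncomputable section

namespace TwistedKR

/-! ### Twisted current algebras -/

section Current

variable {L : Type} [LieRing L] [LieAlgebra ℂ L]

/-- The Lie subalgebra of fixed points of a Lie algebra endomorphism. -/
def fixedPoints (φ : L →ₗ⁅ℂ⁆ L) : LieSubalgebra ℂ L where
  carrier := {x | φ x = x}
  add_mem' := by
    intro a b ha hb
    change φ a = a at ha
    change φ b = b at hb
    change φ (a + b) = a + b
    rw [map_add, ha, hb]
  zero_mem' := by simp
  smul_mem' := by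
    intro c x hx
    change φ x = x at hx
    change φ (c • x) = c • x
    rw [map_smul, hx]
  lie_mem' := by
    intro x y hx hy
    change φ x = x at hx
    change φ y = y at hy
    change φ ⁅x, y⁆ = ⁅x, y⁆
    rw [LieHom.map_lie, hx, hy]

/-- `σ_t : L[t] → L[t]`, `x ⊗ t ^ r ↦ σ x ⊗ (-t) ^ r`, where `L[t]` is `ℂ[X] ⊗ L`. -/
def twist (σ : L →ₗ⁅ℂ⁆ L) : (ℂ[X] ⊗[ℂ] L) →ₗ⁅ℂ⁆ (ℂ[X] ⊗[ℂ] L) where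
  toLinearMap :=
    TensorProduct.map (Polynomial.aeval (-Polynomial.X : ℂ[X])).toLinearMap (σ : L →ₗ[ℂ] L)
  map_lie' := by
    intro x y
    simp only [AddHom.toFun_eq_coe, LinearMap.coe_toAddHom]
    induction x using TensorProduct.induction_on with
    | zero => simp
    | add a b ha hb => rw [add_lie, map_add, ha, hb, map_add, add_lie]
    | tmul p a =>
      induction y using TensorProduct.induction_on with
      | zero => simp
      | add a b ha hb => rw [lie_add, map_add, ha, hb, map_add, lie_add]
      | tmul q b => simp

/-- The twisted current algebra `L[t]^σ`. -/
abbrev twistedCurrent (σ : L →ₗ⁅ℂ⁆ L) : LieSubalgebra ℂ (ℂ[X] ⊗[ℂ] L) :=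
  fixedPoints (twist σ)

/-- The element `x ⊗ t ^ r` of `L[t]^σ`, where `σ x = (-1) ^ r x`. -/
def tpow (σ : L →ₗ⁅ℂ⁆ L) (r : ℕ) (x : L) (hx : σ x = (-1 : ℂ) ^ r • x) :
    twistedCurrent σ :=
  ⟨(Polynomial.X ^ r : ℂ[X]) ⊗ₜ[ℂ] x, by
    change TensorProduct.map _ _ _ = _
    rw [TensorProduct.map_tmul]
    simp only [AlgHom.toLinearMap_apply, map_pow, Polynomial.aeval_X]
    change ((-Polynomial.X : ℂ[X]) ^ r) ⊗ₜ[ℂ] (σ x) = _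
    rw [hx, TensorProduct.tmul_smul, ← neg_one_smul ℂ (Polynomial.X : ℂ[X]), smul_pow,
      TensorProduct.smul_tmul', smul_smul, ← mul_pow]
    simp⟩

/-- The inclusion `x ↦ x ⊗ 1` of the fixed point algebra of `σ` in `L[t]^σ`. -/
def constHom (σ : L →ₗ⁅ℂ⁆ L) : fixedPoints σ →ₗ⁅ℂ⁆ twistedCurrent σ where
  toFun x := tpow σ 0 x.1 (by
    have h : σ x.1 = x.1 := x.2
    simpa using h)
  map_add' x y := by
    apply Subtype.ext
    simp [tpow, TensorProduct.tmul_add]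
  map_smul' c x := by
    apply Subtype.ext
    simp [tpow]
  map_lie' := by
    intro x y
    apply Subtype.ext
    simp [tpow]

end Current

/-! ### Modules given by one generator and relations -/

section Cyclic

variable (L : Type) [LieRing L] [LieAlgebra ℂ L]

/-- The `L`-module with one generator and defining relations `u v = 0` for `u ∈ rels`. -/
abbrev Cyclic (rels : Set (UniversalEnvelopingAlgebra ℂ L)) : Type :=
  UniversalEnvelopingAlgebra ℂ L ⧸
    Submodule.span (UniversalEnvelopingAlgebra ℂ L) rels

variable {L} (M : Type) [AddCommGroup M] [Module ℂ M] [Module (UniversalEnvelopingAlgebra ℂ L) M]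
  [IsScalarTower ℂ (UniversalEnvelopingAlgebra ℂ L) M]

/-- A module over the enveloping algebra of `L`, regarded as a module over a Lie algebra `L'` by
means of `f : L' → L`. -/
@[reducible] def lieRingModuleOfHom {L' : Type} [LieRing L'] [LieAlgebra ℂ L'] (f : L' →ₗ⁅ℂ⁆ L) :
    LieRingModule L' M :=
  letI := LieRingModule.ofAssociativeModule (A := UniversalEnvelopingAlgebra ℂ L) (M := M)
  LieRingModule.compLieHom M ((UniversalEnvelopingAlgebra.ι ℂ).comp f)

theorem lieModuleOfHom {L' : Type} [LieRing L'] [LieAlgebra ℂ L'] (f : L' →ₗ⁅ℂ⁆ L) :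
    letI := lieRingModuleOfHom M f
    LieModule ℂ L' M :=
  letI := LieRingModule.ofAssociativeModule (A := UniversalEnvelopingAlgebra ℂ L) (M := M)
  letI : LieModule ℂ (UniversalEnvelopingAlgebra ℂ L) M := LieModule.ofAssociativeModule
  LieModule.compLieHom M ((UniversalEnvelopingAlgebra.ι ℂ).comp f)

end Cyclic

/-! ### The Lie algebras of type `A_{2n-1}`, `A_{2n}`, `D_{n+1}` with their diagram automorphism -/

/-- The three families: for a given rank `n` of the fixed point algebra, `AOdd`, `AEven` and `D`
stand for a Lie algebra of type `A_{2n-1}`, `A_{2n}` and `D_{n+1}`. -/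
inductive TwistedType where
  | AOdd
  | AEven
  | D

/-- The smallest rank for which the type makes sense: `A_3`, `A_2`, `D_3`. -/
def TwistedType.minRank : TwistedType → ℕ
  | .AOdd => 2
  | .AEven => 1
  | .D => 2

/-- The size of the matrices in the standard realization. -/
abbrev size : TwistedType → ℕ → ℕ
  | .AOdd, n => 2 * n
  | .AEven, n => 2 * n + 1
  | .D, n => 2 * n + 2

/-- The matrix with ones on the antidiagonal and zeros elsewhere. -/
def antidiag (N : ℕ) : Matrix (Fin N) (Fin N) ℂ :=
  Matrix.of fun a b => if b = a.rev then 1 else 0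

/-- `𝔤`: the algebra `𝔰𝔩` of traceless matrices in type `A`, and in type `D` the orthogonal algebra
of the symmetric form with ones on the antidiagonal. -/
def ambient : (X : TwistedType) → (n : ℕ) →
    LieSubalgebra ℂ (Matrix (Fin (size X n)) (Fin (size X n)) ℂ)
  | .AOdd, n => LieAlgebra.SpecialLinear.sl (Fin (2 * n)) ℂ
  | .AEven, n => LieAlgebra.SpecialLinear.sl (Fin (2 * n + 1)) ℂ
  | .D, n => skewAdjointMatricesLieSubalgebra (antidiag (2 * n + 2))

/-- The map `x ↦ -S xᵀ S⁻¹` on `N × N` matrices, where `S` is the matrix with the alternating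
entries `1, -1, 1, …` on the antidiagonal. It sends the matrix unit `E_{i,i+1}` to
`E_{N-i,N+1-i}`. -/
def flipMap (N : ℕ) : Matrix (Fin N) (Fin N) ℂ →ₗ⁅ℂ⁆ Matrix (Fin N) (Fin N) ℂ where
  toFun x := Matrix.of fun a b => -((-1) ^ ((a : ℕ) + b) * x b.rev a.rev)
  map_add' x y := by
    ext a b
    simp
    ring
  map_smul' c x := by
    ext a b
    simp
    ring
  map_lie' := by
    intro x y
    ext a b
    simp only [Ring.lie_def, Matrix.of_apply, Matrix.sub_apply, Matrix.mul_apply]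
    have key : ∀ u v : Matrix (Fin N) (Fin N) ℂ,
        ∑ c : Fin N, -((-1 : ℂ) ^ ((a : ℕ) + c) * u c.rev a.rev) *
          -((-1) ^ ((c : ℕ) + b) * v b.rev c.rev) =
        (-1) ^ ((a : ℕ) + b) * ∑ c, v b.rev c * u c a.rev := by
      intro u v
      rw [Finset.mul_sum, ← Equiv.sum_comp Fin.revPerm]
      refine Finset.sum_congr rfl fun c _ => ?_
      simp only [Fin.revPerm_apply, Fin.rev_rev]
      have h : (-1 : ℂ) ^ (((Fin.rev c : Fin N) : ℕ) + ((Fin.rev c : Fin N) : ℕ)) = 1 := by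
        rw [← two_mul, pow_mul]
        simp
      have h' : (-1 : ℂ) ^ ((a : ℕ) + (Fin.rev c : Fin N)) * (-1) ^ (((Fin.rev c : Fin N) : ℕ) + b)
          = (-1) ^ ((a : ℕ) + b) := by
        have e : (a : ℕ) + (Fin.rev c : Fin N) + (((Fin.rev c : Fin N) : ℕ) + b) =
            (a + b) + (((Fin.rev c : Fin N) : ℕ) + ((Fin.rev c : Fin N) : ℕ)) := by ring
        rw [← pow_add, e, pow_add, h, mul_one]
      rw [← h']
      ring
    rw [key x y, key y x]
    ring

/-- The permutation of the `2n + 2` coordinates that swaps the two middle ones. -/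
def midSwap (n : ℕ) : Equiv.Perm (Fin (2 * n + 2)) :=
  Equiv.swap ⟨n, by omega⟩ ⟨n + 1, by omega⟩

/-- Conjugation by the permutation matrix that swaps the two middle coordinates. -/
def swapMap (n : ℕ) : Matrix (Fin (2 * n + 2)) (Fin (2 * n + 2)) ℂ →ₗ⁅ℂ⁆
    Matrix (Fin (2 * n + 2)) (Fin (2 * n + 2)) ℂ where
  toFun x := x.submatrix (midSwap n) (midSwap n)
  map_add' x y := rfl
  map_smul' c x := rfl
  map_lie' := by
    intro x y
    simp only [Ring.lie_def, Matrix.submatrix_sub, Pi.sub_apply, Matrix.submatrix_mul_equiv]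

/-- The diagram automorphism, as a map on all matrices. -/
def matAut : (X : TwistedType) → (n : ℕ) →
    Matrix (Fin (size X n)) (Fin (size X n)) ℂ →ₗ⁅ℂ⁆ Matrix (Fin (size X n)) (Fin (size X n)) ℂ
  | .AOdd, n => flipMap (2 * n)
  | .AEven, n => flipMap (2 * n + 1)
  | .D, n => swapMap n

theorem flipMap_mem (N : ℕ) {x : Matrix (Fin N) (Fin N) ℂ}
    (hx : x ∈ LieAlgebra.SpecialLinear.sl (Fin N) ℂ) :
    flipMap N x ∈ LieAlgebra.SpecialLinear.sl (Fin N) ℂ := by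
  change Matrix.trace x = 0 at hx
  change Matrix.trace (flipMap N x) = 0
  have h : ∀ a : Fin N, (-1 : ℂ) ^ ((a : ℕ) + a) = 1 := by
    intro a
    rw [← two_mul, pow_mul]
    simp
  simp only [Matrix.trace, Matrix.diag_apply] at hx ⊢
  have h2 : ∀ a : Fin N, flipMap N x a a = -x a.rev a.rev := by
    intro a
    change -((-1 : ℂ) ^ ((a : ℕ) + a) * x a.rev a.rev) = _
    rw [h, one_mul]
  simp only [h2, Finset.sum_neg_distrib]
  have h3 : ∑ a : Fin N, x a.rev a.rev = ∑ a : Fin N, x a a :=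
    Equiv.sum_comp Fin.revPerm (fun a : Fin N => x a a)
  rw [h3, hx, neg_zero]

theorem midSwap_rev (n : ℕ) (a : Fin (2 * n + 2)) : midSwap n a.rev = (midSwap n a).rev := by
  simp only [midSwap, Equiv.swap_apply_def, Fin.ext_iff, Fin.val_rev]
  split_ifs <;> simp only [Fin.val_rev] <;> omega

theorem mem_skew_iff (N : ℕ) (x : Matrix (Fin N) (Fin N) ℂ) :
    x ∈ skewAdjointMatricesLieSubalgebra (antidiag N) ↔
      ∀ a b : Fin N, x a b = -x b.rev a.rev := by
  rw [mem_skewAdjointMatricesLieSubalgebra, mem_skewAdjointMatricesSubmodule,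
    Matrix.IsSkewAdjoint, Matrix.IsAdjointPair, ← Matrix.ext_iff]
  have h1 : ∀ a b : Fin N, (x.transpose * antidiag N) a b = x b.rev a := by
    intro a b
    rw [Matrix.mul_apply, Finset.sum_eq_single b.rev]
    · simp [antidiag]
    · intro c _ hc
      have : ¬ b = c.rev := fun h => hc (by simp [h])
      simp [antidiag, this]
    · simp
  have h2 : ∀ a b : Fin N, (antidiag N * -x) a b = -x a.rev b := by
    intro a b
    rw [Matrix.mul_apply, Finset.sum_eq_single a.rev]
    · simp [antidiag]
    · intro c _ hc
      simp [antidiag, hc]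
    · simp
  simp only [h1, h2]
  constructor
  · intro h a b
    have := h b a.rev
    simpa using this
  · intro h a b
    have := h b.rev a
    simpa using this

theorem matAut_mem : ∀ (X : TwistedType) (n : ℕ) (x : Matrix (Fin (size X n)) (Fin (size X n)) ℂ),
    x ∈ ambient X n → matAut X n x ∈ ambient X n
  | .AOdd, n, _, hx => flipMap_mem (2 * n) hx
  | .AEven, n, _, hx => flipMap_mem (2 * n + 1) hx
  | .D, n, x, hx => by
    change swapMap n x ∈ skewAdjointMatricesLieSubalgebra (antidiag (2 * n + 2))
    have hx' : ∀ a b : Fin (2 * n + 2), x a b = -x b.rev a.rev := (mem_skew_iff _ x).1 hx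
    rw [mem_skew_iff]
    intro a b
    change x (midSwap n a) (midSwap n b) = -x (midSwap n b.rev) (midSwap n a.rev)
    rw [midSwap_rev, midSwap_rev]
    exact hx' _ _

/-- The diagram automorphism `σ` of `𝔤`. -/
def sigma (X : TwistedType) (n : ℕ) : ambient X n →ₗ⁅ℂ⁆ ambient X n where
  toFun x := ⟨matAut X n x.1, matAut_mem X n x.1 x.2⟩
  map_add' x y := Subtype.ext (map_add (matAut X n) x.1 y.1)
  map_smul' c x := Subtype.ext (map_smul (matAut X n) c x.1)
  map_lie' := by
    intro x y
    exact Subtype.ext (LieHom.map_lie (matAut X n) x.1 y.1)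

/-- The fixed point algebra `𝔤₀`. -/
abbrev g0 (X : TwistedType) (n : ℕ) : LieSubalgebra ℂ (ambient X n) := fixedPoints (sigma X n)

/-- `𝔥`: the diagonal matrices in `𝔤`. -/
def cartan (X : TwistedType) (n : ℕ) : Set (ambient X n) :=
  {x | ∀ a b, a ≠ b → x.1 a b = 0}

/-- `𝔫⁺`: the strictly upper triangular matrices in `𝔤`. -/
def nPos (X : TwistedType) (n : ℕ) : Set (ambient X n) :=
  {x | ∀ a b, b ≤ a → x.1 a b = 0}

theorem rank_le_size : ∀ (X : TwistedType) (n : ℕ), n ≤ size X n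
  | .AOdd, n => by simp only [size]; omega
  | .AEven, n => by simp only [size]; omega
  | .D, n => by simp only [size]; omega

/-- The `a`-th diagonal entry, `1 ≤ a ≤ n` (here counted from `0`). On `𝔥₀` these are the
coordinates in which the roots and weights of the classical algebra `𝔤₀` are usually written. -/
def coord (X : TwistedType) (n : ℕ) (a : Fin n) (h : ambient X n) : ℂ :=
  h.1 (Fin.castLE (rank_le_size X n) a) (Fin.castLE (rank_le_size X n) a)

/-- The simple roots of `𝔤₀` on `𝔥₀`, in Bourbaki's numbering: the `i`-th one is the difference of
two consecutive coordinates for `i < n`, and the last one is twice the last coordinate in type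
`C_n` and the last coordinate in type `B_n`. -/
def simpleRoot (X : TwistedType) (n : ℕ) (i : Fin n) (h : ambient X n) : ℂ :=
  if hi : (i : ℕ) + 1 < n then coord X n i h - coord X n ⟨i + 1, hi⟩ h
  else match X with
    | .AOdd => 2 * coord .AOdd n i h
    | .AEven => coord .AEven n i h
    | .D => coord .D n i h

/-- The fundamental weights of `𝔤₀` on `𝔥₀`: the `i`-th one is the sum of the first `i`
coordinates, except that the last one in type `B_n` is half of that sum. -/
def fundWeight (X : TwistedType) (n : ℕ) (i : Fin n) (h : ambient X n) : ℂ :=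
  match X with
  | .AOdd => ∑ a ∈ Finset.Iic i, coord .AOdd n a h
  | .AEven => (if (i : ℕ) + 1 = n then 1 / 2 else 1) * ∑ a ∈ Finset.Iic i, coord .AEven n a h
  | .D => (if (i : ℕ) + 1 = n then 1 / 2 else 1) * ∑ a ∈ Finset.Iic i, coord .D n a h

/-- Dominant integral weights of `𝔤₀`, written by their coefficients on the fundamental weights. -/
abbrev Weight (n : ℕ) : Type := Fin n → ℕ

/-- The value of a weight at an element of `𝔥₀`. -/
def Weight.eval (X : TwistedType) {n : ℕ} (μ : Weight n) (h : ambient X n) : ℂ :=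
  ∑ i, (μ i : ℂ) * fundWeight X n i h

/-- `ω_j` for `1 ≤ j ≤ n`, and `ω_0 = 0`. -/
def om (n j : ℕ) : Weight n := fun k => if (k : ℕ) + 1 = j then 1 else 0

/-- The elements of `𝔤` of weight `-α_i` with respect to `𝔥₀`. -/
def negRoot (X : TwistedType) (n : ℕ) (i : Fin n) : Set (ambient X n) :=
  {x | ∀ h ∈ cartan X n, sigma X n h = h → ⁅h, x⁆ = -simpleRoot X n i h • x}

/-! ### The irreducible modules `V(μ)` -/

/-- The relations of `V(μ)`: `𝔫⁺₀ v = 0`, `h v = μ(h) v` for `h ∈ 𝔥₀`, and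
`x ^ (μ(h_{α_i}) + 1) v = 0` for `x` in the root space of `-α_i`. -/
inductive VRel (X : TwistedType) (n : ℕ) (μ : Weight n) :
    UniversalEnvelopingAlgebra ℂ (g0 X n) → Prop
  | pos (x : g0 X n) (hx : x.1 ∈ nPos X n) :
      VRel X n μ (UniversalEnvelopingAlgebra.ι ℂ x)
  | weight (h : g0 X n) (hh : h.1 ∈ cartan X n) :
      VRel X n μ (UniversalEnvelopingAlgebra.ι ℂ h - algebraMap ℂ _ (μ.eval X h.1))
  | neg (i : Fin n) (x : g0 X n) (hx : x.1 ∈ negRoot X n i) :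
      VRel X n μ (UniversalEnvelopingAlgebra.ι ℂ x ^ (μ i + 1))

/-- The irreducible finite-dimensional `𝔤₀`-module `V(μ)` of highest weight `μ`, by generators and
relations. -/
def V (X : TwistedType) (n : ℕ) (μ : Weight n) : Type :=
  Cyclic (g0 X n) {u | VRel X n μ u}

instance (X : TwistedType) (n : ℕ) (μ : Weight n) : AddCommGroup (V X n μ) :=
  inferInstanceAs (AddCommGroup (Cyclic (g0 X n) {u | VRel X n μ u}))

instance (X : TwistedType) (n : ℕ) (μ : Weight n) : Module ℂ (V X n μ) :=
  inferInstanceAs (Module ℂ (Cyclic (g0 X n) {u | VRel X n μ u}))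

instance (X : TwistedType) (n : ℕ) (μ : Weight n) : LieRingModule (g0 X n) (V X n μ) :=
  lieRingModuleOfHom (L := g0 X n) (Cyclic (g0 X n) {u | VRel X n μ u}) LieHom.id

instance (X : TwistedType) (n : ℕ) (μ : Weight n) : LieModule ℂ (g0 X n) (V X n μ) :=
  lieModuleOfHom (L := g0 X n) (Cyclic (g0 X n) {u | VRel X n μ u}) LieHom.id

/-! ### The modules `KR^σ(m ω_i)` -/

/-- The twisted current algebra `𝔤[t]^σ`. -/
abbrev gt (X : TwistedType) (n : ℕ) : LieSubalgebra ℂ (ℂ[X] ⊗[ℂ] ambient X n) :=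
  twistedCurrent (sigma X n)

/-- The element `x ⊗ t ^ r` of the enveloping algebra of `𝔤[t]^σ`, where `x ∈ 𝔤₀` if `r` is even and
`x ∈ 𝔤₁` if `r` is odd. -/
abbrev ut (X : TwistedType) (n : ℕ) (r : ℕ) (x : ambient X n)
    (hx : sigma X n x = (-1 : ℂ) ^ r • x) : UniversalEnvelopingAlgebra ℂ (gt X n) :=
  UniversalEnvelopingAlgebra.ι ℂ (tpow (sigma X n) r x hx)

/-- The relations of `KR^σ(m ω_i)`. The space `𝔞[t]^σ` is spanned by the elements `x ⊗ t ^ r` with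
`x ∈ 𝔞` and `σ x = (-1) ^ r x`. -/
inductive KRRel (X : TwistedType) (n : ℕ) (i : Fin n) (m : ℕ) :
    UniversalEnvelopingAlgebra ℂ (gt X n) → Prop
  /-- `𝔫⁺[t]^σ v = 0`. -/
  | pos (r : ℕ) (x : ambient X n) (hx : sigma X n x = (-1 : ℂ) ^ r • x) (hp : x ∈ nPos X n) :
      KRRel X n i m (ut X n r x hx)
  /-- `h v = m ω_i(h) v` for `h ∈ 𝔥₀`. -/
  | weight (h : ambient X n) (hx : sigma X n h = (-1 : ℂ) ^ 0 • h) (hh : h ∈ cartan X n) :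
      KRRel X n i m (ut X n 0 h hx - algebraMap ℂ _ ((m : ℂ) * fundWeight X n i h))
  /-- `(h ⊗ t ^ r) v = 0` for `r ≥ 1` and `h ∈ 𝔥₀` or `h ∈ 𝔥₁`, according to the parity of `r`. -/
  | cartan (r : ℕ) (hr : 1 ≤ r) (h : ambient X n) (hx : sigma X n h = (-1 : ℂ) ^ r • h)
      (hh : h ∈ cartan X n) : KRRel X n i m (ut X n r h hx)
  /-- `x⁻_{α_j} v = 0` for `j ≠ i`. -/
  | other (j : Fin n) (hj : j ≠ i) (x : ambient X n) (hx : sigma X n x = (-1 : ℂ) ^ 0 • x)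
      (hn : x ∈ negRoot X n j) : KRRel X n i m (ut X n 0 x hx)
  /-- `(x⁻_{α_i}) ^ (m + 1) v = 0`. -/
  | power (x : ambient X n) (hx : sigma X n x = (-1 : ℂ) ^ 0 • x) (hn : x ∈ negRoot X n i) :
      KRRel X n i m (ut X n 0 x hx ^ (m + 1))
  /-- `(x⁻_{α_i} ⊗ t²) v = 0`. -/
  | tsq (x : ambient X n) (hx : sigma X n x = (-1 : ℂ) ^ 2 • x) (hn : x ∈ negRoot X n i) :
      KRRel X n i m (ut X n 2 x hx)
  /-- `(y⁻_{α_i} ⊗ t) v = 0`, where `y⁻_{α_i}` lies in the weight space of `-α_i` in `𝔤₁`. -/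
  | tone (y : ambient X n) (hy : sigma X n y = (-1 : ℂ) ^ 1 • y) (hn : y ∈ negRoot X n i) :
      KRRel X n i m (ut X n 1 y hy)

/-- The `𝔤[t]^σ`-module `KR^σ(m ω_i)`. -/
def KR (X : TwistedType) (n : ℕ) (i : Fin n) (m : ℕ) : Type :=
  Cyclic (gt X n) {u | KRRel X n i m u}

instance (X : TwistedType) (n : ℕ) (i : Fin n) (m : ℕ) : AddCommGroup (KR X n i m) :=
  inferInstanceAs (AddCommGroup (Cyclic (gt X n) {u | KRRel X n i m u}))

instance (X : TwistedType) (n : ℕ) (i : Fin n) (m : ℕ) : Module ℂ (KR X n i m) :=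
  inferInstanceAs (Module ℂ (Cyclic (gt X n) {u | KRRel X n i m u}))

/-- `KR^σ(m ω_i)` as a module over `𝔤[t]^σ`. -/
instance (X : TwistedType) (n : ℕ) (i : Fin n) (m : ℕ) :
    LieRingModule (gt X n) (KR X n i m) :=
  lieRingModuleOfHom (L := gt X n) (Cyclic (gt X n) {u | KRRel X n i m u}) LieHom.id

instance (X : TwistedType) (n : ℕ) (i : Fin n) (m : ℕ) : LieModule ℂ (gt X n) (KR X n i m) :=
  lieModuleOfHom (L := gt X n) (Cyclic (gt X n) {u | KRRel X n i m u}) LieHom.id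

/-- `KR^σ(m ω_i)` as a module over `𝔤₀ = 𝔤₀ ⊗ 1`. -/
instance (X : TwistedType) (n : ℕ) (i : Fin n) (m : ℕ) :
    LieRingModule (g0 X n) (KR X n i m) :=
  lieRingModuleOfHom (L := gt X n) (Cyclic (gt X n) {u | KRRel X n i m u}) (constHom (sigma X n))

instance (X : TwistedType) (n : ℕ) (i : Fin n) (m : ℕ) : LieModule ℂ (g0 X n) (KR X n i m) :=
  lieModuleOfHom (L := gt X n) (Cyclic (gt X n) {u | KRRel X n i m u}) (constHom (sigma X n))

/-! ### The sets `P₀⁺(i, m)^σ` -/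

/-- The integer `d_i^σ`. -/
def period (X : TwistedType) (n : ℕ) (i : Fin n) : ℕ :=
  match X with
  | .AOdd => 1
  | .AEven => if (i : ℕ) + 1 = n then 4 else 2
  | .D => 1

theorem period_pos (X : TwistedType) (n : ℕ) (i : Fin n) : 0 < period X n i := by
  cases X
  · exact Nat.one_pos
  · simp only [period]
    split_ifs <;> norm_num
  · exact Nat.one_pos

/-- The set `P₀⁺(i, d_i^σ)^σ`. The node with index `i : Fin n` is the node `i + 1` in the numbering
from `1`. -/
def topSet (X : TwistedType) (n : ℕ) (i : Fin n) : Set (Weight n) :=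
  match X with
  | .AOdd => {μ | ∃ j : ℕ, j ≤ (i : ℕ) + 1 ∧ j % 2 = ((i : ℕ) + 1) % 2 ∧ μ = om n j}
  | .AEven =>
    if (i : ℕ) + 1 = n then {μ | μ = 4 • om n n ∨ ∃ j : ℕ, j < n ∧ μ = 2 • om n j}
    else {μ | ∃ j : ℕ, j ≤ (i : ℕ) + 1 ∧ μ = 2 • om n j}
  | .D =>
    if (i : ℕ) + 1 = n then {om n n}
    else {μ | ∃ j : ℕ, j ≤ (i : ℕ) + 1 ∧ μ = om n j}

/-- The set `P₀⁺(i, m)^σ`: for `m < d_i^σ` it is `{m ω_i}`, and for `m > d_i^σ` it is the sum of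
`P₀⁺(i, d_i^σ)^σ` and `P₀⁺(i, m - d_i^σ)^σ`. -/
def domSet (X : TwistedType) (n : ℕ) (i : Fin n) (m : ℕ) : Set (Weight n) :=
  if period X n i < m then
    {μ | ∃ a ∈ topSet X n i, ∃ b ∈ domSet X n i (m - period X n i), μ = a + b}
  else if m = period X n i then topSet X n i
  else {m • om n ((i : ℕ) + 1)}
termination_by m
decreasing_by
  have := period_pos X n i
  omega

end TwistedKR

end

/-!
The module `KR^σ(m ω_i)` is an integrable `𝔤₀`-module with weights bounded by `m ω_i`, so that it is
completely reducible, and everything is a question about the weights of its `𝔫₀⁺`-singular vectors.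
By `TriData.Sing.unique` the following suffices: the module is generated under `𝔫₀⁻` by weight
vectors of pairwise different weights, and these weights, as far as they are dominant, lie in
`P₀⁺(i, m)^σ` (`decomposition_of_span`).

*Complete reducibility.* The fixed point algebra `𝔤₀` is of type `B_n` or `C_n`; all that is used is
its triangular decomposition together with a Casimir element that separates comparable dominant
weights (`TriData`, `tri`). With `𝔰𝔩₂`-theory for the simple roots this shows that integrable modules
with bounded weights are generated by their singular vectors (`TriData.socle_eq_top`), are direct
sums of highest weight modules (`TriData.bijective_directSumHom`), and that highest weight modules
are finite-dimensional (`TriData.Adm.finiteDimensional`).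

*The annihilator of the generator.* Grade `𝔤` by the coefficient of `α_i` (`deg`). The defining
relations imply that the generator `v` of `KR^σ(m ω_i)` is annihilated by all homogeneous elements
`x ⊗ t ^ r` with `r ≥ 1` other than the following, which are spanned by finitely many letters: in
type `A` the elements `x ⊗ t` with `x` of degree `-2`, and in type `D` the elements `x ⊗ t` of degree
`-1` and `x ⊗ t²` of degree `-2`, except for the last node of type `D`, where there are none. Hence words in the
letters, applied to `v`, generate the module under `𝔫₀⁻` (`eq_top_of_letters`).

*Straightening.* The letters are the entries of a symmetric (type `A_{2n}`) or antisymmetric (types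
`A_{2n-1}` and `D_{n+1}`) matrix, in type `D` with an additional row and column. They commute up to
letters, and those elements of `𝔫₀⁻` which annihilate `v` act on them by lowering indices. A subspace
of the polynomial ring in such variables that is stable under the lowering derivations contains all
polynomials as soon as it contains the monomials in the diagonal variables, or in the
antisymmetric case the monomials in the variables next to the diagonal, paired off from the top
(`sym_straightening`, `alt_straightening`); this is transferred to words in the letters in
`wd_mem_of_sym` and `wd_mem_of_alt`. The remaining words have pairwise different weights, and an
elementary computation shows that the dominant ones among these weights lie in `P₀⁺(i, m)^σ`.
-/


set_option linter.unusedSectionVars false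

noncomputable section

namespace TwistedKR

/-! ### Words, generators and relations, joint eigenspaces and `𝔰𝔩₂` -/

section Words

variable {L M : Type} [LieRing L] [LieAlgebra ℂ L] [AddCommGroup M] [Module ℂ M]
  [LieRingModule L M] [LieModule ℂ L M]

/-- The span of the vectors obtained from `v` by applying at most `k` elements of `C`. -/
def wordFiltration (C : Submodule ℂ L) (v : M) : ℕ → Submodule ℂ M
  | 0 => Submodule.span ℂ {v}
  | k + 1 => wordFiltration C v k ⊔
      Submodule.span ℂ {y | ∃ c ∈ C, ∃ x ∈ wordFiltration C v k, ⁅c, x⁆ = y}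

theorem wordFiltration_mono (C : Submodule ℂ L) (v : M) : Monotone (wordFiltration C v) :=
  monotone_nat_of_le_succ fun _ => le_sup_left

theorem lie_mem_wordFiltration (C : Submodule ℂ L) (v : M) {k : ℕ} {c : L} (hc : c ∈ C) {x : M}
    (hx : x ∈ wordFiltration C v k) : ⁅c, x⁆ ∈ wordFiltration C v (k + 1) :=
  Submodule.mem_sup_right (Submodule.subset_span ⟨c, hc, x, hx, rfl⟩)

/-- The weak form of the Poincaré-Birkhoff-Witt theorem: if `L = C + B` and `B` preserves the line
spanned by `v`, then the submodule generated by `v` is spanned by the words in `C` applied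
to `v`. -/
theorem lieSpan_le_of_words (C B : Submodule ℂ L) (hCB : C ⊔ B = ⊤) (v : M)
    (hB : ∀ b ∈ B, ∃ c : ℂ, ⁅b, v⁆ = c • v) (S : Submodule ℂ M) (hv : v ∈ S)
    (hS : ∀ c ∈ C, ∀ x ∈ S, ⁅c, x⁆ ∈ S) :
    (LieSubmodule.lieSpan ℂ L {v}).toSubmodule ≤ S := by
  have hL : ∀ k, (∀ b ∈ B, ∀ x ∈ wordFiltration C v k, ⁅b, x⁆ ∈ wordFiltration C v k) →
      ∀ z : L, ∀ x ∈ wordFiltration C v k, ⁅z, x⁆ ∈ wordFiltration C v (k + 1) := by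
    intro k hk z x hx
    have hz : z ∈ C ⊔ B := hCB ▸ Submodule.mem_top
    obtain ⟨c, hc, b, hb, rfl⟩ := Submodule.mem_sup.1 hz
    rw [add_lie]
    exact add_mem (lie_mem_wordFiltration C v hc hx)
      (wordFiltration_mono C v k.le_succ (hk b hb x hx))
  have hBk : ∀ k, ∀ b ∈ B, ∀ x ∈ wordFiltration C v k, ⁅b, x⁆ ∈ wordFiltration C v k := by
    intro k
    induction k with
    | zero =>
      intro b hb x hx
      obtain ⟨a, rfl⟩ := Submodule.mem_span_singleton.1 hx
      obtain ⟨c, hc⟩ := hB b hb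
      rw [lie_smul, hc]
      exact Submodule.smul_mem _ _ (Submodule.smul_mem _ _ (Submodule.mem_span_singleton_self v))
    | succ k ih =>
      intro b hb x hx
      obtain ⟨y, hy, w, hw, rfl⟩ := Submodule.mem_sup.1 hx
      rw [lie_add]
      refine add_mem (Submodule.mem_sup_left (ih b hb y hy)) ?_
      clear hx
      induction hw using Submodule.span_induction with
      | mem w hw =>
        obtain ⟨c, hc, x, hx, rfl⟩ := hw
        rw [leibniz_lie]
        exact add_mem (hL k ih _ _ hx) (lie_mem_wordFiltration C v hc (ih b hb x hx))
      | zero => simp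
      | add w₁ w₂ _ _ h₁ h₂ =>
        rw [lie_add]
        exact add_mem h₁ h₂
      | smul a w _ h =>
        rw [lie_smul]
        exact Submodule.smul_mem _ _ h
  let N : LieSubmodule ℂ L M :=
    { (⨆ k, wordFiltration C v k : Submodule ℂ M) with
      lie_mem := by
        intro z x hx
        simp only [AddSubsemigroup.mem_carrier, AddSubmonoid.mem_toSubsemigroup,
          Submodule.mem_toAddSubmonoid] at hx ⊢
        rw [Submodule.mem_iSup_of_directed _ (wordFiltration_mono C v).directed_le] at hx ⊢
        obtain ⟨k, hk⟩ := hx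
        exact ⟨k + 1, hL k (hBk k) z x hk⟩ }
  have h1 : LieSubmodule.lieSpan ℂ L {v} ≤ N := by
    rw [LieSubmodule.lieSpan_le, Set.singleton_subset_iff]
    exact Submodule.mem_iSup_of_mem (p := wordFiltration C v) 0
      (Submodule.mem_span_singleton_self v)
  have h2 : ∀ k, wordFiltration C v k ≤ S := by
    intro k
    induction k with
    | zero => exact (Submodule.span_singleton_le_iff_mem _ _).2 hv
    | succ k ih =>
      refine sup_le ih (Submodule.span_le.2 ?_)
      rintro _ ⟨c, hc, x, hx, rfl⟩
      exact hS c hc x (ih hx)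
  exact fun x hx => (iSup_le h2 : (⨆ k, wordFiltration C v k) ≤ S) (h1 hx)

end Words

section Enveloping

variable {L : Type} [LieRing L] [LieAlgebra ℂ L]

theorem adjoin_range_ι :
    Algebra.adjoin ℂ (Set.range (UniversalEnvelopingAlgebra.ι ℂ (L := L))) = ⊤ := by
  set S := Algebra.adjoin ℂ (Set.range (UniversalEnvelopingAlgebra.ι ℂ (L := L))) with hS
  let j : L →ₗ⁅ℂ⁆ S :=
    { toFun := fun x => ⟨UniversalEnvelopingAlgebra.ι ℂ x, Algebra.subset_adjoin ⟨x, rfl⟩⟩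
      map_add' := fun x y => Subtype.ext (map_add _ x y)
      map_smul' := fun c x => Subtype.ext (map_smul _ c x)
      map_lie' := fun {x y} => Subtype.ext (LieHom.map_lie (UniversalEnvelopingAlgebra.ι ℂ) x y) }
  have h : (S.val.comp (UniversalEnvelopingAlgebra.lift ℂ j)) =
      AlgHom.id ℂ (UniversalEnvelopingAlgebra ℂ L) := by
    apply UniversalEnvelopingAlgebra.hom_ext
    ext x
    change ((UniversalEnvelopingAlgebra.lift ℂ j (UniversalEnvelopingAlgebra.ι ℂ x) : S) :
      UniversalEnvelopingAlgebra ℂ L) = _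
    rw [UniversalEnvelopingAlgebra.lift_ι_apply]
    rfl
  rw [eq_top_iff]
  intro x _
  have := congrArg (fun φ => φ x) h
  simp only [AlgHom.comp_apply, AlgHom.id_apply] at this
  rw [← this]
  exact (UniversalEnvelopingAlgebra.lift ℂ j x).2

/-- A subspace of a module over the enveloping algebra that is stable under `L` is a submodule. -/
theorem smul_mem_of_ι_smul_mem {M : Type} [AddCommGroup M] [Module ℂ M]
    [Module (UniversalEnvelopingAlgebra ℂ L) M]
    [IsScalarTower ℂ (UniversalEnvelopingAlgebra ℂ L) M] (S : Submodule ℂ M)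
    (hS : ∀ z : L, ∀ x ∈ S, UniversalEnvelopingAlgebra.ι ℂ z • x ∈ S)
    (u : UniversalEnvelopingAlgebra ℂ L) : ∀ x ∈ S, u • x ∈ S := by
  have hu : u ∈ Algebra.adjoin ℂ (Set.range (UniversalEnvelopingAlgebra.ι ℂ (L := L))) := by
    rw [adjoin_range_ι]
    trivial
  induction hu using Algebra.adjoin_induction with
  | mem _ h =>
    obtain ⟨z, rfl⟩ := h
    exact hS z
  | algebraMap r =>
    intro x hx
    rw [algebraMap_smul]
    exact S.smul_mem r hx
  | add a b _ _ ha hb =>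
    intro x hx
    rw [add_smul]
    exact add_mem (ha x hx) (hb x hx)
  | mul a b _ _ ha hb =>
    intro x hx
    rw [mul_smul]
    exact ha _ (hb x hx)

/-- The universal property of a module given by a generator and relations. -/
theorem exists_cyclic_hom (rels : Set (UniversalEnvelopingAlgebra ℂ L)) {M : Type}
    [AddCommGroup M] [Module ℂ M] [LieRingModule L M] [LieModule ℂ L M] (u : M)
    (hu : ∀ a ∈ rels, UniversalEnvelopingAlgebra.lift ℂ (LieModule.toEnd ℂ L M) a u = 0) :
    ∃ φ : Cyclic L rels →ₗ[ℂ] M, φ (Submodule.Quotient.mk 1) = u ∧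
      ∀ (z : L) (x : Cyclic L rels), φ (UniversalEnvelopingAlgebra.ι ℂ z • x) = ⁅z, φ x⁆ := by
  let A := UniversalEnvelopingAlgebra.lift ℂ (LieModule.toEnd ℂ L M)
  let : Module (UniversalEnvelopingAlgebra ℂ L) M := Module.compHom M A.toRingHom
  have hsm : ∀ (a : UniversalEnvelopingAlgebra ℂ L) (x : M), a • x = A a x := fun _ _ => rfl
  let ψ := Submodule.liftQ (Submodule.span (UniversalEnvelopingAlgebra ℂ L) rels)
    (LinearMap.toSpanSingleton (UniversalEnvelopingAlgebra ℂ L) M u) (by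
      rw [Submodule.span_le]
      intro a ha
      exact hu a ha)
  have : IsScalarTower ℂ (UniversalEnvelopingAlgebra ℂ L) M := ⟨fun c a x => by
    rw [hsm, hsm, map_smul, LinearMap.smul_apply]⟩
  refine ⟨ψ.restrictScalars ℂ, ?_, ?_⟩
  · change ψ (Submodule.Quotient.mk 1) = u
    rw [Submodule.liftQ_apply, LinearMap.toSpanSingleton_apply, one_smul]
  · intro z x
    change ψ _ = ⁅z, ψ x⁆
    rw [map_smul, hsm]
    change UniversalEnvelopingAlgebra.lift ℂ (LieModule.toEnd ℂ L M) _ _ = _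
    rw [UniversalEnvelopingAlgebra.lift_ι_apply]
    rfl

end Enveloping

section Eigen

variable {M : Type} [AddCommGroup M] [Module ℂ M]

/-- The joint eigenspaces of a commuting family of operators are independent. -/
theorem iSupIndep_joint_eigenspace {ι : Type} (T : ι → Module.End ℂ M)
    (h : ∀ i j, Commute (T i) (T j)) :
    iSupIndep fun χ : ι → ℂ => ⨅ i, (T i).eigenspace (χ i) := by
  refine iSupIndep.mono (Module.End.independent_iInf_maxGenEigenspace_of_forall_mapsTo T
    fun i j φ => Module.End.mapsTo_maxGenEigenspace_of_comm (h j i) φ) fun χ => ?_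
  exact iInf_mono fun i => Module.End.eigenspace_le_maxGenEigenspace

theorem mem_span_inter_of_homogeneous {ι : Type} (E : ι → Submodule ℂ M) (hE : iSupIndep E)
    (B : Set M) (hB : ∀ b ∈ B, ∃ i, b ∈ E i) {x : M} (hx : x ∈ Submodule.span ℂ B) {i : ι}
    (hi : x ∈ E i) : x ∈ Submodule.span ℂ (B ∩ E i) := by
  have h1 : Submodule.span ℂ B ≤ Submodule.span ℂ (B ∩ E i) ⊔ ⨆ j ≠ i, E j := by
    rw [Submodule.span_le]
    intro b hb
    obtain ⟨j, hj⟩ := hB b hb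
    by_cases h : j = i
    · subst h
      exact Submodule.mem_sup_left (Submodule.subset_span ⟨hb, hj⟩)
    · exact Submodule.mem_sup_right (Submodule.mem_iSup_of_mem j (Submodule.mem_iSup_of_mem h hj))
  obtain ⟨y, hy, z, hz, rfl⟩ := Submodule.mem_sup.1 (h1 hx)
  have hyi : y ∈ E i := (Submodule.span_le.2 Set.inter_subset_right : _ ≤ E i) hy
  have hzi : z ∈ E i := by simpa using sub_mem hi hyi
  have : z = 0 := by
    have := (hE i).le_bot ⟨hzi, hz⟩
    simpa using this
  rw [this, add_zero]
  exact hy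

end Eigen

section SlTwo

variable {L M : Type} [LieRing L] [LieAlgebra ℂ L] [AddCommGroup M] [Module ℂ M]
  [LieRingModule L M] [LieModule ℂ L M] {h e f : L}

theorem lie_h_pow_f (t : IsSl2Triple h e f) {u : M} {k : ℂ} (hu : ⁅h, u⁆ = k • u) (j : ℕ) :
    ⁅h, (LieModule.toEnd ℂ L M f ^ j) u⁆ = (k - 2 * j) • (LieModule.toEnd ℂ L M f ^ j) u := by
  induction j with
  | zero => simpa using hu
  | succ j ih =>
    rw [pow_succ', Module.End.mul_apply, LieModule.toEnd_apply_apply, leibniz_lie h,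
      t.lie_lie_smul_f ℂ, ih, lie_smul, neg_lie, smul_lie, ← neg_smul, ← add_smul]
    congr 1
    push_cast
    ring

theorem lie_e_pow_f (t : IsSl2Triple h e f) {u : M} {k : ℂ} (hu : ⁅h, u⁆ = k • u) (j : ℕ) :
    ⁅e, (LieModule.toEnd ℂ L M f ^ (j + 1)) u⁆ = (LieModule.toEnd ℂ L M f ^ (j + 1)) ⁅e, u⁆ +
      ((j + 1) * (k - j)) • (LieModule.toEnd ℂ L M f ^ j) u := by
  induction j with
  | zero =>
    simp [leibniz_lie e, t.lie_e_f, hu, add_comm]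
  | succ j ih =>
    rw [pow_succ', Module.End.mul_apply, LieModule.toEnd_apply_apply, leibniz_lie e, t.lie_e_f,
      ih, lie_h_pow_f t hu, lie_add, lie_smul, Module.End.mul_apply,
      LieModule.toEnd_apply_apply]
    have : ⁅f, (LieModule.toEnd ℂ L M f ^ j) u⁆ = (LieModule.toEnd ℂ L M f ^ (j + 1)) u := by
      rw [pow_succ', Module.End.mul_apply, LieModule.toEnd_apply_apply]
    rw [this, add_left_comm, ← add_smul]
    congr 2
    push_cast
    ring

/-- The weight of a primitive vector on which `f` is nilpotent is a natural number. -/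
theorem exists_nat_of_primitive (t : IsSl2Triple h e f) {u : M} {k : ℂ} (hu : ⁅h, u⁆ = k • u)
    (he : ⁅e, u⁆ = 0) (h0 : u ≠ 0) (hf : ∃ N, (LieModule.toEnd ℂ L M f ^ N) u = 0) :
    ∃ m : ℕ, k = m ∧ (LieModule.toEnd ℂ L M f ^ (m + 1)) u = 0 := by
  obtain ⟨m, h1, h2⟩ := Nat.exists_not_and_succ_of_not_zero_of_exists
    (p := fun N => (LieModule.toEnd ℂ L M f ^ N) u = 0) (by simpa using h0) hf
  refine ⟨m, ?_, h2⟩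
  have := lie_e_pow_f t hu m
  rw [h2, lie_zero, he, map_zero, zero_add, eq_comm, smul_eq_zero_iff_left h1, mul_eq_zero,
    sub_eq_zero] at this
  exact this.resolve_left (Nat.cast_add_one_ne_zero m)

/-- On a vector of weight `k` on which `e` is nilpotent, `f ^ k` does not vanish. -/
theorem pow_f_ne_zero (t : IsSl2Triple h e f) (r : ℕ) : ∀ (u : M) (k : ℕ),
    ⁅h, u⁆ = (k : ℂ) • u → (LieModule.toEnd ℂ L M e ^ r) u = 0 → u ≠ 0 →
      (LieModule.toEnd ℂ L M f ^ k) u ≠ 0 := by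
  induction r with
  | zero => intro u k _ h1 h2; exact absurd h1 h2
  | succ r ih =>
    intro u k hu hr h0 hk
    have hk1 : (LieModule.toEnd ℂ L M f ^ (k + 1)) u = 0 := by
      rw [pow_succ', Module.End.mul_apply, hk, map_zero]
    have hk2 : (LieModule.toEnd ℂ L M f ^ (k + 2)) u = 0 := by
      rw [pow_succ', Module.End.mul_apply, hk1, map_zero]
    by_cases he : ⁅e, u⁆ = 0
    · have hz : ∀ j, j ≤ k → (LieModule.toEnd ℂ L M f ^ (k - j)) u = 0 := by
        intro j
        induction j with
        | zero => intro _; simpa using hk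
        | succ j ihj =>
          intro hj
          have h1 := ihj (by omega)
          have h2 := lie_e_pow_f t hu (k - (j + 1))
          have h3 : k - (j + 1) + 1 = k - j := by omega
          rw [h3, h1, lie_zero, he, map_zero, zero_add, eq_comm, smul_eq_zero] at h2
          refine h2.resolve_left ?_
          have h4 : ((k - (j + 1) : ℕ) : ℂ) = k - (j + 1) := by
            rw [Nat.cast_sub hj]; push_cast; ring
          rw [mul_eq_zero, not_or]
          refine ⟨Nat.cast_add_one_ne_zero _, ?_⟩
          rw [h4]
          have : (k : ℂ) - (k - (j + 1)) = (j : ℂ) + 1 := by ring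
          rw [this]
          exact Nat.cast_add_one_ne_zero j
      exact h0 (by simpa using hz k le_rfl)
    · refine ih ⁅e, u⁆ (k + 2) ?_ ?_ he ?_
      · rw [leibniz_lie, t.lie_h_e_smul ℂ, hu, lie_smul, smul_lie, ← add_smul]
        congr 1
        push_cast
        ring
      · rw [pow_succ, Module.End.mul_apply, LieModule.toEnd_apply_apply] at hr
        exact hr
      · have := lie_e_pow_f t hu (k + 1)
        rw [hk2, lie_zero, hk1, smul_zero, add_zero] at this
        exact this.symm

end SlTwo

/-! ### Triangular decompositions and weights -/

section Weights

variable {n : ℕ}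

/-- The positive cone: integral vectors with nonnegative partial sums. -/
def Qpos (d : Fin n → ℤ) : Prop := ∀ k, 0 ≤ ∑ a ∈ Finset.Iic k, d a

/-- The sum of all partial sums of `d`; it is positive on nonzero elements of the cone. -/
def ht (d : Fin n → ℤ) : ℤ := ∑ k, ∑ a ∈ Finset.Iic k, d a

/-- An integral vector as a complex weight. -/
def cst (d : Fin n → ℤ) : Fin n → ℂ := fun a => (d a : ℂ)

/-- The pairing of `l` with the `j`-th simple coroot, where the last coroot is `c` times the last
coordinate. -/
def pr {R : Type} [Ring R] (c : R) (l : Fin n → R) (j : Fin n) : R :=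
  if h : (j : ℕ) + 1 < n then l j - l ⟨j + 1, h⟩ else c * l j

/-- The `j`-th simple root, where the last root is `c` times the last coordinate. -/
def sr (c : ℤ) (j a : Fin n) : ℤ :=
  (if (a : ℕ) = j then (if (j : ℕ) + 1 < n then 1 else c) else 0) -
    (if (a : ℕ) = j + 1 then 1 else 0)

@[simp] theorem cst_zero : cst (0 : Fin n → ℤ) = 0 := by ext; simp [cst]

theorem cst_add (d d' : Fin n → ℤ) : cst (d + d') = cst d + cst d' := by ext; simp [cst]

theorem cst_neg (d : Fin n → ℤ) : cst (-d) = -cst d := by ext; simp [cst]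

theorem cst_injective : Function.Injective (cst : (Fin n → ℤ) → Fin n → ℂ) := by
  intro d d' h
  ext a
  have := congrFun h a
  simpa [cst] using this

theorem sum_Iic_ite {R : Type} [AddCommMonoid R] (k : Fin n) (m : ℕ) (c : R) :
    ∑ a ∈ Finset.Iic k, (if (a : ℕ) = m then c else 0) = if m ≤ k then c else 0 := by
  split_ifs with h
  · have hm : m < n := lt_of_le_of_lt h k.2
    rw [Finset.sum_eq_single (⟨m, hm⟩ : Fin n)]
    · simp
    · intro b _ hb
      rw [if_neg]
      exact fun h' => hb (Fin.ext h')
    · intro h'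
      exact absurd (Finset.mem_Iic.2 (Fin.le_def.2 h)) h'
  · refine Finset.sum_eq_zero fun a ha => if_neg ?_
    have := Fin.le_def.1 (Finset.mem_Iic.1 ha)
    omega

theorem sum_Iic_sr (c : ℤ) (j k : Fin n) :
    ∑ a ∈ Finset.Iic k, sr c j a = if k = j then (if (j : ℕ) + 1 < n then 1 else c) else 0 := by
  simp only [sr, Finset.sum_sub_distrib, sum_Iic_ite, Fin.ext_iff]
  have := k.2
  split_ifs <;> omega

theorem Qpos.add {d d' : Fin n → ℤ} (h : Qpos d) (h' : Qpos d') : Qpos (d + d') := fun k => by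
  have := add_nonneg (h k) (h' k)
  simpa [Finset.sum_add_distrib] using this

theorem Qpos_zero : Qpos (0 : Fin n → ℤ) := fun k => by simp

theorem ht_add (d d' : Fin n → ℤ) : ht (d + d') = ht d + ht d' := by
  simp [ht, Finset.sum_add_distrib]

theorem ht_neg (d : Fin n → ℤ) : ht (-d) = -ht d := by
  simp [ht]

theorem Qpos.ht_nonneg {d : Fin n → ℤ} (h : Qpos d) : 0 ≤ ht d := Finset.sum_nonneg fun k _ => h k

theorem eq_sum_Ici {R : Type} [Ring R] (s : Fin n → R) (a : Fin n) :
    s a = ∑ k ∈ Finset.Ici a, if h : (k : ℕ) + 1 < n then s k - s ⟨k + 1, h⟩ else s k := by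
  obtain ⟨m, hm⟩ : ∃ m, m = n - (a : ℕ) := ⟨_, rfl⟩
  induction m generalizing a with
  | zero => have := a.2; omega
  | succ m ih =>
    by_cases h : (a : ℕ) + 1 < n
    · have h1 : Finset.Ici a = insert a (Finset.Ici (⟨a + 1, h⟩ : Fin n)) := by
        ext b
        simp only [Finset.mem_Ici, Finset.mem_insert, Fin.le_def, Fin.ext_iff]
        omega
      rw [h1, Finset.sum_insert (by simp [Fin.le_def]), ← ih ⟨a + 1, h⟩ (by simp; omega), dif_pos h]
      simp
    · have h1 : Finset.Ici a = {a} := by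
        ext b
        have := b.2
        simp only [Finset.mem_Ici, Finset.mem_singleton, Fin.le_def, Fin.ext_iff]
        omega
      rw [h1, Finset.sum_singleton, dif_neg h]

/-- Summation by parts. -/
theorem sum_mul_eq_sum_partial {R : Type} [CommRing R] (d s : Fin n → R) :
    ∑ a, d a * s a = ∑ k : Fin n, (∑ a ∈ Finset.Iic k, d a) *
      (if h : (k : ℕ) + 1 < n then s k - s ⟨k + 1, h⟩ else s k) := by
  have h1 : ∀ a, d a * s a = ∑ k ∈ Finset.Ici a, d a *
      (if h : (k : ℕ) + 1 < n then s k - s ⟨k + 1, h⟩ else s k) := by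
    intro a
    rw [← Finset.mul_sum, ← eq_sum_Ici]
  simp only [h1, Finset.sum_mul]
  refine Finset.sum_comm' fun a k => ?_
  simp

/-- A nonzero element of the positive cone pairs positively with some simple coroot in its
support. -/
theorem Qpos.exists_pr_pos {d : Fin n → ℤ} (h : Qpos d) (h0 : d ≠ 0) :
    ∃ j, 0 < ∑ a ∈ Finset.Iic j, d a ∧ 0 < pr 1 d j := by
  by_contra hcon
  push Not at hcon
  have h1 : 0 < ∑ a, d a * d a := by
    obtain ⟨a, ha⟩ : ∃ a, d a ≠ 0 := by
      by_contra hc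
      push Not at hc
      exact h0 (funext hc)
    exact Finset.sum_pos' (fun b _ => mul_self_nonneg _)
      ⟨a, Finset.mem_univ a, mul_self_pos.2 ha⟩
  rw [sum_mul_eq_sum_partial] at h1
  refine absurd h1 (not_lt.2 (Finset.sum_nonpos fun k _ => ?_))
  rcases (h k).eq_or_lt with h2 | h2
  · rw [← h2, zero_mul]
  · have h3 := hcon k h2
    refine mul_nonpos_of_nonneg_of_nonpos h2.le ?_
    simpa [pr] using h3

theorem Qpos.ht_pos {d : Fin n → ℤ} (h : Qpos d) (h0 : d ≠ 0) : 0 < ht d := by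
  obtain ⟨j, hj, _⟩ := h.exists_pr_pos h0
  exact Finset.sum_pos' (fun k _ => h k) ⟨j, Finset.mem_univ j, hj⟩

theorem Qpos.eq_zero_of_neg {d : Fin n → ℤ} (h : Qpos d) (h' : Qpos (-d)) : d = 0 := by
  by_contra h0
  have := h.ht_pos h0
  have := h'.ht_nonneg
  rw [ht_neg] at this
  omega

theorem sum_mul_pos {d : Fin n → ℤ} (h : Qpos d) (h0 : d ≠ 0) (s : Fin n → ℝ)
    (hs : ∀ a, 0 < s a) (hs' : ∀ a b, a < b → s b < s a) : 0 < ∑ a, (d a : ℝ) * s a := by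
  obtain ⟨j, hj, _⟩ := h.exists_pr_pos h0
  rw [sum_mul_eq_sum_partial]
  have ht : ∀ k : Fin n, 0 < if h : (k : ℕ) + 1 < n then s k - s ⟨k + 1, h⟩ else s k := by
    intro k
    split_ifs with hk
    · exact sub_pos.2 (hs' _ _ (Fin.lt_def.2 (Nat.lt_succ_self _)))
    · exact hs k
  have hc : ∀ k : Fin n, ∑ a ∈ Finset.Iic k, (d a : ℝ) = ((∑ a ∈ Finset.Iic k, d a : ℤ) : ℝ) :=
    fun k => by push_cast; rfl
  refine Finset.sum_pos' (fun k _ => ?_) ⟨j, Finset.mem_univ j, ?_⟩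
  · rw [hc]
    exact mul_nonneg (by exact_mod_cast h k) (ht k).le
  · rw [hc]
    exact mul_pos (by exact_mod_cast hj) (ht j)

end Weights

/-- A triangular decomposition of a Lie algebra `g` of classical type `B_n` or `C_n`, together with
a Casimir element. The vectors `e p`, `f p` are positive and negative root vectors of weights
`± rt p`, in the coordinates given by the basis `H` of the Cartan subalgebra, and the vectors
`es j`, `fs j` belong to the simple roots. The coefficients `Bc` of the Casimir element are those of
a positive multiple of `2 ρ`; the conditions on their signs and on the sign of `A` are all that is
needed to see that the Casimir element separates comparable dominant weights. -/
structure TriData (g : Type) [LieRing g] [LieAlgebra ℂ g] (n : ℕ) where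
  P : Type
  finP : Fintype P
  e : P → g
  f : P → g
  H : Fin n → g
  rt : P → Fin n → ℤ
  /-- The last simple coroot is `cl` times the last coordinate. -/
  cl : ℕ
  /-- The last simple root is `sl` times the last coordinate. -/
  sl : ℕ
  es : Fin n → g
  fs : Fin n → g
  k : P → ℂ
  A : ℝ
  Bc : Fin n → ℝ
  cas : UniversalEnvelopingAlgebra ℂ g
  lie_H_H : ∀ a b, ⁅H a, H b⁆ = 0
  lie_H_e : ∀ a p, ⁅H a, e p⁆ = (rt p a : ℂ) • e p
  lie_H_f : ∀ a p, ⁅H a, f p⁆ = -(rt p a : ℂ) • f p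
  span_top : Submodule.span ℂ (Set.range f) ⊔
    (Submodule.span ℂ (Set.range e) ⊔ Submodule.span ℂ (Set.range H)) = ⊤
  rt_nonneg : ∀ p, Qpos (rt p)
  rt_ne : ∀ p, rt p ≠ 0
  cl_mul_sl : cl * sl = 2
  triple : ∀ j : Fin n, IsSl2Triple (if h : (j : ℕ) + 1 < n then H j - H ⟨j + 1, h⟩ else (cl : ℂ) • H j)
    (es j) (fs j)
  lie_H_es : ∀ a j, ⁅H a, es j⁆ = (sr sl j a : ℂ) • es j
  lie_H_fs : ∀ a j, ⁅H a, fs j⁆ = -(sr sl j a : ℂ) • fs j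
  es_mem : ∀ j, es j ∈ Submodule.span ℂ (Set.range e)
  cas_comm : ∀ x, UniversalEnvelopingAlgebra.ι ℂ x * cas = cas * UniversalEnvelopingAlgebra.ι ℂ x
  cas_eq : cas = (A : ℂ) • ∑ a, UniversalEnvelopingAlgebra.ι ℂ (H a) ^ 2 +
    ∑ a, (Bc a : ℂ) • UniversalEnvelopingAlgebra.ι ℂ (H a) +
    ∑ p, k p • (UniversalEnvelopingAlgebra.ι ℂ (f p) * UniversalEnvelopingAlgebra.ι ℂ (e p))
  A_pos : 0 < A
  Bc_pos : ∀ a, 0 < Bc a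
  Bc_anti : ∀ a b, a < b → Bc b < Bc a

namespace TriData

attribute [instance] TriData.finP

variable {g : Type} [LieRing g] [LieAlgebra ℂ g] {n : ℕ} (D : TriData g n)
variable {M : Type} [AddCommGroup M] [Module ℂ M] [LieRingModule g M] [LieModule ℂ g M]

/-- The weight space of weight `l`. -/
def wt (M : Type) [AddCommGroup M] [Module ℂ M] [LieRingModule g M] [LieModule ℂ g M]
    (l : Fin n → ℂ) : Submodule ℂ M where
  carrier := {x | ∀ a, ⁅D.H a, x⁆ = l a • x}
  add_mem' := by
    intro x y hx hy a
    rw [lie_add, hx a, hy a, smul_add]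
  zero_mem' := by intro a; simp
  smul_mem' := by
    intro c x hx a
    rw [lie_smul, hx a, smul_comm]

/-- The singular vectors of weight `l`. -/
def Sing (M : Type) [AddCommGroup M] [Module ℂ M] [LieRingModule g M] [LieModule ℂ g M]
    (l : Fin n → ℂ) : Submodule ℂ M where
  carrier := {x | x ∈ D.wt M l ∧ ∀ p, ⁅D.e p, x⁆ = 0}
  add_mem' := by
    intro x y hx hy
    exact ⟨add_mem hx.1 hy.1, fun p => by rw [lie_add, hx.2, hy.2, add_zero]⟩
  zero_mem' := ⟨zero_mem _, fun p => lie_zero _⟩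
  smul_mem' := by
    intro c x hx
    exact ⟨Submodule.smul_mem _ c hx.1, fun p => by rw [lie_smul, hx.2, smul_zero]⟩

/-- Dominant integral weights. -/
def Dom (l : Fin n → ℂ) : Prop := ∀ j, ∃ k : ℕ, pr (D.cl : ℂ) l j = k

/-- The eigenvalue of the Casimir element on a singular vector of weight `l`. -/
def cval (l : Fin n → ℂ) : ℂ := (D.A : ℂ) * ∑ a, l a ^ 2 + ∑ a, (D.Bc a : ℂ) * l a

/-- The action of the Casimir element. -/
def Cas (M : Type) [AddCommGroup M] [Module ℂ M] [LieRingModule g M] [LieModule ℂ g M] :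
    Module.End ℂ M :=
  UniversalEnvelopingAlgebra.lift ℂ (LieModule.toEnd ℂ g M) D.cas

/-- The vectors obtained from `u` by words in the negative root vectors, with their depth. -/
inductive Word (u : M) : (Fin n → ℤ) → M → Prop
  | base : Word u 0 u
  | step (p : D.P) (d : Fin n → ℤ) (x : M) (h : Word u d x) : Word u (d + D.rt p) ⁅D.f p, x⁆

/-- Integrable modules with weights bounded by `l₀`. -/
structure Adm (M : Type) [AddCommGroup M] [Module ℂ M] [LieRingModule g M] [LieModule ℂ g M]
    (l₀ : Fin n → ℂ) : Prop where
  spn : Submodule.span ℂ {x : M | ∃ d, Qpos d ∧ x ∈ D.wt M (l₀ - cst d)} = ⊤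
  nil : ∀ j (x : M), ∃ N, (LieModule.toEnd ℂ g M (D.fs j) ^ N) x = 0

variable {D}

theorem mem_wt {l : Fin n → ℂ} {x : M} : x ∈ D.wt M l ↔ ∀ a, ⁅D.H a, x⁆ = l a • x := Iff.rfl

theorem lie_e_mem_wt {l : Fin n → ℂ} {x : M} (hx : x ∈ D.wt M l) (p : D.P) :
    ⁅D.e p, x⁆ ∈ D.wt M (l + cst (D.rt p)) := fun a => by
  rw [leibniz_lie, D.lie_H_e, hx a, lie_smul, smul_lie, ← add_smul, add_comm]
  rfl

theorem lie_f_mem_wt {l : Fin n → ℂ} {x : M} (hx : x ∈ D.wt M l) (p : D.P) :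
    ⁅D.f p, x⁆ ∈ D.wt M (l - cst (D.rt p)) := fun a => by
  rw [leibniz_lie, D.lie_H_f, hx a, lie_smul, smul_lie, ← add_smul, neg_add_eq_sub]
  rfl

theorem lie_es_mem_wt {l : Fin n → ℂ} {x : M} (hx : x ∈ D.wt M l) (j : Fin n) :
    ⁅D.es j, x⁆ ∈ D.wt M (l + cst (sr D.sl j)) := fun a => by
  rw [leibniz_lie, D.lie_H_es, hx a, lie_smul, smul_lie, ← add_smul, add_comm]
  rfl

theorem lie_fs_mem_wt {l : Fin n → ℂ} {x : M} (hx : x ∈ D.wt M l) (j : Fin n) :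
    ⁅D.fs j, x⁆ ∈ D.wt M (l - cst (sr D.sl j)) := fun a => by
  rw [leibniz_lie, D.lie_H_fs, hx a, lie_smul, smul_lie, ← add_smul, neg_add_eq_sub]
  rfl

theorem lie_coroot {l : Fin n → ℂ} {x : M} (hx : x ∈ D.wt M l) (j : Fin n) :
    ⁅(if h : (j : ℕ) + 1 < n then D.H j - D.H ⟨j + 1, h⟩ else (D.cl : ℂ) • D.H j), x⁆ =
      pr (D.cl : ℂ) l j • x := by
  unfold pr
  split_ifs
  · rw [sub_lie, hx, hx, sub_smul]
  · rw [smul_lie, hx, smul_smul]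

theorem wt_eq_iInf (l : Fin n → ℂ) :
    D.wt M l = ⨅ a, (LieModule.toEnd ℂ g M (D.H a)).eigenspace (l a) := by
  ext x
  simp only [mem_wt, Submodule.mem_iInf, Module.End.mem_eigenspace_iff,
    LieModule.toEnd_apply_apply]

theorem commute_toEnd {x y : g} (h : ⁅x, y⁆ = 0) :
    Commute (LieModule.toEnd ℂ g M x) (LieModule.toEnd ℂ g M y) := by
  have := LieHom.map_lie (LieModule.toEnd ℂ g M) x y
  rw [h, map_zero, LieRing.of_associative_ring_bracket, eq_comm, sub_eq_zero] at this
  exact this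

theorem Cas_commute (x : g) : Commute (D.Cas M) (LieModule.toEnd ℂ g M x) := by
  have := congrArg (UniversalEnvelopingAlgebra.lift ℂ (LieModule.toEnd ℂ g M)) (D.cas_comm x)
  rw [map_mul, map_mul, UniversalEnvelopingAlgebra.lift_ι_apply] at this
  exact this.symm

theorem Cas_lie (x : g) (y : M) : D.Cas M ⁅x, y⁆ = ⁅x, D.Cas M y⁆ :=
  congrArg (fun φ : Module.End ℂ M => φ y) (Cas_commute (D := D) (M := M) x)

theorem iSupIndep_wt : iSupIndep (D.wt M) := by
  have := iSupIndep_joint_eigenspace (fun a => LieModule.toEnd ℂ g M (D.H a))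
    fun a b => commute_toEnd (D.lie_H_H a b)
  simpa only [← wt_eq_iInf] using this

theorem iSupIndep_wt_Cas :
    iSupIndep fun q : (Fin n → ℂ) × ℂ => D.wt M q.1 ⊓ (D.Cas M).eigenspace q.2 := by
  have h := iSupIndep_joint_eigenspace
    (fun o : Option (Fin n) => o.elim (D.Cas M) fun a => LieModule.toEnd ℂ g M (D.H a)) (by
      rintro (_ | a) (_ | b)
      · exact Commute.refl _
      · exact Cas_commute _
      · exact (Cas_commute _).symm
      · exact commute_toEnd (D.lie_H_H a b))
  have hinj : Function.Injective
      (fun q : (Fin n → ℂ) × ℂ => fun o : Option (Fin n) => o.elim q.2 q.1) := by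
    intro q q' hq
    refine Prod.ext (funext fun a => congrFun hq (some a)) (congrFun hq none)
  have h2 := h.comp hinj
  refine h2.mono fun q => ?_
  simp only [Function.comp_apply, iInf_option, Option.elim]
  rw [← wt_eq_iInf, inf_comm]

theorem wt_eq_of_ne_zero {l l' : Fin n → ℂ} {x : M} (hx : x ∈ D.wt M l) (hx' : x ∈ D.wt M l')
    (h0 : x ≠ 0) : l = l' := by
  ext a
  have := (hx a).symm.trans (hx' a)
  exact smul_left_injective ℂ h0 this

theorem Cas_sub_mem (S : LieSubmodule ℂ g M) {l : Fin n → ℂ} {x : M} (hx : x ∈ D.wt M l)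
    (he : ∀ p, ⁅D.e p, x⁆ ∈ S) : D.Cas M x - D.cval l • x ∈ S := by
  have h : D.Cas M x = D.cval l • x + ∑ p, D.k p • ⁅D.f p, ⁅D.e p, x⁆⁆ := by
    have h1 : ∀ a, ⁅D.H a, x⁆ = l a • x := hx
    rw [Cas, D.cas_eq]
    simp only [map_add, map_smul, map_sum, map_mul,
      UniversalEnvelopingAlgebra.lift_ι_apply, LinearMap.add_apply, LinearMap.smul_apply,
      LinearMap.sum_apply, Module.End.mul_apply, LieModule.toEnd_apply_apply, pow_two, h1, cval, add_smul, Finset.mul_sum, Finset.sum_smul, Finset.smul_sum, smul_smul]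
  rw [h, add_sub_cancel_left]
  exact sum_mem fun p _ => S.smul_mem _ (S.lie_mem (he p))

theorem Cas_of_Sing {l : Fin n → ℂ} {x : M} (hx : x ∈ D.Sing M l) : D.Cas M x = D.cval l • x := by
  have := Cas_sub_mem (D := D) (⊥ : LieSubmodule ℂ g M) hx.1 fun p => by simp [hx.2 p]
  simpa [sub_eq_zero] using this

/-! #### Words -/

theorem Word.mem_wt {u x : M} {l : Fin n → ℂ} {d : Fin n → ℤ} (hu : u ∈ D.wt M l)
    (h : D.Word u d x) : x ∈ D.wt M (l - cst d) := by
  induction h with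
  | base => simpa using hu
  | step p d x _ ih =>
    have := lie_f_mem_wt ih p
    rwa [sub_sub, ← cst_add] at this

theorem Word.nonneg {u x : M} {d : Fin n → ℤ} (h : D.Word u d x) : Qpos d := by
  induction h with
  | base => exact Qpos_zero
  | step p d x _ ih => exact ih.add (D.rt_nonneg p)

theorem Word.eq_or {u x : M} {d : Fin n → ℤ} (h : D.Word u d x) : d ≠ 0 ∨ x = u := by
  cases h with
  | base => exact Or.inr rfl
  | step p d x h =>
    refine Or.inl fun h0 => ?_
    have h1 := (D.rt_nonneg p).ht_pos (D.rt_ne p)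
    have h2 := h.nonneg.ht_nonneg
    have h3 : ht (d + D.rt p) = 0 := by rw [h0]; simp [ht]
    rw [ht_add] at h3
    omega

theorem Word.Cas {u x : M} {d : Fin n → ℤ} {c : ℂ} (hu : D.Cas M u = c • u) (h : D.Word u d x) :
    D.Cas M x = c • x := by
  induction h with
  | base => exact hu
  | step p d x _ ih => rw [Cas_lie, ih, lie_smul]

theorem Word.mem {u x : M} {d : Fin n → ℤ} (S : LieSubmodule ℂ g M) (hu : u ∈ S)
    (h : D.Word u d x) : x ∈ S := by
  induction h with
  | base => exact hu
  | step p d x _ ih => exact S.lie_mem ih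

theorem lie_mem_span_word {u : M} {c : g} (hc : c ∈ Submodule.span ℂ (Set.range D.f)) {x : M}
    (hx : x ∈ Submodule.span ℂ {x | ∃ d, D.Word u d x}) :
    ⁅c, x⁆ ∈ Submodule.span ℂ {x | ∃ d, D.Word u d x} := by
  induction hx using Submodule.span_induction with
  | mem x hx =>
    obtain ⟨d, hx⟩ := hx
    induction hc using Submodule.span_induction with
    | mem c hc =>
      obtain ⟨p, rfl⟩ := hc
      exact Submodule.subset_span ⟨_, hx.step p⟩
    | zero => simp
    | add a b _ _ ha hb => rw [add_lie]; exact add_mem ha hb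
    | smul r a _ ha => rw [smul_lie]; exact Submodule.smul_mem _ _ ha
  | zero => simp
  | add a b _ _ ha hb => rw [lie_add]; exact add_mem ha hb
  | smul r a _ ha => rw [lie_smul]; exact Submodule.smul_mem _ _ ha

theorem lieSpan_le_span_word {l : Fin n → ℂ} {u : M} (hu : u ∈ D.Sing M l) :
    (LieSubmodule.lieSpan ℂ g {u}).toSubmodule ≤ Submodule.span ℂ {x | ∃ d, D.Word u d x} := by
  refine lieSpan_le_of_words _ _ D.span_top u ?_ _ (Submodule.subset_span ⟨0, Word.base⟩)
    fun c hc x hx => lie_mem_span_word hc hx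
  intro b hb
  obtain ⟨b₁, h₁, b₂, h₂, rfl⟩ := Submodule.mem_sup.1 hb
  have h1 : ⁅b₁, u⁆ = 0 := by
    clear hb
    induction h₁ using Submodule.span_induction with
    | mem c hc => obtain ⟨p, rfl⟩ := hc; exact hu.2 p
    | zero => simp
    | add a b _ _ ha hb =>
      rw [add_lie, ha, hb, add_zero]
    | smul r a _ ha => rw [smul_lie, ha, smul_zero]
  have h2 : ∃ c : ℂ, ⁅b₂, u⁆ = c • u := by
    clear hb
    induction h₂ using Submodule.span_induction with
    | mem c hc => obtain ⟨a, rfl⟩ := hc; exact ⟨l a, hu.1 a⟩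
    | zero => exact ⟨0, by simp⟩
    | add a b _ _ ha hb =>
      obtain ⟨c, hc⟩ := ha
      obtain ⟨c', hc'⟩ := hb
      exact ⟨c + c', by rw [add_lie, hc, hc', add_smul]⟩
    | smul r a _ ha =>
      obtain ⟨c, hc⟩ := ha
      exact ⟨r * c, by rw [smul_lie, hc, smul_smul]⟩
  obtain ⟨c, hc⟩ := h2
  exact ⟨c, by rw [add_lie, h1, hc, zero_add]⟩

/-! #### Dominance -/

theorem Sing.exists_nat {l : Fin n → ℂ} {u : M} (hu : u ∈ D.wt M l) (h0 : u ≠ 0) (j : Fin n)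
    (he : ⁅D.es j, u⁆ = 0) (nil : ∃ N, (LieModule.toEnd ℂ g M (D.fs j) ^ N) u = 0) :
    ∃ m : ℕ, pr (D.cl : ℂ) l j = m ∧ (LieModule.toEnd ℂ g M (D.fs j) ^ (m + 1)) u = 0 :=
  exists_nat_of_primitive (D.triple j) (lie_coroot hu j) he h0 nil

theorem Sing.lie_es {l : Fin n → ℂ} {u : M} (hu : u ∈ D.Sing M l) (j : Fin n) :
    ⁅D.es j, u⁆ = 0 := by
  have := D.es_mem j
  generalize D.es j = z at this ⊢
  induction this using Submodule.span_induction with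
  | mem c hc => obtain ⟨p, rfl⟩ := hc; exact hu.2 p
  | zero => simp
  | add a b _ _ ha hb => rw [add_lie, ha, hb, add_zero]
  | smul r a _ ha => rw [smul_lie, ha, smul_zero]

theorem Dom.re_of_sl {l : Fin n → ℂ} (hl : D.Dom l) :
    (∀ a, l a = ((l a).re : ℂ)) ∧ (∀ a, 0 ≤ (l a).re) ∧ ∀ a b, a ≤ b → (l b).re ≤ (l a).re := by
  have hcl : (0 : ℝ) < D.cl := by
    have := D.cl_mul_sl
    have : D.cl ≠ 0 := by rintro h; simp [h] at this
    exact_mod_cast Nat.pos_of_ne_zero this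
  have key : ∀ k : Fin n, ∃ r : ℝ, 0 ≤ r ∧
      (if h : (k : ℕ) + 1 < n then l k - l ⟨k + 1, h⟩ else l k) = (r : ℂ) := by
    intro k
    obtain ⟨m, hm⟩ := hl k
    unfold pr at hm
    split_ifs at hm ⊢
    · exact ⟨m, Nat.cast_nonneg m, by rw [hm]; norm_num⟩
    · refine ⟨m / D.cl, by positivity, ?_⟩
      have : (D.cl : ℂ) ≠ 0 := by exact_mod_cast hcl.ne'
      push_cast
      rw [eq_div_iff this, mul_comm, hm]
  choose r hr0 hr using key
  have h1 : ∀ a, l a = ((∑ k ∈ Finset.Ici a, r k : ℝ) : ℂ) := by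
    intro a
    rw [eq_sum_Ici l a]
    push_cast
    exact Finset.sum_congr rfl fun k _ => hr k
  refine ⟨fun a => by rw [h1 a]; simp, fun a => ?_, fun a b hab => ?_⟩
  · rw [h1 a, Complex.ofReal_re]
    exact Finset.sum_nonneg fun k _ => hr0 k
  · rw [h1 a, h1 b, Complex.ofReal_re, Complex.ofReal_re]
    exact Finset.sum_le_sum_of_subset_of_nonneg (Finset.Ici_subset_Ici.2 hab) fun k _ _ => hr0 k

/-- The Casimir eigenvalues of two comparable, distinct dominant weights are different. -/
theorem cval_ne {l : Fin n → ℂ} {d : Fin n → ℤ} (hl : D.Dom l) (hl' : D.Dom (l + cst d))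
    (hd : Qpos d) (h0 : d ≠ 0) : D.cval (l + cst d) ≠ D.cval l := by
  obtain ⟨h1, h2, h3⟩ := hl.re_of_sl
  obtain ⟨h1', h2', h3'⟩ := hl'.re_of_sl
  set r : Fin n → ℝ := fun a => (l a).re with hr
  set r' : Fin n → ℝ := fun a => ((l + cst d) a).re with hr'
  have hd' : ∀ a, (d a : ℝ) = r' a - r a := fun a => by simp [hr, hr', cst]
  have key : D.cval (l + cst d) - D.cval l =
      ((∑ a, (d a : ℝ) * (D.A * (r a + r' a) + D.Bc a) : ℝ) : ℂ) := by
    have e1 : ∀ a, l a = (r a : ℂ) := h1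
    have e2 : ∀ a, (l + cst d) a = (r' a : ℂ) := h1'
    simp only [cval, e1, e2, hd']
    push_cast
    rw [Finset.mul_sum, Finset.mul_sum, ← Finset.sum_add_distrib, ← Finset.sum_add_distrib,
      ← Finset.sum_sub_distrib]
    exact Finset.sum_congr rfl fun a _ => by ring
  have hpos := sum_mul_pos hd h0 (fun a => D.A * (r a + r' a) + D.Bc a)
    (fun a => by
      have := mul_nonneg D.A_pos.le (add_nonneg (h2 a) (h2' a))
      have := D.Bc_pos a
      change 0 < D.A * ((l a).re + ((l + cst d) a).re) + D.Bc a
      linarith)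
    (fun a b hab => by
      have := mul_le_mul_of_nonneg_left (add_le_add (h3 a b hab.le) (h3' a b hab.le)) D.A_pos.le
      have := D.Bc_anti a b hab
      change D.A * ((l b).re + ((l + cst d) b).re) + D.Bc b <
        D.A * ((l a).re + ((l + cst d) a).re) + D.Bc a
      linarith)
  intro h
  rw [h, sub_self] at key
  have : (0 : ℝ) = ∑ a, (d a : ℝ) * (D.A * (r a + r' a) + D.Bc a) := by exact_mod_cast key
  exact hpos.ne this

end TriData

namespace TriData

variable {g : Type} [LieRing g] [LieAlgebra ℂ g] {n : ℕ} {D : TriData g n}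
variable {M : Type} [AddCommGroup M] [Module ℂ M] [LieRingModule g M] [LieModule ℂ g M]

/-! ### Complete reducibility of integrable modules -/

theorem Adm.exists_of_mem_wt {l₀ l : Fin n → ℂ} (h : D.Adm M l₀) {x : M} (hx : x ∈ D.wt M l)
    (h0 : x ≠ 0) : ∃ d, Qpos d ∧ l = l₀ - cst d := by
  by_contra hc
  push Not at hc
  have hx' : x ∈ Submodule.span ℂ {x : M | ∃ d, Qpos d ∧ x ∈ D.wt M (l₀ - cst d)} := by
    rw [h.spn]; trivial
  have := mem_span_inter_of_homogeneous (D.wt M) iSupIndep_wt _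
    (by rintro b ⟨d, _, hb⟩; exact ⟨_, hb⟩) hx' hx
  refine h0 ?_
  have h1 : Submodule.span ℂ ({x : M | ∃ d, Qpos d ∧ x ∈ D.wt M (l₀ - cst d)} ∩ D.wt M l) ≤ ⊥ := by
    rw [Submodule.span_le]
    rintro b ⟨⟨d, hd, hb⟩, hb'⟩
    by_contra hb0
    exact hc d hd (wt_eq_of_ne_zero hb' hb hb0)
  simpa using h1 this

theorem toEnd_pow_map {N : Type} [AddCommGroup N] [Module ℂ N] [LieRingModule g N]
    [LieModule ℂ g N] (φ : M →ₗ⁅ℂ,g⁆ N) (z : g) (k : ℕ) (x : M) :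
    φ ((LieModule.toEnd ℂ g M z ^ k) x) = (LieModule.toEnd ℂ g N z ^ k) (φ x) := by
  induction k with
  | zero => simp
  | succ k ih =>
    rw [pow_succ', pow_succ', Module.End.mul_apply, Module.End.mul_apply,
      LieModule.toEnd_apply_apply, LieModule.toEnd_apply_apply, LieModuleHom.map_lie, ih]

theorem map_mem_wt {N : Type} [AddCommGroup N] [Module ℂ N] [LieRingModule g N]
    [LieModule ℂ g N] (φ : M →ₗ⁅ℂ,g⁆ N) {l : Fin n → ℂ} {x : M} (hx : x ∈ D.wt M l) :
    φ x ∈ D.wt N l := fun a => by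
  rw [← LieModuleHom.map_lie, hx a, map_smul]

theorem Adm.of_surjective {N : Type} [AddCommGroup N] [Module ℂ N] [LieRingModule g N]
    [LieModule ℂ g N] (φ : M →ₗ⁅ℂ,g⁆ N) (hφ : Function.Surjective φ) {l₀ : Fin n → ℂ}
    (h : D.Adm M l₀) : D.Adm N l₀ where
  spn := by
    rw [eq_top_iff]
    rintro y -
    obtain ⟨x, rfl⟩ := hφ y
    have hx : x ∈ Submodule.span ℂ {x : M | ∃ d, Qpos d ∧ x ∈ D.wt M (l₀ - cst d)} := by
      rw [h.spn]; trivial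
    induction hx using Submodule.span_induction with
    | mem x hx =>
      obtain ⟨d, hd, hx⟩ := hx
      exact Submodule.subset_span ⟨d, hd, map_mem_wt φ hx⟩
    | zero => simp
    | add a b _ _ ha hb => rw [map_add]; exact add_mem ha hb
    | smul r a _ ha => rw [map_smul]; exact Submodule.smul_mem _ _ ha
  nil := by
    intro j y
    obtain ⟨x, rfl⟩ := hφ y
    obtain ⟨N, hN⟩ := h.nil j x
    exact ⟨N, by rw [← toEnd_pow_map, hN, map_zero]⟩

theorem Adm.quotient {l₀ : Fin n → ℂ} (h : D.Adm M l₀) (S : LieSubmodule ℂ g M) :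
    D.Adm (M ⧸ S) l₀ :=
  h.of_surjective (LieSubmodule.Quotient.mk' S) (LieSubmodule.Quotient.surjective_mk' S)

theorem Sing.dom {l₀ : Fin n → ℂ} (h : D.Adm M l₀) {l : Fin n → ℂ} {u : M} (hu : u ∈ D.Sing M l)
    (h0 : u ≠ 0) : D.Dom l := fun j => by
  obtain ⟨m, hm, _⟩ := Sing.exists_nat hu.1 h0 j (Sing.lie_es hu j) (h.nil j u)
  exact ⟨m, hm⟩

variable (D M) in
/-- The vectors obtained by words in the negative root vectors from nonzero singular vectors. -/
def Piece : Set M := {x | ∃ u l d, u ∈ D.Sing M l ∧ u ≠ 0 ∧ D.Word u d x}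

variable (D M) in
/-- The submodule generated by the singular vectors. -/
def socle : LieSubmodule ℂ g M where
  __ := Submodule.span ℂ (D.Piece M)
  lie_mem := by
    intro z x hx
    change x ∈ Submodule.span ℂ (D.Piece M) at hx
    change ⁅z, x⁆ ∈ Submodule.span ℂ (D.Piece M)
    induction hx using Submodule.span_induction with
    | mem x hx =>
      obtain ⟨u, l, d, hu, h0, hx⟩ := hx
      have h1 : ⁅z, x⁆ ∈ LieSubmodule.lieSpan ℂ g {u} :=
        LieSubmodule.lie_mem _ (hx.mem _ (LieSubmodule.subset_lieSpan rfl))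
      refine Submodule.span_mono ?_ (lieSpan_le_span_word hu h1)
      rintro y ⟨d', hy⟩
      exact ⟨u, l, d', hu, h0, hy⟩
    | zero => simp
    | add a b _ _ ha hb => rw [lie_add]; exact add_mem ha hb
    | smul r a _ ha => rw [lie_smul]; exact Submodule.smul_mem _ _ ha

theorem mem_socle {x : M} : x ∈ D.socle M ↔ x ∈ Submodule.span ℂ (D.Piece M) := Iff.rfl

theorem Piece.exists_mem {b : M} (hb : b ∈ D.Piece M) :
    ∃ q : (Fin n → ℂ) × ℂ, b ∈ D.wt M q.1 ⊓ (D.Cas M).eigenspace q.2 := by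
  obtain ⟨u, l, d, hu, h0, hx⟩ := hb
  exact ⟨(l - cst d, D.cval l), hx.mem_wt hu.1,
    Module.End.mem_eigenspace_iff.2 (hx.Cas (Cas_of_Sing hu))⟩

/-- The depth of a word is determined by its weight and its Casimir eigenvalue, if these are
compatible with a dominant weight. -/
theorem Word.depth_eq_zero {l₀ : Fin n → ℂ} (hM : D.Adm M l₀) {l ν : Fin n → ℂ} (hl : D.Dom l)
    {d d' : Fin n → ℤ} (hd : Qpos d) {u b : M} (hu : u ∈ D.Sing M ν) (hu0 : u ≠ 0)
    (hb : D.Word u d' b) (h0 : b ≠ 0) (hw : b ∈ D.wt M (l + cst d))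
    (hc : D.Cas M b = D.cval l • b) : d + d' = 0 ∧ ν = l := by
  have h1 : l + cst d = ν - cst d' := wt_eq_of_ne_zero hw (hb.mem_wt hu.1) h0
  have h2 : ν = l + cst (d + d') := by rw [cst_add, ← add_assoc, h1, sub_add_cancel]
  have h3 : D.cval ν = D.cval l :=
    smul_left_injective ℂ h0 ((hb.Cas (Cas_of_Sing hu)).symm.trans hc)
  by_cases h4 : d + d' = 0
  · exact ⟨h4, by rw [h2, h4, cst_zero, add_zero]⟩
  · have h5 := Sing.dom hM hu hu0
    rw [h2] at h3 h5
    exact absurd h3 (cval_ne hl h5 (hd.add hb.nonneg) h4)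

theorem Piece.mem_Sing {l₀ : Fin n → ℂ} (hM : D.Adm M l₀) {l : Fin n → ℂ} (hl : D.Dom l)
    {b : M} (hb : b ∈ D.Piece M) (hw : b ∈ D.wt M l) (hc : D.Cas M b = D.cval l • b) :
    b ∈ D.Sing M l := by
  by_cases h0 : b = 0
  · rw [h0]; exact zero_mem _
  obtain ⟨u, ν, d, hu, hu0, hx⟩ := hb
  have h1 : b ∈ D.wt M (l + cst 0) := by simpa using hw
  obtain ⟨h2, rfl⟩ := Word.depth_eq_zero hM hl Qpos_zero hu hu0 hx h0 h1 hc
  rw [zero_add] at h2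
  rcases hx.eq_or with h3 | rfl
  · exact absurd h2 h3
  · exact hu

theorem Piece.eq_zero {l₀ : Fin n → ℂ} (hM : D.Adm M l₀) {l : Fin n → ℂ} (hl : D.Dom l)
    {d : Fin n → ℤ} (hd : Qpos d) (hd0 : d ≠ 0)
    {b : M} (hb : b ∈ D.Piece M) (hw : b ∈ D.wt M (l + cst d))
    (hc : D.Cas M b = D.cval l • b) : b = 0 := by
  by_contra h0
  obtain ⟨u, ν, d', hu, hu0, hx⟩ := hb
  obtain ⟨h2, _⟩ := Word.depth_eq_zero hM hl hd hu hu0 hx h0 hw hc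
  exact hd0 (hd.eq_zero_of_neg (by rw [neg_eq_of_add_eq_zero_right h2]; exact hx.nonneg))

theorem Cas_mem_wt {l : Fin n → ℂ} {x : M} (hx : x ∈ D.wt M l) : D.Cas M x ∈ D.wt M l := fun a => by
  rw [← Cas_lie, hx a, map_smul]

/-- An integrable module is generated by its singular vectors. A weight vector `x` of maximal
weight outside of the submodule `S` generated by them would be singular modulo `S`; since the
Casimir element separates comparable dominant weights, `x` can be corrected by an element of `S`
to a singular vector. -/
theorem socle_eq_top {l₀ : Fin n → ℂ} (hM : D.Adm M l₀) : D.socle M = ⊤ := by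
  classical
  by_contra hne
  have hex : ∃ m : ℕ, ∃ d, ∃ x : M, Qpos d ∧ x ∈ D.wt M (l₀ - cst d) ∧ x ∉ D.socle M ∧
      (ht d).toNat = m := by
    by_contra hc
    push Not at hc
    refine hne (LieSubmodule.toSubmodule_injective ?_)
    rw [LieSubmodule.top_toSubmodule, eq_top_iff, ← hM.spn, Submodule.span_le]
    rintro x ⟨d, hd, hx⟩
    by_contra hxS
    exact hc _ d x hd hx hxS rfl
  obtain ⟨d, x, hd, hx, hxS, hm⟩ := Nat.find_spec hex
  have hmin := fun k => Nat.find_min hex (m := k)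
  set m := Nat.find hex with hmdef
  clear_value m
  set l := l₀ - cst d with hl
  have he : ∀ p, ⁅D.e p, x⁆ ∈ D.socle M := by
    intro p
    by_contra hc
    have h0 : ⁅D.e p, x⁆ ≠ 0 := fun h => hc (by rw [h]; exact zero_mem _)
    have h1 := lie_e_mem_wt hx p
    obtain ⟨d', hd', h2⟩ := hM.exists_of_mem_wt h1 h0
    have h3 : d = d' + D.rt p := by
      apply cst_injective
      rw [cst_add]
      rw [hl, sub_add, sub_right_inj] at h2
      rw [← h2, sub_add_cancel]
    have h4 := (D.rt_nonneg p).ht_pos (D.rt_ne p)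
    have h5 := hd'.ht_nonneg
    refine hmin (ht d').toNat ?_ ⟨d', ⁅D.e p, x⁆, hd', h2 ▸ h1, hc, rfl⟩
    rw [← hm, h3, ht_add]
    omega
  have hx0 : LieSubmodule.Quotient.mk' (D.socle M) x ≠ 0 := by
    rw [Ne, LieSubmodule.Quotient.mk'_apply, LieSubmodule.Quotient.mk_eq_zero']
    exact hxS
  have hdom : D.Dom l := by
    refine Sing.dom (hM.quotient (D.socle M)) (u := LieSubmodule.Quotient.mk' (D.socle M) x)
      ⟨map_mem_wt _ hx, fun p => ?_⟩ hx0
    rw [← LieModuleHom.map_lie, LieSubmodule.Quotient.mk'_apply,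
      LieSubmodule.Quotient.mk_eq_zero']
    exact he p
  -- the Casimir element acts on `x` by `cval l` up to an element of the socle
  have hy : D.Cas M x - D.cval l • x ∈ Submodule.span ℂ (D.Piece M) := Cas_sub_mem (D.socle M) hx he
  have hyw : D.Cas M x - D.cval l • x ∈ D.wt M l :=
    sub_mem (Cas_mem_wt hx) (Submodule.smul_mem _ _ hx)
  have hy' := mem_span_inter_of_homogeneous (D.wt M) iSupIndep_wt _
    (fun b hb => (Piece.exists_mem hb).imp' Prod.fst fun q hq => hq.1) hy hyw
  have hz : ∀ y ∈ Submodule.span ℂ (D.Piece M ∩ D.wt M l), ∃ z ∈ D.socle M, z ∈ D.wt M l ∧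
      D.Cas M z - D.cval l • z - y ∈ D.Sing M l := by
    intro y hy
    induction hy using Submodule.span_induction with
    | mem b hb =>
      obtain ⟨⟨u, ν, d', hu, hu0, hb1⟩, hb2⟩ := hb
      have hbP : b ∈ D.Piece M := ⟨u, ν, d', hu, hu0, hb1⟩
      have hbc := hb1.Cas (Cas_of_Sing hu)
      by_cases hc : D.cval ν = D.cval l
      · refine ⟨0, zero_mem _, zero_mem _, ?_⟩
        rw [map_zero, smul_zero, sub_zero, zero_sub]
        exact neg_mem (Piece.mem_Sing hM hdom hbP hb2 (by rw [hbc, hc]))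
      · refine ⟨(D.cval ν - D.cval l)⁻¹ • b, Submodule.smul_mem _ _ (Submodule.subset_span hbP),
          Submodule.smul_mem _ _ hb2, ?_⟩
        rw [map_smul, hbc, smul_comm (D.cval l), ← smul_sub, ← sub_smul, smul_smul,
          inv_mul_cancel₀ (sub_ne_zero.2 hc), one_smul, sub_self]
        exact zero_mem _
    | zero => exact ⟨0, zero_mem _, zero_mem _, by simp⟩
    | add a b _ _ ha hb =>
      obtain ⟨z, hz, hzw, hz1⟩ := ha
      obtain ⟨z', hz', hzw', hz1'⟩ := hb
      refine ⟨z + z', add_mem hz hz', add_mem hzw hzw', ?_⟩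
      have := add_mem hz1 hz1'
      rw [map_add, smul_add]
      convert this using 1
      abel
    | smul r a _ ha =>
      obtain ⟨z, hz, hzw, hz1⟩ := ha
      refine ⟨r • z, Submodule.smul_mem _ _ hz, Submodule.smul_mem _ _ hzw, ?_⟩
      have := Submodule.smul_mem _ r hz1
      rwa [smul_sub, smul_sub, ← map_smul, smul_comm] at this
  obtain ⟨z, hzS, hzw, hz1⟩ := hz _ hy'
  have hx'w : x - z ∈ D.wt M l := sub_mem hx hzw
  have hsing : x - z ∈ D.Sing M l := by
    refine ⟨hx'w, fun p => ?_⟩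
    have h1 : D.Cas M (x - z) - D.cval l • (x - z) ∈ D.Sing M l := by
      have := neg_mem hz1
      rw [map_sub, smul_sub]
      convert this using 1
      abel
    have h2 : D.Cas M ⁅D.e p, x - z⁆ = D.cval l • ⁅D.e p, x - z⁆ := by
      have := h1.2 p
      rwa [lie_sub, ← Cas_lie, lie_smul, sub_eq_zero] at this
    have h3 : ⁅D.e p, x - z⁆ ∈ Submodule.span ℂ (D.Piece M) := by
      rw [lie_sub]
      exact sub_mem (he p) ((D.socle M).lie_mem hzS)
    have h4 := lie_e_mem_wt hx'w p
    have h5 := mem_span_inter_of_homogeneous _ (iSupIndep_wt_Cas (D := D)) _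
      (fun b hb => Piece.exists_mem hb) h3 (i := (l + cst (D.rt p), D.cval l))
      ⟨h4, Module.End.mem_eigenspace_iff.2 h2⟩
    have h6 : Submodule.span ℂ (D.Piece M ∩ (D.wt M (l + cst (D.rt p)) ⊓
        (D.Cas M).eigenspace (D.cval l) : Submodule ℂ M)) ≤ ⊥ := by
      rw [Submodule.span_le]
      rintro b ⟨hb, hbw, hbc⟩
      exact Piece.eq_zero hM hdom (D.rt_nonneg p) (D.rt_ne p) hb hbw
        (Module.End.mem_eigenspace_iff.1 hbc)
    simpa using h6 h5
  refine hxS ?_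
  have h7 : x - z ∈ D.socle M := by
    by_cases h0 : x - z = 0
    · rw [h0]; exact zero_mem _
    · exact Submodule.subset_span ⟨x - z, l, 0, hsing, h0, Word.base⟩
  simpa using add_mem h7 hzS

/-- A singular vector is not a combination of vectors obtained by applying negative root
vectors. -/
theorem Sing.eq_zero_of_mem_span {l₀ : Fin n → ℂ} (hM : D.Adm M l₀) {l : Fin n → ℂ} {u : M}
    (hu : u ∈ D.Sing M l)
    (h : u ∈ Submodule.span ℂ {y : M | ∃ p, ∃ x ∈ D.Piece M, ⁅D.f p, x⁆ = y}) : u = 0 := by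
  by_contra h0
  have hdom := Sing.dom hM hu h0
  have h1 := mem_span_inter_of_homogeneous _ (iSupIndep_wt_Cas (D := D)) _
    (by
      rintro _ ⟨p, x, ⟨u', l', d, hu', hu0', hx⟩, rfl⟩
      exact Piece.exists_mem ⟨u', l', _, hu', hu0', hx.step p⟩) h (i := (l, D.cval l))
    ⟨hu.1, Module.End.mem_eigenspace_iff.2 (Cas_of_Sing hu)⟩
  refine h0 ?_
  have h2 : Submodule.span ℂ ({y : M | ∃ p, ∃ x ∈ D.Piece M, ⁅D.f p, x⁆ = y} ∩
      (D.wt M l ⊓ (D.Cas M).eigenspace (D.cval l) : Submodule ℂ M)) ≤ ⊥ := by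
    rw [Submodule.span_le]
    rintro _ ⟨⟨p, x, ⟨u', l', d, hu', hu0', hx⟩, rfl⟩, hbw, hbc⟩
    by_contra hb0
    have hw : ⁅D.f p, x⁆ ∈ D.wt M (l + cst 0) := by simpa using hbw
    obtain ⟨h3, _⟩ := Word.depth_eq_zero hM hdom Qpos_zero hu' hu0' (hx.step p) hb0 hw
      (Module.End.mem_eigenspace_iff.1 hbc)
    have h4 := (D.rt_nonneg p).ht_pos (D.rt_ne p)
    have h5 := hx.nonneg.ht_nonneg
    have h6 : ht (0 + (d + D.rt p)) = 0 := by rw [h3]; simp [ht]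
    rw [zero_add, ht_add] at h6
    omega
  simpa using h2 h1

/-- If an integrable module is spanned by words on weight vectors of pairwise distinct weights,
then every space of singular vectors is at most one-dimensional, and its weight is one of
these. -/
theorem Sing.unique {l₀ : Fin n → ℂ} (hM : D.Adm M l₀) {K : Type} (w : K → M)
    (lam : K → Fin n → ℂ) (hlam : Function.Injective lam) (hw : ∀ k, w k ∈ D.wt M (lam k))
    (hspan : Submodule.span ℂ {x : M | ∃ k d, D.Word (w k) d x} = ⊤) {l : Fin n → ℂ} {u u' : M}
    (hu : u ∈ D.Sing M l) (hu' : u' ∈ D.Sing M l) (h0 : u ≠ 0) :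
    ∃ k, lam k = l ∧ w k ≠ 0 ∧ ∃ c : ℂ, u' = c • u := by
  -- Modulo the image of the negative root vectors only the vectors `w k` survive, while no nonzero
  -- singular vector lies in this image.
  set Neg : Set M := {y : M | ∃ p, ∃ x ∈ D.Piece M, ⁅D.f p, x⁆ = y} with hNeg
  have hf : ∀ p (x : M), ⁅D.f p, x⁆ ∈ Submodule.span ℂ Neg := by
    intro p x
    have hx : x ∈ Submodule.span ℂ (D.Piece M) := by
      rw [← mem_socle, socle_eq_top hM]
      trivial
    induction hx using Submodule.span_induction with
    | mem x hx => exact Submodule.subset_span ⟨p, x, hx, rfl⟩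
    | zero => simp
    | add a b _ _ ha hb => rw [lie_add]; exact add_mem ha hb
    | smul r a _ ha => rw [lie_smul]; exact Submodule.smul_mem _ _ ha
  have htop : Submodule.span ℂ (Set.range w ∪ Neg) = ⊤ := by
    rw [eq_top_iff, ← hspan, Submodule.span_le]
    rintro x ⟨k, d, hx⟩
    cases hx with
    | base => exact Submodule.subset_span (Or.inl ⟨k, rfl⟩)
    | step p d x _ => exact Submodule.span_mono Set.subset_union_right (hf p x)
  have hom : ∀ b ∈ Set.range w ∪ Neg, ∃ l, b ∈ D.wt M l := by
    rintro b (⟨k, rfl⟩ | ⟨p, x, ⟨u', l', d, hu', hu0', hx⟩, rfl⟩)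
    · exact ⟨_, hw k⟩
    · exact ⟨_, (hx.step p).mem_wt hu'.1⟩
  have key : ∀ v ∈ D.Sing M l,
      v ∈ Submodule.span ℂ ((Set.range w ∪ Neg) ∩ D.wt M l : Set M) := fun v hv =>
    mem_span_inter_of_homogeneous (D.wt M) iSupIndep_wt _ hom (by rw [htop]; trivial) hv.1
  by_cases hk : ∃ k, lam k = l ∧ w k ≠ 0
  · obtain ⟨k, hk1, hk2⟩ := hk
    have hle : Submodule.span ℂ ((Set.range w ∪ Neg) ∩ D.wt M l : Set M) ≤
        Submodule.span ℂ {w k} ⊔ Submodule.span ℂ Neg := by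
      rw [Submodule.span_le]
      rintro b ⟨⟨k', rfl⟩ | hb, hb'⟩
      · by_cases h1 : w k' = 0
        · rw [h1]; exact zero_mem _
        · have h2 := wt_eq_of_ne_zero (hw k') hb' h1
          rw [hlam (h2.trans hk1.symm)]
          exact Submodule.mem_sup_left (Submodule.mem_span_singleton_self _)
      · exact Submodule.mem_sup_right (Submodule.subset_span hb)
    have hdec : ∀ v ∈ D.Sing M l, ∃ c : ℂ, v - c • w k ∈ Submodule.span ℂ Neg := by
      intro v hv
      obtain ⟨a, ha, b, hb, rfl⟩ := Submodule.mem_sup.1 (hle (key v hv))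
      obtain ⟨c, rfl⟩ := Submodule.mem_span_singleton.1 ha
      exact ⟨c, by simpa using hb⟩
    obtain ⟨c, hc⟩ := hdec u hu
    obtain ⟨c', hc'⟩ := hdec u' hu'
    have hc0 : c ≠ 0 := by
      rintro rfl
      rw [zero_smul, sub_zero] at hc
      exact h0 (Sing.eq_zero_of_mem_span hM hu hc)
    refine ⟨k, hk1, hk2, c' / c, ?_⟩
    have h3 : u' - (c' / c) • u ∈ Submodule.span ℂ Neg := by
      have := sub_mem hc' (Submodule.smul_mem _ (c' / c) hc)
      rw [smul_sub, smul_smul, div_mul_cancel₀ _ hc0] at this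
      convert this using 1
      abel
    exact sub_eq_zero.1 (Sing.eq_zero_of_mem_span hM
      (sub_mem hu' (Submodule.smul_mem _ _ hu)) h3)
  · push Not at hk
    exfalso
    refine h0 (Sing.eq_zero_of_mem_span hM hu ?_)
    refine (Submodule.span_le.2 ?_ : Submodule.span ℂ _ ≤ Submodule.span ℂ Neg) (key u hu)
    rintro b ⟨⟨k', rfl⟩ | hb, hb'⟩
    · by_cases h1 : w k' = 0
      · rw [h1]; exact zero_mem _
      · exact absurd (hk k' (wt_eq_of_ne_zero (hw k') hb' h1)) h1
    · exact Submodule.subset_span hb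

end TriData

namespace TriData

variable {g : Type} [LieRing g] [LieAlgebra ℂ g] {n : ℕ} {D : TriData g n}
variable {M : Type} [AddCommGroup M] [Module ℂ M] [LieRingModule g M] [LieModule ℂ g M]

/-- A nonzero submodule of a module with bounded weights contains a nonzero weight vector. -/
theorem Adm.exists_wt_mem {l₀ : Fin n → ℂ} (h : D.Adm M l₀) (K : LieSubmodule ℂ g M) (hK : K ≠ ⊥) :
    ∃ x ∈ K, x ≠ 0 ∧ ∃ l, x ∈ D.wt M l := by
  classical
  obtain ⟨x, hxK, hx0⟩ : ∃ x ∈ K, x ≠ 0 := by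
    by_contra hc
    push Not at hc
    exact hK ((LieSubmodule.eq_bot_iff K).2 hc)
  have hx : x ∈ ⨆ l, D.wt M l := by
    have h1 : (⊤ : Submodule ℂ M) ≤ ⨆ l, D.wt M l := by
      rw [← h.spn, Submodule.span_le]
      rintro y ⟨d, _, hy⟩
      exact Submodule.mem_iSup_of_mem _ hy
    exact h1 trivial
  obtain ⟨f, hf, rfl⟩ := (Submodule.mem_iSup_iff_exists_finsupp _ _).1 hx
  have hind := (iSupIndep_iff_finsetSum_eq_zero_imp_eq_zero _).1
    (iSupIndep_wt (D := D) (M := M ⧸ K)) f.support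
    (fun l => LieSubmodule.Quotient.mk' K (f l)) (fun l _ => map_mem_wt _ (hf l)) (by
      rw [← map_sum, LieSubmodule.Quotient.mk'_apply, LieSubmodule.Quotient.mk_eq_zero']
      exact hxK)
  have hne : f.support.Nonempty := by
    by_contra hc
    rw [Finset.not_nonempty_iff_eq_empty] at hc
    exact hx0 (by simp [Finsupp.sum, hc])
  obtain ⟨l, hl⟩ := hne
  have h2 := hind l hl
  rw [LieSubmodule.Quotient.mk'_apply, LieSubmodule.Quotient.mk_eq_zero'] at h2
  exact ⟨f l, h2, Finsupp.mem_support_iff.1 hl, l, hf l⟩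

/-- A nonzero submodule of a module with bounded weights contains a nonzero singular vector. -/
theorem Adm.exists_Sing_mem {l₀ : Fin n → ℂ} (h : D.Adm M l₀) (K : LieSubmodule ℂ g M)
    (hK : K ≠ ⊥) : ∃ x ∈ K, x ≠ 0 ∧ ∃ l, x ∈ D.Sing M l := by
  classical
  have hex : ∃ m : ℕ, ∃ d, ∃ x : M, Qpos d ∧ x ∈ D.wt M (l₀ - cst d) ∧ x ∈ K ∧ x ≠ 0 ∧
      (ht d).toNat = m := by
    obtain ⟨x, hxK, hx0, l, hx⟩ := h.exists_wt_mem K hK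
    obtain ⟨d, hd, rfl⟩ := h.exists_of_mem_wt hx hx0
    exact ⟨_, d, x, hd, hx, hxK, hx0, rfl⟩
  obtain ⟨d, x, hd, hx, hxK, hx0, hm⟩ := Nat.find_spec hex
  have hmin := fun k => Nat.find_min hex (m := k)
  set m := Nat.find hex with hmdef
  clear_value m
  refine ⟨x, hxK, hx0, _, hx, fun p => ?_⟩
  by_contra h0
  have h1 := lie_e_mem_wt hx p
  obtain ⟨d', hd', h2⟩ := h.exists_of_mem_wt h1 h0
  have h3 : d = d' + D.rt p := by
    apply cst_injective
    rw [cst_add]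
    rw [sub_add, sub_right_inj] at h2
    rw [← h2, sub_add_cancel]
  have h4 := (D.rt_nonneg p).ht_pos (D.rt_ne p)
  have h5 := hd'.ht_nonneg
  refine hmin (ht d').toNat ?_ ⟨d', ⁅D.e p, x⁆, hd', h2 ▸ h1, K.lie_mem hxK, h0, rfl⟩
  rw [← hm, h3, ht_add]
  omega

/-- The only singular vectors of an integrable highest weight module are the multiples of its
generator. -/
theorem Sing.eq_smul_of_cyclic {l l' : Fin n → ℂ} (hM : D.Adm M l) {v : M} (hv : v ∈ D.Sing M l)
    (hgen : LieSubmodule.lieSpan ℂ g {v} = ⊤) {x : M} (hx : x ∈ D.Sing M l') (h0 : x ≠ 0) :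
    l' = l ∧ ∃ c : ℂ, x = c • v := by
  have htop : Submodule.span ℂ {x | ∃ d, D.Word v d x} = ⊤ := by
    rw [eq_top_iff]
    refine le_trans ?_ (lieSpan_le_span_word hv)
    rw [hgen, LieSubmodule.top_toSubmodule]
  have hv0 : v ≠ 0 := by
    rintro rfl
    have h1 : x ∈ LieSubmodule.lieSpan ℂ g {(0 : M)} := by rw [hgen]; trivial
    rw [(LieSubmodule.lieSpan_eq_bot_iff ℂ g M).2 (by simp)] at h1
    exact h0 (by simpa using h1)
  have hcas : D.Cas M x = D.cval l • x := by
    have hxs : x ∈ Submodule.span ℂ {x | ∃ d, D.Word v d x} := by rw [htop]; trivial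
    clear hx h0
    induction hxs using Submodule.span_induction with
    | mem x hx => obtain ⟨d, hx⟩ := hx; exact hx.Cas (Cas_of_Sing hv)
    | zero => simp
    | add a b _ _ ha hb => rw [map_add, ha, hb, smul_add]
    | smul r a _ ha => rw [map_smul, ha, smul_comm]
  have hc : D.cval l = D.cval l' :=
    smul_left_injective ℂ h0 (hcas.symm.trans (Cas_of_Sing hx))
  obtain ⟨d, hd, rfl⟩ := hM.exists_of_mem_wt hx.1 h0
  have hd0 : d = 0 := by
    by_contra hd0
    have h1 := Sing.dom hM hx h0
    have h2 : l - cst d + cst d = l := sub_add_cancel _ _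
    have h3 := cval_ne h1 (h2.symm ▸ Sing.dom hM hv hv0) hd hd0
    rw [h2] at h3
    exact h3 hc
  subst hd0
  rw [cst_zero, sub_zero] at hx ⊢
  refine ⟨rfl, ?_⟩
  have h1 := mem_span_inter_of_homogeneous (D.wt M) iSupIndep_wt {x | ∃ d, D.Word v d x}
    (by rintro b ⟨d, hb⟩; exact ⟨_, hb.mem_wt hv.1⟩) (x := x) (by rw [htop]; trivial) hx.1
  have h2 : Submodule.span ℂ ({x | ∃ d, D.Word v d x} ∩ D.wt M l : Set M) ≤
      Submodule.span ℂ {v} := by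
    rw [Submodule.span_le]
    rintro b ⟨⟨d, hb⟩, hbw⟩
    by_cases hb0 : b = 0
    · rw [hb0]; exact zero_mem _
    have h3 := wt_eq_of_ne_zero hbw (hb.mem_wt hv.1) hb0
    have h4 : d = 0 := by
      apply cst_injective
      rw [cst_zero]
      exact sub_eq_self.1 h3.symm
    rcases hb.eq_or with h5 | rfl
    · exact absurd h4 h5
    · exact Submodule.mem_span_singleton_self _
  obtain ⟨c, hc⟩ := Submodule.mem_span_singleton.1 (h2 h1)
  exact ⟨c, hc.symm⟩

theorem Adm.of_le {l l₀ : Fin n → ℂ} (h : D.Adm M l) {d : Fin n → ℤ} (hd : Qpos d)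
    (hl : l = l₀ - cst d) : D.Adm M l₀ where
  spn := by
    rw [eq_top_iff, ← h.spn, Submodule.span_le]
    rintro x ⟨d', hd', hx⟩
    refine Submodule.subset_span ⟨d + d', hd.add hd', ?_⟩
    rwa [cst_add, ← sub_sub, ← hl]
  nil := h.nil

/-! ### Direct sums of highest weight modules -/

section DirectSum

variable {J : Type} {V : J → Type} [∀ j, AddCommGroup (V j)] [∀ j, Module ℂ (V j)]
  [∀ j, LieRingModule g (V j)] [∀ j, LieModule ℂ g (V j)]

theorem Adm.directSum {l₀ : Fin n → ℂ} (h : ∀ j, D.Adm (V j) l₀) :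
    D.Adm (⨁ j, V j) l₀ where
  spn := by
    classical
    rw [eq_top_iff]
    rintro x -
    induction x using DirectSum.induction_on with
    | zero => exact zero_mem _
    | add a b ha hb => exact add_mem ha hb
    | of j x =>
      change DirectSum.lieModuleOf ℂ J g V j x ∈ _
      have hx : x ∈ Submodule.span ℂ {x : V j | ∃ d, Qpos d ∧ x ∈ D.wt (V j) (l₀ - cst d)} := by
        rw [(h j).spn]; trivial
      induction hx using Submodule.span_induction with
      | mem x hx =>
        obtain ⟨d, hd, hx⟩ := hx
        exact Submodule.subset_span ⟨d, hd, map_mem_wt _ hx⟩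
      | zero => simp
      | add a b _ _ ha hb => rw [map_add]; exact add_mem ha hb
      | smul r a _ ha => rw [map_smul]; exact Submodule.smul_mem _ _ ha
  nil := by
    classical
    intro j x
    induction x using DirectSum.induction_on with
    | zero => exact ⟨0, by simp⟩
    | add a b ha hb =>
      obtain ⟨N, hN⟩ := ha
      obtain ⟨N', hN'⟩ := hb
      refine ⟨N + N', ?_⟩
      rw [map_add]
      nth_rewrite 1 [add_comm N N']
      rw [pow_add, pow_add, Module.End.mul_apply, Module.End.mul_apply, hN, hN', map_zero,
        map_zero, add_zero]
    | of i x =>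
      obtain ⟨N, hN⟩ := (h i).nil j x
      refine ⟨N, ?_⟩
      change (LieModule.toEnd ℂ g _ (D.fs j) ^ N) (DirectSum.lieModuleOf ℂ J g V i x) = 0
      rw [← toEnd_pow_map, hN, map_zero]

/-- The module homomorphism from a direct sum with given components. -/
def directSumHom [DecidableEq J] (φ : ∀ j, V j →ₗ⁅ℂ,g⁆ M) : (⨁ j, V j) →ₗ⁅ℂ,g⁆ M where
  __ := DirectSum.toModule ℂ J M fun j => (φ j : V j →ₗ[ℂ] M)
  map_lie' := by
    intro z x
    change DirectSum.toModule ℂ J M (fun j => (φ j : V j →ₗ[ℂ] M)) _ =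
      ⁅z, DirectSum.toModule ℂ J M (fun j => (φ j : V j →ₗ[ℂ] M)) x⁆
    induction x using DirectSum.induction_on with
    | zero => simp
    | add a b ha hb => rw [lie_add, map_add, ha, hb, map_add, lie_add]
    | of j x =>
      have h1 : ⁅z, DirectSum.of V j x⁆ = DirectSum.of V j ⁅z, x⁆ :=
        ((DirectSum.lieModuleOf ℂ J g V j).map_lie z x).symm
      rw [h1]
      change DirectSum.toModule ℂ J M (fun j => (φ j : V j →ₗ[ℂ] M))
        (DirectSum.lof ℂ J V j _) = ⁅z, DirectSum.toModule ℂ J M (fun j => (φ j : V j →ₗ[ℂ] M))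
          (DirectSum.lof ℂ J V j x)⁆
      rw [DirectSum.toModule_lof, DirectSum.toModule_lof]
      exact (φ j).map_lie z x

theorem directSumHom_of [DecidableEq J] (φ : ∀ j, V j →ₗ⁅ℂ,g⁆ M) (j : J) (x : V j) :
    directSumHom φ (DirectSum.lof ℂ J V j x) = φ j x :=
  DirectSum.toModule_lof _ _ _

/-- An integrable module whose spaces of singular vectors are at most one-dimensional is the direct
sum of the highest weight modules generated by its singular vectors. -/
theorem bijective_directSumHom [DecidableEq J] {l₀ : Fin n → ℂ} (hM : D.Adm M l₀)
    (ev : J → Fin n → ℂ) (hev : Function.Injective ev) (hV : ∀ j, D.Adm (V j) (ev j))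
    (v : ∀ j, V j) (hv : ∀ j, v j ∈ D.Sing (V j) (ev j))
    (hgen : ∀ j, LieSubmodule.lieSpan ℂ g {v j} = ⊤) (φ : ∀ j, V j →ₗ⁅ℂ,g⁆ M)
    (hφ : ∀ j, φ j (v j) ≠ 0)
    (hsing : ∀ l, ∀ u ∈ D.Sing M l, u ≠ 0 → ∃ j, ∃ c : ℂ, u = c • φ j (v j)) :
    Function.Bijective (directSumHom φ) := by
  have hφs : ∀ j, φ j (v j) ∈ D.Sing M (ev j) := fun j =>
    ⟨map_mem_wt _ (hv j).1, fun p => by rw [← LieModuleHom.map_lie, (hv j).2, map_zero]⟩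
  have hV' : ∀ j, D.Adm (V j) l₀ := by
    intro j
    obtain ⟨d, hd, h⟩ := hM.exists_of_mem_wt (hφs j).1 (hφ j)
    exact (hV j).of_le hd h
  constructor
  · rw [← LieModuleHom.ker_eq_bot]
    by_contra hK
    obtain ⟨x, hxK, hx0, l, hx⟩ := (Adm.directSum hV').exists_Sing_mem _ hK
    have hcomp : ∀ j, x j ∈ D.Sing (V j) l := fun j =>
      ⟨map_mem_wt (DirectSum.lieModuleComponent ℂ J g V j) hx.1, fun p => by
        have := congrArg (fun y => y j) (hx.2 p)
        simpa using this⟩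
    obtain ⟨j, hj⟩ : ∃ j, x j ≠ 0 := by
      by_contra hc
      push Not at hc
      exact hx0 (DFinsupp.ext hc)
    obtain ⟨hl, c, hc⟩ := Sing.eq_smul_of_cyclic (hV j) (hv j) (hgen j) (hcomp j) hj
    have hxj : x = DirectSum.lof ℂ J V j (x j) := by
      refine DFinsupp.ext fun i => ?_
      by_cases hij : i = j
      · subst hij
        exact (DirectSum.lof_apply ℂ i (x i)).symm
      · have h1 : DirectSum.lof ℂ J V j (x j) i = 0 := DirectSum.of_eq_of_ne _ _ _ hij
        rw [h1]
        by_contra hi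
        obtain ⟨hl', _⟩ := Sing.eq_smul_of_cyclic (hV i) (hv i) (hgen i) (hcomp i) hi
        exact hij (hev (hl'.symm.trans hl))
    rw [LieModuleHom.mem_ker, hxj, directSumHom_of, hc, map_smul, smul_eq_zero] at hxK
    rcases hxK with rfl | h
    · exact hj (by rw [hc, zero_smul])
    · exact hφ j h
  · rw [← LieModuleHom.range_eq_top, eq_top_iff, ← socle_eq_top hM]
    refine fun x hx => ?_
    have h1 : Submodule.span ℂ (D.Piece M) ≤ (directSumHom φ).range.toSubmodule := by
      rw [Submodule.span_le]
      rintro y ⟨u, l, d, hu, hu0, hy⟩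
      refine hy.mem _ ?_
      obtain ⟨j, c, rfl⟩ := hsing l u hu hu0
      refine Submodule.smul_mem _ c ?_
      exact (LieModuleHom.mem_range _ _).2 ⟨_, directSumHom_of φ j (v j)⟩
    exact h1 hx

end DirectSum

/-! ### Finite-dimensionality of integrable highest weight modules -/

theorem ht_sr_pos (j : Fin n) : 0 < ht (sr D.sl j) := by
  have hsl : (0 : ℤ) < D.sl := by
    have := D.cl_mul_sl
    have : D.sl ≠ 0 := by rintro h; simp [h] at this
    exact_mod_cast Nat.pos_of_ne_zero this
  simp only [ht, sum_Iic_sr, Finset.sum_ite_eq', Finset.mem_univ, if_true]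
  split_ifs <;> omega

theorem pow_fs_mem_wt {l : Fin n → ℂ} {x : M} (hx : x ∈ D.wt M l) (j : Fin n) (k : ℕ) :
    (LieModule.toEnd ℂ g M (D.fs j) ^ k) x ∈ D.wt M (l - (k : ℂ) • cst (sr D.sl j)) := by
  induction k with
  | zero => simpa using hx
  | succ k ih =>
    rw [pow_succ', Module.End.mul_apply, LieModule.toEnd_apply_apply]
    have := lie_fs_mem_wt ih j
    rw [sub_sub] at this
    convert this using 2
    push_cast
    rw [add_smul, one_smul]

theorem pow_es_mem_wt {l : Fin n → ℂ} {x : M} (hx : x ∈ D.wt M l) (j : Fin n) (k : ℕ) :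
    (LieModule.toEnd ℂ g M (D.es j) ^ k) x ∈ D.wt M (l + (k : ℂ) • cst (sr D.sl j)) := by
  induction k with
  | zero => simpa using hx
  | succ k ih =>
    rw [pow_succ', Module.End.mul_apply, LieModule.toEnd_apply_apply]
    have := lie_es_mem_wt ih j
    rw [add_assoc] at this
    convert this using 2
    push_cast
    rw [add_smul, one_smul]

theorem Adm.nil_es {l₀ l : Fin n → ℂ} (h : D.Adm M l₀) {x : M} (hx : x ∈ D.wt M l) (j : Fin n) :
    ∃ N, (LieModule.toEnd ℂ g M (D.es j) ^ N) x = 0 := by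
  by_contra hc
  push Not at hc
  obtain ⟨d, hd, rfl⟩ := h.exists_of_mem_wt hx (by simpa using hc 0)
  obtain ⟨d', hd', h1⟩ := h.exists_of_mem_wt (pow_es_mem_wt hx j ((ht d).toNat + 1)) (hc _)
  have h2 : d = d' + ((ht d).toNat + 1) • sr D.sl j := by
    apply cst_injective
    rw [sub_add, sub_right_inj] at h1
    rw [cst_add, ← h1]
    generalize (ht d).toNat = k
    ext a
    simp [cst]
  have h3 : ht d = ht d' + ((ht d).toNat + 1) * ht (sr D.sl j) := by
    nth_rewrite 1 [h2]
    rw [ht_add]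
    simp [ht, Finset.mul_sum]
  have h4 := hd'.ht_nonneg
  have h5 := hd.ht_nonneg
  have h6 := ht_sr_pos (D := D) j
  have h7 : ((ht d).toNat : ℤ) = ht d := Int.toNat_of_nonneg h5
  nlinarith

/-- The set of weights is stable under the simple reflections. -/
theorem Adm.reflect {l₀ l : Fin n → ℂ} (h : D.Adm M l₀) {x : M} (hx : x ∈ D.wt M l) (h0 : x ≠ 0)
    (j : Fin n) {k : ℤ} (hk : pr (D.cl : ℂ) l j = k) :
    ∃ y ≠ 0, y ∈ D.wt M (l - (k : ℂ) • cst (sr D.sl j)) := by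
  have hh := lie_coroot hx j
  rw [hk] at hh
  obtain ⟨m, rfl | rfl⟩ := k.eq_nat_or_neg
  · obtain ⟨r, hr⟩ := h.nil_es hx j
    refine ⟨_, pow_f_ne_zero (D.triple j) r x m (by simpa using hh) hr h0, ?_⟩
    simpa using pow_fs_mem_wt hx j m
  · obtain ⟨r, hr⟩ := h.nil j x
    refine ⟨_, pow_f_ne_zero (D.triple j).symm r x m ?_ hr h0, ?_⟩
    · rw [neg_lie, hh, ← neg_smul]
      simp
    · have := pow_es_mem_wt hx j m
      simpa using this

theorem pr_sub_cst_int {l : Fin n → ℂ} (hl : D.Dom l) (d : Fin n → ℤ) (j : Fin n) :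
    ∃ k : ℤ, pr (D.cl : ℂ) (l - cst d) j = k := by
  obtain ⟨m, hm⟩ := hl j
  refine ⟨m - pr (D.cl : ℤ) d j, ?_⟩
  unfold pr at hm ⊢
  split_ifs at hm ⊢ with hj
  · push_cast
    rw [← hm]
    simp only [Pi.sub_apply, cst]
    ring
  · push_cast
    rw [← hm]
    simp only [Pi.sub_apply, cst]
    ring

theorem Adm.reflect_coord {l₀ l : Fin n → ℂ} (h : D.Adm M l₀) (hd : D.Dom l₀) {x : M}
    (hx : x ∈ D.wt M l) (h0 : x ≠ 0) (j : Fin n) :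
    ∃ l', (∃ y ≠ 0, y ∈ D.wt M l') ∧ (if hj : (j : ℕ) + 1 < n then
      l' j = l ⟨j + 1, hj⟩ ∧ l' ⟨j + 1, hj⟩ = l j else l' j = -l j) := by
  obtain ⟨d, _, rfl⟩ := h.exists_of_mem_wt hx h0
  obtain ⟨k, hk⟩ := pr_sub_cst_int hd d j
  refine ⟨_, h.reflect hx h0 j hk, ?_⟩
  have hcs : (D.cl : ℂ) * D.sl = 2 := by exact_mod_cast D.cl_mul_sl
  rw [← hk]
  generalize l₀ - cst d = l
  unfold pr
  split_ifs with hj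
  · constructor <;> simp [cst, sr, hj]
  · simp only [Pi.sub_apply, Pi.smul_apply, smul_eq_mul, cst, sr, if_neg hj]
    simp
    linear_combination (-l j) * hcs

theorem Adm.re_le {l₀ : Fin n → ℂ} (h : D.Adm M l₀) (hd : D.Dom l₀) (h1 : 0 < n) (a : ℕ) :
    ∀ (ha : a < n) (l : Fin n → ℂ), (∃ y ≠ 0, y ∈ D.wt M l) →
      (l ⟨a, ha⟩).re ≤ (l₀ ⟨0, h1⟩).re := by
  induction a with
  | zero =>
    rintro ha l ⟨y, hy0, hy⟩
    obtain ⟨d, hd, rfl⟩ := h.exists_of_mem_wt hy hy0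
    have h2 := hd ⟨0, h1⟩
    have h3 : Finset.Iic (⟨0, h1⟩ : Fin n) = {⟨0, h1⟩} := by
      ext b
      simp [Fin.le_def, Fin.ext_iff]
    rw [h3, Finset.sum_singleton] at h2
    have h4 : (0 : ℝ) ≤ d ⟨0, h1⟩ := by exact_mod_cast h2
    simp [cst]
    exact h2
  | succ a ih =>
    rintro ha l ⟨y, hy0, hy⟩
    obtain ⟨l', hl', h2⟩ := h.reflect_coord hd hy hy0 ⟨a, by omega⟩
    rw [dif_pos ha] at h2
    rw [← h2.1]
    exact ih (by omega) l' hl'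

theorem Adm.neg_re_le {l₀ : Fin n → ℂ} (h : D.Adm M l₀) (hd : D.Dom l₀) (h1 : 0 < n) (b : ℕ) :
    ∀ (a : Fin n) (_ : (a : ℕ) + 1 + b = n) (l : Fin n → ℂ), (∃ y ≠ 0, y ∈ D.wt M l) →
      -(l a).re ≤ (l₀ ⟨0, h1⟩).re := by
  induction b with
  | zero =>
    rintro a ha l ⟨y, hy0, hy⟩
    obtain ⟨l', hl', h2⟩ := h.reflect_coord hd hy hy0 a
    rw [dif_neg (by omega)] at h2
    have := h.re_le hd h1 a a.2 l' hl'
    rw [Fin.eta, h2, Complex.neg_re] at this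
    exact this
  | succ b ih =>
    rintro a ha l ⟨y, hy0, hy⟩
    obtain ⟨l', hl', h2⟩ := h.reflect_coord hd hy hy0 a
    rw [dif_pos (by omega)] at h2
    rw [← h2.2]
    exact ih _ (by simp; omega) l' hl'

variable (D) in
/-- The vectors obtained from `v` by words of length `k` in the negative root vectors. -/
def wordSet (v : M) : ℕ → Set M
  | 0 => {v}
  | k + 1 => Set.image2 (fun p x => ⁅D.f p, x⁆) Set.univ (wordSet v k)

theorem wordSet_finite (v : M) (k : ℕ) : (D.wordSet v k).Finite := by
  induction k with
  | zero => exact Set.finite_singleton v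
  | succ k ih => exact Set.Finite.image2 _ Set.finite_univ ih

theorem Word.mem_wordSet {v x : M} {d : Fin n → ℤ} (h : D.Word v d x) :
    ∃ k : ℕ, (k : ℤ) ≤ ht d ∧ x ∈ D.wordSet v k := by
  induction h with
  | base => exact ⟨0, by simp [ht], rfl⟩
  | step p d x _ ih =>
    obtain ⟨k, hk, hx⟩ := ih
    refine ⟨k + 1, ?_, Set.mem_image2_of_mem trivial hx⟩
    have := (D.rt_nonneg p).ht_pos (D.rt_ne p)
    rw [ht_add]
    push_cast
    omega

/-- The weights of an integrable highest weight module are bounded, by reflection invariance, so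
that only words of bounded length act nontrivially on the generator. -/
theorem Adm.finiteDimensional {l : Fin n → ℂ} (hM : D.Adm M l) {v : M} (hv : v ∈ D.Sing M l)
    (hgen : LieSubmodule.lieSpan ℂ g {v} = ⊤) : FiniteDimensional ℂ M := by
  have htop : Submodule.span ℂ {x | ∃ d, D.Word v d x} = ⊤ := by
    rw [eq_top_iff]
    refine le_trans ?_ (lieSpan_le_span_word hv)
    rw [hgen, LieSubmodule.top_toSubmodule]
  have hb : ∃ B : ℕ, ∀ d x, D.Word v d x → x ≠ 0 → ht d ≤ B := by
    by_cases hv0 : v = 0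
    · refine ⟨0, fun d x hx hx0 => absurd ?_ hx0⟩
      have := hx.mem ⊥ (by simpa using hv0)
      simpa using this
    have hdom := Sing.dom hM hv hv0
    rcases Nat.eq_zero_or_pos n with rfl | hn
    · exact ⟨0, fun d x _ _ => by simp [ht]⟩
    obtain ⟨B, hB⟩ := exists_nat_ge (∑ k : Fin n, ∑ a ∈ Finset.Iic k,
      ((l a).re + (l ⟨0, hn⟩).re))
    refine ⟨B, fun d x hx hx0 => ?_⟩
    have h1 : ((ht d : ℤ) : ℝ) ≤ B := by
      refine le_trans ?_ hB
      unfold ht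
      push_cast
      refine Finset.sum_le_sum fun k _ => Finset.sum_le_sum fun a _ => ?_
      have h2 := hM.neg_re_le hdom hn (n - 1 - a) a (by have := a.2; omega) _
        ⟨x, hx0, hx.mem_wt hv.1⟩
      simp [cst] at h2
      linarith
    exact_mod_cast h1
  obtain ⟨B, hB⟩ := hb
  refine Module.finite_def.2 ⟨((Set.finite_Iic B).biUnion fun k _ =>
    wordSet_finite (D := D) v k).toFinset, ?_⟩
  rw [Set.Finite.coe_toFinset, eq_top_iff, ← htop, Submodule.span_le]
  rintro x ⟨d, hx⟩
  by_cases hx0 : x = 0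
  · rw [hx0]; exact zero_mem _
  obtain ⟨k, hk, hxk⟩ := hx.mem_wordSet
  have := hB d x hx hx0
  refine Submodule.subset_span (Set.mem_biUnion (x := k) ?_ hxk)
  simp only [Set.mem_Iic]
  omega

end TriData

/-! ### Straightening in a commutative algebra with lowering derivations -/

section Straightening

variable {R : Type} [CommRing R] [Algebra ℂ R]

/-- The index lowering rule: `D` replaces the index `c` by `d`. -/
def Lowers (D : Derivation ℂ R R) (z : ℕ → ℕ → R) (c d : ℕ) : Prop :=
  ∀ a b, D (z a b) = (if a = c then z d b else 0) + (if b = c then z a d else 0)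

/-- The variables `z a c` with `a < b` and `c < b` or `c = B`. -/
def gens (z : ℕ → ℕ → R) (B b : ℕ) : Set R := {x | ∃ a c, a < b ∧ (c < b ∨ c = B) ∧ x = z a c}

variable {z : ℕ → ℕ → R} {B : ℕ} {K : Submodule ℂ R}

theorem mem_adjoin_gens {b a c : ℕ} (ha : a < b) (hc : c < b ∨ c = B) :
    z a c ∈ Algebra.adjoin ℂ (gens z B b) :=
  Algebra.subset_adjoin ⟨a, c, ha, hc, rfl⟩

theorem adjoin_gens_zero {p : R} (hp : p ∈ Algebra.adjoin ℂ (gens z B 0)) :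
    ∃ c : ℂ, p = algebraMap ℂ R c := by
  have : gens z B 0 = ∅ := by
    ext x
    simp [gens]
  rw [this, Algebra.adjoin_empty, Algebra.mem_bot] at hp
  obtain ⟨c, rfl⟩ := hp
  exact ⟨c, rfl⟩

theorem mul_mem_of_closure {s : Set R} {w : R} (h : ∀ p ∈ Submonoid.closure s, p * w ∈ K) :
    ∀ p ∈ Algebra.adjoin ℂ s, p * w ∈ K := by
  intro p hp
  have hp' : p ∈ Submodule.span ℂ (Submonoid.closure s : Set R) := by
    rw [← Algebra.adjoin_eq_span]
    exact hp
  clear hp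
  induction hp' using Submodule.span_induction with
  | mem p hp => exact h p hp
  | zero => simp
  | add a b _ _ ha hb => rw [add_mul]; exact add_mem ha hb
  | smul c a _ ha => rw [smul_mul_assoc]; exact K.smul_mem c ha

theorem Lowers.eq_zero {D : Derivation ℂ R R} {c d t : ℕ} (h : Lowers D z c d) (hc : t ≤ c)
    (hB : c < B) {p : R} (hp : p ∈ Algebra.adjoin ℂ (gens z B t)) : D p = 0 := by
  induction hp using Algebra.adjoin_induction with
  | mem x hx =>
    obtain ⟨a, b, ha, hb, rfl⟩ := hx
    rw [h, if_neg (by omega), if_neg (by omega), add_zero]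
  | algebraMap r => simp
  | add x y _ _ hx hy => rw [map_add, hx, hy, add_zero]
  | mul x y _ _ hx hy => simp [hx, hy]

theorem Lowers.mem_adjoin {D : Derivation ℂ R R} {c d t : ℕ} (h : Lowers D z c d) (hd : d < t)
    {p : R} (hp : p ∈ Algebra.adjoin ℂ (gens z B t)) :
    D p ∈ Algebra.adjoin ℂ (gens z B t) := by
  induction hp using Algebra.adjoin_induction with
  | mem x hx =>
    obtain ⟨a, b, ha, hb, rfl⟩ := hx
    rw [h]
    refine add_mem ?_ ?_
    · split_ifs
      · exact mem_adjoin_gens hd hb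
      · exact zero_mem _
    · split_ifs
      · exact mem_adjoin_gens ha (Or.inl hd)
      · exact zero_mem _
  | algebraMap r => simp
  | add x y _ _ hx hy => rw [map_add]; exact add_mem hx hy
  | mul x y hx' hy' hx hy =>
    rw [Derivation.leibniz]
    exact add_mem (mul_mem hx' hy) (mul_mem hy' hx)

/-- Monomials, sorted by the factors that contain the largest index `t`. -/
theorem exists_peel (hz : ∀ a b, ∃ ε : ℂ, z a b = ε • z b a) {t : ℕ} {p : R}
    (hp : p ∈ Submonoid.closure (gens z B (t + 1))) :
    ∃ L : List ℕ, (∀ a ∈ L, a < t) ∧ ∃ h ∈ Algebra.adjoin ℂ (gens z B t), ∃ k l : ℕ,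
      p = (L.map (z t)).prod * h * z t t ^ k * z t B ^ l := by
  induction hp using Submonoid.closure_induction with
  | mem x hx =>
    obtain ⟨a, b, ha, hb, rfl⟩ := hx
    by_cases hat : a = t
    · subst hat
      by_cases hbB : b = B
      · exact ⟨[], by simp, 1, one_mem _, 0, 1, by simp [hbB]⟩
      by_cases hba : b = a
      · exact ⟨[], by simp, 1, one_mem _, 1, 0, by simp [hba]⟩
      · exact ⟨[b], by simp; omega, 1, one_mem _, 0, 0, by simp⟩
    · by_cases hbB : b = B
      · exact ⟨[], by simp, z a b, mem_adjoin_gens (by omega) (Or.inr hbB), 0, 0, by simp⟩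
      by_cases hbt : b = t
      · obtain ⟨ε, hε⟩ := hz a b
        refine ⟨[a], by simp; omega, algebraMap ℂ R ε, Subalgebra.algebraMap_mem _ _, 0, 0, ?_⟩
        subst hbt
        simp [hε, Algebra.smul_def, mul_comm]
      · exact ⟨[], by simp, z a b, mem_adjoin_gens (by omega) (Or.inl (by omega)), 0, 0, by simp⟩
  | one => exact ⟨[], by simp, 1, one_mem _, 0, 0, by simp⟩
  | mul x y _ _ hx hy =>
    obtain ⟨L, hL, h, hh, k, l, rfl⟩ := hx
    obtain ⟨L', hL', h', hh', k', l', rfl⟩ := hy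
    refine ⟨L ++ L', ?_, h * h', mul_mem hh hh', k + k', l + l', ?_⟩
    · intro a ha
      rcases List.mem_append.1 ha with ha | ha
      · exact hL a ha
      · exact hL' a ha
    · rw [List.map_append, List.prod_append]
      ring

/-- The representatives `∏ z a a ^ k a`. -/
def symSlice (z : ℕ → ℕ → R) (k : ℕ → ℕ) : ℕ → R
  | 0 => 1
  | b + 1 => z b b ^ k b * symSlice z k b

/-- A subspace that is stable under the lowering derivations and contains the monomials in the
diagonal variables contains all polynomials in the variables of a symmetric matrix. The factor `w`
absorbs the variables that have already been treated. -/
theorem sym_straightening {D : ℕ → ℕ → Derivation ℂ R R}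
    (hD : ∀ c d, d < c → c < B → Lowers (D c d) z c d)
    (hK : ∀ c d, d < c → c < B → ∀ p ∈ K, D c d p ∈ K) (hz : ∀ a b, z a b = z b a)
    (hzB : ∀ a, z a B = 0) (b : ℕ) : b ≤ B → ∀ w : R, (∀ c d, d < c → c < b → D c d w = 0) →
      (∀ k, symSlice z k b * w ∈ K) → ∀ p ∈ Algebra.adjoin ℂ (gens z B b), p * w ∈ K := by
  induction b with
  | zero =>
    intro _ w _ hw p hp
    obtain ⟨c, rfl⟩ := adjoin_gens_zero hp
    rw [← Algebra.smul_def]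
    exact K.smul_mem c (by simpa [symSlice] using hw 0)
  | succ t ih =>
    intro htB w hw0 hw
    have key : ∀ l, ∀ L : List ℕ, L.length = l → (∀ a ∈ L, a < t) →
        ∀ h ∈ Algebra.adjoin ℂ (gens z B t), ∀ k,
          (L.map (z t)).prod * h * z t t ^ k * w ∈ K := by
      intro l
      induction l using Nat.strong_induction_on with
      | _ l ihl =>
      rintro (_ | ⟨a, L⟩) hl hL h hh k
      · have := ih (by omega) (z t t ^ k * w) (fun c d hdc hct => ?_) (fun k' => ?_) h hh
        · simpa [mul_assoc] using this
        · have h1 : D c d (z t t) = 0 := by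
            rw [hD c d hdc (by omega), if_neg (by omega), if_neg (by omega), add_zero]
          simp [h1, hw0 c d hdc (by omega)]
        · have := hw (fun a => if a = t then k else k' a)
          have h2 : ∀ b ≤ t, symSlice z (fun a => if a = t then k else k' a) b = symSlice z k' b := by
            intro b hb
            induction b with
            | zero => rfl
            | succ b ihb => simp only [symSlice]; rw [ihb (by omega), if_neg (by omega)]
          simp only [symSlice, if_true] at this
          rw [h2 t le_rfl] at this
          convert this using 1
          ring
      · have hat : a < t := hL a (by simp)
        have hlow := hD t a hat (by omega)
        have hL' : ∀ a ∈ L, a < t := fun x hx => hL x (by simp [hx])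
        simp only [List.length_cons] at hl
        have h1 : ∀ L₁ L₂ : List ℕ, (∀ a ∈ L₁, a < t) → (∀ a ∈ L₂, a < t) →
            L₁.length + L₂.length < l → D t a (L₁.map (z t)).prod *
              ((L₂.map (z t)).prod * h * z t t ^ (k + 1) * w) ∈ K := by
          intro L₁
          induction L₁ with
          | nil => intro L₂ _ _ _; simp
          | cons c L₁ ih₁ =>
            intro L₂ h₁ h₂ hlen
            simp only [List.length_cons] at hlen
            have hc : c < t := h₁ c (by simp)
            have e1 := ihl (L₁.length + L₂.length) (by omega) (L₁ ++ L₂) (by simp) (by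
                intro x hx
                rcases List.mem_append.1 hx with hx | hx
                · exact h₁ x (by simp [hx])
                · exact h₂ x hx) (z a c * h) (mul_mem (mem_adjoin_gens hat (Or.inl hc)) hh) (k + 1)
            have e2 := ih₁ (c :: L₂) (fun x hx => h₁ x (by simp [hx])) (by
                intro x hx
                rcases List.mem_cons.1 hx with rfl | hx
                · exact hc
                · exact h₂ x hx) (by simp; omega)
            convert add_mem e1 e2 using 1
            rw [List.map_cons, List.prod_cons, Derivation.leibniz, hlow, if_pos rfl,
              if_neg (by omega), List.map_append, List.prod_append, List.map_cons, List.prod_cons]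
            simp only [smul_eq_mul]
            ring
        have h2 := h1 L [] hL' (by simp) (by simp; omega)
        have h3 := hK t a hat (by omega) _ (ihl L.length (by omega) L rfl hL' h hh (k + 1))
        have h4 : D t a ((L.map (z t)).prod * h * z t t ^ (k + 1) * w) =
            D t a (L.map (z t)).prod * (([].map (z t)).prod * h * z t t ^ (k + 1) * w) +
              (2 * (k + 1) : ℂ) • (((a :: L).map (z t)).prod * h * z t t ^ k * w) := by
          simp only [Derivation.leibniz, hw0 t a hat (by omega), hlow.eq_zero le_rfl (by omega) hh,
            Derivation.leibniz_pow, hlow t t, if_true, smul_eq_mul, hz a t,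
            Algebra.smul_def, map_mul, map_add, map_one, map_natCast, map_ofNat]
          simp
          ring
        rw [h4] at h3
        have h5 := (K.add_mem_iff_right h2).1 h3
        exact (K.smul_mem_iff (by
          have := Nat.cast_add_one_ne_zero (R := ℂ) k
          simpa using this)).1 h5
    refine mul_mem_of_closure fun p hp => ?_
    obtain ⟨L, hL, h, hh, k, l, rfl⟩ := exists_peel (fun a b => ⟨1, by rw [one_smul, hz]⟩) hp
    rcases l with _ | l
    · simpa using key _ L rfl hL h hh k
    · simp [hzB]

/-- The representatives in the alternating case: the variable `z (b + 1) b` and the variable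
`z (b + 1) B` of each pair of consecutive indices, paired off from the top. -/
def altSlice (z : ℕ → ℕ → R) (B : ℕ) (k : ℕ → ℕ) : ℕ → R
  | 0 => 1
  | 1 => z 0 B ^ k 0
  | b + 2 => z (b + 1) b ^ k b * z (b + 1) B ^ k (b + 1) * altSlice z B k b

theorem altSlice_congr {k k' : ℕ → ℕ} : ∀ b : ℕ, (∀ a < b, k a = k' a) →
    altSlice z B k b = altSlice z B k' b
  | 0, _ => rfl
  | 1, h => by simp only [altSlice]; rw [h 0 (by omega)]
  | b + 2, h => by
    simp only [altSlice]
    rw [h b (by omega), h (b + 1) (by omega), altSlice_congr b fun a ha => h a (by omega)]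

theorem exists_split_prod {t : ℕ} (L : List ℕ) (hL : ∀ a ∈ L, a < t + 1) :
    ∃ A : List ℕ, (∀ a ∈ A, a < t) ∧ ∃ k, (L.map (z (t + 1))).prod =
      (A.map (z (t + 1))).prod * z (t + 1) t ^ k := by
  induction L with
  | nil => exact ⟨[], by simp, 0, by simp⟩
  | cons a L ih =>
    obtain ⟨A, hA, k, h⟩ := ih fun x hx => hL x (by simp [hx])
    by_cases hat : a = t
    · refine ⟨A, hA, k + 1, ?_⟩
      rw [List.map_cons, List.prod_cons, h, hat]
      ring
    · refine ⟨a :: A, ?_, k, ?_⟩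
      · intro x hx
        rcases List.mem_cons.1 hx with rfl | hx
        · have := hL x (by simp)
          omega
        · exact hA x hx
      · rw [List.map_cons, List.prod_cons, h, List.map_cons, List.prod_cons]
        ring

/-- The analogue of `sym_straightening` for an antisymmetric matrix, possibly with an additional last
row and column of index `B` that is not lowered. The indices are treated in consecutive pairs, from
the top. -/
theorem alt_straightening {D : ℕ → ℕ → Derivation ℂ R R}
    (hD : ∀ c d, d < c → c < B → Lowers (D c d) z c d)
    (hK : ∀ c d, d < c → c < B → ∀ p ∈ K, D c d p ∈ K) (hz : ∀ a b, z a b = -z b a) :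
    ∀ b : ℕ, b ≤ B → ∀ w : R, (∀ c d, d < c → c < b → D c d w = 0) →
      (∀ k, altSlice z B k b * w ∈ K) → ∀ p ∈ Algebra.adjoin ℂ (gens z B b), p * w ∈ K
  | 0 => by
    intro _ w _ hw p hp
    obtain ⟨c, rfl⟩ := adjoin_gens_zero hp
    rw [← Algebra.smul_def]
    exact K.smul_mem c (by simpa [altSlice] using hw 0)
  | 1 => by
    intro _ w _ hw
    have hz0 : ∀ a, z a a = 0 := fun a => by
      have h := hz a a
      have h2 : (2 : ℂ) • z a a = 0 := by
        rw [two_smul]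
        nth_rewrite 1 [h]
        simp
      exact (smul_eq_zero.1 h2).resolve_left two_ne_zero
    refine mul_mem_of_closure fun p hp => ?_
    obtain ⟨L, hL, h, hh, k, l, rfl⟩ := exists_peel (fun a b => ⟨-1, by
      rw [neg_one_smul, hz]⟩) (t := 0) hp
    obtain ⟨c, rfl⟩ := adjoin_gens_zero hh
    have hL0 : L = [] := List.eq_nil_iff_forall_not_mem.2 fun a ha => by
      have := hL a ha
      omega
    subst hL0
    rcases k with _ | k
    · have := K.smul_mem c (hw fun _ => l)
      simp only [altSlice, Algebra.smul_def] at this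
      simpa [mul_assoc] using this
    · simp [hz0]
  | s + 2 => by
    intro hB w hw0 hw
    have hz0 : ∀ a, z a a = 0 := fun a => by
      have h := hz a a
      have h2 : (2 : ℂ) • z a a = 0 := by
        rw [two_smul]
        nth_rewrite 1 [h]
        simp
      exact (smul_eq_zero.1 h2).resolve_left two_ne_zero
    have hε : ∀ a b, ∃ ε : ℂ, z a b = ε • z b a := fun a b => ⟨-1, by rw [neg_one_smul, hz]⟩
    -- No factor contains the second largest index `s`, except for `z (s + 1) s`.
    have h1 : ∀ g ∈ Algebra.adjoin ℂ (gens z B s), ∀ k l,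
        g * (z (s + 1) s ^ k * z (s + 1) B ^ l * w) ∈ K := by
      intro g hg k l
      refine alt_straightening hD hK hz s (by omega) _ (fun c d hdc hcs => ?_) (fun k' => ?_) g hg
      · have e1 : D c d (z (s + 1) s) = 0 := by
          rw [hD c d hdc (by omega), if_neg (by omega), if_neg (by omega), add_zero]
        have e2 : D c d (z (s + 1) B) = 0 := by
          rw [hD c d hdc (by omega), if_neg (by omega), if_neg (by omega), add_zero]
        simp [e1, e2, hw0 c d hdc (by omega)]
      · have := hw (fun a => if a = s then k else if a = s + 1 then l else k' a)
        simp only [altSlice, if_true] at this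
        rw [altSlice_congr (k' := k') s fun a ha => by
          rw [if_neg (by omega), if_neg (by omega)]] at this
        rw [if_neg (by omega)] at this
        convert this using 1
        ring
    -- Factors `z s B` are produced from `z (s + 1) B`.
    have hts := hD (s + 1) s (by omega) (by omega)
    have h2 : ∀ r, ∀ g ∈ Algebra.adjoin ℂ (gens z B s), ∀ k l,
        g * z s B ^ r * (z (s + 1) s ^ k * z (s + 1) B ^ l * w) ∈ K := by
      intro r
      induction r with
      | zero => intro g hg k l; simpa using h1 g hg k l
      | succ r ih =>
        intro g hg k l
        have e1 := hK (s + 1) s (by omega) (by omega) _ (ih g hg k (l + 1))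
        have e2 : D (s + 1) s (g * z s B ^ r * (z (s + 1) s ^ k * z (s + 1) B ^ (l + 1) * w)) =
            ((l : ℂ) + 1) • (g * z s B ^ (r + 1) * (z (s + 1) s ^ k * z (s + 1) B ^ l * w)) := by
          have n1 : B ≠ s + 1 := by omega
          simp only [Derivation.leibniz, hw0 (s + 1) s (by omega) (by omega),
            hts.eq_zero (by omega : s ≤ s + 1) (by omega) hg,
            Derivation.leibniz_pow, hts s B, hts (s + 1) s, hts (s + 1) B, if_true, smul_eq_mul,
            Algebra.smul_def, map_add, map_one, map_natCast, hz0, if_neg n1]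
          simp
          ring
        rw [e2] at e1
        exact (K.smul_mem_iff (Nat.cast_add_one_ne_zero l)).1 e1
    -- Factors `z s a` are produced from `z (s + 1) s` by lowering `s + 1` to `a`.
    have h3 : ∀ A : List ℕ, (∀ a ∈ A, a < s) → ∀ g ∈ Algebra.adjoin ℂ (gens z B s), ∀ r k l,
        (A.map (z s)).prod * g * z s B ^ r * (z (s + 1) s ^ k * z (s + 1) B ^ l * w) ∈ K := by
      intro A
      induction A with
      | nil => intro _ g hg r k l; simpa using h2 r g hg k l
      | cons a A ih =>
        intro hA g hg r k l
        have ha : a < s := hA a (by simp)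
        have hA' : ∀ a ∈ A, a < s := fun x hx => hA x (by simp [hx])
        have hta := hD (s + 1) a (by omega) (by omega)
        have e1 := hK (s + 1) a (by omega) (by omega) _ (ih hA' g hg r (k + 1) l)
        have e0 : D (s + 1) a (A.map (z s)).prod = 0 := by
          refine hta.eq_zero (B := B) (t := s + 1) le_rfl (by omega) (list_prod_mem ?_)
          intro x hx
          obtain ⟨c, hc, rfl⟩ := List.mem_map.1 hx
          exact mem_adjoin_gens (by omega) (Or.inl (by have := hA' c hc; omega))
        have n1 : B ≠ s + 1 := by omega
        have e2 : D (s + 1) a ((A.map (z s)).prod * g * z s B ^ r *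
            (z (s + 1) s ^ (k + 1) * z (s + 1) B ^ l * w)) =
            (l : ℂ) • ((A.map (z s)).prod * (z a B * g) * z s B ^ r *
              (z (s + 1) s ^ (k + 1) * z (s + 1) B ^ (l - 1) * w)) +
            (-((k : ℂ) + 1)) • (((a :: A).map (z s)).prod * g * z s B ^ r *
              (z (s + 1) s ^ k * z (s + 1) B ^ l * w)) := by
          simp only [Derivation.leibniz, hw0 (s + 1) a (by omega) (by omega), e0,
            hta.eq_zero (by omega : s ≤ s + 1) (by omega) hg,
            Derivation.leibniz_pow, hta s B, hta (s + 1) s, hta (s + 1) B, if_true, smul_eq_mul,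
            Algebra.smul_def, map_add, map_one, map_natCast, map_neg, hz a s,
            if_neg n1]
          simp
          ring
        rw [e2] at e1
        have e3 := (K.add_mem_iff_right (K.smul_mem _ (ih hA' (z a B * g)
          (mul_mem (mem_adjoin_gens ha (Or.inr rfl)) hg) r (k + 1) (l - 1)))).1 e1
        exact (K.smul_mem_iff (neg_ne_zero.2 (Nat.cast_add_one_ne_zero k))).1 e3
    have h4 : ∀ h ∈ Algebra.adjoin ℂ (gens z B (s + 1)), ∀ k l,
        h * (z (s + 1) s ^ k * z (s + 1) B ^ l * w) ∈ K := by
      intro h hh k l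
      refine mul_mem_of_closure (fun p hp => ?_) h hh
      obtain ⟨L, hL, g, hg, k', r, rfl⟩ := exists_peel hε hp
      rcases k' with _ | k'
      · simpa using h3 L hL g hg r k l
      · simp [hz0]
    -- Factors `z (s + 1) a` are produced from `z (s + 1) s` by lowering `s` to `a`.
    have h5 : ∀ A : List ℕ, (∀ a ∈ A, a < s) → ∀ h ∈ Algebra.adjoin ℂ (gens z B (s + 1)), ∀ k l,
        (A.map (z (s + 1))).prod * h * (z (s + 1) s ^ k * z (s + 1) B ^ l * w) ∈ K := by
      intro A
      induction A with
      | nil => intro _ h hh k l; simpa using h4 h hh k l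
      | cons a A ih =>
        intro hA h hh k l
        have ha : a < s := hA a (by simp)
        have hA' : ∀ a ∈ A, a < s := fun x hx => hA x (by simp [hx])
        have hsa := hD s a (by omega) (by omega)
        have e1 := hK s a (by omega) (by omega) _ (ih hA' h hh (k + 1) l)
        have e0 : ∀ A : List ℕ, (∀ a ∈ A, a < s) → D s a (A.map (z (s + 1))).prod = 0 := by
          intro A hA
          induction A with
          | nil => simp
          | cons c A ihA =>
            have hc : c < s := hA c (by simp)
            rw [List.map_cons, List.prod_cons, Derivation.leibniz, hsa,
              ihA fun x hx => hA x (by simp [hx]), if_neg (by omega), if_neg (by omega)]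
            simp
        have n1 : B ≠ s := by omega
        have e2 : D s a ((A.map (z (s + 1))).prod * h *
            (z (s + 1) s ^ (k + 1) * z (s + 1) B ^ l * w)) =
            (A.map (z (s + 1))).prod * D s a h * (z (s + 1) s ^ (k + 1) * z (s + 1) B ^ l * w) +
            ((k : ℂ) + 1) • (((a :: A).map (z (s + 1))).prod * h *
              (z (s + 1) s ^ k * z (s + 1) B ^ l * w)) := by
          simp only [Derivation.leibniz, hw0 s a (by omega) (by omega), e0 A hA',
            Derivation.leibniz_pow, hsa (s + 1) s, hsa (s + 1) B, if_true, smul_eq_mul,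
            Algebra.smul_def, map_add, map_one, map_natCast, if_neg n1]
          simp
          ring
        rw [e2] at e1
        have e3 := (K.add_mem_iff_right (ih hA' (D s a h)
          (hsa.mem_adjoin (by omega) hh) (k + 1) l)).1 e1
        exact (K.smul_mem_iff (Nat.cast_add_one_ne_zero k)).1 e3
    refine mul_mem_of_closure fun p hp => ?_
    obtain ⟨L, hL, h, hh, k, l, rfl⟩ := exists_peel hε hp
    rcases k with _ | k
    · obtain ⟨A, hA, k, hk⟩ := exists_split_prod (z := z) L hL
      rw [hk]
      convert h5 A hA h hh k l using 1
      ring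
    · simp [hz0]

end Straightening

/-! ### Words in operators that commute up to shorter words -/

section Transfer

variable {M G : Type} [AddCommGroup M] [Module ℂ M] (Z : G → Module.End ℂ M) (v : M)

/-- The word `Z x₁ (Z x₂ (⋯ v))`. -/
def wd (L : List G) : M := (L.map Z).prod v

@[simp] theorem wd_nil : wd Z v [] = v := rfl

theorem wd_cons (x : G) (L : List G) : wd Z v (x :: L) = Z x (wd Z v L) := by
  simp [wd]

/-- The span of the words of length less than `k`. -/
def wdLt (k : ℕ) : Submodule ℂ M := Submodule.span ℂ {y | ∃ L : List G, L.length < k ∧ wd Z v L = y}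

variable {Z v}

theorem wd_mem_wdLt {L : List G} {k : ℕ} (h : L.length < k) : wd Z v L ∈ wdLt Z v k :=
  Submodule.subset_span ⟨L, h, rfl⟩

theorem wdLt_mono : Monotone (wdLt Z v) := fun _ _ h =>
  Submodule.span_mono fun _ ⟨L, hL, hy⟩ => ⟨L, hL.trans_le h, hy⟩

theorem apply_mem_wdLt (x : G) {k : ℕ} {y : M} (hy : y ∈ wdLt Z v k) : Z x y ∈ wdLt Z v (k + 1) := by
  induction hy using Submodule.span_induction with
  | mem y hy =>
    obtain ⟨L, hL, rfl⟩ := hy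
    rw [← wd_cons]
    exact wd_mem_wdLt (by simpa using hL)
  | zero => simp
  | add a b _ _ ha hb => rw [map_add]; exact add_mem ha hb
  | smul c a _ ha => rw [map_smul]; exact Submodule.smul_mem _ c ha

/-- Words that differ by a permutation agree up to shorter words. -/
theorem wd_perm (hZ : ∀ x y, Z x * Z y - Z y * Z x ∈ Submodule.span ℂ (Set.range Z))
    {L L' : List G} (h : L.Perm L') : wd Z v L - wd Z v L' ∈ wdLt Z v L.length := by
  induction h with
  | nil => simp
  | cons x h ih =>
    rw [wd_cons, wd_cons, ← map_sub]
    exact apply_mem_wdLt x ih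
  | swap x y L =>
    have h1 : ∀ u ∈ Submodule.span ℂ (Set.range Z), u (wd Z v L) ∈ wdLt Z v (L.length + 2) := by
      intro u hu
      induction hu using Submodule.span_induction with
      | mem u hu =>
        obtain ⟨x, rfl⟩ := hu
        rw [← wd_cons]
        exact wd_mem_wdLt (by simp)
      | zero => simp
      | add a b _ _ ha hb => exact add_mem ha hb
      | smul c a _ ha => exact Submodule.smul_mem _ c ha
    simpa [wd_cons] using h1 _ (hZ y x)
  | trans h₁ _ ih₁ ih₂ =>
    rw [← h₁.length_eq] at ih₂
    simpa using add_mem ih₁ ih₂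

variable (Z v) in
/-- A monomial as a word in the operators, in an arbitrary order. -/
def evalWord : MvPolynomial G ℂ →ₗ[ℂ] M :=
  (MvPolynomial.basisMonomials G ℂ).constr ℂ fun s => wd Z v s.toMultiset.toList

theorem evalWord_prod (hZ : ∀ x y, Z x * Z y - Z y * Z x ∈ Submodule.span ℂ (Set.range Z))
    (L : List G) :
    evalWord Z v (L.map MvPolynomial.X).prod - wd Z v L ∈ wdLt Z v L.length := by
  classical
  have h1 : (L.map (MvPolynomial.X (R := ℂ))).prod =
      MvPolynomial.basisMonomials G ℂ (Multiset.toFinsupp (L : Multiset G)) := by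
    rw [MvPolynomial.coe_basisMonomials]
    induction L with
    | nil => simp
    | cons x L ih =>
      rw [List.map_cons, List.prod_cons, ih, MvPolynomial.X, MvPolynomial.monomial_mul, one_mul,
        ← Multiset.cons_coe, ← Multiset.singleton_add, map_add, Multiset.toFinsupp_singleton]
  rw [h1, evalWord, Module.Basis.constr_basis, Multiset.toFinsupp_toMultiset]
  have := wd_perm (v := v) hZ (Multiset.coe_eq_coe.1 (Multiset.coe_toList (L : Multiset G)))
  simpa using this

/-- `Represents k p u` says that `p` is homogeneous of degree `k` and that `u` is its value, up to
words of length less than `k`. -/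
def Represents (Z : G → Module.End ℂ M) (v : M) (k : ℕ) (p : MvPolynomial G ℂ) (u : M) : Prop :=
  p.IsHomogeneous k ∧ evalWord Z v p - u ∈ wdLt Z v k

theorem Represents.add {k : ℕ} {p q : MvPolynomial G ℂ} {u w : M} (h : Represents Z v k p u)
    (h' : Represents Z v k q w) : Represents Z v k (p + q) (u + w) := by
  refine ⟨h.1.add h'.1, ?_⟩
  rw [map_add, add_sub_add_comm]
  exact add_mem h.2 h'.2

theorem Represents.smul {k : ℕ} {p : MvPolynomial G ℂ} {u : M} (c : ℂ)
    (h : Represents Z v k p u) : Represents Z v k (c • p) (c • u) := by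
  refine ⟨?_, ?_⟩
  · rw [MvPolynomial.smul_eq_C_mul]
    simpa using (MvPolynomial.isHomogeneous_C G c).mul h.1
  · rw [map_smul, ← smul_sub]
    exact Submodule.smul_mem _ c h.2

theorem represents_zero (k : ℕ) : Represents Z v k 0 0 :=
  ⟨MvPolynomial.isHomogeneous_zero _ _ _, by simp⟩

theorem represents_wd (hZ : ∀ x y, Z x * Z y - Z y * Z x ∈ Submodule.span ℂ (Set.range Z))
    (L : List G) : Represents Z v L.length (L.map MvPolynomial.X).prod (wd Z v L) := by
  refine ⟨?_, evalWord_prod hZ L⟩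
  induction L with
  | nil => exact MvPolynomial.isHomogeneous_one _ _
  | cons x L ih =>
    rw [List.map_cons, List.prod_cons, List.length_cons, add_comm]
    exact (MvPolynomial.isHomogeneous_X _ x).mul ih

theorem span_monomials : Submodule.span ℂ
    (Set.range fun L : List G => (L.map (MvPolynomial.X (R := ℂ))).prod) = ⊤ := by
  rw [eq_top_iff]
  rintro p -
  induction p using MvPolynomial.induction_on with
  | C a =>
    rw [← mul_one (MvPolynomial.C a), ← MvPolynomial.smul_eq_C_mul]
    exact Submodule.smul_mem _ _ (Submodule.subset_span ⟨[], rfl⟩)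
  | add p q hp hq => exact add_mem hp hq
  | mul_X p x hp =>
    induction hp using Submodule.span_induction with
    | mem p hp =>
      obtain ⟨L, rfl⟩ := hp
      exact Submodule.subset_span ⟨x :: L, by simp [mul_comm]⟩
    | zero => simp
    | add a b _ _ ha hb => rw [add_mul]; exact add_mem ha hb
    | smul c a _ ha => rw [smul_mul_assoc]; exact Submodule.smul_mem _ _ ha

theorem homogeneous_mem_span {k : ℕ} {p : MvPolynomial G ℂ} (hp : p.IsHomogeneous k) :
    p ∈ Submodule.span ℂ {q | ∃ L : List G, L.length = k ∧ (L.map MvPolynomial.X).prod = q} := by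
  have h1 : ∀ p : MvPolynomial G ℂ, MvPolynomial.homogeneousComponent k p ∈
      Submodule.span ℂ {q | ∃ L : List G, L.length = k ∧ (L.map MvPolynomial.X).prod = q} := by
    intro p
    have hp : p ∈ Submodule.span ℂ
        (Set.range fun L : List G => (L.map (MvPolynomial.X (R := ℂ))).prod) := by
      rw [span_monomials]; trivial
    induction hp using Submodule.span_induction with
    | mem p hp =>
      obtain ⟨L, rfl⟩ := hp
      have hL : ((L.map (MvPolynomial.X (R := ℂ))).prod).IsHomogeneous L.length := by
        induction L with
        | nil => exact MvPolynomial.isHomogeneous_one _ _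
        | cons x L ih =>
          rw [List.map_cons, List.prod_cons, List.length_cons, add_comm]
          exact (MvPolynomial.isHomogeneous_X _ x).mul ih
      change MvPolynomial.homogeneousComponent k (L.map (MvPolynomial.X (R := ℂ))).prod ∈ _
      rw [MvPolynomial.homogeneousComponent_of_mem hL]
      split_ifs with hk
      · exact Submodule.subset_span ⟨L, hk.symm, rfl⟩
      · exact zero_mem _
    | zero => simp
    | add a b _ _ ha hb => rw [map_add]; exact add_mem ha hb
    | smul c a _ ha => rw [map_smul]; exact Submodule.smul_mem _ _ ha
  have := h1 p
  rwa [MvPolynomial.homogeneousComponent_of_mem hp, if_pos rfl] at this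

/-- Multiplication by a variable is represented by the corresponding operator. -/
theorem Represents.mul_X (hZ : ∀ x y, Z x * Z y - Z y * Z x ∈ Submodule.span ℂ (Set.range Z))
    {k : ℕ} {p : MvPolynomial G ℂ} {u : M} (h : Represents Z v k p u) (x : G) :
    Represents Z v (k + 1) (MvPolynomial.X x * p) (Z x u) := by
  have h1 : ∀ q : MvPolynomial G ℂ, q.IsHomogeneous k →
      evalWord Z v (MvPolynomial.X x * q) - Z x (evalWord Z v q) ∈ wdLt Z v (k + 1) := by
    intro q hq
    have hq' := homogeneous_mem_span hq
    clear hq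
    induction hq' using Submodule.span_induction with
    | mem q hq =>
      obtain ⟨L, rfl, rfl⟩ := hq
      have e1 := (represents_wd (v := v) hZ (x :: L)).2
      have e2 := apply_mem_wdLt x (represents_wd (v := v) hZ L).2
      rw [List.map_cons, List.prod_cons, wd_cons] at e1
      rw [map_sub] at e2
      simpa using sub_mem e1 e2
    | zero => simp
    | add a b _ _ ha hb =>
      rw [mul_add, map_add, map_add, map_add, add_sub_add_comm]; exact add_mem ha hb
    | smul c a _ ha =>
      rw [mul_smul_comm, map_smul, map_smul, map_smul, ← smul_sub]
      exact Submodule.smul_mem _ _ ha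
  refine ⟨by rw [add_comm]; exact (MvPolynomial.isHomogeneous_X _ x).mul h.1, ?_⟩
  have := add_mem (h1 p h.1) (apply_mem_wdLt x h.2)
  rw [map_sub] at this
  simpa using this

theorem Represents.mul_linear
    (hZ : ∀ x y, Z x * Z y - Z y * Z x ∈ Submodule.span ℂ (Set.range Z))
    {k : ℕ} {p : MvPolynomial G ℂ} {u : M} (h : Represents Z v k p u) (c : G →₀ ℂ) :
    Represents Z v (k + 1) (Finsupp.linearCombination ℂ MvPolynomial.X c * p)
      (Finsupp.linearCombination ℂ Z c u) := by
  induction c using Finsupp.induction_linear with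
  | zero => simpa using represents_zero _
  | add a b ha hb =>
    rw [map_add, map_add, add_mul, LinearMap.add_apply]
    exact ha.add hb
  | single x a =>
    rw [Finsupp.linearCombination_single, Finsupp.linearCombination_single, smul_mul_assoc,
      LinearMap.smul_apply]
    exact (h.mul_X hZ x).smul a

/-- An operator that annihilates `v` and normalizes the span of the operators `Z x` acts on words
like a derivation. -/
theorem represents_derivation
    (hZ : ∀ x y, Z x * Z y - Z y * Z x ∈ Submodule.span ℂ (Set.range Z))
    (F : Module.End ℂ M) (hF : F v = 0) (c : G → G →₀ ℂ)
    (hc : ∀ x, F * Z x - Z x * F = Finsupp.linearCombination ℂ Z (c x)) (L : List G) :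
    Represents Z v L.length (MvPolynomial.mkDerivation ℂ
      (fun x => Finsupp.linearCombination ℂ MvPolynomial.X (c x))
        (L.map (MvPolynomial.X (R := ℂ))).prod) (F (wd Z v L)) := by
  induction L with
  | nil => simpa [hF] using represents_zero (Z := Z) (v := v) 0
  | cons x L ih =>
    have h1 : F (wd Z v (x :: L)) = Z x (F (wd Z v L)) +
        Finsupp.linearCombination ℂ Z (c x) (wd Z v L) := by
      rw [← hc x, wd_cons]
      simp
    rw [h1, List.map_cons, List.prod_cons, Derivation.leibniz, MvPolynomial.mkDerivation_X,
      smul_eq_mul, smul_eq_mul, mul_comm _ (Finsupp.linearCombination ℂ _ (c x))]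
    exact (ih.mul_X hZ x).add ((represents_wd hZ L).mul_linear hZ (c x))

theorem derivation_mem_wdLt
    (hZ : ∀ x y, Z x * Z y - Z y * Z x ∈ Submodule.span ℂ (Set.range Z))
    (F : Module.End ℂ M) (hF : F v = 0) (c : G → G →₀ ℂ)
    (hc : ∀ x, F * Z x - Z x * F = Finsupp.linearCombination ℂ Z (c x)) {k : ℕ} {y : M}
    (hy : y ∈ wdLt Z v k) : F y ∈ wdLt Z v k := by
  induction hy using Submodule.span_induction with
  | mem y hy =>
    obtain ⟨L, hL, rfl⟩ := hy
    have h1 := represents_derivation hZ F hF c hc L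
    have h2 : ∀ p : MvPolynomial G ℂ, p.IsHomogeneous L.length →
        evalWord Z v p ∈ wdLt Z v (L.length + 1) := by
      intro p hp
      have hp' := homogeneous_mem_span hp
      clear hp
      induction hp' using Submodule.span_induction with
      | mem p hp =>
        obtain ⟨L', hL', rfl⟩ := hp
        have := (represents_wd (v := v) hZ L').2
        rw [hL'] at this
        have := add_mem (wdLt_mono (Nat.le_succ _) this)
          (wd_mem_wdLt (Z := Z) (v := v) (L := L') (k := L.length + 1) (by omega))
        simpa using this
      | zero => simp
      | add a b _ _ ha hb => rw [map_add]; exact add_mem ha hb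
      | smul c a _ ha => rw [map_smul]; exact Submodule.smul_mem _ _ ha
    have h3 := sub_mem (h2 _ h1.1) (wdLt_mono (Nat.le_succ _) h1.2)
    rw [sub_sub_cancel] at h3
    exact wdLt_mono (by omega) h3
  | zero => simp
  | add a b _ _ ha hb => rw [map_add]; exact add_mem ha hb
  | smul c a _ ha => rw [map_smul]; exact Submodule.smul_mem _ c ha

/-- If a subspace is stable under the operators `F s` and contains the words belonging to a set of
monomials from which all monomials can be obtained by the derivations corresponding to the `F s`,
then it contains all words. The polynomial `z x` is a linear form that the operator `Z x`
represents. -/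
theorem wd_mem_of_straightening {S : Type}
    (hZ : ∀ x y, Z x * Z y - Z y * Z x ∈ Submodule.span ℂ (Set.range Z))
    (F : S → Module.End ℂ M) (hF : ∀ s, F s v = 0) (c : S → G → G →₀ ℂ)
    (hc : ∀ s x, F s * Z x - Z x * F s = Finsupp.linearCombination ℂ Z (c s x))
    (z : G → G →₀ ℂ) (hz : ∀ x, Finsupp.linearCombination ℂ Z (z x) = Z x)
    (T : Submodule ℂ M) (hT : ∀ s, ∀ x ∈ T, F s x ∈ T) (slices : Set (List G))
    (hs : ∀ L ∈ slices, wd Z v L ∈ T)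
    (hstr : ∀ K : Submodule ℂ (MvPolynomial G ℂ),
      (∀ s, ∀ p ∈ K, MvPolynomial.mkDerivation ℂ
        (fun x => Finsupp.linearCombination ℂ (MvPolynomial.X (R := ℂ)) (c s x)) p ∈ K) →
      (∀ L ∈ slices, (L.map fun x =>
        Finsupp.linearCombination ℂ (MvPolynomial.X (R := ℂ)) (z x)).prod ∈ K) →
      ∀ L : List G, (L.map fun x =>
        Finsupp.linearCombination ℂ (MvPolynomial.X (R := ℂ)) (z x)).prod ∈ K) :
    ∀ L : List G, wd Z v L ∈ T := by
  have hlin : ∀ L : List G, Represents Z v L.length (L.map fun x =>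
      Finsupp.linearCombination ℂ (MvPolynomial.X (R := ℂ)) (z x)).prod (wd Z v L) := by
    intro L
    induction L with
    | nil => exact represents_wd hZ []
    | cons x L ih =>
      have := ih.mul_linear hZ (z x)
      rw [hz] at this
      rw [List.map_cons, List.prod_cons, wd_cons]
      exact this
  have key : ∀ k, ∀ L : List G, L.length = k → wd Z v L ∈ T := by
    intro k
    induction k using Nat.strong_induction_on with
    | _ k ih =>
    have hlow : wdLt Z v k ≤ T := by
      refine Submodule.span_le.2 ?_
      rintro _ ⟨L, hL, rfl⟩
      exact ih _ hL L rfl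
    let K : Submodule ℂ (MvPolynomial G ℂ) :=
      T.comap (evalWord Z v ∘ₗ MvPolynomial.homogeneousComponent k)
    have hKmem : ∀ {p : MvPolynomial G ℂ} {u : M} {m : ℕ}, Represents Z v m p u →
        (m = k → u ∈ T) → p ∈ K := by
      intro p u m hp hu
      change evalWord Z v (MvPolynomial.homogeneousComponent k p) ∈ T
      rw [MvPolynomial.homogeneousComponent_of_mem hp.1]
      split_ifs with hm
      · subst hm
        have := add_mem (hlow hp.2) (hu rfl)
        simpa using this
      · simp
    have hK := hstr K (fun s p hp => ?_) (fun L hL => hKmem (hlin L) fun _ => hs L hL)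
    · rintro L rfl
      have h1 : evalWord Z v (MvPolynomial.homogeneousComponent L.length (L.map fun x =>
        Finsupp.linearCombination ℂ (MvPolynomial.X (R := ℂ)) (z x)).prod) ∈ T := hK L
      rw [MvPolynomial.homogeneousComponent_of_mem (hlin L).1, if_pos rfl] at h1
      have := sub_mem h1 (hlow (hlin L).2)
      simpa using this
    · -- Derivations preserve the degree, and correspond to operators that preserve `T`.
      set δ := MvPolynomial.mkDerivation ℂ
        (fun x => Finsupp.linearCombination ℂ (MvPolynomial.X (R := ℂ)) (c s x)) with hδ
      have h1 : ∀ q : MvPolynomial G ℂ, MvPolynomial.homogeneousComponent k (δ q) =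
          δ (MvPolynomial.homogeneousComponent k q) := by
        intro q
        have hq : q ∈ Submodule.span ℂ
            (Set.range fun L : List G => (L.map (MvPolynomial.X (R := ℂ))).prod) := by
          rw [span_monomials]; trivial
        induction hq using Submodule.span_induction with
        | mem q hq =>
          obtain ⟨L, rfl⟩ := hq
          change MvPolynomial.homogeneousComponent k (δ (L.map MvPolynomial.X).prod) =
            δ (MvPolynomial.homogeneousComponent k (L.map MvPolynomial.X).prod)
          rw [MvPolynomial.homogeneousComponent_of_mem
            (represents_derivation hZ (F s) (hF s) (c s) (hc s) L).1,
            MvPolynomial.homogeneousComponent_of_mem (represents_wd (v := v) hZ L).1]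
          split_ifs <;> simp [hδ]
        | zero => simp
        | add a b _ _ ha hb => simp only [map_add, ha, hb]
        | smul r a _ ha => simp only [map_smul, ha, Derivation.map_smul]
      have h2 : ∀ q : MvPolynomial G ℂ, q.IsHomogeneous k →
          evalWord Z v (δ q) - F s (evalWord Z v q) ∈ wdLt Z v k := by
        intro q hq
        have hq' := homogeneous_mem_span hq
        clear hq
        induction hq' using Submodule.span_induction with
        | mem q hq =>
          obtain ⟨L, rfl, rfl⟩ := hq
          have e1 := (represents_derivation hZ (F s) (hF s) (c s) (hc s) L).2
          have e2 := derivation_mem_wdLt hZ (F s) (hF s) (c s) (hc s)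
            (represents_wd (v := v) hZ L).2
          rw [map_sub] at e2
          simpa using sub_mem e1 e2
        | zero => simp
        | add a b _ _ ha hb =>
          simp only [map_add]
          rw [add_sub_add_comm]
          exact add_mem ha hb
        | smul r a _ ha =>
          simp only [map_smul, Derivation.map_smul]
          rw [← smul_sub]
          exact Submodule.smul_mem _ _ ha
      change evalWord Z v (MvPolynomial.homogeneousComponent k (δ p)) ∈ T
      rw [h1]
      have h3 := h2 _ (MvPolynomial.homogeneousComponent_isHomogeneous k p)
      have h4 := add_mem (hlow h3) (hT s _ hp)
      simpa using h4
  exact fun L => key _ L rfl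

section Pairs

variable {M : Type} [AddCommGroup M] [Module ℂ M] {Z : ℕ → ℕ → Module.End ℂ M} {v : M}
  {F : ℕ → ℕ → Module.End ℂ M} {B : ℕ}

/-- `wd_mem_of_straightening` for operators `Z a b = η Z b a` on which `F c d` acts by replacing the
index `c` by `d`. -/
theorem wd_mem_of_pairs (r : ℕ → ℕ → Prop) (hr : ∀ a b, r a b → r b a)
    (hr' : ∀ a b d, a < B → d < B → r a b → r d b) (η : ℂ) (hη : η * η = 1)
    (hZη : ∀ a b, Z a b = η • Z b a) (hZ0 : ∀ a b, ¬r a b → Z a b = 0)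
    (hZ : ∀ a b c d, Z a b * Z c d - Z c d * Z a b ∈
      Submodule.span ℂ (Set.range fun x : ℕ × ℕ => Z x.1 x.2))
    (hF : ∀ c d, d < c → c < B → F c d v = 0)
    (hFZ : ∀ c d, d < c → c < B → ∀ a b, F c d * Z a b - Z a b * F c d =
      (if a = c then Z d b else 0) + (if b = c then Z a d else 0))
    (T : Submodule ℂ M) (hT : ∀ c d, d < c → c < B → ∀ x ∈ T, F c d x ∈ T)
    (slices : Set (List (ℕ × ℕ))) (hs : ∀ L ∈ slices, wd (fun x : ℕ × ℕ => Z x.1 x.2) v L ∈ T)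
    (hstr : ∀ (z : ℕ → ℕ → MvPolynomial (ℕ × ℕ) ℂ)
      (D : ℕ → ℕ → Derivation ℂ (MvPolynomial (ℕ × ℕ) ℂ) (MvPolynomial (ℕ × ℕ) ℂ))
      (K : Submodule ℂ (MvPolynomial (ℕ × ℕ) ℂ)),
      (∀ c d, d < c → c < B → Lowers (D c d) z c d) →
      (∀ c d, d < c → c < B → ∀ p ∈ K, D c d p ∈ K) → (∀ a b, z a b = η • z b a) →
      (∀ a b, ¬r a b → z a b = 0) →
      (∀ L ∈ slices, (L.map fun x => z x.1 x.2).prod ∈ K) →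
      ∀ L : List (ℕ × ℕ), (L.map fun x => z x.1 x.2).prod ∈ K) (L : List (ℕ × ℕ)) :
    wd (fun x : ℕ × ℕ => Z x.1 x.2) v L ∈ T := by
  classical
  let S := {p : ℕ × ℕ // p.2 < p.1 ∧ p.1 < B}
  let c : ℕ → ℕ → ℕ × ℕ → ℕ × ℕ →₀ ℂ := fun p q x =>
    (if x.1 = p then Finsupp.single (q, x.2) 1 else 0) +
      (if x.2 = p then Finsupp.single (x.1, q) 1 else 0)
  let z : ℕ × ℕ → ℕ × ℕ →₀ ℂ := fun x => if r x.1 x.2 then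
    Finsupp.single x (1 / 2) + Finsupp.single (x.2, x.1) (η / 2) else 0
  let Df : ℕ → ℕ → Derivation ℂ (MvPolynomial (ℕ × ℕ) ℂ) (MvPolynomial (ℕ × ℕ) ℂ) := fun p q =>
    MvPolynomial.mkDerivation ℂ
      fun x => Finsupp.linearCombination ℂ (MvPolynomial.X (R := ℂ)) (c p q x)
  have hDX : ∀ p q a b, Df p q (MvPolynomial.X (a, b)) =
      (if a = p then MvPolynomial.X (q, b) else 0) +
        (if b = p then MvPolynomial.X (a, q) else 0) := by
    intro p q a b
    simp only [Df, c, MvPolynomial.mkDerivation_X, map_add]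
    split_ifs <;> simp only [Finsupp.linearCombination_single, one_smul, map_zero]
  have hzr : ∀ a b, r a b → Finsupp.linearCombination ℂ (MvPolynomial.X (R := ℂ)) (z (a, b)) =
      (1 / 2 : ℂ) • MvPolynomial.X (a, b) + (η / 2) • MvPolynomial.X (b, a) := by
    intro a b h
    simp only [z, if_pos h, map_add, Finsupp.linearCombination_single]
  have hzn : ∀ a b, ¬r a b →
      Finsupp.linearCombination ℂ (MvPolynomial.X (R := ℂ)) (z (a, b)) = 0 := by
    intro a b h
    simp only [z, if_neg h, map_zero]
  refine wd_mem_of_straightening (S := S) (fun x y => hZ _ _ _ _) (fun s => F s.1.1 s.1.2)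
    (fun s => hF _ _ s.2.1 s.2.2) (fun s => c s.1.1 s.1.2) (fun s x => ?_) z (fun x => ?_) T
    (fun s => hT _ _ s.2.1 s.2.2) slices hs (fun K hK hKs L => ?_) L
  · rw [hFZ _ _ s.2.1 s.2.2]
    simp only [c, map_add]
    split_ifs <;> simp only [Finsupp.linearCombination_single, one_smul, map_zero]
  · obtain ⟨a, b⟩ := x
    by_cases h : r a b
    · simp only [z, if_pos h, map_add, Finsupp.linearCombination_single]
      rw [hZη b a, smul_smul, ← add_smul]
      have : (1 / 2 : ℂ) + η / 2 * η = 1 := by linear_combination (1 / 2 : ℂ) * hη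
      rw [this, one_smul]
    · simp only [z, if_neg h, map_zero]
      exact (hZ0 _ _ h).symm
  · refine hstr (fun a b => Finsupp.linearCombination ℂ (MvPolynomial.X (R := ℂ)) (z (a, b))) Df K
      (fun p q hqp hpB a b => ?_) (fun p q hqp hpB => hK ⟨(p, q), hqp, hpB⟩) (fun a b => ?_)
      (fun a b h => hzn a b h) hKs L
    · by_cases h : r a b
      · have h1 : a = p → r q b := fun e => hr' a b q (e ▸ hpB) (hqp.trans hpB) h
        have h2 : b = p → r a q := fun e => hr _ _ (hr' b a q (e ▸ hpB) (hqp.trans hpB) (hr _ _ h))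
        simp only [hzr a b h, map_add, Derivation.map_smul, hDX]
        by_cases ha : a = p <;> by_cases hb : b = p <;>
          simp only [ha, hb, if_true, if_false, smul_zero, add_zero, zero_add, smul_add]
        · rw [hzr _ _ (hb ▸ h1 ha), hzr _ _ (ha ▸ h2 hb)]
          abel
        · rw [hzr _ _ (h1 ha)]
        · rw [hzr _ _ (h2 hb)]
      · have h1 : a = p → ¬r q b := fun e h' => h (hr' q b a (hqp.trans hpB) (e ▸ hpB) h')
        have h2 : b = p → ¬r a q := fun e h' =>
          h (hr _ _ (hr' q a b (hqp.trans hpB) (e ▸ hpB) (hr _ _ h')))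
        simp only [hzn a b h, map_zero]
        split_ifs with ha hb hb
        · rw [hzn _ _ (h1 ha), hzn _ _ (h2 hb), add_zero]
        · rw [hzn _ _ (h1 ha), add_zero]
        · rw [hzn _ _ (h2 hb), add_zero]
        · rw [add_zero]
    · by_cases h : r a b
      · simp only [hzr a b h, hzr b a (hr _ _ h), smul_add, smul_smul]
        have : η * (η / 2) = 1 / 2 := by linear_combination (1 / 2 : ℂ) * hη
        rw [this, add_comm]
        congr 2
        ring
      · simp only [hzn a b h, hzn b a fun h' => h (hr _ _ h'), smul_zero]

/-- The letters of `symSlice`. -/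
def symWord (k : ℕ → ℕ) : ℕ → List (ℕ × ℕ)
  | 0 => []
  | b + 1 => List.replicate (k b) (b, b) ++ symWord k b

/-- The letters of `altSlice`. -/
def altWord (B : ℕ) (k : ℕ → ℕ) : ℕ → List (ℕ × ℕ)
  | 0 => []
  | 1 => List.replicate (k 0) (0, B)
  | b + 2 => List.replicate (k b) (b + 1, b) ++ (List.replicate (k (b + 1)) (b + 1, B) ++
      altWord B k b)

theorem prod_symWord {R : Type} [CommRing R] (z : ℕ → ℕ → R) (k : ℕ → ℕ) (b : ℕ) :
    ((symWord k b).map fun x => z x.1 x.2).prod = symSlice z k b := by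
  induction b with
  | zero => simp [symWord, symSlice]
  | succ b ih => simp [symWord, symSlice, ih]

theorem prod_altWord {R : Type} [CommRing R] (z : ℕ → ℕ → R) (k : ℕ → ℕ) :
    ∀ b : ℕ, ((altWord B k b).map fun x => z x.1 x.2).prod = altSlice z B k b
  | 0 => by simp [altWord, altSlice]
  | 1 => by simp [altWord, altSlice]
  | b + 2 => by simp [altWord, altSlice, prod_altWord z k b, mul_assoc]

theorem wd_mem_of_sym (hZη : ∀ a b, Z a b = Z b a) (hZ0 : ∀ a b, B ≤ b → Z a b = 0)
    (hZ : ∀ a b c d, Z a b * Z c d - Z c d * Z a b ∈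
      Submodule.span ℂ (Set.range fun x : ℕ × ℕ => Z x.1 x.2))
    (hF : ∀ c d, d < c → c < B → F c d v = 0)
    (hFZ : ∀ c d, d < c → c < B → ∀ a b, F c d * Z a b - Z a b * F c d =
      (if a = c then Z d b else 0) + (if b = c then Z a d else 0))
    (T : Submodule ℂ M) (hT : ∀ c d, d < c → c < B → ∀ x ∈ T, F c d x ∈ T)
    (hs : ∀ k, wd (fun x : ℕ × ℕ => Z x.1 x.2) v (symWord k B) ∈ T) (L : List (ℕ × ℕ)) :
    wd (fun x : ℕ × ℕ => Z x.1 x.2) v L ∈ T := by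
  refine wd_mem_of_pairs (B := B) (fun a b => a < B ∧ b < B) (fun a b h => ⟨h.2, h.1⟩)
    (fun a b d _ hd h => ⟨hd, h.2⟩) 1 (by norm_num) (fun a b => by rw [one_smul, hZη])
    (fun a b h => ?_) hZ hF hFZ T hT (Set.range fun k => symWord k B)
    (by rintro _ ⟨k, rfl⟩; exact hs k) (fun z D K hD hK hz hz0 hsl L => ?_) L
  · by_cases hb : b < B
    · rw [hZη]
      exact hZ0 _ _ (by by_contra hc; exact h ⟨by omega, hb⟩)
    · exact hZ0 _ _ (by omega)
  · have h1 := sym_straightening (B := B) (K := K) hD hK (fun a b => by rw [hz, one_smul])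
      (fun a => hz0 _ _ (by omega)) B le_rfl 1 (fun c d _ _ => by simp)
      (fun k => by rw [mul_one, ← prod_symWord]; exact hsl _ ⟨k, rfl⟩)
    rw [← mul_one (List.prod _)]
    refine h1 _ (list_prod_mem fun x hx => ?_)
    obtain ⟨⟨a, b⟩, _, rfl⟩ := List.mem_map.1 hx
    by_cases h : a < B ∧ b < B
    · exact mem_adjoin_gens h.1 (Or.inl h.2)
    · simp only [hz0 a b h]
      exact zero_mem _

theorem wd_mem_of_alt (hZη : ∀ a b, Z a b = -Z b a) (hZ0 : ∀ a b, B < b → Z a b = 0)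
    (hZ : ∀ a b c d, Z a b * Z c d - Z c d * Z a b ∈
      Submodule.span ℂ (Set.range fun x : ℕ × ℕ => Z x.1 x.2))
    (hF : ∀ c d, d < c → c < B → F c d v = 0)
    (hFZ : ∀ c d, d < c → c < B → ∀ a b, F c d * Z a b - Z a b * F c d =
      (if a = c then Z d b else 0) + (if b = c then Z a d else 0))
    (T : Submodule ℂ M) (hT : ∀ c d, d < c → c < B → ∀ x ∈ T, F c d x ∈ T)
    (hs : ∀ k, wd (fun x : ℕ × ℕ => Z x.1 x.2) v (altWord B k B) ∈ T) (L : List (ℕ × ℕ)) :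
    wd (fun x : ℕ × ℕ => Z x.1 x.2) v L ∈ T := by
  refine wd_mem_of_pairs (B := B) (fun a b => a ≤ B ∧ b ≤ B) (fun a b h => ⟨h.2, h.1⟩)
    (fun a b d _ hd h => ⟨hd.le, h.2⟩) (-1) (by norm_num) (fun a b => by rw [neg_one_smul, hZη])
    (fun a b h => ?_) hZ hF hFZ T hT (Set.range fun k => altWord B k B)
    (by rintro _ ⟨k, rfl⟩; exact hs k) (fun z D K hD hK hz hz0 hsl L => ?_) L
  · by_cases hb : b ≤ B
    · rw [hZη, hZ0 _ _ (by by_contra hc; exact h ⟨by omega, hb⟩), neg_zero]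
    · exact hZ0 _ _ (by omega)
  · have hz' : ∀ a b, z a b = -z b a := fun a b => by rw [hz, neg_one_smul]
    have h1 := alt_straightening (B := B) (K := K) hD hK hz' B le_rfl 1 (fun c d _ _ => by simp)
      (fun k => by rw [mul_one, ← prod_altWord]; exact hsl _ ⟨k, rfl⟩)
    rw [← mul_one (List.prod _)]
    refine h1 _ (list_prod_mem fun x hx => ?_)
    obtain ⟨⟨a, b⟩, _, rfl⟩ := List.mem_map.1 hx
    by_cases h : a ≤ B ∧ b ≤ B
    · by_cases ha : a = B
      · by_cases hb : b = B
        · have h2 : (2 : ℂ) • z a b = 0 := by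
            rw [two_smul]
            nth_rewrite 1 [hz' a b]
            simp [ha, hb]
          simp only [(smul_eq_zero.1 h2).resolve_left two_ne_zero]
          exact zero_mem _
        · simp only [hz' a b]
          exact neg_mem (mem_adjoin_gens (by omega) (Or.inr ha))
      · exact mem_adjoin_gens (by omega) (by omega)
    · simp only [hz0 a b h]
      exact zero_mem _

end Pairs

end Transfer

/-! ### Weights of matrices -/

section Kap

variable {N n : ℕ}

/-- The weight of the `p`-th coordinate vector: `e_p` for `p < n`, minus the weight of the opposite
coordinate in the second half, and zero in the middle. -/
def kap (N n : ℕ) (p : Fin N) (a : Fin n) : ℤ :=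
  (if (p : ℕ) = a then 1 else 0) - (if (p : ℕ) + a + 1 = N then 1 else 0)

theorem kap_rev (p : Fin N) : kap N n p.rev = -kap N n p := by
  ext a
  have := p.2
  simp only [kap, Fin.val_rev, Pi.neg_apply]
  split_ifs <;> omega

theorem sum_kap (p : Fin N) (k : Fin n) : ∑ a ∈ Finset.Iic k, kap N n p a =
    (if (p : ℕ) ≤ k then 1 else 0) - (if N ≤ p + k + 1 then 1 else 0) := by
  have h : ∀ a : Fin n, kap N n p a =
      (if (a : ℕ) = p then 1 else 0) - (if (a : ℕ) = N - 1 - p then 1 else 0) := by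
    intro a
    have := p.2
    simp only [kap]
    split_ifs <;> omega
  have := p.2
  simp only [h, Finset.sum_sub_distrib, sum_Iic_ite]
  split_ifs <;> omega

theorem Qpos_kap {p q : Fin N} (h : p ≤ q) : Qpos (kap N n p - kap N n q) := by
  intro k
  have h' := Fin.le_def.1 h
  simp only [Pi.sub_apply, Finset.sum_sub_distrib, sum_kap]
  split_ifs <;> omega

theorem eq_or_of_kap_eq (hN : 2 * n ≤ N) {p q : Fin N} (h : kap N n p = kap N n q) :
    p = q ∨ (n ≤ (p : ℕ) ∧ (p : ℕ) + n < N ∧ n ≤ (q : ℕ) ∧ (q : ℕ) + n < N) := by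
  have hp := p.2
  have hq := q.2
  have key : ∀ a (ha : a < n), kap N n p ⟨a, ha⟩ = kap N n q ⟨a, ha⟩ := fun a ha => congrFun h _
  simp only [kap] at key
  by_cases h1 : (p : ℕ) < n
  · have := key p h1
    left; ext
    split_ifs at this <;> omega
  by_cases h2 : N - 1 - (p : ℕ) < n
  · have := key _ h2
    left; ext
    split_ifs at this <;> omega
  by_cases h3 : (q : ℕ) < n
  · have := key q h3
    left; ext
    split_ifs at this <;> omega
  by_cases h4 : N - 1 - (q : ℕ) < n
  · have := key _ h4
    left; ext
    split_ifs at this <;> omega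
  right
  omega

/-- The matrices of weight `b`. -/
def wtMat (N n : ℕ) (b : Fin n → ℤ) : Submodule ℂ (Matrix (Fin N) (Fin N) ℂ) where
  carrier := {x | ∀ p q, x p q ≠ 0 → kap N n p - kap N n q = b}
  add_mem' := by
    intro x y hx hy p q h
    by_cases h1 : x p q = 0
    · exact hy p q fun h2 => h (by simp [h1, h2])
    · exact hx p q h1
  zero_mem' := by intro p q h; exact absurd rfl h
  smul_mem' := by
    intro c x hx p q h
    exact hx p q fun h1 => h (by simp [h1])

variable {b c : Fin n → ℤ} {x y : Matrix (Fin N) (Fin N) ℂ}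

theorem mul_mem_wtMat (hx : x ∈ wtMat N n b) (hy : y ∈ wtMat N n c) :
    x * y ∈ wtMat N n (b + c) := by
  intro p q h
  rw [Matrix.mul_apply] at h
  obtain ⟨r, _, hr⟩ := Finset.exists_ne_zero_of_sum_ne_zero h
  rw [← hx p r (left_ne_zero_of_mul hr), ← hy r q (right_ne_zero_of_mul hr)]
  abel

theorem lie_mem_wtMat (hx : x ∈ wtMat N n b) (hy : y ∈ wtMat N n c) :
    ⁅x, y⁆ ∈ wtMat N n (b + c) := by
  rw [Ring.lie_def]
  refine sub_mem (mul_mem_wtMat hx hy) ?_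
  rw [add_comm]
  exact mul_mem_wtMat hy hx

/-- The matrix units. -/
abbrev E (p q : Fin N) : Matrix (Fin N) (Fin N) ℂ := Matrix.single p q 1

theorem E_apply_ne {p q a b : Fin N} (h : ¬(p = a ∧ q = b)) : E p q a b = 0 :=
  Matrix.single_apply_of_ne (c := (1 : ℂ)) (h := h)

theorem E_mem_wtMat (p q : Fin N) : E p q ∈ wtMat N n (kap N n p - kap N n q) := by
  intro r s h
  by_cases hrs : p = r ∧ q = s
  · rw [hrs.1, hrs.2]
  · exact absurd (E_apply_ne hrs) h

theorem lie_E (p q r s : Fin N) :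
    ⁅E p q, E r s⁆ = (if q = r then E p s else 0) - (if s = p then E r q else 0) := by
  rw [Ring.lie_def]
  congr 1
  · split_ifs with h
    · subst h
      simp [E]
    · exact Matrix.single_mul_single_of_ne _ _ _ _ h _
  · split_ifs with h
    · subst h
      simp [E]
    · exact Matrix.single_mul_single_of_ne _ _ _ _ h _

theorem eq_sum_E (x : Matrix (Fin N) (Fin N) ℂ) : x = ∑ p, ∑ q, x p q • E p q := by
  conv_lhs => rw [Matrix.matrix_eq_sum_single x]
  refine Finset.sum_congr rfl fun p _ => Finset.sum_congr rfl fun q _ => ?_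
  simp [E]

/-- A subspace of matrices of weight `b` is detected on matrix units. -/
theorem mem_of_E_mem (S : Submodule ℂ (Matrix (Fin N) (Fin N) ℂ))
    (h : ∀ p q, x p q ≠ 0 → E p q ∈ S) : x ∈ S := by
  rw [eq_sum_E x]
  refine sum_mem fun p _ => sum_mem fun q _ => ?_
  by_cases hx : x p q = 0
  · simp [hx]
  · exact S.smul_mem _ (h p q hx)

end Kap

/-! ### Projections to the eigenspaces of the diagram automorphism -/

section Proj

variable {N : ℕ}

theorem flipMap_apply (x : Matrix (Fin N) (Fin N) ℂ) (a b : Fin N) :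
    flipMap N x a b = -((-1) ^ ((a : ℕ) + b) * x b.rev a.rev) := rfl

theorem neg_one_pow_rev (a b : Fin N) :
    (-1 : ℂ) ^ ((a.rev : ℕ) + (b.rev : ℕ)) = (-1) ^ ((a : ℕ) + b) := by
  have ha := a.2
  have hb := b.2
  rw [neg_one_pow_eq_pow_mod_two, neg_one_pow_eq_pow_mod_two ((a : ℕ) + b)]
  congr 1
  simp only [Fin.val_rev]
  omega

theorem neg_one_pow_mul_self (k : ℕ) : (-1 : ℂ) ^ k * (-1) ^ k = 1 := by
  rw [← mul_pow]
  simp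

theorem flipMap_flipMap (x : Matrix (Fin N) (Fin N) ℂ) : flipMap N (flipMap N x) = x := by
  ext a b
  rw [flipMap_apply, flipMap_apply, neg_one_pow_rev, Fin.rev_rev, Fin.rev_rev, add_comm (b : ℕ)]
  linear_combination x a b * neg_one_pow_mul_self ((a : ℕ) + b)

theorem flipMap_one : flipMap N 1 = -1 := by
  ext a b
  rw [flipMap_apply, Matrix.neg_apply]
  by_cases h : a = b
  · subst h
    simp [← two_mul, pow_mul]
  · rw [Matrix.one_apply_ne h, Matrix.one_apply_ne (by simpa using Ne.symm h)]
    simp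

theorem trace_flipMap (x : Matrix (Fin N) (Fin N) ℂ) :
    Matrix.trace (flipMap N x) = -Matrix.trace x := by
  simp only [Matrix.trace, Matrix.diag_apply]
  rw [← Finset.sum_neg_distrib, ← Equiv.sum_comp Fin.revPerm]
  refine Finset.sum_congr rfl fun a _ => ?_
  simp only [Fin.revPerm_apply, flipMap_apply, Fin.rev_rev]
  simp [← two_mul, pow_mul]

theorem flipMap_E (p q : Fin N) :
    flipMap N (E p q) = (-((-1) ^ ((p : ℕ) + q)) : ℂ) • E q.rev p.rev := by
  ext a b
  rw [flipMap_apply, Matrix.smul_apply]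
  by_cases h : q.rev = a ∧ p.rev = b
  · obtain ⟨rfl, rfl⟩ := h
    rw [neg_one_pow_rev]
    simp [E, add_comm]
  · rw [E_apply_ne h, E_apply_ne fun h' => h
      ⟨by rw [h'.2, Fin.rev_rev], by rw [h'.1, Fin.rev_rev]⟩]
    simp

/-- The projection `x ↦ x + (-1) ^ ε σ(x)`, made traceless. -/
def projA (N ε : ℕ) : Matrix (Fin N) (Fin N) ℂ →ₗ[ℂ] Matrix (Fin N) (Fin N) ℂ where
  toFun x := x + (-1 : ℂ) ^ ε • flipMap N x -
    ((1 - (-1 : ℂ) ^ ε) * (Matrix.trace x / N)) • (1 : Matrix (Fin N) (Fin N) ℂ)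
  map_add' x y := by
    rw [map_add, Matrix.trace_add, add_div, mul_add, add_smul, smul_add]
    abel
  map_smul' c x := by
    simp only [map_smul, Matrix.trace_smul, smul_add, smul_sub, RingHom.id_apply, smul_smul,
      smul_eq_mul]
    congr 2
    · rw [mul_comm]
    · ring_nf

theorem projA_apply (ε : ℕ) (x : Matrix (Fin N) (Fin N) ℂ) :
    projA N ε x = x + (-1 : ℂ) ^ ε • flipMap N x -
      ((1 - (-1 : ℂ) ^ ε) * (Matrix.trace x / N)) • (1 : Matrix (Fin N) (Fin N) ℂ) := rfl

theorem projA_of_trace {ε : ℕ} {x : Matrix (Fin N) (Fin N) ℂ} (hx : Matrix.trace x = 0) :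
    projA N ε x = x + (-1 : ℂ) ^ ε • flipMap N x := by
  rw [projA_apply, hx]
  simp

theorem projA_zero (x : Matrix (Fin N) (Fin N) ℂ) : projA N 0 x = x + flipMap N x := by
  rw [projA_apply]
  simp

theorem trace_projA (hN : N ≠ 0) (ε : ℕ) (x : Matrix (Fin N) (Fin N) ℂ) :
    Matrix.trace (projA N ε x) = 0 := by
  have hN' : (N : ℂ) ≠ 0 := Nat.cast_ne_zero.2 hN
  rw [projA_apply, Matrix.trace_sub, Matrix.trace_add, Matrix.trace_smul, Matrix.trace_smul,
    trace_flipMap, Matrix.trace_one, Fintype.card_fin, smul_eq_mul, smul_eq_mul]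
  field_simp
  ring

theorem flipMap_projA (ε : ℕ) (x : Matrix (Fin N) (Fin N) ℂ) :
    flipMap N (projA N ε x) = (-1 : ℂ) ^ ε • projA N ε x := by
  rw [projA_apply, map_sub, map_add, map_smul, map_smul, flipMap_flipMap, flipMap_one, smul_sub,
    smul_add, smul_smul, smul_smul, neg_one_pow_mul_self, one_smul, smul_neg, sub_neg_eq_add]
  have h : (-1 : ℂ) ^ ε * ((1 - (-1 : ℂ) ^ ε) * (Matrix.trace x / N)) =
      -((1 - (-1 : ℂ) ^ ε) * (Matrix.trace x / N)) := by
    linear_combination (-(Matrix.trace x / N)) * neg_one_pow_mul_self ε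
  rw [h, neg_smul]
  abel

theorem lie_projA (ε δ : ℕ) (x w : Matrix (Fin N) (Fin N) ℂ)
    (hw : flipMap N w = (-1 : ℂ) ^ δ • w) : ⁅projA N ε x, w⁆ = projA N (ε + δ) ⁅x, w⁆ := by
  have h1 : Matrix.trace ⁅x, w⁆ = 0 := by
    rw [Ring.lie_def, Matrix.trace_sub, Matrix.trace_mul_comm, sub_self]
  rw [projA_of_trace h1, LieHom.map_lie, hw, projA_apply, sub_lie, add_lie, smul_lie, smul_lie,
    lie_smul, smul_smul, pow_add, mul_assoc, neg_one_pow_mul_self, mul_one]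
  have h2 : ⁅(1 : Matrix (Fin N) (Fin N) ℂ), w⁆ = 0 := by simp [Ring.lie_def]
  rw [h2, smul_zero, sub_zero]

/-- The map `x ↦ -J xᵀ J`, where `J` is the antidiagonal matrix of ones. -/
def skewMap (N : ℕ) : Matrix (Fin N) (Fin N) ℂ →ₗ[ℂ] Matrix (Fin N) (Fin N) ℂ where
  toFun x := Matrix.of fun a b => -x b.rev a.rev
  map_add' x y := by ext a b; simp; ring
  map_smul' c x := by ext a b; simp

theorem skewMap_apply (x : Matrix (Fin N) (Fin N) ℂ) (a b : Fin N) :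
    skewMap N x a b = -x b.rev a.rev := rfl

theorem skewMap_skewMap (x : Matrix (Fin N) (Fin N) ℂ) : skewMap N (skewMap N x) = x := by
  ext a b
  simp [skewMap_apply]

theorem skewMap_lie (x y : Matrix (Fin N) (Fin N) ℂ) :
    skewMap N ⁅x, y⁆ = ⁅skewMap N x, skewMap N y⁆ := by
  have key : ∀ u w : Matrix (Fin N) (Fin N) ℂ, ∀ a b,
      (skewMap N u * skewMap N w) a b = (w * u) b.rev a.rev := by
    intro u w a b
    rw [Matrix.mul_apply, Matrix.mul_apply, ← Equiv.sum_comp Fin.revPerm]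
    refine Finset.sum_congr rfl fun c _ => ?_
    simp only [Fin.revPerm_apply, skewMap_apply, Fin.rev_rev]
    ring
  ext a b
  rw [skewMap_apply, Ring.lie_def, Ring.lie_def, Matrix.sub_apply, Matrix.sub_apply, key, key]
  ring

theorem skewMap_E (p q : Fin N) : skewMap N (E p q) = -E q.rev p.rev := by
  ext a b
  rw [skewMap_apply, Matrix.neg_apply]
  by_cases h : q.rev = a ∧ p.rev = b
  · obtain ⟨rfl, rfl⟩ := h
    simp [E]
  · rw [E_apply_ne h, E_apply_ne fun h' => h
      ⟨by rw [h'.2, Fin.rev_rev], by rw [h'.1, Fin.rev_rev]⟩]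

variable {n : ℕ}

theorem swapMap_apply (x : Matrix (Fin (2 * n + 2)) (Fin (2 * n + 2)) ℂ) (a b : Fin (2 * n + 2)) :
    swapMap n x a b = x (midSwap n a) (midSwap n b) := rfl

theorem midSwap_midSwap (a : Fin (2 * n + 2)) : midSwap n (midSwap n a) = a :=
  Equiv.swap_apply_self _ _ _

theorem swapMap_swapMap (x : Matrix (Fin (2 * n + 2)) (Fin (2 * n + 2)) ℂ) :
    swapMap n (swapMap n x) = x := by
  ext a b
  simp only [swapMap_apply, midSwap_midSwap]

theorem swapMap_E (p q : Fin (2 * n + 2)) : swapMap n (E p q) = E (midSwap n p) (midSwap n q) := by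
  ext a b
  rw [swapMap_apply]
  by_cases h : midSwap n p = a ∧ midSwap n q = b
  · obtain ⟨rfl, rfl⟩ := h
    simp [E, midSwap_midSwap]
  · rw [E_apply_ne h, E_apply_ne fun h' => h
      ⟨by rw [h'.1, midSwap_midSwap], by rw [h'.2, midSwap_midSwap]⟩]

theorem swapMap_skewMap (x : Matrix (Fin (2 * n + 2)) (Fin (2 * n + 2)) ℂ) :
    swapMap n (skewMap _ x) = skewMap _ (swapMap n x) := by
  ext a b
  simp only [swapMap_apply, skewMap_apply, midSwap_rev]

theorem mem_skew_iff_skewMap {x : Matrix (Fin N) (Fin N) ℂ} :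
    x ∈ skewAdjointMatricesLieSubalgebra (antidiag N) ↔ skewMap N x = x := by
  rw [mem_skew_iff, ← Matrix.ext_iff]
  exact ⟨fun h a b => (h a b).symm, fun h a b => (h a b).symm⟩

/-- The projection to the eigenspaces of the diagram automorphism in the orthogonal case. -/
def projD (n ε : ℕ) : Matrix (Fin (2 * n + 2)) (Fin (2 * n + 2)) ℂ →ₗ[ℂ]
    Matrix (Fin (2 * n + 2)) (Fin (2 * n + 2)) ℂ :=
  (LinearMap.id + (-1 : ℂ) ^ ε • (swapMap n : _ →ₗ[ℂ] _)) ∘ₗ (LinearMap.id + skewMap _)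

theorem projD_apply (ε : ℕ) (x : Matrix (Fin (2 * n + 2)) (Fin (2 * n + 2)) ℂ) :
    projD n ε x = x + skewMap _ x + (-1 : ℂ) ^ ε • (swapMap n x + swapMap n (skewMap _ x)) := by
  simp [projD]

theorem skewMap_projD (ε : ℕ) (x : Matrix (Fin (2 * n + 2)) (Fin (2 * n + 2)) ℂ) :
    skewMap _ (projD n ε x) = projD n ε x := by
  rw [projD_apply, map_add, map_add, map_smul, map_add, ← swapMap_skewMap, ← swapMap_skewMap,
    skewMap_skewMap, add_comm x, add_comm (swapMap n x)]

theorem swapMap_projD (ε : ℕ) (x : Matrix (Fin (2 * n + 2)) (Fin (2 * n + 2)) ℂ) :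
    swapMap n (projD n ε x) = (-1 : ℂ) ^ ε • projD n ε x := by
  rw [projD_apply, map_add, map_add, map_smul, map_add, swapMap_swapMap, swapMap_swapMap, smul_add (_ ^ ε)
    (x + _), smul_smul, neg_one_pow_mul_self, one_smul, add_comm (swapMap n x + _)]

theorem lie_projD (ε δ : ℕ) (x w : Matrix (Fin (2 * n + 2)) (Fin (2 * n + 2)) ℂ)
    (hw : skewMap _ w = w) (hw' : swapMap n w = (-1 : ℂ) ^ δ • w) :
    ⁅projD n ε x, w⁆ = projD n (ε + δ) ⁅x, w⁆ := by
  rw [projD_apply, projD_apply, skewMap_lie, hw, LieHom.map_lie, LieHom.map_lie, hw', lie_smul,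
    lie_smul, ← smul_add, smul_smul, pow_add, mul_assoc, neg_one_pow_mul_self, mul_one,
    add_lie, add_lie, smul_lie, add_lie]

end Proj

/-! ### The fixed point algebra -/

/-- The matrices in which the ambient algebra is realized. -/
abbrev Mat (X : TwistedType) (n : ℕ) : Type := Matrix (Fin (size X n)) (Fin (size X n)) ℂ

/-- The projection of all matrices to the `(-1) ^ ε`-eigenspace of the diagram automorphism on the
ambient algebra, up to a scalar. -/
def Qm : (X : TwistedType) → (n ε : ℕ) → Mat X n →ₗ[ℂ] Mat X n
  | .AOdd, n, ε => projA (2 * n) ε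
  | .AEven, n, ε => projA (2 * n + 1) ε
  | .D, n, ε => projD n ε

/-- Half of the factor by which `Qm` acts on its image. -/
def cc : TwistedType → ℕ
  | .AOdd => 1
  | .AEven => 1
  | .D => 2

variable {X : TwistedType} {n : ℕ}

theorem cc_ne_zero : (cc X : ℂ) ≠ 0 := by cases X <;> simp [cc]

theorem cc_pos : (0 : ℝ) < cc X := by cases X <;> simp [cc]

theorem two_mul_le_size : 2 * n ≤ size X n := by cases X <;> simp only [size] <;> omega

theorem trace_projA' {N : ℕ} (ε : ℕ) (x : Matrix (Fin N) (Fin N) ℂ) :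
    Matrix.trace (projA N ε x) = 0 := by
  rcases Nat.eq_zero_or_pos N with rfl | hN
  · simp [Matrix.trace]
  · exact trace_projA hN.ne' ε x

theorem Qm_mem (ε : ℕ) (x : Mat X n) : Qm X n ε x ∈ ambient X n := by
  cases X
  · exact trace_projA' ε x
  · exact trace_projA' ε x
  · exact mem_skew_iff_skewMap.2 (skewMap_projD ε x)

theorem matAut_Qm (ε : ℕ) (x : Mat X n) :
    matAut X n (Qm X n ε x) = (-1 : ℂ) ^ ε • Qm X n ε x := by
  cases X
  · exact flipMap_projA ε x
  · exact flipMap_projA ε x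
  · exact swapMap_projD ε x

theorem Qm_of_mem (ε : ℕ) {x : Mat X n} (hx : x ∈ ambient X n) :
    Qm X n ε x = (cc X : ℂ) • (x + (-1 : ℂ) ^ ε • matAut X n x) := by
  cases X
  · change projA _ ε x = _
    rw [projA_of_trace hx]
    simp [cc, matAut]
  · change projA _ ε x = _
    rw [projA_of_trace hx]
    simp [cc, matAut]
  · change projD n ε x = ((2 : ℕ) : ℂ) • (x + (-1 : ℂ) ^ ε • swapMap n x)
    rw [projD_apply, mem_skew_iff_skewMap.1 hx, ← two_smul ℂ x, ← two_smul ℂ (swapMap n x),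
      smul_comm _ (2 : ℂ), ← smul_add]
    norm_num

theorem lie_Qm (ε δ : ℕ) (x : Mat X n) {w : Mat X n} (hw : w ∈ ambient X n)
    (hw' : matAut X n w = (-1 : ℂ) ^ δ • w) : ⁅Qm X n ε x, w⁆ = Qm X n (ε + δ) ⁅x, w⁆ := by
  cases X
  · exact lie_projA ε δ x w hw'
  · exact lie_projA ε δ x w hw'
  · exact lie_projD ε δ x w (mem_skew_iff_skewMap.1 hw) hw'

theorem Qm_add_two (ε : ℕ) : Qm X n (ε + 2) = Qm X n ε := by
  have h : (-1 : ℂ) ^ (ε + 2) = (-1) ^ ε := by rw [pow_add]; norm_num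
  cases X
  · ext1 x; change projA _ _ x = projA _ _ x; rw [projA_apply, projA_apply, h]
  · ext1 x; change projA _ _ x = projA _ _ x; rw [projA_apply, projA_apply, h]
  · ext1 x; change projD _ _ x = projD _ _ x; rw [projD_apply, projD_apply, h]

theorem Qm_Qm (ε : ℕ) (x : Mat X n) :
    Qm X n ε (Qm X n ε x) = (2 * cc X : ℂ) • Qm X n ε x := by
  rw [Qm_of_mem ε (Qm_mem ε x), matAut_Qm, smul_smul, neg_one_pow_mul_self, one_smul, ← two_smul ℂ,
    smul_smul, mul_comm]

section Weights

variable {N : ℕ} {b : Fin n → ℤ}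

theorem flipMap_mem_wtMat {x : Matrix (Fin N) (Fin N) ℂ} (hx : x ∈ wtMat N n b) :
    flipMap N x ∈ wtMat N n b := by
  intro p q h
  rw [flipMap_apply] at h
  have := hx _ _ (right_ne_zero_of_mul (neg_ne_zero.1 h))
  rw [kap_rev, kap_rev] at this
  rw [← this]
  abel

theorem skewMap_mem_wtMat {x : Matrix (Fin N) (Fin N) ℂ} (hx : x ∈ wtMat N n b) :
    skewMap N x ∈ wtMat N n b := by
  intro p q h
  rw [skewMap_apply] at h
  have := hx _ _ (neg_ne_zero.1 h)
  rw [kap_rev, kap_rev] at this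
  rw [← this]
  abel

theorem midSwap_val (p : Fin (2 * n + 2)) : (midSwap n p : ℕ) =
    if (p : ℕ) = n then n + 1 else if (p : ℕ) = n + 1 then n else p := by
  simp only [midSwap, Equiv.swap_apply_def, Fin.ext_iff]
  split_ifs <;> simp

theorem kap_midSwap (p : Fin (2 * n + 2)) : kap (2 * n + 2) n (midSwap n p) = kap _ n p := by
  ext a
  have := a.2
  simp only [kap, midSwap_val]
  split_ifs <;> omega

theorem swapMap_mem_wtMat {x : Matrix (Fin (2 * n + 2)) (Fin (2 * n + 2)) ℂ}
    (hx : x ∈ wtMat _ n b) : swapMap n x ∈ wtMat _ n b := by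
  intro p q h
  rw [swapMap_apply] at h
  have := hx _ _ h
  rwa [kap_midSwap, kap_midSwap] at this

theorem one_mem_wtMat : (1 : Matrix (Fin N) (Fin N) ℂ) ∈ wtMat N n 0 := by
  intro p q h
  by_cases hpq : p = q
  · rw [hpq, sub_self]
  · exact absurd (Matrix.one_apply_ne hpq) h

theorem projA_mem_wtMat (ε : ℕ) {x : Matrix (Fin N) (Fin N) ℂ} (hx : x ∈ wtMat N n b) :
    projA N ε x ∈ wtMat N n b := by
  rw [projA_apply]
  refine sub_mem (add_mem hx (Submodule.smul_mem _ _ (flipMap_mem_wtMat hx))) ?_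
  by_cases hb : b = 0
  · subst hb
    exact Submodule.smul_mem _ _ one_mem_wtMat
  · have : Matrix.trace x = 0 := Finset.sum_eq_zero fun p _ => by
      by_contra h
      exact hb (by rw [← hx p p h, sub_self])
    rw [this]
    simp

theorem Qm_mem_wtMat (ε : ℕ) {x : Mat X n} (hx : x ∈ wtMat (size X n) n b) :
    Qm X n ε x ∈ wtMat (size X n) n b := by
  cases X
  · exact projA_mem_wtMat ε hx
  · exact projA_mem_wtMat ε hx
  · change projD n ε x ∈ _
    rw [projD_apply]
    exact add_mem (add_mem hx (skewMap_mem_wtMat hx)) (Submodule.smul_mem _ _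
      (add_mem (swapMap_mem_wtMat hx) (swapMap_mem_wtMat (skewMap_mem_wtMat hx))))

end Weights

theorem kap_eq_iff {p q : Fin (size X n)} (h : kap _ n p = kap _ n q) (hpq : p ≠ q) :
    X = .D ∧ q = p.rev := by
  rcases eq_or_of_kap_eq two_mul_le_size h with h | h
  · exact absurd h hpq
  · have h3 : (p : ℕ) ≠ q := fun h => hpq (Fin.ext h)
    cases X
    · simp only [size] at h; omega
    · simp only [size] at h; omega
    · refine ⟨rfl, ?_⟩
      simp only [size] at h
      ext
      rw [Fin.val_rev]
      simp only [size]
      omega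

theorem Qm_E_of_kap_eq (ε : ℕ) {p q : Fin (size X n)} (h : kap _ n p = kap _ n q) (hpq : p ≠ q) :
    Qm X n ε (E p q) = 0 := by
  obtain ⟨rfl, rfl⟩ := kap_eq_iff h hpq
  change projD n ε _ = 0
  rw [projD_apply, skewMap_E, Fin.rev_rev]
  simp

/-- Matrices of weight zero are projected to diagonal matrices. -/
theorem Qm_apply_of_ne (ε : ℕ) {x : Mat X n} (hx : x ∈ wtMat (size X n) n 0) {p q : Fin (size X n)}
    (hpq : p ≠ q) : Qm X n ε x p q = 0 := by
  by_contra h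
  obtain ⟨rfl, rfl⟩ := kap_eq_iff (sub_eq_zero.1 (Qm_mem_wtMat ε hx p q h)) hpq
  have h1 := Qm_mem (X := .D) ε x
  have h2 := (mem_skew_iff _ _).1 h1 p p.rev
  rw [Fin.rev_rev] at h2
  exact h (by linear_combination (1 / 2 : ℂ) * h2)

/-- The index of the `a`-th coordinate. -/
abbrev idx (X : TwistedType) (n : ℕ) (a : Fin n) : Fin (size X n) :=
  Fin.castLE (rank_le_size X n) a

theorem eq_sum_kap {N : ℕ} (hN : 2 * n ≤ N) (f : Fin N → ℂ) (h : ∀ p, f p.rev = -f p)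
    (h0 : ∀ p : Fin N, n ≤ (p : ℕ) → (p : ℕ) + n < N → f p = 0) (hnN : n ≤ N) (p : Fin N) :
    f p = ∑ a : Fin n, (kap N n p a : ℂ) * f (Fin.castLE hnN a) := by
  have h1 : ∀ p : Fin N, ∀ hp : (p : ℕ) < n,
      f p = ∑ a : Fin n, (kap N n p a : ℂ) * f (Fin.castLE hnN a) := by
    intro p hp
    rw [Finset.sum_eq_single (⟨p, hp⟩ : Fin n)]
    · have : kap N n p ⟨p, hp⟩ = 1 := by
        simp only [kap]
        rw [if_pos trivial, if_neg (by omega), sub_zero]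
      rw [this, Int.cast_one, one_mul]
      rfl
    · intro a _ ha
      have ha' : (p : ℕ) ≠ a := fun h => ha (Fin.ext h.symm)
      have := a.2
      have : kap N n p a = 0 := by
        simp only [kap]
        rw [if_neg ha', if_neg (by omega), sub_zero]
      rw [this, Int.cast_zero, zero_mul]
    · simp
  by_cases hp : (p : ℕ) < n
  · exact h1 p hp
  by_cases hp' : (p.rev : ℕ) < n
  · have := h1 p.rev hp'
    rw [kap_rev, h p] at this
    rw [← neg_inj, this, ← Finset.sum_neg_distrib]
    refine Finset.sum_congr rfl fun a _ => ?_
    simp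
  · rw [Fin.val_rev] at hp'
    have hp2 := p.2
    rw [h0 p (by omega) (by omega)]
    refine (Finset.sum_eq_zero fun a _ => ?_).symm
    have := a.2
    have : kap N n p a = 0 := by
      simp only [kap]
      rw [if_neg (by omega), if_neg (by omega), sub_zero]
    rw [this, Int.cast_zero, zero_mul]

/-- The diagonal entries of elements of the fixed point algebra. -/
theorem diag_eq_sum {h : Mat X n} (hh : h ∈ ambient X n) (hs : matAut X n h = h)
    (p : Fin (size X n)) :
    h p p = ∑ a : Fin n, (kap _ n p a : ℂ) * h (idx X n a) (idx X n a) := by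
  have hA : ∀ {N : ℕ} {h : Matrix (Fin N) (Fin N) ℂ}, flipMap N h = h → ∀ p : Fin N,
      h p.rev p.rev = -h p p := by
    intro N h hs p
    have := congrFun (congrFun hs p) p
    rw [flipMap_apply, ← two_mul, pow_mul] at this
    simp only [even_two, Even.neg_pow, one_pow, one_mul] at this
    linear_combination -this
  refine eq_sum_kap two_mul_le_size (fun p => h p p) ?_ ?_ _ p
  · cases X
    · exact hA hs
    · exact hA hs
    · intro p
      have := (mem_skew_iff _ h).1 hh p p
      linear_combination this
  · intro p hp hp'
    cases X
    · simp only [size] at hp'; omega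
    · have h1 := hA hs p
      have h2 : p.rev = p := by
        ext
        rw [Fin.val_rev]
        simp only [size] at hp' ⊢
        omega
      simp only [h2] at h1
      linear_combination (1 / 2 : ℂ) * h1
    · have h1 := (mem_skew_iff _ h).1 hh p p
      have h2 : p.rev = midSwap n p := by
        ext
        rw [Fin.val_rev, midSwap_val]
        simp only [size] at hp' ⊢
        split_ifs <;> omega
      have h3 := congrFun (congrFun hs p) p
      change h (midSwap n p) (midSwap n p) = h p p at h3
      rw [h2, h3] at h1
      linear_combination (1 / 2 : ℂ) * h1

theorem Qm_zero_E_apply (p : Fin (size X n)) (a : Fin n) :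
    Qm X n 0 (E p p) (idx X n a) (idx X n a) = cc X * kap _ n p a := by
  have e1 : ∀ {N : ℕ} (p q : Fin N), E p p q q = if p = q then 1 else 0 := by
    intro N p q
    split_ifs with h
    · simp [E, h]
    · exact E_apply_ne fun h' => h h'.1
  have hp := p.2
  have ha := a.2
  have hA : ∀ {N : ℕ} (p q : Fin N), projA N 0 (E p p) q q =
      (if p = q then 1 else 0) - (if p.rev = q then 1 else 0) := by
    intro N p q
    rw [projA_zero, flipMap_E, ← two_mul, pow_mul]
    simp only [even_two, Even.neg_pow, one_pow, neg_smul, one_smul, Matrix.add_apply,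
      Matrix.neg_apply, e1]
    ring
  have hk : ∀ {N : ℕ} (hN : n ≤ N) (p : Fin N), ((kap N n p a : ℤ) : ℂ) =
      (if p = Fin.castLE hN a then 1 else 0) - (if p.rev = Fin.castLE hN a then 1 else 0) := by
    intro N hN p
    have : ((p : ℕ) + a + 1 = N) ↔ p.rev = Fin.castLE hN a := by
      rw [Fin.ext_iff, Fin.val_rev, Fin.val_castLE]
      have := p.2
      omega
    simp only [kap, this, Fin.ext_iff, Fin.val_castLE]
    push_cast
    rfl
  cases X
  · refine (hA _ _).trans ?_
    rw [hk (rank_le_size .AOdd n) p]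
    simp [cc]
  · refine (hA _ _).trans ?_
    rw [hk (rank_le_size .AEven n) p]
    simp [cc]
  · change projD n 0 (E p p) (idx .D n a) (idx .D n a) = _
    have hm : midSwap n (idx .D n a) = idx .D n a := by
      ext
      rw [midSwap_val]
      simp only [Fin.val_castLE]
      rw [if_neg (by omega), if_neg (by omega)]
    rw [hk (rank_le_size .D n) p, projD_apply, skewMap_E]
    simp only [Matrix.add_apply, Matrix.smul_apply, swapMap_apply, hm, Matrix.neg_apply, e1, cc]
    norm_num
    ring

/-- The coefficients of `[E p q, X q p]`, where `X q p` is the projection of the matrix unit. -/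
def mm (X : TwistedType) (n : ℕ) (p q : Fin (size X n)) : ℝ :=
  match X with
  | .AOdd => 1 + if q = p.rev then 1 else 0
  | .AEven => 1 - if q = p.rev then 1 else 0
  | .D => 2 - 2 * (if q = p.rev then 1 else 0) -
      ((if n ≤ (p : ℕ) ∧ (p : ℕ) < n + 2 then 1 else 0) +
        (if n ≤ (q : ℕ) ∧ (q : ℕ) < n + 2 then 1 else 0))

theorem Qm_lie_E (p q : Fin (size X n)) (hpq : kap _ n p ≠ kap _ n q) :
    Qm X n 0 ⁅E p q, Qm X n 0 (E q p)⁆ = (mm X n p q : ℂ) • Qm X n 0 (E p p - E q q) := by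
  have hne : p ≠ q := fun h => hpq (by rw [h])
  have hA : ∀ {N : ℕ} (p q : Fin N), p ≠ q → ⁅E p q, projA N 0 (E q p)⁆ =
      (1 - if q = p.rev then (-1 : ℂ) ^ (N + 1) else 0) • (E p p - E q q) := by
    intro N p q hpq
    have e1 : (q = p.rev) ↔ (q.rev = p) := by rw [Fin.rev_eq_iff]
    have e2 := p.2
    rw [projA_zero, flipMap_E, lie_add, lie_smul, lie_E, lie_E, if_pos rfl, if_pos rfl]
    by_cases h : q = p.rev
    · rw [if_pos h, if_pos h, if_pos (e1.1 h)]
      subst h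
      have e3 : (-1 : ℂ) ^ ((p.rev : ℕ) + p) = (-1) ^ (N + 1) := by
        rw [neg_one_pow_eq_pow_mod_two, neg_one_pow_eq_pow_mod_two (N + 1)]
        congr 1
        rw [Fin.val_rev]
        omega
      rw [e3, Fin.rev_rev, sub_smul, one_smul, neg_smul]
      abel
    · rw [if_neg h, if_neg h, if_neg (fun h' => h (e1.2 h'))]
      simp
  cases X
  · change projA _ 0 ⁅E p q, projA _ 0 (E q p)⁆ = _
    rw [hA p q hne, map_smul]
    congr 1
    simp only [mm, size]
    split_ifs <;> simp [pow_add, pow_mul]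
  · change projA _ 0 ⁅E p q, projA _ 0 (E q p)⁆ = _
    rw [hA p q hne, map_smul]
    congr 1
    simp only [mm, size]
    split_ifs <;> simp [pow_add, pow_mul]
  · have hp := p.2
    have hq := q.2
    simp only [size] at hp hq
    have hmid : ¬((n ≤ (p : ℕ) ∧ (p : ℕ) < n + 2) ∧ (n ≤ (q : ℕ) ∧ (q : ℕ) < n + 2)) := by
      rintro ⟨h1, h2⟩
      refine hpq (funext fun a => ?_)
      have := a.2
      simp only [kap, size]
      rw [if_neg (by omega), if_neg (by omega), if_neg (by omega), if_neg (by omega)]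
    have hz : ∀ p : Fin (2 * n + 2), midSwap n p ≠ p → Qm .D n 0 (E p (midSwap n p)) = 0 ∧
        Qm .D n 0 (E (midSwap n p) p) = 0 := fun p h =>
      ⟨Qm_E_of_kap_eq 0 (kap_midSwap p).symm h.symm, Qm_E_of_kap_eq 0 (kap_midSwap p) h⟩
    have hfix : ∀ p : Fin (2 * n + 2), midSwap n p = p ↔ ¬(n ≤ (p : ℕ) ∧ (p : ℕ) < n + 2) := by
      intro p
      rw [Fin.ext_iff, midSwap_val]
      split_ifs <;> omega
    have e0 : Qm .D n 0 (E q p) = E q p - E p.rev q.rev +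
        (E (midSwap n q) (midSwap n p) - E (midSwap n p.rev) (midSwap n q.rev)) := by
      change projD n 0 _ = _
      rw [projD_apply, skewMap_E, map_neg, swapMap_E, swapMap_E, pow_zero, one_smul]
      abel
    have hval : ∀ p q : Fin (2 * n + 2), p = q ↔ (p : ℕ) = q := fun p q => Fin.ext_iff
    rw [e0, midSwap_rev, midSwap_rev, lie_add, lie_sub, lie_sub, lie_E, lie_E, lie_E, lie_E,
      if_pos rfl, if_pos rfl]
    by_cases h1 : n ≤ (p : ℕ) ∧ (p : ℕ) < n + 2
    · have h2 : ¬(n ≤ (q : ℕ) ∧ (q : ℕ) < n + 2) := fun h => hmid ⟨h1, h⟩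
      have f1 := (hfix q).2 h2
      have f2 : midSwap n p ≠ p := fun h => (hfix p).1 h h1
      have f3 : q ≠ p.rev := by rw [Ne, hval, Fin.val_rev]; omega
      have f4 : q ≠ (midSwap n p).rev := by
        rw [Ne, hval, Fin.val_rev, midSwap_val]; split_ifs <;> omega
      have f5 : q.rev ≠ p := by rw [Ne, hval, Fin.val_rev]; omega
      rw [f1, if_pos rfl, if_neg f2, if_neg f3, if_neg f4, if_neg f5]
      simp only [sub_zero, map_add, map_sub, (hz p f2).1]
      simp [mm, h1, h2, f3, f5]
      norm_num
    · have f1 := (hfix p).2 h1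
      by_cases h2 : n ≤ (q : ℕ) ∧ (q : ℕ) < n + 2
      · have f2 : midSwap n q ≠ q := fun h => (hfix q).1 h h2
        have f3 : q ≠ p.rev := by rw [Ne, hval, Fin.val_rev]; omega
        have f4 : (midSwap n q).rev ≠ p := by
          rw [Ne, hval, Fin.val_rev, midSwap_val]; split_ifs <;> omega
        have f5 : q.rev ≠ p := by rw [Ne, hval, Fin.val_rev]; omega
        rw [f1, if_pos rfl, if_neg f2.symm, if_neg f3, if_neg f4, if_neg f5]
        simp only [sub_zero, zero_sub, map_add, map_sub, map_neg, (hz q f2).2, neg_zero]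
        simp [mm, h1, h2, f3]
        norm_num
      · have f2 := (hfix q).2 h2
        rw [f1, f2, if_pos rfl, if_pos rfl]
        by_cases f3 : q = p.rev
        · subst f3
          have h3 : mm .D n p p.rev = 0 := by
            simp only [mm]
            rw [if_pos trivial, if_neg h1, if_neg h2]
            norm_num
          rw [h3]
          simp
        · have f5 : q.rev ≠ p := fun h => f3 (by rw [← h, Fin.rev_rev])
          rw [if_neg f3, if_neg f5]
          simp [mm, h1, h2, f3, two_smul]

section FixedAlgebra

variable {X : TwistedType} {n : ℕ}

/-- The projection of matrices to the fixed point algebra. -/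
def Q0 (X : TwistedType) (n : ℕ) : Mat X n →ₗ[ℂ] g0 X n where
  toFun x := ⟨⟨Qm X n 0 x, Qm_mem 0 x⟩, Subtype.ext (by
    change matAut X n (Qm X n 0 x) = Qm X n 0 x
    rw [matAut_Qm, pow_zero, one_smul])⟩
  map_add' x y := Subtype.ext (Subtype.ext (map_add _ x y))
  map_smul' c x := Subtype.ext (Subtype.ext (map_smul _ c x))

theorem Q0_val (x : Mat X n) : (Q0 X n x).1.1 = Qm X n 0 x := rfl

theorem g0_ext {x y : g0 X n} (h : x.1.1 = y.1.1) : x = y := Subtype.ext (Subtype.ext h)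

theorem matAut_g0 (w : g0 X n) : matAut X n w.1.1 = w.1.1 := congrArg Subtype.val w.2

theorem Q0_lie (x : Mat X n) (w : g0 X n) : ⁅Q0 X n x, w⁆ = Q0 X n ⁅x, w.1.1⁆ :=
  g0_ext (lie_Qm 0 0 x w.1.2 (by rw [matAut_g0, pow_zero, one_smul]))

theorem lie_Q0 (w : g0 X n) (x : Mat X n) : ⁅w, Q0 X n x⁆ = Q0 X n ⁅w.1.1, x⁆ := by
  rw [← lie_skew, Q0_lie, ← map_neg, lie_skew]

theorem Q0_self (w : g0 X n) : Q0 X n w.1.1 = (2 * cc X : ℂ) • w := by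
  refine g0_ext ?_
  rw [Q0_val, Qm_of_mem 0 w.1.2, matAut_g0, pow_zero, one_smul, ← two_smul ℂ, smul_smul, mul_comm]
  rfl

theorem two_cc_ne_zero : (2 * cc X : ℂ) ≠ 0 := mul_ne_zero two_ne_zero cc_ne_zero

theorem eq_Q0 (w : g0 X n) : w = Q0 X n ((2 * cc X : ℂ)⁻¹ • w.1.1) := by
  rw [map_smul, Q0_self, smul_smul, inv_mul_cancel₀ two_cc_ne_zero, one_smul]

/-- The basis of the Cartan subalgebra dual to the coordinates. -/
def Hh (X : TwistedType) (n : ℕ) (a : Fin n) : g0 X n :=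
  Q0 X n ((cc X : ℂ)⁻¹ • E (idx X n a) (idx X n a))

theorem kap_idx (a b : Fin n) : kap (size X n) n (idx X n a) b = if a = b then 1 else 0 := by
  have := a.2
  have := b.2
  have := two_mul_le_size (X := X) (n := n)
  simp only [kap, Fin.val_castLE, Fin.ext_iff]
  rw [if_neg (c := (a : ℕ) + b + 1 = size X n) (by omega), sub_zero]

theorem Hh_apply_idx (a b : Fin n) :
    (Hh X n a).1.1 (idx X n b) (idx X n b) = if a = b then 1 else 0 := by
  change (Q0 X n _).1.1 _ _ = _
  rw [Q0_val, map_smul, Matrix.smul_apply, Qm_zero_E_apply, kap_idx, smul_eq_mul,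
    inv_mul_cancel_left₀ cc_ne_zero]
  split_ifs <;> simp

theorem E_diag_mem (p : Fin (size X n)) : E p p ∈ wtMat (size X n) n 0 := by
  have := E_mem_wtMat (n := n) p p
  rwa [sub_self] at this

theorem Hh_apply_of_ne (a : Fin n) {p q : Fin (size X n)} (h : p ≠ q) :
    (Hh X n a).1.1 p q = 0 :=
  Qm_apply_of_ne 0 (Submodule.smul_mem _ _ (E_diag_mem _)) h

theorem g0_diag (w : g0 X n) (p : Fin (size X n)) :
    w.1.1 p p = ∑ a : Fin n, (kap _ n p a : ℂ) * w.1.1 (idx X n a) (idx X n a) :=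
  diag_eq_sum w.1.2 (matAut_g0 w) p

theorem Hh_apply_self (a : Fin n) (p : Fin (size X n)) : (Hh X n a).1.1 p p = kap _ n p a := by
  rw [g0_diag]
  simp [Hh_apply_idx]

theorem Hh_mem_cartan (a : Fin n) : (Hh X n a).1 ∈ cartan X n := fun _ _ h => Hh_apply_of_ne a h

/-- Diagonal elements in terms of the basis `Hh`. -/
theorem eq_sum_Hh (w : g0 X n) (hw : w.1 ∈ cartan X n) :
    w = ∑ a, w.1.1 (idx X n a) (idx X n a) • Hh X n a := by
  have hval : (∑ a, w.1.1 (idx X n a) (idx X n a) • Hh X n a : g0 X n).1.1 =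
      ∑ a, w.1.1 (idx X n a) (idx X n a) • (Hh X n a).1.1 := by
    let φ : g0 X n →ₗ[ℂ] Mat X n :=
      (ambient X n).toSubmodule.subtype ∘ₗ (g0 X n).toSubmodule.subtype
    change φ _ = ∑ a, w.1.1 (idx X n a) (idx X n a) • φ (Hh X n a)
    rw [map_sum]
    simp only [map_smul]
  refine g0_ext ?_
  rw [hval]
  ext p q
  rw [Matrix.sum_apply]
  by_cases h : p = q
  · subst h
    rw [g0_diag]
    refine Finset.sum_congr rfl fun a _ => ?_
    rw [Matrix.smul_apply, Hh_apply_self, smul_eq_mul, mul_comm]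
  · rw [hw p q h]
    refine (Finset.sum_eq_zero fun a _ => ?_).symm
    rw [Matrix.smul_apply, Hh_apply_of_ne a h, smul_zero]

theorem diag_lie_apply {N : ℕ} {h x : Matrix (Fin N) (Fin N) ℂ} (hh : ∀ a b, a ≠ b → h a b = 0)
    (p q : Fin N) : ⁅h, x⁆ p q = (h p p - h q q) * x p q := by
  rw [Ring.lie_def, Matrix.sub_apply, Matrix.mul_apply, Matrix.mul_apply,
    Finset.sum_eq_single p, Finset.sum_eq_single q]
  · ring
  · intro r _ hr
    rw [hh r q hr, mul_zero]
  · simp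
  · intro r _ hr
    rw [hh p r (Ne.symm hr), zero_mul]
  · simp

/-- The action of the Cartan subalgebra on matrices of a given weight. -/
theorem Hh_lie {b : Fin n → ℤ} (a : Fin n) {x : Mat X n} (hx : x ∈ wtMat (size X n) n b) :
    ⁅(Hh X n a).1.1, x⁆ = (b a : ℂ) • x := by
  ext p q
  rw [diag_lie_apply (Hh_mem_cartan a), Hh_apply_self, Hh_apply_self, Matrix.smul_apply,
    smul_eq_mul]
  by_cases h : x p q = 0
  · simp [h]
  · rw [← hx p q h]
    simp

/-- The images of the matrix units. -/
def XX (X : TwistedType) (n : ℕ) (p q : Fin (size X n)) : g0 X n := Q0 X n (E p q)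

theorem XX_self (p : Fin (size X n)) : XX X n p p = (cc X : ℂ) • ∑ a, (kap _ n p a : ℂ) • Hh X n a := by
  have h1 : (XX X n p p).1 ∈ cartan X n := fun _ _ h => Qm_apply_of_ne 0 (E_diag_mem _) h
  rw [eq_sum_Hh _ h1, Finset.smul_sum]
  refine Finset.sum_congr rfl fun a _ => ?_
  change (Q0 X n _).1.1 _ _ • _ = _
  rw [Q0_val, Qm_zero_E_apply, smul_smul]

theorem XX_eq_zero {p q : Fin (size X n)} (h : kap _ n p = kap _ n q) (hpq : p ≠ q) :
    XX X n p q = 0 := g0_ext (Qm_E_of_kap_eq 0 h hpq)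

theorem lie_XX (p q : Fin (size X n)) : ⁅XX X n p q, XX X n q p⁆ =
    (mm X n p q * cc X : ℂ) • ∑ a, ((kap _ n p a - kap _ n q a : ℤ) : ℂ) • Hh X n a := by
  by_cases h : kap _ n p = kap _ n q
  · by_cases hpq : p = q
    · subst hpq; simp
    · rw [XX_eq_zero h hpq, zero_lie, h]
      simp
  · have h1 : ⁅XX X n p q, XX X n q p⁆ = (mm X n p q : ℂ) • (XX X n p p - XX X n q q) := by
      refine g0_ext ?_
      change (⁅Q0 X n (E p q), XX X n q p⁆ : g0 X n).1.1 = _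
      rw [Q0_lie, Q0_val]
      change Qm X n 0 ⁅E p q, Qm X n 0 (E q p)⁆ = _
      rw [Qm_lie_E p q h, map_sub]
      rfl
    rw [h1, XX_self, XX_self, ← smul_sub, ← Finset.sum_sub_distrib, smul_smul]
    congr 1
    refine Finset.sum_congr rfl fun a _ => ?_
    push_cast
    rw [sub_smul]

theorem Hh_lie_XX (a : Fin n) (p q : Fin (size X n)) :
    ⁅Hh X n a, XX X n p q⁆ = ((kap _ n p a - kap _ n q a : ℤ) : ℂ) • XX X n p q := by
  change ⁅Hh X n a, Q0 X n _⁆ = _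
  rw [lie_Q0, Hh_lie a (E_mem_wtMat p q), map_smul]
  rfl

theorem Hh_lie_Hh (a b : Fin n) : ⁅Hh X n a, Hh X n b⁆ = 0 := by
  change ⁅Hh X n a, Q0 X n _⁆ = 0
  rw [lie_Q0, Hh_lie a (Submodule.smul_mem _ _ (E_diag_mem _))]
  simp

theorem sum_kap_mul_kap (a b : Fin n) :
    ∑ p, kap (size X n) n p a * kap _ n p b = if a = b then 2 else 0 := by
  have h1 : ∀ p : Fin (size X n), kap _ n p a =
      (if p = idx X n a then 1 else 0) - (if p = (idx X n a).rev then 1 else 0) := by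
    intro p
    have e1 : ((p : ℕ) + a + 1 = size X n) ↔ p = (idx X n a).rev := by
      rw [Fin.ext_iff, Fin.val_rev, Fin.val_castLE]
      have := p.2
      have := a.2
      have := two_mul_le_size (X := X) (n := n)
      omega
    have e2 : ((p : ℕ) = a) ↔ p = idx X n a := by
      rw [Fin.ext_iff, Fin.val_castLE]
    simp only [kap, e1, e2]
  simp only [h1 _, sub_mul, ite_mul, one_mul, zero_mul, Finset.sum_sub_distrib,
    Finset.sum_ite_eq', Finset.mem_univ, if_true]
  have h2 : kap (size X n) n (idx X n a).rev b = -kap (size X n) n (idx X n a) b := by rw [kap_rev]; rfl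
  have h3 := kap_idx (X := X) a b
  rw [h2, h3]
  split_ifs <;> norm_num

/-! ### The Casimir element -/

/-- The Casimir element. -/
def casimir (X : TwistedType) (n : ℕ) : UniversalEnvelopingAlgebra ℂ (g0 X n) :=
  ∑ p, ∑ q, UniversalEnvelopingAlgebra.ι ℂ (XX X n p q) * UniversalEnvelopingAlgebra.ι ℂ (XX X n q p)

theorem lie_XX_of (w : g0 X n) (p q : Fin (size X n)) :
    ⁅w, XX X n p q⁆ = ∑ r, w.1.1 r p • XX X n r q - ∑ r, w.1.1 q r • XX X n p r := by
  have h1 : ⁅w.1.1, E p q⁆ = ∑ r, w.1.1 r p • E r q - ∑ r, w.1.1 q r • E p r := by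
    have h0 := eq_sum_E w.1.1
    have e1 : ∀ r s : Fin (size X n), ⁅w.1.1 r s • E r s, E p q⁆ =
        (if s = p then w.1.1 r s • E r q else 0) - (if q = r then w.1.1 r s • E p s else 0) := by
      intro r s
      rw [smul_lie, lie_E, smul_sub]
      split_ifs <;> simp
    conv_lhs => rw [h0]
    rw [sum_lie]
    simp only [sum_lie, e1, Finset.sum_sub_distrib, Finset.sum_ite_eq', Finset.mem_univ,
      if_true]
    congr 1
    rw [Finset.sum_comm]
    simp
  change ⁅w, Q0 X n _⁆ = _
  rw [lie_Q0, h1, map_sub, map_sum, map_sum]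
  simp only [map_smul]
  rfl

theorem casimir_comm (w : g0 X n) :
    UniversalEnvelopingAlgebra.ι ℂ w * casimir X n = casimir X n * UniversalEnvelopingAlgebra.ι ℂ w := by
  set j := UniversalEnvelopingAlgebra.ι ℂ (L := g0 X n) with hj
  have h1 : ∀ a b : g0 X n, j a * j b = j b * j a + j ⁅a, b⁆ := by
    intro a b
    rw [LieHom.map_lie, Ring.lie_def]
    abel
  have h2 : ∀ p q, j w * (j (XX X n p q) * j (XX X n q p)) =
      (j (XX X n p q) * j (XX X n q p)) * j w + (j ⁅w, XX X n p q⁆ * j (XX X n q p) +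
        j (XX X n p q) * j ⁅w, XX X n q p⁆) := by
    intro p q
    rw [← mul_assoc, h1, add_mul, mul_assoc, h1 w (XX X n q p), mul_add, mul_assoc]
    abel
  have h3 : ∑ p, ∑ q, (j ⁅w, XX X n p q⁆ * j (XX X n q p) + j (XX X n p q) * j ⁅w, XX X n q p⁆) = 0 := by
    simp only [lie_XX_of, map_sub, map_sum, map_smul, sub_mul, mul_sub, Finset.sum_mul,
      Finset.mul_sum, smul_mul_assoc, mul_smul_comm, Finset.sum_add_distrib,
      Finset.sum_sub_distrib]
    have e1 : ∑ p, ∑ q, ∑ r, w.1.1 r p • (j (XX X n r q) * j (XX X n q p)) =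
        ∑ p, ∑ q, ∑ r, w.1.1 p r • (j (XX X n p q) * j (XX X n q r)) := by
      rw [Finset.sum_comm]
      refine (Finset.sum_congr rfl fun q _ => Finset.sum_comm).trans ?_
      rw [Finset.sum_comm]
    have e2 : ∑ p, ∑ q, ∑ r, w.1.1 q r • (j (XX X n p r) * j (XX X n q p)) =
        ∑ p, ∑ q, ∑ r, w.1.1 r q • (j (XX X n p q) * j (XX X n r p)) :=
      Finset.sum_congr rfl fun p _ => Finset.sum_comm
    rw [e1, e2]
    abel
  simp only [casimir, Finset.mul_sum, Finset.sum_mul]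
  rw [← hj]
  simp only [h2, Finset.sum_add_distrib] at h3 ⊢
  rw [h3, add_zero]

end FixedAlgebra

section Triangular

variable {X : TwistedType} {n : ℕ}

/-- The positive root vectors are indexed by pairs of coordinates. -/
abbrev PosPair (X : TwistedType) (n : ℕ) : Type :=
  {x : Fin (size X n) × Fin (size X n) // x.1 < x.2 ∧ kap _ n x.1 ≠ kap _ n x.2}

/-- The coefficients of `2 ρ` in the Casimir element. -/
def Bcoef (X : TwistedType) (n : ℕ) (a : Fin n) : ℝ :=
  cc X * ∑ p : Fin (size X n), ∑ q, if p < q then mm X n p q * (kap _ n p a - kap _ n q a : ℤ) else 0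

theorem sum_lt {N : ℕ} (p : Fin N) : ∑ q : Fin N, (if p < q then (1 : ℝ) else 0) = N - 1 - p := by
  rw [Finset.sum_boole]
  have h : (Finset.univ.filter fun q => p < q) = Finset.Ioi p := by ext; simp
  rw [h, Fin.card_Ioi, Nat.cast_sub (by have := p.2; omega), Nat.cast_sub (by have := p.2; omega)]
  simp

theorem sum_gt {N : ℕ} (p : Fin N) : ∑ q : Fin N, (if q < p then (1 : ℝ) else 0) = p := by
  rw [Finset.sum_boole]
  have h : (Finset.univ.filter fun q => q < p) = Finset.Iio p := by ext; simp
  rw [h, Fin.card_Iio]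

theorem sum_mul_kap {N : ℕ} (hN : 2 * n ≤ N) (hnN : n ≤ N) (a : Fin n) (g : Fin N → ℝ) :
    ∑ p, g p * (kap N n p a : ℝ) = g (Fin.castLE hnN a) - g (Fin.castLE hnN a).rev := by
  have h1 : ∀ p : Fin N, (kap N n p a : ℝ) =
      (if p = Fin.castLE hnN a then 1 else 0) - (if p = (Fin.castLE hnN a).rev then 1 else 0) := by
    intro p
    have e1 : ((p : ℕ) + a + 1 = N) ↔ p = (Fin.castLE hnN a).rev := by
      rw [Fin.ext_iff, Fin.val_rev, Fin.val_castLE]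
      have := p.2
      have := a.2
      omega
    have e2 : ((p : ℕ) = a) ↔ p = Fin.castLE hnN a := by
      rw [Fin.ext_iff, Fin.val_castLE]
    simp only [kap, e1, e2]
    push_cast
    rfl
  simp [h1, mul_sub, Finset.sum_sub_distrib]

theorem sum_val_eq {N : ℕ} (k : ℕ) (hk : k < N) :
    ∑ q : Fin N, (if (q : ℕ) = k then (1 : ℝ) else 0) = 1 := by
  rw [Finset.sum_eq_single (⟨k, hk⟩ : Fin N)]
  · simp
  · intro q _ hq
    rw [if_neg (fun h => hq (Fin.ext h))]
  · simp

/-- The function that appears as the coefficient of a coordinate in the sum of the positive roots. -/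
theorem sum_pairs {N : ℕ} (hN : 2 * n ≤ N) (hnN : n ≤ N) (a : Fin n) (m : Fin N → Fin N → ℝ) :
    ∑ p : Fin N, ∑ q, (if p < q then m p q * (kap N n p a - kap N n q a : ℤ) else 0) =
      (∑ q, ((if Fin.castLE hnN a < q then m (Fin.castLE hnN a) q else 0) -
        if q < Fin.castLE hnN a then m q (Fin.castLE hnN a) else 0)) -
      ∑ q, ((if (Fin.castLE hnN a).rev < q then m (Fin.castLE hnN a).rev q else 0) -
        if q < (Fin.castLE hnN a).rev then m q (Fin.castLE hnN a).rev else 0) := by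
  have h1 : ∀ p q : Fin N, (if p < q then m p q * (kap N n p a - kap N n q a : ℤ) else 0) =
      (if p < q then m p q else 0) * (kap N n p a : ℝ) -
        (if p < q then m p q else 0) * (kap N n q a : ℝ) := by
    intro p q
    split_ifs
    · push_cast; ring
    · ring
  have h2 : ∑ p : Fin N, ∑ q, (if p < q then m p q * (kap N n p a - kap N n q a : ℤ) else 0) =
      ∑ p, (∑ q, ((if p < q then m p q else 0) - if q < p then m q p else 0)) *
        (kap N n p a : ℝ) := by
    simp only [h1, Finset.sum_sub_distrib, sub_mul, Finset.sum_mul]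
    congr 1
    rw [Finset.sum_comm]
  rw [h2, sum_mul_kap hN hnN a]

theorem Bcoef_eq (a : Fin n) : Bcoef X n a = 2 * cc X * (match X with
    | .AOdd => 2 * n - 2 * a
    | .AEven => 2 * n - 2 * a - 1
    | .D => 4 * n - 4 * a - 2) := by
  have ha := a.2
  -- The values for the variables `a` and `a.rev` of a symmetric function of three summands.
  have key : ∀ (N : ℕ) (hN : 2 * n ≤ N) (hnN : n ≤ N) (al be : ℝ) (m : Fin N → Fin N → ℝ)
      (ga : Fin N → ℝ), (∀ p q : Fin N, (ga p = 0 ∨ ga q = 0) → m p q = al + be * (if q = p.rev then 1 else 0) + (ga p + ga q)) →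
      (∀ q : Fin N, (q : ℕ) < n ∨ N < q + n + 1 → ga q = 0) →
      ∑ p : Fin N, ∑ q, (if p < q then m p q * (kap N n p a - kap N n q a : ℤ) else 0) =
        2 * (al * (N - 1 - 2 * a) + be + ∑ q, ga q) := by
    intro N hN hnN al be m ga hm hga
    rw [sum_pairs hN hnN]
    set k : Fin N := Fin.castLE hnN a with hk
    have hkv : (k : ℕ) = a := rfl
    have hkr : (k.rev : ℕ) = N - 1 - a := by rw [Fin.val_rev, hkv]; omega
    have hg1 : ga k = 0 := hga _ (Or.inl (by omega))
    have hg2 : ga k.rev = 0 := hga _ (Or.inr (by omega))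
    have h1 : ∀ q, ((if k < q then m k q else 0) - if q < k then m q k else 0) =
        al * (if k < q then 1 else 0) - al * (if q < k then 1 else 0) +
          be * (if q = k.rev then 1 else 0) + ga q := by
      intro q
      have e1 : k = q.rev ↔ q = k.rev := by rw [eq_comm, Fin.rev_eq_iff]
      rw [hm k q (Or.inl hg1), hm q k (Or.inr hg1), hg1]
      simp only [e1]
      have e2 : q = k.rev → k < q := by rintro rfl; rw [Fin.lt_def]; omega
      have e3 : ¬k < q → ga q = 0 := fun h => hga q (Or.inl (by rw [Fin.lt_def] at h; omega))
      by_cases c1 : k < q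
      · rw [if_pos c1, if_pos c1, if_neg (not_lt.2 c1.le), if_neg (not_lt.2 c1.le)]; ring
      · rw [if_neg c1, if_neg c1, if_neg (fun h => c1 (e2 h)), e3 c1]
        split_ifs <;> ring
    have h2 : ∀ q, ((if k.rev < q then m k.rev q else 0) - if q < k.rev then m q k.rev else 0) =
        al * (if k.rev < q then 1 else 0) - al * (if q < k.rev then 1 else 0) -
          be * (if q = k then 1 else 0) - ga q := by
      intro q
      have e1 : k.rev = q.rev ↔ q = k := by rw [Fin.rev_inj, eq_comm]
      have e1' : q = k.rev.rev ↔ q = k := by rw [Fin.rev_rev]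
      rw [hm k.rev q (Or.inl hg2), hm q k.rev (Or.inr hg2), hg2]
      simp only [e1, e1']
      have e2 : q = k → q < k.rev := by rintro rfl; rw [Fin.lt_def]; omega
      have e3 : ¬q < k.rev → ga q = 0 := fun h => hga q (Or.inr (by rw [Fin.lt_def] at h; omega))
      by_cases c1 : q < k.rev
      · rw [if_pos c1, if_pos c1, if_neg (not_lt.2 c1.le), if_neg (not_lt.2 c1.le)]; ring
      · rw [if_neg c1, if_neg c1, if_neg (fun h => c1 (e2 h)), e3 c1]
        split_ifs <;> ring
    simp only [h1, h2, Finset.sum_add_distrib, Finset.sum_sub_distrib, ← Finset.mul_sum, sum_lt,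
      sum_gt, Finset.sum_ite_eq', Finset.mem_univ, if_true, hkr, hkv]
    rw [Nat.cast_sub (by omega), Nat.cast_sub (by omega)]
    push_cast
    ring
  unfold Bcoef
  cases X
  · rw [key (2 * n) le_rfl (by omega) 1 1 (mm .AOdd n) (fun _ => 0) (by intro p q _; simp [mm])
      (fun _ _ => rfl)]
    simp [cc]
    ring
  · rw [key (2 * n + 1) (by omega) (by omega) 1 (-1) (mm .AEven n) (fun _ => 0)
      (by intro p q _; simp only [mm]; ring) (fun _ _ => rfl)]
    simp [cc]
    ring
  · have hsum : ∑ q : Fin (2 * n + 2), (-(if n ≤ (q : ℕ) ∧ (q : ℕ) < n + 2 then 1 else 0) : ℝ) =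
        -2 := by
      have : ∀ q : Fin (2 * n + 2), (-(if n ≤ (q : ℕ) ∧ (q : ℕ) < n + 2 then 1 else 0) : ℝ) =
          -(if (q : ℕ) = n then 1 else 0) - (if (q : ℕ) = n + 1 then 1 else 0) := by
        intro q
        by_cases h1 : (q : ℕ) = n
        · simp [h1]
        by_cases h2 : (q : ℕ) = n + 1
        · simp [h2]
        · rw [if_neg (by omega)]; simp [h1, h2]
      simp only [this, Finset.sum_sub_distrib, Finset.sum_neg_distrib]
      rw [sum_val_eq n (by omega), sum_val_eq (n + 1) (by omega)]
      norm_num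
    rw [key (2 * n + 2) (by omega) (by omega) 2 (-2) (mm .D n)
      (fun q => -(if n ≤ (q : ℕ) ∧ (q : ℕ) < n + 2 then 1 else 0))
      (by intro p q _; simp only [mm]; ring) (by
        intro q hq
        rw [if_neg (by omega), neg_zero]), hsum]
    simp [cc]
    ring

theorem Bcoef_pos (a : Fin n) : 0 < Bcoef X n a := by
  have ha : (a : ℝ) + 1 ≤ n := by exact_mod_cast a.2
  rw [Bcoef_eq]
  refine mul_pos (mul_pos two_pos cc_pos) ?_
  cases X <;> simp only <;> linarith

theorem Bcoef_anti {a b : Fin n} (h : a < b) : Bcoef X n b < Bcoef X n a := by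
  have h' : (a : ℝ) < b := by exact_mod_cast (Fin.lt_def.1 h)
  rw [Bcoef_eq, Bcoef_eq]
  refine mul_lt_mul_of_pos_left ?_ (mul_pos two_pos cc_pos)
  cases X <;> simp only <;> linarith

set_option maxHeartbeats 1000000 in
theorem casimir_eq : casimir X n = ((2 * cc X ^ 2 : ℝ) : ℂ) •
      ∑ a, UniversalEnvelopingAlgebra.ι ℂ (Hh X n a) ^ 2 +
    ∑ a, (Bcoef X n a : ℂ) • UniversalEnvelopingAlgebra.ι ℂ (Hh X n a) +
    ∑ p : PosPair X n, (2 : ℂ) • (UniversalEnvelopingAlgebra.ι ℂ (XX X n p.1.2 p.1.1) *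
      UniversalEnvelopingAlgebra.ι ℂ (XX X n p.1.1 p.1.2)) := by
  set j := UniversalEnvelopingAlgebra.ι ℂ (L := g0 X n) with hj
  have h1 : ∀ a b : g0 X n, j a * j b = j b * j a + j ⁅a, b⁆ := by
    intro a b
    rw [LieHom.map_lie, Ring.lie_def]
    abel
  have h2 : casimir X n = ∑ p, j (XX X n p p) ^ 2 + ∑ p, ∑ q, (if p < q then
      (2 : ℂ) • (j (XX X n q p) * j (XX X n p q)) + j ⁅XX X n p q, XX X n q p⁆ else 0) := by
    have e1 : ∀ p q, j (XX X n p q) * j (XX X n q p) =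
        (if p = q then j (XX X n p q) * j (XX X n q p) else 0) +
        ((if p < q then j (XX X n p q) * j (XX X n q p) else 0) +
          if q < p then j (XX X n p q) * j (XX X n q p) else 0) := by
      intro p q
      rcases lt_trichotomy p q with h | h | h
      · rw [if_pos h, if_neg h.ne, if_neg (not_lt.2 h.le)]; simp
      · rw [if_pos h, if_neg (by simp [h]), if_neg (by simp [h])]; simp
      · rw [if_pos h, if_neg h.ne', if_neg (not_lt.2 h.le)]; simp
    have e2 : ∑ p, ∑ q, (if q < p then j (XX X n p q) * j (XX X n q p) else 0) =
        ∑ p, ∑ q, (if p < q then j (XX X n q p) * j (XX X n p q) else 0) := Finset.sum_comm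
    unfold casimir
    rw [← hj]
    conv_lhs => enter [2, p, 2, q]; rw [e1]
    simp only [Finset.sum_add_distrib]
    rw [e2]
    congr 1
    · simp [pow_two]
    · simp only [← Finset.sum_add_distrib]
      refine Finset.sum_congr rfl fun p _ => Finset.sum_congr rfl fun q _ => ?_
      split_ifs
      · rw [h1 (XX X n p q), two_smul]; abel
      · simp
  have h3 : ∑ p, j (XX X n p p) ^ 2 = ((2 * cc X ^ 2 : ℝ) : ℂ) • ∑ a, j (Hh X n a) ^ 2 := by
    have e1 : ∀ p, j (XX X n p p) ^ 2 = (cc X ^ 2 : ℂ) • ∑ a, ∑ b,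
        ((kap _ n p a * kap _ n p b : ℤ) : ℂ) • (j (Hh X n a) * j (Hh X n b)) := by
      intro p
      rw [XX_self, map_smul, smul_pow, map_sum, pow_two (∑ a, _), Finset.sum_mul_sum]
      congr 1
      refine Finset.sum_congr rfl fun a _ => Finset.sum_congr rfl fun b _ => ?_
      rw [map_smul, map_smul, smul_mul_smul_comm]
      push_cast
      rfl
    simp only [e1]
    rw [← Finset.smul_sum]
    have e2 : ∑ p, ∑ a, ∑ b, ((kap (size X n) n p a * kap (size X n) n p b : ℤ) : ℂ) •
        (j (Hh X n a) * j (Hh X n b)) = ∑ a, ∑ b,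
          ((∑ p, kap (size X n) n p a * kap _ n p b : ℤ) : ℂ) • (j (Hh X n a) * j (Hh X n b)) := by
      rw [Finset.sum_comm]
      refine Finset.sum_congr rfl fun a _ => ?_
      rw [Finset.sum_comm]
      refine Finset.sum_congr rfl fun b _ => ?_
      rw [← Finset.sum_smul]
      push_cast
      rfl
    rw [e2]
    have e3 : ∀ a b, ((∑ p, kap (size X n) n p a * kap _ n p b : ℤ) : ℂ) •
        (j (Hh X n a) * j (Hh X n b)) =
        if a = b then (2 : ℂ) • (j (Hh X n a) * j (Hh X n b)) else 0 := by
      intro a b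
      rw [sum_kap_mul_kap]
      split_ifs <;> simp
    simp only [e3, Finset.sum_ite_eq, Finset.mem_univ, if_true]
    rw [← Finset.smul_sum, smul_smul]
    simp only [pow_two]
    congr 1
    push_cast
    ring
  have h4 : ∑ p, ∑ q, (if p < q then j ⁅XX X n p q, XX X n q p⁆ else 0) =
      ∑ a, (Bcoef X n a : ℂ) • j (Hh X n a) := by
    have e1 : ∀ p q, (if p < q then j ⁅XX X n p q, XX X n q p⁆ else 0) = ∑ a,
        ((cc X * if p < q then mm X n p q * (kap _ n p a - kap _ n q a : ℤ) else 0 : ℝ) : ℂ) •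
          j (Hh X n a) := by
      intro p q
      split_ifs
      · rw [lie_XX, map_smul, map_sum, Finset.smul_sum]
        refine Finset.sum_congr rfl fun a _ => ?_
        rw [map_smul, smul_smul]
        congr 1
        push_cast
        ring
      · simp
    simp only [e1]
    have e2 : ∀ p : Fin (size X n), ∑ q, ∑ a,
        ((cc X * if p < q then mm X n p q * (kap _ n p a - kap _ n q a : ℤ) else 0 : ℝ) : ℂ) •
          j (Hh X n a) = ∑ a, (∑ q, ((cc X * if p < q then
            mm X n p q * (kap _ n p a - kap _ n q a : ℤ) else 0 : ℝ) : ℂ)) • j (Hh X n a) := by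
      intro p
      rw [Finset.sum_comm]
      refine Finset.sum_congr rfl fun a _ => ?_
      rw [Finset.sum_smul]
    simp only [e2]
    rw [Finset.sum_comm]
    refine Finset.sum_congr rfl fun a _ => ?_
    rw [← Finset.sum_smul, Bcoef]
    congr 1
    push_cast
    simp only [Finset.mul_sum]
  have h5 : ∑ p, ∑ q, (if p < q then (2 : ℂ) • (j (XX X n q p) * j (XX X n p q)) else 0) =
      ∑ p : PosPair X n, (2 : ℂ) • (j (XX X n p.1.2 p.1.1) * j (XX X n p.1.1 p.1.2)) := by
    rw [← Finset.sum_product', Finset.univ_product_univ]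
    rw [← Finset.sum_filter]
    have : ∀ F : Fin (size X n) × Fin (size X n) → UniversalEnvelopingAlgebra ℂ (g0 X n),
        ∑ p : PosPair X n, F p.1 =
          ∑ x ∈ Finset.univ.filter (fun x : Fin (size X n) × Fin (size X n) =>
            x.1 < x.2 ∧ kap _ n x.1 ≠ kap _ n x.2), F x := by
      intro F
      rw [Finset.sum_subtype (p := fun x : Fin (size X n) × Fin (size X n) =>
        x.1 < x.2 ∧ kap _ n x.1 ≠ kap _ n x.2)]
      intro x
      simp
    rw [this fun x => (2 : ℂ) • (j (XX X n x.2 x.1) * j (XX X n x.1 x.2))]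
    symm
    refine Finset.sum_subset ?_ ?_
    · intro x hx
      simp only [Finset.mem_filter, Finset.mem_univ, true_and] at hx ⊢
      exact hx.1
    · intro x hx hx'
      simp only [Finset.mem_filter, Finset.mem_univ, true_and, not_and, not_not] at hx hx'
      rw [XX_eq_zero (hx' hx) hx.ne]
      simp
  rw [h2, h3, ← h4, ← h5, add_assoc, ← Finset.sum_add_distrib]
  congr 1
  refine Finset.sum_congr rfl fun p _ => ?_
  rw [← Finset.sum_add_distrib]
  refine Finset.sum_congr rfl fun q _ => ?_
  split_ifs
  · exact add_comm _ _
  · simp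

end Triangular

section TriangularData

variable {X : TwistedType} {n : ℕ}

/-! ### The triangular decomposition of the fixed point algebra -/

/-- The last simple coroot of `𝔤₀` is `clX` times the last coordinate. -/
def clX : TwistedType → ℕ
  | .AOdd => 1
  | .AEven => 2
  | .D => 2

/-- The last simple root of `𝔤₀` is `slX` times the last coordinate. -/
def slX : TwistedType → ℕ
  | .AOdd => 2
  | .AEven => 1
  | .D => 1

theorem succ_lt_size (j : Fin n) : (j : ℕ) + 1 < size X n := by
  have := j.2
  have := two_mul_le_size (X := X) (n := n)
  by_cases h : n = 1
  · subst h
    cases X <;> simp only [size] <;> omega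
  · omega

/-- The coordinate after the `j`-th one. -/
abbrev nxt (X : TwistedType) (n : ℕ) (j : Fin n) : Fin (size X n) := ⟨j + 1, succ_lt_size j⟩

theorem kap_idx_sub_nxt (j : Fin n) : kap (size X n) n (idx X n j) - kap _ n (nxt X n j) =
    sr (slX X) j := by
  ext a
  have := j.2
  have := a.2
  rw [Pi.sub_apply, kap_idx]
  cases X <;> simp only [kap, sr, size, slX, Fin.ext_iff] <;> split_ifs <;> omega

theorem idx_lt_nxt (j : Fin n) : idx X n j < nxt X n j := by
  rw [Fin.lt_def]
  simp

theorem slX_pos : 0 < slX X := by cases X <;> simp [slX]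

theorem sr_ne_zero (j : Fin n) : sr (slX X) j ≠ 0 := by
  intro h
  have h1 := congrFun h j
  have h2 := slX_pos (X := X)
  simp only [sr, Pi.zero_apply] at h1
  split_ifs at h1 <;> omega

theorem kap_idx_ne_nxt (j : Fin n) : kap (size X n) n (idx X n j) ≠ kap _ n (nxt X n j) := fun h =>
  sr_ne_zero (X := X) j (by rw [← kap_idx_sub_nxt, sub_eq_zero.2 h])

theorem mm_ne_zero (j : Fin n) : mm X n (idx X n j) (nxt X n j) ≠ 0 := by
  have hj := j.2
  have h1 : nxt X n j = (idx X n j).rev ↔ (j : ℕ) + 1 = size X n - ((j : ℕ) + 1) := by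
    rw [Fin.ext_iff, Fin.val_rev]
    exact Iff.rfl
  cases X
  · simp only [mm]
    split_ifs <;> norm_num
  · simp only [mm, h1, size]
    rw [if_neg (by omega)]
    norm_num
  · simp only [mm, h1, size, Fin.val_castLE]
    rw [if_neg (by omega), if_neg (by omega)]
    split_ifs <;> norm_num

theorem sum_sr_smul {V : Type} [AddCommGroup V] [Module ℂ V] (c : ℤ) (j : Fin n) (H : Fin n → V) :
    ∑ a, (sr c j a : ℂ) • H a =
      if h : (j : ℕ) + 1 < n then H j - H ⟨j + 1, h⟩ else (c : ℂ) • H j := by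
  have h1 : ∀ a, (sr c j a : ℂ) • H a =
      (if a = j then (if (j : ℕ) + 1 < n then (1 : ℂ) else c) • H a else 0) -
        (if (a : ℕ) = j + 1 then H a else 0) := by
    intro a
    simp only [sr, ← Fin.ext_iff]
    push_cast
    rw [sub_smul]
    split_ifs <;> simp
  simp only [h1, Finset.sum_sub_distrib, Finset.sum_ite_eq', Finset.mem_univ, if_true]
  split_ifs with h
  · rw [one_smul]
    congr 1
    rw [Finset.sum_eq_single (⟨j + 1, h⟩ : Fin n)]
    · simp
    · intro b _ hb
      rw [if_neg fun h' => hb (Fin.ext h')]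
    · simp
  · rw [Finset.sum_eq_zero, sub_zero]
    intro b _
    have := b.2
    rw [if_neg (by omega)]

/-- The scalar that normalizes the negative simple root vectors. -/
def nu (X : TwistedType) (n : ℕ) (j : Fin n) : ℂ :=
  (if (j : ℕ) + 1 < n then 1 else (clX X : ℂ) / slX X) / (mm X n (idx X n j) (nxt X n j) * cc X)

theorem nu_ne_zero (j : Fin n) : nu X n j ≠ 0 := by
  have h1 : (mm X n (idx X n j) (nxt X n j) : ℂ) ≠ 0 := by exact_mod_cast mm_ne_zero j
  refine div_ne_zero ?_ (mul_ne_zero h1 cc_ne_zero)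
  cases X <;> simp only [clX, slX] <;> split_ifs <;> norm_num

theorem clX_mul_slX : clX X * slX X = 2 := by cases X <;> rfl

/-- The simple coroots. -/
def corootX (X : TwistedType) (n : ℕ) (j : Fin n) : g0 X n :=
  if h : (j : ℕ) + 1 < n then Hh X n j - Hh X n ⟨j + 1, h⟩ else (clX X : ℂ) • Hh X n j

theorem corootX_lie {M : Type} [AddCommGroup M] [Module ℂ M] [LieRingModule (g0 X n) M]
    [LieModule ℂ (g0 X n) M] {l : Fin n → ℂ} {u : M} (hu : ∀ a, ⁅Hh X n a, u⁆ = l a • u)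
    (j : Fin n) : ⁅corootX X n j, u⁆ = pr (clX X : ℂ) l j • u := by
  unfold corootX pr
  split_ifs with h
  · rw [sub_lie, hu, hu, sub_smul]
  · rw [smul_lie, hu, smul_smul]

theorem pr_sr (j : Fin n) : pr (clX X : ℂ) (fun a => (sr (slX X) j a : ℂ)) j = 2 := by
  have h := clX_mul_slX (X := X)
  unfold pr
  split_ifs with h1
  · simp [sr, h1]
    norm_num
  · simp [sr, h1]
    exact_mod_cast h

theorem sl2_triple (j : Fin n) : IsSl2Triple (corootX X n j) (XX X n (idx X n j) (nxt X n j))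
    (nu X n j • XX X n (nxt X n j) (idx X n j)) where
  h_ne_zero := by
    intro h
    have h1 : (corootX X n j).1.1 (idx X n j) (idx X n j) = 0 := by rw [h]; rfl
    unfold corootX at h1
    split_ifs at h1 with h2
    · change (Hh X n j).1.1 (idx X n j) (idx X n j) -
        (Hh X n ⟨j + 1, h2⟩).1.1 (idx X n j) (idx X n j) = 0 at h1
      rw [Hh_apply_idx, Hh_apply_idx, if_pos rfl, if_neg (by simp [Fin.ext_iff])] at h1
      norm_num at h1
    · change (clX X : ℂ) * (Hh X n j).1.1 (idx X n j) (idx X n j) = 0 at h1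
      rw [Hh_apply_idx, if_pos rfl] at h1
      cases X <;> simp [clX] at h1
  lie_e_f := by
    have h1 : (mm X n (idx X n j) (nxt X n j) : ℂ) ≠ 0 := by exact_mod_cast mm_ne_zero j
    have h2 := cc_ne_zero (X := X)
    have h3 : (slX X : ℂ) ≠ 0 := Nat.cast_ne_zero.2 slX_pos.ne'
    have h4 : ∀ a, kap (size X n) n (idx X n j) a - kap _ n (nxt X n j) a = sr (slX X) j a :=
      fun a => congrFun (kap_idx_sub_nxt j) a
    rw [lie_smul, lie_XX, smul_smul]
    simp only [h4]
    rw [sum_sr_smul]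
    unfold nu corootX
    split_ifs with h
    · rw [div_mul_cancel₀ _ (mul_ne_zero h1 h2), one_smul]
    · rw [div_mul_cancel₀ _ (mul_ne_zero h1 h2), smul_smul]
      congr 1
      push_cast
      field_simp
  lie_h_e_nsmul := by
    have h1 : ∀ a, ⁅Hh X n a, XX X n (idx X n j) (nxt X n j)⁆ =
        (sr (slX X) j a : ℂ) • XX X n (idx X n j) (nxt X n j) := fun a => by
      rw [Hh_lie_XX]
      congr 2
      exact congrFun (kap_idx_sub_nxt j) a
    rw [corootX_lie h1 j, pr_sr, ← Nat.cast_smul_eq_nsmul ℂ]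
    norm_num
  lie_h_f_nsmul := by
    have h1 : ∀ a, ⁅Hh X n a, nu X n j • XX X n (nxt X n j) (idx X n j)⁆ =
        (-(sr (slX X) j a : ℂ)) • nu X n j • XX X n (nxt X n j) (idx X n j) := fun a => by
      rw [lie_smul, Hh_lie_XX, smul_comm]
      congr 1
      rw [← congrFun (kap_idx_sub_nxt j) a, ← Int.cast_neg]
      congr 2
      simp
    rw [corootX_lie h1 j]
    have h2 : pr (clX X : ℂ) (fun a => -(sr (slX X) j a : ℂ)) j = -2 := by
      rw [← pr_sr (X := X) j]
      unfold pr
      split_ifs <;> ring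
    rw [h2, ← Nat.cast_smul_eq_nsmul ℂ, neg_smul]
    norm_num

theorem Q0_E (p q : Fin (size X n)) : Q0 X n (E p q) = XX X n p q := rfl

theorem Q0_mem_span (x : Mat X n) : Q0 X n x ∈
    Submodule.span ℂ (Set.range fun p : PosPair X n => XX X n p.1.2 p.1.1) ⊔
      (Submodule.span ℂ (Set.range fun p : PosPair X n => XX X n p.1.1 p.1.2) ⊔
        Submodule.span ℂ (Set.range (Hh X n))) := by
  have h := mem_of_E_mem (x := x) (Submodule.comap (Q0 X n) (Submodule.span ℂ (Set.range fun p : PosPair X n => XX X n p.1.2 p.1.1) ⊔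
      (Submodule.span ℂ (Set.range fun p : PosPair X n => XX X n p.1.1 p.1.2) ⊔
        Submodule.span ℂ (Set.range (Hh X n))))) (fun p q _ => ?_)
  · exact h
  · rw [Submodule.mem_comap, Q0_E]
    by_cases hk : kap _ n p = kap _ n q
    · by_cases hpq : p = q
      · subst hpq
        rw [XX_self]
        refine Submodule.mem_sup_right (Submodule.mem_sup_right (Submodule.smul_mem _ _
          (sum_mem fun a _ => Submodule.smul_mem _ _ (Submodule.subset_span ⟨a, rfl⟩))))
      · rw [XX_eq_zero hk hpq]
        exact zero_mem _
    · rcases lt_trichotomy p q with h | h | h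
      · exact Submodule.mem_sup_right (Submodule.mem_sup_left
          (Submodule.subset_span ⟨⟨(p, q), h, hk⟩, rfl⟩))
      · exact absurd (by rw [h]) hk
      · exact Submodule.mem_sup_left (Submodule.subset_span ⟨⟨(q, p), h, Ne.symm hk⟩, rfl⟩)

/-- The triangular decomposition of the fixed point algebra. -/
def tri (X : TwistedType) (n : ℕ) : TriData (g0 X n) n where
  P := PosPair X n
  finP := inferInstance
  e p := XX X n p.1.1 p.1.2
  f p := XX X n p.1.2 p.1.1
  H := Hh X n
  rt p := kap _ n p.1.1 - kap _ n p.1.2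
  cl := clX X
  sl := slX X
  es j := XX X n (idx X n j) (nxt X n j)
  fs j := nu X n j • XX X n (nxt X n j) (idx X n j)
  k _ := 2
  A := 2 * cc X ^ 2
  Bc := Bcoef X n
  cas := casimir X n
  lie_H_H := Hh_lie_Hh
  lie_H_e a p := Hh_lie_XX a _ _
  lie_H_f a p := by
    rw [Hh_lie_XX, ← Int.cast_neg]
    congr 2
    simp
  span_top := by
    rw [eq_top_iff]
    rintro w -
    rw [eq_Q0 w]
    exact Q0_mem_span _
  rt_nonneg p := Qpos_kap p.2.1.le
  rt_ne p h := p.2.2 (sub_eq_zero.1 h)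
  cl_mul_sl := clX_mul_slX
  triple := sl2_triple
  lie_H_es a j := by
    rw [Hh_lie_XX]
    congr 2
    exact congrFun (kap_idx_sub_nxt j) a
  lie_H_fs a j := by
    rw [lie_smul, Hh_lie_XX, smul_comm]
    congr 1
    rw [← congrFun (kap_idx_sub_nxt j) a, ← Int.cast_neg]
    congr 2
    simp
  es_mem j := Submodule.subset_span ⟨⟨(idx X n j, nxt X n j), idx_lt_nxt j, kap_idx_ne_nxt j⟩, rfl⟩
  cas_comm := casimir_comm
  cas_eq := casimir_eq
  A_pos := mul_pos two_pos (pow_pos cc_pos 2)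
  Bc_pos := Bcoef_pos
  Bc_anti _ _ := Bcoef_anti

/-! ### Weights, positive elements and negative simple root vectors -/

theorem eval_eq {h : ambient X n} (j : Fin n) : fundWeight X n j h =
    (if (j : ℕ) + 1 < n then 1 else 1 / (clX X : ℂ)) * ∑ a ∈ Finset.Iic j, coord X n a h := by
  have := j.2
  cases X
  · simp only [fundWeight, clX]
    split_ifs <;> simp
  · simp only [fundWeight, clX]
    split_ifs <;> first | omega | norm_num
  · simp only [fundWeight, clX]
    split_ifs <;> first | omega | norm_num

/-- The coordinates of a dominant weight. -/
def ev (X : TwistedType) {n : ℕ} (μ : Weight n) (a : Fin n) : ℂ := μ.eval X (Hh X n a).1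

theorem ev_eq (μ : Weight n) (a : Fin n) : ev X μ a =
    ∑ j ∈ Finset.Ici a, (μ j : ℂ) * (if (j : ℕ) + 1 < n then 1 else 1 / (clX X : ℂ)) := by
  unfold ev Weight.eval
  have h1 : ∀ j, (μ j : ℂ) * fundWeight X n j (Hh X n a).1 = if a ≤ j then
      (μ j : ℂ) * (if (j : ℕ) + 1 < n then 1 else 1 / (clX X : ℂ)) else 0 := by
    intro j
    rw [eval_eq]
    have h2 : ∑ b ∈ Finset.Iic j, coord X n b (Hh X n a).1 = if a ≤ j then 1 else 0 := by
      have : ∀ b, coord X n b (Hh X n a).1 = if a = b then 1 else 0 := fun b => Hh_apply_idx a b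
      simp only [this, Finset.sum_ite_eq, Finset.mem_Iic]
    rw [h2]
    split_ifs <;> simp
  simp only [h1]
  rw [← Finset.sum_filter]
  refine Finset.sum_congr ?_ fun _ _ => rfl
  ext j
  simp

theorem pr_ev (μ : Weight n) (j : Fin n) : pr (clX X : ℂ) (ev X μ) j = μ j := by
  have hcl : (clX X : ℂ) ≠ 0 := by cases X <;> simp [clX]
  unfold pr
  rw [ev_eq]
  split_ifs with h
  · rw [ev_eq]
    have h1 : Finset.Ici j = insert j (Finset.Ici (⟨j + 1, h⟩ : Fin n)) := by
      ext b
      simp only [Finset.mem_Ici, Finset.mem_insert, Fin.le_def, Fin.ext_iff]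
      omega
    rw [h1, Finset.sum_insert (by simp [Fin.le_def]), if_pos h]
    ring
  · have h1 : Finset.Ici j = {j} := by
      ext b
      have := b.2
      simp only [Finset.mem_Ici, Finset.mem_singleton, Fin.le_def, Fin.ext_iff]
      omega
    rw [h1, Finset.sum_singleton, if_neg h]
    field_simp

theorem pr_injective {c : ℂ} (hc : c ≠ 0) {l l' : Fin n → ℂ} (h : ∀ j, pr c l j = pr c l' j) :
    l = l' := by
  have key : ∀ k, ∀ a : Fin n, (a : ℕ) + 1 + k = n → l a = l' a := by
    intro k
    induction k with
    | zero =>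
      intro a ha
      have := h a
      unfold pr at this
      rw [dif_neg (by omega), dif_neg (by omega)] at this
      exact mul_left_cancel₀ hc this
    | succ k ih =>
      intro a ha
      have := h a
      unfold pr at this
      have h1 : (a : ℕ) + 1 < n := by omega
      rw [dif_pos h1, dif_pos h1, ih ⟨a + 1, h1⟩ (by simp; omega)] at this
      exact sub_left_inj.1 this
  ext a
  exact key (n - 1 - a) a (by have := a.2; omega)

theorem clX_ne_zero : (clX X : ℂ) ≠ 0 := by cases X <;> simp [clX]

theorem ev_injective : Function.Injective (ev X : Weight n → Fin n → ℂ) := by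
  intro μ μ' h
  ext j
  have h1 := pr_ev (X := X) μ j
  rw [h, pr_ev] at h1
  exact_mod_cast h1.symm

theorem exists_weight_of_dom {l : Fin n → ℂ} (h : (tri X n).Dom l) : ∃ μ : Weight n, l = ev X μ := by
  choose μ hμ using h
  exact ⟨μ, pr_injective clX_ne_zero fun j => by rw [pr_ev]; exact hμ j⟩

theorem eval_g0 (μ : Weight n) (h : g0 X n) :
    μ.eval X h.1 = ∑ a, h.1.1 (idx X n a) (idx X n a) * ev X μ a := by
  have h1 : ∀ a, coord X n a h.1 = h.1.1 (idx X n a) (idx X n a) := fun a => rfl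
  unfold Weight.eval
  simp only [eval_eq, ev_eq, h1, Finset.mul_sum]
  rw [Finset.sum_comm' (t' := Finset.univ) (s' := fun a => Finset.Ici a) (by simp)]
  refine Finset.sum_congr rfl fun a _ => Finset.sum_congr rfl fun j _ => ?_
  ring

/-- Positive elements are combinations of the positive root vectors. -/
theorem mem_span_of_nPos (x : g0 X n) (hx : x.1 ∈ nPos X n) :
    x ∈ Submodule.span ℂ (Set.range (tri X n).e) := by
  rw [eq_Q0 x, map_smul]
  refine Submodule.smul_mem _ _ ?_
  refine mem_of_E_mem (Submodule.comap (Q0 X n) (Submodule.span ℂ (Set.range (tri X n).e)))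
    fun p q h => ?_
  have hpq : p < q := by
    by_contra hc
    exact h (hx p q (not_lt.1 hc))
  rw [Submodule.mem_comap, Q0_E]
  by_cases hk : kap _ n p = kap _ n q
  · rw [XX_eq_zero hk hpq.ne]
    exact zero_mem _
  · exact Submodule.subset_span ⟨⟨(p, q), hpq, hk⟩, rfl⟩

theorem simpleRoot_eq (j : Fin n) (h : ambient X n) :
    simpleRoot X n j h = ∑ a, (sr (slX X) j a : ℂ) * coord X n a h := by
  have h1 := sum_sr_smul (slX X) j fun a => coord X n a h
  simp only [smul_eq_mul] at h1
  rw [h1]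
  unfold simpleRoot
  split_ifs
  · rfl
  · cases X <;> simp [slX]

theorem E_mem_wtMat_of {N : ℕ} {b : Fin n → ℤ} {p q : Fin N} (h : kap N n p - kap N n q = b) :
    E p q ∈ wtMat N n b := h ▸ E_mem_wtMat p q

/-- The elements of weight `-α_j`, in terms of matrices. -/
theorem mem_negRoot {j : Fin n} {x : ambient X n} :
    x ∈ negRoot X n j ↔ x.1 ∈ wtMat (size X n) n (-sr (slX X) j) := by
  constructor
  · intro hx p q hpq
    have hkey : ∀ a, (kap _ n p a - kap _ n q a : ℂ) = -(sr (slX X) j a : ℂ) := by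
      intro a
      have h1 := hx (Hh X n a).1 (Hh_mem_cartan a) (Hh X n a).2
      have h2 := congrFun (congrFun (congrArg Subtype.val h1) p) q
      change ⁅(Hh X n a).1.1, x.1⁆ p q = -simpleRoot X n j (Hh X n a).1 * x.1 p q at h2
      rw [diag_lie_apply (Hh_mem_cartan a), Hh_apply_self, Hh_apply_self, simpleRoot_eq] at h2
      have h3 := mul_right_cancel₀ hpq h2
      rw [h3]
      have : ∀ b, coord X n b (Hh X n a).1 = if a = b then 1 else 0 := fun b => Hh_apply_idx a b
      simp [this]
    ext a
    have := hkey a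
    exact_mod_cast this
  · intro hx h hh hs
    refine Subtype.ext ?_
    change ⁅h.1, x.1⁆ = -simpleRoot X n j h • x.1
    ext p q
    rw [diag_lie_apply hh, Matrix.smul_apply, smul_eq_mul]
    by_cases h0 : x.1 p q = 0
    · rw [h0]; ring
    · have h1 := hx p q h0
      have hs' : matAut X n h.1 = h.1 := congrArg Subtype.val hs
      rw [diag_eq_sum h.2 hs' p, diag_eq_sum h.2 hs' q, ← Finset.sum_sub_distrib, simpleRoot_eq,
        ← Finset.sum_neg_distrib]
      congr 1
      refine Finset.sum_congr rfl fun a _ => ?_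
      have h2 : (kap _ n p a : ℂ) - kap _ n q a = -(sr (slX X) j a : ℂ) := by
        exact_mod_cast congrFun h1 a
      change _ = -((sr (slX X) j a : ℂ) * h.1 (idx X n a) (idx X n a))
      linear_combination h.1 (idx X n a) (idx X n a) * h2

end TriangularData

/-! ### The twisted current algebra -/

section CurrentAlgebra

variable {X : TwistedType} {n : ℕ}

/-- The element `x ⊗ t ^ r` of the twisted current algebra, where `x` is the projection of a
matrix. -/
def Tt (X : TwistedType) (n r : ℕ) : Mat X n →ₗ[ℂ] gt X n where
  toFun x := tpow (sigma X n) r ⟨Qm X n r x, Qm_mem r x⟩ (Subtype.ext (matAut_Qm r x))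
  map_add' x y := Subtype.ext (by
    change (Polynomial.X ^ r : ℂ[X]) ⊗ₜ[ℂ] _ = (Polynomial.X ^ r : ℂ[X]) ⊗ₜ[ℂ] _ +
      (Polynomial.X ^ r : ℂ[X]) ⊗ₜ[ℂ] _
    rw [← TensorProduct.tmul_add]
    congr 1
    exact Subtype.ext (map_add _ x y))
  map_smul' c x := Subtype.ext (by
    change (Polynomial.X ^ r : ℂ[X]) ⊗ₜ[ℂ] _ = c • ((Polynomial.X ^ r : ℂ[X]) ⊗ₜ[ℂ] _)
    rw [← TensorProduct.tmul_smul]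
    congr 1
    exact Subtype.ext (map_smul _ c x))

theorem Tt_lie (r s : ℕ) (x y : Mat X n) :
    ⁅Tt X n r x, Tt X n s y⁆ = Tt X n (r + s) ⁅x, Qm X n s y⁆ := by
  refine Subtype.ext ?_
  change ⁅(Polynomial.X ^ r : ℂ[X]) ⊗ₜ[ℂ] (⟨Qm X n r x, Qm_mem r x⟩ : ambient X n),
    (Polynomial.X ^ s : ℂ[X]) ⊗ₜ[ℂ] (⟨Qm X n s y, Qm_mem s y⟩ : ambient X n)⁆ =
      (Polynomial.X ^ (r + s) : ℂ[X]) ⊗ₜ[ℂ] (⟨_, Qm_mem (r + s) ⁅x, Qm X n s y⁆⟩ : ambient X n)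
  rw [LieAlgebra.ExtendScalars.bracket_tmul, ← pow_add]
  congr 1
  exact Subtype.ext (lie_Qm r s x (Qm_mem s y) (matAut_Qm s y))

theorem Tt_lie' (r s : ℕ) (x y : Mat X n) :
    ⁅Tt X n r x, Tt X n s y⁆ = Tt X n (r + s) ⁅Qm X n r x, y⁆ := by
  rw [← lie_skew, Tt_lie, ← map_neg, lie_skew, add_comm]

theorem Tt_Qm (r : ℕ) (x : Mat X n) : Tt X n r (Qm X n r x) = (2 * cc X : ℂ) • Tt X n r x := by
  rw [← map_smul]
  refine Subtype.ext ?_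
  change (Polynomial.X ^ r : ℂ[X]) ⊗ₜ[ℂ] (⟨_, Qm_mem r (Qm X n r x)⟩ : ambient X n) =
    (Polynomial.X ^ r : ℂ[X]) ⊗ₜ[ℂ] (⟨_, Qm_mem r ((2 * cc X : ℂ) • x)⟩ : ambient X n)
  congr 1
  refine Subtype.ext ?_
  change Qm X n r (Qm X n r x) = Qm X n r _
  rw [Qm_Qm, map_smul]

theorem Tt_eq_zero {r : ℕ} {x : Mat X n} (h : Qm X n r x = 0) : Tt X n r x = 0 := by
  have := Tt_Qm r x
  rw [h, map_zero, eq_comm, smul_eq_zero] at this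
  exact this.resolve_left two_cc_ne_zero

theorem Tt_zero (x : Mat X n) : Tt X n 0 x = constHom (sigma X n) (Q0 X n x) :=
  rfl

/-- The twisted current algebra is spanned by the elements `x ⊗ t ^ r`. -/
theorem span_Tt : Submodule.span ℂ {z | ∃ r x, Tt X n r x = z} = ⊤ := by
  rw [eq_top_iff]
  rintro ⟨z, hz⟩ -
  -- Averaging over the twist maps `t ^ r ⊗ x` to a multiple of `Tt r x`.
  let ψ : (ℂ[X] ⊗[ℂ] ambient X n) →ₗ[ℂ] (ℂ[X] ⊗[ℂ] ambient X n) :=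
    LinearMap.id + (twist (sigma X n) : _ →ₗ[ℂ] _)
  have h1 : ∀ z : ℂ[X] ⊗[ℂ] ambient X n, ψ z ∈ (Submodule.span ℂ {z | ∃ r x, Tt X n r x = z}).map
      (gt X n).toSubmodule.subtype := by
    intro z
    induction z using TensorProduct.induction_on with
    | zero => rw [map_zero]; exact zero_mem _
    | add a b ha hb => rw [map_add]; exact add_mem ha hb
    | tmul p x =>
      induction p using Polynomial.induction_on' with
      | add p q hp hq => rw [TensorProduct.add_tmul, map_add]; exact add_mem hp hq
      | monomial r c =>
        refine ⟨c • (cc X : ℂ)⁻¹ • Tt X n r x.1, Submodule.smul_mem _ _ (Submodule.smul_mem _ _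
          (Submodule.subset_span ⟨r, x.1, rfl⟩)), ?_⟩
        have e1 : (twist (sigma X n)) ((Polynomial.monomial r c) ⊗ₜ[ℂ] x) =
            c • ((Polynomial.X ^ r : ℂ[X]) ⊗ₜ[ℂ] ((-1 : ℂ) ^ r • sigma X n x)) := by
          change TensorProduct.map _ _ _ = _
          rw [TensorProduct.map_tmul]
          simp only [AlgHom.toLinearMap_apply, Polynomial.aeval_monomial]
          change (_ : ℂ[X]) ⊗ₜ[ℂ] (sigma X n x) = _
          rw [TensorProduct.tmul_smul, ← neg_one_smul ℂ (Polynomial.X : ℂ[X]), smul_pow,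
            ← Algebra.smul_def, TensorProduct.smul_tmul', TensorProduct.smul_tmul']
        have e2 : (⟨Qm X n r x.1, Qm_mem r x.1⟩ : ambient X n) =
            (cc X : ℂ) • (x + (-1 : ℂ) ^ r • sigma X n x) := Subtype.ext (Qm_of_mem r x.2)
        change c • (cc X : ℂ)⁻¹ • ((Polynomial.X ^ r : ℂ[X]) ⊗ₜ[ℂ]
          (⟨Qm X n r x.1, Qm_mem r x.1⟩ : ambient X n)) = _ + twist (sigma X n) _
        rw [e1, e2, TensorProduct.tmul_smul, smul_smul (cc X : ℂ)⁻¹, inv_mul_cancel₀ cc_ne_zero,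
          one_smul, TensorProduct.tmul_add, smul_add]
        congr 1
        rw [TensorProduct.smul_tmul', ← Polynomial.C_mul_X_pow_eq_monomial, Polynomial.smul_eq_C_mul]
        rfl
  obtain ⟨y, hy, hyz⟩ := h1 z
  have h2 : (⟨z, hz⟩ : gt X n) = (2 : ℂ)⁻¹ • y := by
    refine Subtype.ext ?_
    change z = (2 : ℂ)⁻¹ • ((gt X n).toSubmodule.subtype y)
    rw [hyz]
    have h3 : twist (sigma X n) z = z := hz
    change z = (2 : ℂ)⁻¹ • (z + twist (sigma X n) z)
    rw [h3, ← two_smul ℂ z, smul_smul]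
    norm_num
  rw [h2]
  exact Submodule.smul_mem _ _ hy

end CurrentAlgebra

/-! ### Local nilpotence -/

section Nilpotence

theorem locally_nilpotent {L M : Type} [LieRing L] [LieAlgebra ℂ L] [AddCommGroup M] [Module ℂ M]
    [LieRingModule L M] [LieModule ℂ L M] (y : L)
    (hy : ∀ z : L, ∃ k, (LieModule.toEnd ℂ L L y ^ k) z = 0) (v : M)
    (hv : ∃ k, (LieModule.toEnd ℂ L M y ^ k) v = 0) (hgen : LieSubmodule.lieSpan ℂ L {v} = ⊤)
    (x : M) : ∃ k, (LieModule.toEnd ℂ L M y ^ k) x = 0 := by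
  have hm : ∀ {M' : Type} [AddCommGroup M'] [Module ℂ M'] (f : Module.End ℂ M') (x : M'),
      x ∈ f.maxGenEigenspace 0 ↔ ∃ k, (f ^ k) x = 0 := by
    intro M' _ _ f x
    rw [Module.End.mem_maxGenEigenspace]
    simp
  let N : LieSubmodule ℂ L M :=
    { (LieModule.toEnd ℂ L M y).maxGenEigenspace 0 with
      lie_mem := by
        intro z m hm'
        have := LieModule.lie_mem_maxGenEigenspace_toEnd (χ₁ := 0) (χ₂ := 0) (x := y) (y := z)
          (m := m) ((hm _ _).2 (hy z)) hm'
        rwa [add_zero] at this }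
  have h1 : LieSubmodule.lieSpan ℂ L {v} ≤ N := by
    rw [LieSubmodule.lieSpan_le, Set.singleton_subset_iff]
    exact (hm _ _).2 hv
  rw [hgen] at h1
  exact (hm _ _).1 (h1 (LieSubmodule.mem_top x))

variable {X : TwistedType} {n : ℕ}

theorem kap_abs {N : ℕ} (p : Fin N) (a : Fin n) : -1 ≤ kap N n p a ∧ kap N n p a ≤ 1 := by
  simp only [kap]
  split_ifs <;> omega

theorem pow_three_eq_zero {j : Fin n} {x : Mat X n} (hx : x ∈ wtMat (size X n) n (-sr (slX X) j)) :
    x ^ 3 = 0 := by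
  have h1 : x ^ 3 ∈ wtMat (size X n) n (-sr (slX X) j + -sr (slX X) j + -sr (slX X) j) := by
    rw [pow_succ, pow_two]
    exact mul_mem_wtMat (mul_mem_wtMat hx hx) hx
  ext p q
  by_contra h
  have h2 := congrFun (h1 p q h) j
  have h3 := kap_abs (n := n) p j
  have h4 := kap_abs (n := n) q j
  have h5 := slX_pos (X := X)
  simp only [Pi.sub_apply, Pi.add_apply, Pi.neg_apply, sr] at h2
  split_ifs at h2 <;> omega

theorem exists_ad_pow_eq_zero {j : Fin n} {x : Mat X n}
    (hx : x ∈ wtMat (size X n) n (-sr (slX X) j)) :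
    ∃ k, ∀ y : Mat X n, (LieAlgebra.ad ℂ (Mat X n) x ^ k) y = 0 := by
  obtain ⟨k, hk⟩ := LieAlgebra.ad_nilpotent_of_nilpotent (R := ℂ) (a := x) ⟨3, pow_three_eq_zero hx⟩
  exact ⟨k, fun y => by rw [hk]; rfl⟩

theorem g0_ad_nilpotent {j : Fin n} {x : Mat X n}
    (hx : x ∈ wtMat (size X n) n (-sr (slX X) j)) (z : g0 X n) :
    ∃ k, (LieModule.toEnd ℂ (g0 X n) (g0 X n) (Q0 X n x) ^ k) z = 0 := by
  obtain ⟨k, hk⟩ := exists_ad_pow_eq_zero (Qm_mem_wtMat 0 hx)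
  refine ⟨k, ?_⟩
  have h1 : ∀ k, ∀ y : Mat X n, (LieModule.toEnd ℂ (g0 X n) (g0 X n) (Q0 X n x) ^ k) (Q0 X n y) =
      Q0 X n ((LieAlgebra.ad ℂ (Mat X n) (Qm X n 0 x) ^ k) y) := by
    intro k
    induction k with
    | zero => intro y; rfl
    | succ k ih =>
      intro y
      rw [pow_succ', pow_succ', Module.End.mul_apply, Module.End.mul_apply, ih,
        LieModule.toEnd_apply_apply, lie_Q0, LieAlgebra.ad_apply, Q0_val]
  rw [eq_Q0 z, h1, hk, map_zero]

theorem gt_ad_nilpotent {j : Fin n} {x : Mat X n}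
    (hx : x ∈ wtMat (size X n) n (-sr (slX X) j)) (z : gt X n) :
    ∃ k, (LieModule.toEnd ℂ (gt X n) (gt X n) (Tt X n 0 x) ^ k) z = 0 := by
  obtain ⟨k, hk⟩ := exists_ad_pow_eq_zero (Qm_mem_wtMat 0 hx)
  refine ⟨k, ?_⟩
  have h1 : ∀ k r, ∀ y : Mat X n, (LieModule.toEnd ℂ (gt X n) (gt X n) (Tt X n 0 x) ^ k) (Tt X n r y) =
      Tt X n r ((LieAlgebra.ad ℂ (Mat X n) (Qm X n 0 x) ^ k) y) := by
    intro k r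
    induction k with
    | zero => intro y; rfl
    | succ k ih =>
      intro y
      rw [pow_succ', pow_succ', Module.End.mul_apply, Module.End.mul_apply, ih,
        LieModule.toEnd_apply_apply, Tt_lie', LieAlgebra.ad_apply, zero_add]
  have hz : z ∈ Submodule.span ℂ {z | ∃ r x, Tt X n r x = z} := by
    rw [span_Tt]; trivial
  induction hz using Submodule.span_induction with
  | mem z hz =>
    obtain ⟨r, y, rfl⟩ := hz
    rw [h1, hk, map_zero]
  | zero => simp
  | add a b _ _ ha hb => rw [map_add, ha, hb, add_zero]
  | smul c a _ ha => rw [map_smul, ha, smul_zero]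

end Nilpotence

/-! ### The modules given by generators and relations -/

section Generators

theorem cyclic_eq_smul {L : Type} [LieRing L] [LieAlgebra ℂ L]
    (rels : Set (UniversalEnvelopingAlgebra ℂ L)) (x : Cyclic L rels) :
    ∃ u : UniversalEnvelopingAlgebra ℂ L, x = u • (Submodule.Quotient.mk 1 : Cyclic L rels) := by
  obtain ⟨u, rfl⟩ := Submodule.Quotient.mk_surjective _ x
  exact ⟨u, by rw [← Submodule.Quotient.mk_smul, smul_eq_mul, mul_one]⟩

theorem cyclic_rel {L : Type} [LieRing L] [LieAlgebra ℂ L]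
    {rels : Set (UniversalEnvelopingAlgebra ℂ L)} {u : UniversalEnvelopingAlgebra ℂ L}
    (hu : u ∈ rels) : u • (Submodule.Quotient.mk 1 : Cyclic L rels) = 0 := by
  rw [← Submodule.Quotient.mk_smul, smul_eq_mul, mul_one, Submodule.Quotient.mk_eq_zero]
  exact Submodule.subset_span hu

variable (X : TwistedType) (n : ℕ)

/-- The generator of `V(μ)`. -/
def vgen (μ : Weight n) : V X n μ := (Submodule.Quotient.mk 1 : Cyclic (g0 X n) {u | VRel X n μ u})

/-- The generator of `KR^σ(m ω_i)`. -/
def kgen (i : Fin n) (m : ℕ) : KR X n i m :=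
  (Submodule.Quotient.mk 1 : Cyclic (gt X n) {u | KRRel X n i m u})

variable {X n}

theorem cyclic_eq_top {L : Type} [LieRing L] [LieAlgebra ℂ L]
    (rels : Set (UniversalEnvelopingAlgebra ℂ L)) (S : Submodule ℂ (Cyclic L rels))
    (h1 : Submodule.Quotient.mk 1 ∈ S)
    (hS : ∀ z : L, ∀ x ∈ S, UniversalEnvelopingAlgebra.ι ℂ z • x ∈ S) : S = ⊤ := by
  rw [eq_top_iff]
  rintro x -
  obtain ⟨u, rfl⟩ := cyclic_eq_smul _ x
  exact smul_mem_of_ι_smul_mem S hS u _ h1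

theorem lieSpan_vgen (μ : Weight n) : LieSubmodule.lieSpan ℂ (g0 X n) {vgen X n μ} = ⊤ := by
  rw [← LieSubmodule.toSubmodule_eq_top]
  let S : Submodule ℂ (V X n μ) := (LieSubmodule.lieSpan ℂ (g0 X n) {vgen X n μ}).toSubmodule
  have h1 : vgen X n μ ∈ S := LieSubmodule.subset_lieSpan (Set.mem_singleton _)
  have h2 : ∀ z : g0 X n, ∀ x ∈ S, ⁅z, x⁆ ∈ S := fun z x hx =>
    (LieSubmodule.lieSpan ℂ (g0 X n) {vgen X n μ}).lie_mem hx
  exact cyclic_eq_top (L := g0 X n) {u | VRel X n μ u} S h1 h2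

theorem lieSpan_kgen (i : Fin n) (m : ℕ) :
    LieSubmodule.lieSpan ℂ (gt X n) {kgen X n i m} = ⊤ := by
  rw [← LieSubmodule.toSubmodule_eq_top]
  let S : Submodule ℂ (KR X n i m) := (LieSubmodule.lieSpan ℂ (gt X n) {kgen X n i m}).toSubmodule
  have h1 : kgen X n i m ∈ S := LieSubmodule.subset_lieSpan (Set.mem_singleton _)
  have h2 : ∀ z : gt X n, ∀ x ∈ S, ⁅z, x⁆ ∈ S := fun z x hx =>
    (LieSubmodule.lieSpan ℂ (gt X n) {kgen X n i m}).lie_mem hx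
  exact cyclic_eq_top (L := gt X n) {u | KRRel X n i m u} S h1 h2

theorem vgen_pos (μ : Weight n) (x : g0 X n) (hx : x.1 ∈ nPos X n) : ⁅x, vgen X n μ⁆ = 0 :=
  cyclic_rel (L := g0 X n) (rels := {u | VRel X n μ u}) (VRel.pos x hx)

theorem vgen_weight (μ : Weight n) (h : g0 X n) (hh : h.1 ∈ cartan X n) :
    ⁅h, vgen X n μ⁆ = μ.eval X h.1 • vgen X n μ := by
  have h1 := cyclic_rel (L := g0 X n) (rels := {u | VRel X n μ u}) (VRel.weight h hh)
  rw [sub_smul, algebraMap_smul, sub_eq_zero] at h1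
  exact h1

theorem toEnd_pow_vgen (μ : Weight n) (x : g0 X n) (k : ℕ) :
    (LieModule.toEnd ℂ (g0 X n) (V X n μ) x ^ k) (vgen X n μ) =
      (UniversalEnvelopingAlgebra.ι ℂ x ^ k •
        (Submodule.Quotient.mk 1 : Cyclic (g0 X n) {u | VRel X n μ u}) : Cyclic _ _) := by
  induction k with
  | zero => rw [pow_zero, pow_zero, one_smul]; rfl
  | succ k ih =>
    rw [pow_succ', pow_succ', Module.End.mul_apply, ih, mul_smul]
    rfl

theorem vgen_neg (μ : Weight n) (i : Fin n) (x : g0 X n) (hx : x.1 ∈ negRoot X n i) :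
    (LieModule.toEnd ℂ (g0 X n) (V X n μ) x ^ (μ i + 1)) (vgen X n μ) = 0 := by
  rw [toEnd_pow_vgen]
  exact cyclic_rel (L := g0 X n) (rels := {u | VRel X n μ u}) (VRel.neg i x hx)

theorem kgen_rel {i : Fin n} {m : ℕ} {z : gt X n}
    (h : KRRel X n i m (UniversalEnvelopingAlgebra.ι ℂ z)) : ⁅z, kgen X n i m⁆ = 0 :=
  cyclic_rel (L := gt X n) (rels := {u | KRRel X n i m u}) h

theorem kgen_weight (i : Fin n) (m : ℕ) (h : ambient X n) (hx : sigma X n h = (-1 : ℂ) ^ 0 • h)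
    (hh : h ∈ cartan X n) : ⁅tpow (sigma X n) 0 h hx, kgen X n i m⁆ =
      ((m : ℂ) * fundWeight X n i h) • kgen X n i m := by
  have h1 := cyclic_rel (L := gt X n) (rels := {u | KRRel X n i m u}) (KRRel.weight h hx hh)
  rw [sub_smul, algebraMap_smul, sub_eq_zero] at h1
  exact h1

theorem kgen_power (i : Fin n) (m : ℕ) (x : ambient X n) (hx : sigma X n x = (-1 : ℂ) ^ 0 • x)
    (hn : x ∈ negRoot X n i) :
    (LieModule.toEnd ℂ (gt X n) (KR X n i m) (tpow (sigma X n) 0 x hx) ^ (m + 1))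
      (kgen X n i m) = 0 := by
  have h1 : ∀ k, (LieModule.toEnd ℂ (gt X n) (KR X n i m) (tpow (sigma X n) 0 x hx) ^ k)
      (kgen X n i m) = (UniversalEnvelopingAlgebra.ι ℂ (tpow (sigma X n) 0 x hx) ^ k •
        (Submodule.Quotient.mk 1 : Cyclic (gt X n) {u | KRRel X n i m u}) : Cyclic _ _) := by
    intro k
    induction k with
    | zero => rw [pow_zero, pow_zero, one_smul]; rfl
    | succ k ih =>
      rw [pow_succ', pow_succ', Module.End.mul_apply, ih, mul_smul]
      rfl
  rw [h1]
  exact cyclic_rel (L := gt X n) (rels := {u | KRRel X n i m u}) (KRRel.power x hx hn)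

end Generators

/-! ### Root spaces are one-dimensional -/

section RootSpaces

variable {X : TwistedType} {n : ℕ}

theorem kap_eq_of_apply {p r : Fin (size X n)} {a : Fin n} (h : kap (size X n) n p a = kap _ n r a)
    (h0 : kap (size X n) n p a ≠ 0) : p = r := by
  have h1 := two_mul_le_size (X := X) (n := n)
  have h2 := a.2
  refine Fin.ext ?_
  simp only [kap] at h h0
  split_ifs at h h0 <;> omega

theorem kap_sub_eq {p q r s : Fin (size X n)} (hpq : kap (size X n) n p ≠ kap _ n q)
    (h : kap (size X n) n p - kap _ n q = kap _ n r - kap _ n s) :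
    (kap (size X n) n p = kap _ n r ∧ kap (size X n) n q = kap _ n s) ∨
      (kap (size X n) n p = kap _ n s.rev ∧ kap (size X n) n q = kap _ n r.rev) := by
  by_cases h1 : kap (size X n) n p = kap _ n r
  · rw [h1] at h
    exact Or.inl ⟨h1, sub_right_injective h⟩
  by_cases h2 : kap (size X n) n p = kap _ n s.rev
  · refine Or.inr ⟨h2, ?_⟩
    rw [h2, kap_rev, sub_eq_sub_iff_add_eq_add, neg_add_cancel] at h
    rw [kap_rev, eq_neg_iff_add_eq_zero, add_comm, ← h]
  exfalso
  have hc : ∀ a, kap (size X n) n p a - kap _ n q a = kap _ n r a - kap _ n s a := fun a =>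
    congrFun h a
  by_cases h0 : kap (size X n) n p = 0
  · -- A signed unit vector is not the sum of two signed unit vectors.
    have hs : kap (size X n) n s ≠ 0 := by
      intro hs
      exact h2 (by rw [kap_rev, hs, h0, neg_zero])
    obtain ⟨a, ha⟩ := Function.ne_iff.1 hs
    have e := hc a
    rw [h0] at e
    simp only [Pi.zero_apply, zero_sub] at e ha
    have b1 := kap_abs (n := n) q a
    have b2 := kap_abs (n := n) r a
    have b3 := kap_abs (n := n) s a
    by_cases c1 : kap (size X n) n s a = kap _ n r a
    · have := kap_eq_of_apply c1 ha
      subst this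
      rw [sub_self, h0, zero_sub, neg_eq_zero] at h
      exact hpq (by rw [h0, h])
    · have c2 : kap (size X n) n s a = kap _ n q a := by omega
      have := kap_eq_of_apply c2 ha
      subst this
      rw [h0, zero_sub, eq_sub_iff_add_eq, neg_add_cancel] at h
      exact h1 (by rw [h0, h])
  · obtain ⟨a, ha⟩ := Function.ne_iff.1 h0
    have e := hc a
    have b0 := kap_abs (n := n) p a
    have b1 := kap_abs (n := n) q a
    have b2 := kap_abs (n := n) r a
    have b3 := kap_abs (n := n) s a
    have e1 : kap (size X n) n p a ≠ kap _ n q a := fun e => hpq (by rw [kap_eq_of_apply e ha])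
    have e2 : kap (size X n) n p a ≠ kap _ n r a := fun e => h1 (by rw [kap_eq_of_apply e ha])
    have e3 : kap (size X n) n p a ≠ kap _ n s.rev a := fun e => h2 (by rw [kap_eq_of_apply e ha])
    rw [kap_rev] at e3
    simp only [Pi.neg_apply, Pi.zero_apply] at e3 ha
    omega

theorem Qm_E_rev (ε : ℕ) (p q : Fin (size X n)) :
    ∃ c : ℂ, Qm X n ε (E p q) = c • Qm X n ε (E q.rev p.rev) := by
  have key : ∀ (N : ℕ) (p q : Fin N), ∃ c : ℂ, projA N ε (E p q) = c • projA N ε (E q.rev p.rev) := by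
    intro N p q
    refine ⟨-((-1) ^ ε * (-1) ^ ((p : ℕ) + q)), ?_⟩
    have h1 : Matrix.trace (E q.rev p.rev) = Matrix.trace (E p q) := by
      by_cases h : p = q
      · subst h; simp [E]
      · rw [Matrix.trace_single_eq_of_ne _ _ _ h, Matrix.trace_single_eq_of_ne]
        exact fun h' => h (Fin.rev_injective h').symm
    rw [projA_apply, projA_apply, flipMap_E, flipMap_E, h1, Fin.rev_rev, Fin.rev_rev,
      add_comm (q.rev : ℕ), neg_one_pow_rev]
    by_cases h : p = q
    · subst h
      have e := neg_one_pow_mul_self ε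
      have e' : (-1 : ℂ) ^ ((p : ℕ) + p) = 1 := by rw [pow_add, neg_one_pow_mul_self]
      simp only [e', smul_sub, smul_add, smul_smul]
      rw [show -((-1 : ℂ) ^ ε * 1) * ((-1) ^ ε * -1) = 1 by linear_combination e,
        show -((-1 : ℂ) ^ ε * 1) * ((1 - (-1) ^ ε) * (Matrix.trace (E p p) / N)) =
          (1 - (-1) ^ ε) * (Matrix.trace (E p p) / N) by
          linear_combination (Matrix.trace (E p p) / N) * e]
      simp only [one_smul, mul_one, mul_neg]
      abel
    · rw [Matrix.trace_single_eq_of_ne _ _ _ h]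
      have e := neg_one_pow_mul_self ε
      have e' := neg_one_pow_mul_self ((p : ℕ) + q)
      simp only [smul_add, smul_smul, zero_div, mul_zero, zero_smul, sub_zero]
      rw [show -((-1 : ℂ) ^ ε * (-1) ^ ((p : ℕ) + q)) * ((-1) ^ ε * -(-1) ^ ((p : ℕ) + q)) = 1 by
        linear_combination e * (-1) ^ ((p : ℕ) + q) * (-1) ^ ((p : ℕ) + q) + e', one_smul, add_comm]
      congr 2
      ring
  cases X
  · exact key _ p q
  · exact key _ p q
  · refine ⟨-1, ?_⟩
    change projD n ε _ = _ • projD n ε _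
    rw [projD_apply, projD_apply, skewMap_E, skewMap_E, Fin.rev_rev, Fin.rev_rev, map_neg, map_neg]
    simp only [smul_add, smul_neg, neg_smul, one_smul, neg_neg]
    abel

theorem Qm_E_midSwap (ε : ℕ) (p q : Fin (2 * n + 2)) :
    Qm .D n ε (E (midSwap n p) (midSwap n q)) = (-1 : ℂ) ^ ε • Qm .D n ε (E p q) := by
  change projD n ε _ = _ • projD n ε _
  rw [← swapMap_projD, ← swapMap_E]
  simp only [projD_apply, map_add, map_smul, swapMap_skewMap, swapMap_swapMap]

theorem eq_midSwap_of_kap_eq {q s : Fin (2 * n + 2)} (h : kap (2 * n + 2) n q = kap _ n s)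
    (hqs : q ≠ s) : s = midSwap n q := by
  have h1 := eq_or_of_kap_eq (by omega) h
  have h2 := midSwap_val q
  have h3 : (q : ℕ) ≠ s := fun e => hqs (Fin.ext e)
  refine Fin.ext ?_
  rw [h2]
  split_ifs <;> omega

theorem midSwap_eq_self {p q : Fin (2 * n + 2)} (h : kap (2 * n + 2) n p ≠ kap _ n q)
    (hq : midSwap n q ≠ q) : midSwap n p = p := by
  have hm : ∀ p : Fin (2 * n + 2), midSwap n p ≠ p → kap (2 * n + 2) n p = 0 := by
    intro p hp
    have h1 := midSwap_val p
    have h2 : (midSwap n p : ℕ) ≠ p := fun e => hp (Fin.ext e)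
    ext a
    have := a.2
    simp only [kap, Pi.zero_apply]
    split_ifs at h1 ⊢ <;> omega
  by_contra hp
  exact h (by rw [hm p hp, hm q hq])

theorem Qm_E_of_kap_sub_eq (ε : ℕ) {p q r s : Fin (size X n)}
    (hpq : kap (size X n) n p ≠ kap _ n q)
    (h : kap (size X n) n p - kap _ n q = kap _ n r - kap _ n s) :
    ∃ c : ℂ, Qm X n ε (E p q) = c • Qm X n ε (E r s) := by
  have key : ∀ p q r s : Fin (size X n), kap (size X n) n p ≠ kap _ n q →
      kap (size X n) n p = kap _ n r → kap (size X n) n q = kap _ n s →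
      ∃ c : ℂ, Qm X n ε (E p q) = c • Qm X n ε (E r s) := by
    intro p q r s hpq h1 h2
    by_cases hp : p = r
    · by_cases hq : q = s
      · subst hp hq
        exact ⟨1, (one_smul _ _).symm⟩
      · obtain ⟨rfl, -⟩ := kap_eq_iff h2 hq
        obtain rfl := eq_midSwap_of_kap_eq h2 hq
        have e := Qm_E_midSwap ε p q
        rw [midSwap_eq_self hpq (Ne.symm hq)] at e
        subst hp
        refine ⟨(-1) ^ ε, ?_⟩
        rw [e, smul_smul, neg_one_pow_mul_self, one_smul]
    · obtain ⟨rfl, -⟩ := kap_eq_iff h1 hp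
      obtain rfl := eq_midSwap_of_kap_eq h1 hp
      have e := Qm_E_midSwap ε p q
      have e2 := midSwap_eq_self (Ne.symm hpq) (Ne.symm hp)
      have hq : q = s := by
        by_contra hq
        have := eq_midSwap_of_kap_eq h2 hq
        exact hq (by rw [this, e2])
      rw [e2] at e
      subst hq
      refine ⟨(-1) ^ ε, ?_⟩
      rw [e, smul_smul, neg_one_pow_mul_self, one_smul]
  rcases kap_sub_eq hpq h with ⟨h1, h2⟩ | ⟨h1, h2⟩
  · exact key p q r s hpq h1 h2
  · obtain ⟨c, hc⟩ := key p q s.rev r.rev hpq h1 h2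
    obtain ⟨c', hc'⟩ := Qm_E_rev ε s.rev r.rev
    rw [Fin.rev_rev, Fin.rev_rev] at hc'
    exact ⟨c * c', by rw [hc, hc', smul_smul]⟩

theorem Qm_of_mem_wtMat (ε : ℕ) {r s : Fin (size X n)} (hrs : kap (size X n) n r ≠ kap _ n s)
    {x : Mat X n} (hx : x ∈ wtMat (size X n) n (kap _ n r - kap _ n s)) :
    ∃ c : ℂ, Qm X n ε x = c • Qm X n ε (E r s) := by
  have h1 : x ∈ (Submodule.span ℂ {Qm X n ε (E r s)}).comap (Qm X n ε) := by
    refine mem_of_E_mem _ fun p q h => ?_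
    have h2 := hx p q h
    obtain ⟨c, hc⟩ := Qm_E_of_kap_sub_eq ε (fun e => hrs (by
      rw [e, sub_self, eq_comm, sub_eq_zero] at h2
      exact h2)) h2
    rw [Submodule.mem_comap, hc]
    exact Submodule.smul_mem _ _ (Submodule.mem_span_singleton_self _)
  obtain ⟨c, hc⟩ := Submodule.mem_span_singleton.1 h1
  exact ⟨c, hc.symm⟩

theorem apply_eq_zero_of_le {b : Fin n → ℤ} {x : Mat X n} (hx : x ∈ wtMat (size X n) n b)
    (hb : Qpos b) (h0 : b ≠ 0) {p q : Fin (size X n)} (h : q ≤ p) : x p q = 0 := by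
  by_contra hc
  refine h0 (hb.eq_zero_of_neg ?_)
  rw [← hx p q hc, neg_sub]
  exact Qpos_kap h

theorem eq_smul_fs {j : Fin n} (x : g0 X n) (hx : x.1 ∈ negRoot X n j) :
    ∃ c : ℂ, x = c • (tri X n).fs j := by
  have h0 : -sr (slX X) j = kap (size X n) n (nxt X n j) - kap _ n (idx X n j) := by
    rw [← kap_idx_sub_nxt, neg_sub]
  have h1 := mem_negRoot.1 hx
  rw [h0] at h1
  obtain ⟨c, hc⟩ := Qm_of_mem_wtMat 0 (kap_idx_ne_nxt j).symm h1
  have h2 : (2 * cc X : ℂ) • x = c • XX X n (nxt X n j) (idx X n j) := by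
    rw [← Q0_self]
    exact g0_ext hc
  refine ⟨(2 * cc X : ℂ)⁻¹ * c * (nu X n j)⁻¹, ?_⟩
  change x = _ • nu X n j • XX X n (nxt X n j) (idx X n j)
  rw [smul_smul, mul_assoc, inv_mul_cancel₀ (nu_ne_zero j), mul_one, mul_smul, ← h2, smul_smul,
    inv_mul_cancel₀ two_cc_ne_zero, one_smul]

theorem fs_eq (j : Fin n) : ∃ x ∈ wtMat (size X n) n (-sr (slX X) j), (tri X n).fs j = Q0 X n x := by
  refine ⟨nu X n j • E (nxt X n j) (idx X n j), Submodule.smul_mem _ _ (E_mem_wtMat_of ?_), ?_⟩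
  · rw [← kap_idx_sub_nxt, neg_sub]
  · rw [map_smul]
    rfl

theorem fs_mem_negRoot (j : Fin n) : ((tri X n).fs j).1 ∈ negRoot X n j := by
  obtain ⟨x, hx, h⟩ := fs_eq (X := X) j
  rw [h, mem_negRoot, Q0_val]
  exact Qm_mem_wtMat 0 hx

end RootSpaces

/-! ### The modules `V(μ)` -/

section Irreducible

variable {X : TwistedType} {n : ℕ}

theorem vgen_mem_Sing (μ : Weight n) : vgen X n μ ∈ (tri X n).Sing (V X n μ) (ev X μ) := by
  refine ⟨fun a => vgen_weight μ (Hh X n a) (Hh_mem_cartan a), fun p => ?_⟩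
  exact vgen_pos μ _ fun a b hab => apply_eq_zero_of_le (Qm_mem_wtMat 0 (E_mem_wtMat _ _))
    ((tri X n).rt_nonneg p) ((tri X n).rt_ne p) hab

theorem V_adm (μ : Weight n) : (tri X n).Adm (V X n μ) (ev X μ) where
  spn := by
    rw [eq_top_iff]
    have h1 := TriData.lieSpan_le_span_word (vgen_mem_Sing (X := X) μ)
    rw [lieSpan_vgen] at h1
    refine le_trans h1 (Submodule.span_mono ?_)
    rintro x ⟨d, hx⟩
    exact ⟨d, hx.nonneg, hx.mem_wt (vgen_mem_Sing μ).1⟩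
  nil j x := by
    obtain ⟨y, hy, h⟩ := fs_eq (X := X) j
    refine locally_nilpotent _ (fun z => ?_) (vgen X n μ)
      ⟨_, vgen_neg μ j _ (fs_mem_negRoot j)⟩ (lieSpan_vgen μ) x
    rw [h]
    exact g0_ad_nilpotent hy z

theorem V_finiteDimensional (μ : Weight n) : FiniteDimensional ℂ (V X n μ) :=
  (V_adm μ).finiteDimensional (vgen_mem_Sing μ) (lieSpan_vgen μ)

/-- The universal property of `V(μ)` for singular vectors of integrable modules. -/
theorem exists_hom_V {M : Type} [AddCommGroup M] [Module ℂ M] [LieRingModule (g0 X n) M]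
    [LieModule ℂ (g0 X n) M] (μ : Weight n) {u : M} (hu : u ∈ (tri X n).Sing M (ev X μ)) (h0 : u ≠ 0)
    (nil : ∀ j, ∃ N, (LieModule.toEnd ℂ (g0 X n) M ((tri X n).fs j) ^ N) u = 0) :
    ∃ φ : V X n μ →ₗ⁅ℂ,g0 X n⁆ M, φ (vgen X n μ) = u := by
  obtain ⟨φ, h1, h2⟩ := exists_cyclic_hom {u | VRel X n μ u} u (by
    rintro a (⟨x, hx⟩ | ⟨h, hh⟩ | ⟨j, x, hx⟩)
    · rw [UniversalEnvelopingAlgebra.lift_ι_apply, LieModule.toEnd_apply_apply]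
      have h1 := mem_span_of_nPos x hx
      clear hx
      induction h1 using Submodule.span_induction with
      | mem c hc => obtain ⟨p, rfl⟩ := hc; exact hu.2 p
      | zero => simp
      | add a b _ _ ha hb => rw [add_lie, ha, hb, add_zero]
      | smul r a _ ha => rw [smul_lie, ha, smul_zero]
    · rw [map_sub, UniversalEnvelopingAlgebra.lift_ι_apply, AlgHom.commutes, LinearMap.sub_apply,
        LieModule.toEnd_apply_apply, Module.algebraMap_end_apply, sub_eq_zero, eval_g0,
        Finset.sum_smul]
      conv_lhs => rw [eq_sum_Hh h hh, sum_lie]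
      refine Finset.sum_congr rfl fun a _ => ?_
      rw [smul_lie, mul_smul]
      exact congrArg _ (hu.1 a)
    · rw [map_pow, UniversalEnvelopingAlgebra.lift_ι_apply]
      obtain ⟨c, rfl⟩ := eq_smul_fs x hx
      obtain ⟨k, hk, hk'⟩ := TriData.Sing.exists_nat hu.1 h0 j (TriData.Sing.lie_es hu j) (nil j)
      have h3 : k = μ j := by
        have h4 : pr (clX X : ℂ) (ev X μ) j = k := hk
        rw [pr_ev] at h4
        exact_mod_cast h4.symm
      rw [map_smul, smul_pow, LinearMap.smul_apply, ← h3, hk', smul_zero])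
  exact ⟨{ toLinearMap := (φ : V X n μ →ₗ[ℂ] M), map_lie' := fun {z x} => h2 z x }, h1⟩

end Irreducible

/-! ### Elements annihilating the generator of a Kirillov–Reshetikhin module -/

section Annihilation

variable {X : TwistedType} {n : ℕ} {i : Fin n} {m : ℕ}

theorem sigma_Qm (r : ℕ) (x : Mat X n) : sigma X n ⟨Qm X n r x, Qm_mem r x⟩ =
    (-1 : ℂ) ^ r • (⟨Qm X n r x, Qm_mem r x⟩ : ambient X n) :=
  Subtype.ext (matAut_Qm r x)

theorem constHom_lie_Tt (w : g0 X n) (r : ℕ) (x : Mat X n) :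
    ⁅constHom (sigma X n) w, Tt X n r x⁆ = Tt X n r ⁅w.1.1, x⁆ := by
  have h1 : Qm X n 0 ((2 * cc X : ℂ)⁻¹ • w.1.1) = w.1.1 := by
    rw [← Q0_val, ← eq_Q0 w]
  conv_lhs => rw [eq_Q0 w, ← Tt_zero]
  rw [Tt_lie', zero_add, h1]

theorem lie_Tt_mem_wt {l : Fin n → ℂ} {y : KR X n i m} (hy : y ∈ (tri X n).wt (KR X n i m) l)
    {b : Fin n → ℤ} {x : Mat X n} (hx : x ∈ wtMat (size X n) n b) (r : ℕ) :
    ⁅Tt X n r x, y⁆ ∈ (tri X n).wt (KR X n i m) (l + cst b) := fun a => by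
  change ⁅constHom (sigma X n) (Hh X n a), ⁅Tt X n r x, y⁆⁆ = _
  rw [leibniz_lie, constHom_lie_Tt, Hh_lie a hx, map_smul, smul_lie]
  have h1 : ⁅constHom (sigma X n) (Hh X n a), y⁆ = l a • y := hy a
  rw [h1, lie_smul, ← add_smul, add_comm]
  rfl

theorem kgen_mem_wt : kgen X n i m ∈ (tri X n).wt (KR X n i m)
    (ev X (m • om n ((i : ℕ) + 1))) := fun a => by
  have h1 := kgen_weight (X := X) i m (Hh X n a).1 (by
    have h : sigma X n (Hh X n a).1 = (Hh X n a).1 := (Hh X n a).2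
    simpa using h) (Hh_mem_cartan a)
  refine Eq.trans h1 ?_
  congr 1
  rw [ev, Weight.eval]
  rw [Finset.sum_eq_single i]
  · simp [om]
  · intro j _ hj
    have : (j : ℕ) ≠ i := fun h => hj (Fin.ext h)
    simp [om, this]
  · simp

theorem pr_kgen (j : Fin n) : pr (clX X : ℂ) (ev X (m • om n ((i : ℕ) + 1))) j =
    if j = i then (m : ℂ) else 0 := by
  rw [pr_ev]
  simp only [om, Pi.smul_apply, smul_eq_mul, mul_ite, mul_one, mul_zero, add_left_inj, Fin.ext_iff]
  split_ifs <;> simp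

/-- All elements `x ⊗ t ^ r` with `x` of weight `b` annihilate the generator. -/
def Kills (X : TwistedType) (n : ℕ) (i : Fin n) (m r : ℕ) (b : Fin n → ℤ) : Prop :=
  ∀ x ∈ wtMat (size X n) n b, ⁅Tt X n r x, kgen X n i m⁆ = 0

theorem kills_of_pos (r : ℕ) {b : Fin n → ℤ} (hb : Qpos b) (h0 : b ≠ 0) : Kills X n i m r b :=
  fun x hx => kgen_rel (KRRel.pos r ⟨Qm X n r x, Qm_mem r x⟩ (sigma_Qm r x) fun _ _ h =>
    apply_eq_zero_of_le (Qm_mem_wtMat r hx) hb h0 h)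

theorem kills_zero {r : ℕ} (hr : 1 ≤ r) : Kills X n i m r 0 :=
  fun x hx => kgen_rel (KRRel.cartan r hr ⟨Qm X n r x, Qm_mem r x⟩ (sigma_Qm r x) fun _ _ h =>
    Qm_apply_of_ne r hx h)

theorem kills_other {j : Fin n} (hj : j ≠ i) : Kills X n i m 0 (-sr (slX X) j) :=
  fun x hx => kgen_rel (KRRel.other j hj ⟨Qm X n 0 x, Qm_mem 0 x⟩ (sigma_Qm 0 x)
    (mem_negRoot.2 (Qm_mem_wtMat 0 hx)))

theorem kills_one : Kills X n i m 1 (-sr (slX X) i) :=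
  fun x hx => kgen_rel (KRRel.tone ⟨Qm X n 1 x, Qm_mem 1 x⟩ (sigma_Qm 1 x) (mem_negRoot.2 (Qm_mem_wtMat 1 hx)))

theorem kills_two : Kills X n i m 2 (-sr (slX X) i) :=
  fun x hx => kgen_rel (KRRel.tsq ⟨Qm X n 2 x, Qm_mem 2 x⟩ (sigma_Qm 2 x) (mem_negRoot.2 (Qm_mem_wtMat 2 hx)))

theorem kgen_mem_Sing : kgen X n i m ∈ (tri X n).Sing (KR X n i m)
    (ev X (m • om n ((i : ℕ) + 1))) := by
  refine ⟨kgen_mem_wt, fun p => ?_⟩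
  change ⁅constHom (sigma X n) (Q0 X n (E p.1.1 p.1.2)), kgen X n i m⁆ = 0
  rw [← Tt_zero]
  exact kills_of_pos 0 ((tri X n).rt_nonneg p) ((tri X n).rt_ne p) _ (E_mem_wtMat _ _)

theorem toEnd_constHom (w : g0 X n) : LieModule.toEnd ℂ (g0 X n) (KR X n i m) w =
    LieModule.toEnd ℂ (gt X n) (KR X n i m) (constHom (sigma X n) w) := rfl

theorem KR_nil (j : Fin n) (x : KR X n i m) :
    ∃ N, (LieModule.toEnd ℂ (g0 X n) (KR X n i m) ((tri X n).fs j) ^ N) x = 0 := by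
  obtain ⟨y, hy, h⟩ := fs_eq (X := X) j
  rw [h, toEnd_constHom, ← Tt_zero]
  refine locally_nilpotent _ (gt_ad_nilpotent hy) (kgen X n i m) ?_ (lieSpan_kgen i m) x
  by_cases hj : j = i
  · subst hj
    exact ⟨_, kgen_power j m ⟨Qm X n 0 y, Qm_mem 0 y⟩ (sigma_Qm 0 y) (mem_negRoot.2 (Qm_mem_wtMat 0 hy))⟩
  · exact ⟨1, by rw [pow_one]; exact kills_other hj y hy⟩

/-- For `j ≠ i` the simple root vectors of `± α_j` annihilate the generator, so that a vector
`(x ⊗ t ^ r) v` killed by the positive one has a nonnegative `α_j`-weight. -/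
theorem kills_of_add {r : ℕ} {b : Fin n → ℤ} {j : Fin n} (hj : j ≠ i) (hb : pr 1 b j < 0)
    (h : Kills X n i m r (b + sr (slX X) j)) : Kills X n i m r b := by
  intro x hx
  by_contra h0
  have he : ⁅(tri X n).es j, ⁅Tt X n r x, kgen X n i m⁆⁆ = 0 := by
    have h1 : ⁅(tri X n).es j, kgen X n i m⁆ = 0 := TriData.Sing.lie_es kgen_mem_Sing j
    change ⁅constHom (sigma X n) ((tri X n).es j), ⁅Tt X n r x, kgen X n i m⁆⁆ = 0
    rw [leibniz_lie, constHom_lie_Tt]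
    have h2 : ⁅constHom (sigma X n) ((tri X n).es j), kgen X n i m⁆ = 0 := h1
    rw [h2, lie_zero, add_zero]
    refine h _ ?_
    rw [add_comm b, ← kap_idx_sub_nxt]
    exact lie_mem_wtMat (Qm_mem_wtMat 0 (E_mem_wtMat _ _)) hx
  obtain ⟨k, hk, -⟩ := TriData.Sing.exists_nat (lie_Tt_mem_wt kgen_mem_wt hx r) h0 j he (KR_nil j _)
  have h1 : pr (clX X : ℂ) (ev X (m • om n ((i : ℕ) + 1)) + cst b) j = k := hk
  have h2 : pr (clX X : ℂ) (ev X (m • om n ((i : ℕ) + 1)) + cst b) j =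
      pr (clX X : ℂ) (ev X (m • om n ((i : ℕ) + 1))) j + ((pr (clX X : ℤ) b j : ℤ) : ℂ) := by
    unfold pr
    split_ifs
    · simp [cst]; ring
    · simp [cst]; ring
  rw [h2, pr_kgen, if_neg hj, zero_add] at h1
  have h3 : pr (clX X : ℤ) b j = k := by exact_mod_cast h1
  have h4 : pr (clX X : ℤ) b j < 0 := by
    unfold pr at hb ⊢
    split_ifs at hb ⊢
    · exact hb
    · rw [one_mul] at hb
      refine mul_neg_of_pos_of_neg ?_ hb
      cases X <;> simp [clX]
  omega

theorem kills_add_two {r : ℕ} {b : Fin n → ℤ} (h0 : b ≠ 0) (h : Kills X n i m r b) :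
    Kills X n i m (r + 2) b := by
  intro x hx
  obtain ⟨a, ha⟩ := Function.ne_iff.1 h0
  have h1 : Qm X n 2 ((cc X : ℂ)⁻¹ • E (idx X n a) (idx X n a)) = (Hh X n a).1.1 := by
    rw [Qm_add_two 0]
    rfl
  have h2 := leibniz_lie (Tt X n 2 ((cc X : ℂ)⁻¹ • E (idx X n a) (idx X n a))) (Tt X n r x)
    (kgen X n i m)
  rw [h x hx, lie_zero, Tt_lie', h1, Hh_lie a hx,
    kills_zero one_le_two _ (Submodule.smul_mem _ _ (E_diag_mem _)), lie_zero, add_zero, map_smul,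
    smul_lie, eq_comm, smul_eq_zero, add_comm 2] at h2
  exact h2.resolve_left (by exact_mod_cast ha)

theorem kills_of_le {r s : ℕ} {b : Fin n → ℤ} (h0 : b ≠ 0) (h : Kills X n i m r b)
    (h' : Kills X n i m (r + 1) b) (hrs : r ≤ s) : Kills X n i m s b := by
  obtain ⟨k, rfl⟩ := Nat.exists_eq_add_of_le hrs
  have : Kills X n i m (r + k) b ∧ Kills X n i m (r + k + 1) b := by
    induction k with
    | zero => exact ⟨h, h'⟩
    | succ k ih =>
      have := ih (Nat.le_add_right _ _)
      exact ⟨this.2, kills_add_two h0 this.1⟩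
  exact this.1

theorem kills_of_lie {r s : ℕ} {x y : Mat X n} (hx : ⁅Tt X n r x, kgen X n i m⁆ = 0)
    (hy : ⁅Tt X n s y, kgen X n i m⁆ = 0) : ⁅⁅Tt X n r x, Tt X n s y⁆, kgen X n i m⁆ = 0 := by
  rw [lie_lie, hx, hy, lie_zero, lie_zero, sub_zero]

theorem kills_of_E {r : ℕ} {b : Fin n → ℤ} {p q : Fin (size X n)} (hb : kap _ n p - kap _ n q = b)
    (h0 : b ≠ 0) (h : ⁅Tt X n r (E p q), kgen X n i m⁆ = 0) : Kills X n i m r b := by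
  intro x hx
  subst hb
  obtain ⟨c, hc⟩ := Qm_of_mem_wtMat r (sub_ne_zero.1 h0) hx
  have h1 : Tt X n r x = c • Tt X n r (E p q) := by
    have h2 := Tt_Qm r x
    rw [hc, map_smul, Tt_Qm, smul_comm] at h2
    exact (smul_right_injective _ two_cc_ne_zero h2).symm
  rw [h1, smul_lie, h, smul_zero]

end Annihilation

section Annihilation

variable {X : TwistedType} {n : ℕ} {i : Fin n} {m : ℕ}

/-- The coefficient of the `i`-th simple root in a weight, or twice this coefficient if the root is
twice the last coordinate. It grades the weights of matrices, with values in `{-2, …, 2}`. -/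
def deg (i : Fin n) (b : Fin n → ℤ) : ℤ := ∑ a ∈ Finset.Iic i, b a

theorem deg_add (b c : Fin n → ℤ) : deg i (b + c) = deg i b + deg i c := Finset.sum_add_distrib

theorem deg_neg (b : Fin n → ℤ) : deg i (-b) = -deg i b := Finset.sum_neg_distrib _

theorem deg_kap {N : ℕ} (p : Fin N) : deg i (kap N n p) =
    (if (p : ℕ) ≤ i then 1 else 0) - (if N ≤ p + i + 1 then 1 else 0) := sum_kap p i

theorem deg_sub_kap {N : ℕ} (p q : Fin N) : deg i (kap N n p - kap N n q) =
    ((if (p : ℕ) ≤ i then 1 else 0) - (if N ≤ p + i + 1 then 1 else 0)) -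
    ((if (q : ℕ) ≤ i then 1 else 0) - (if N ≤ q + i + 1 then 1 else 0)) := by
  rw [sub_eq_add_neg, deg_add, deg_neg, deg_kap, deg_kap, ← sub_eq_add_neg]

theorem deg_sr {c : ℤ} {j : Fin n} (hj : j ≠ i) : deg i (sr c j) = 0 := by
  rw [deg, sum_Iic_sr, if_neg hj.symm]

/-- The induction along the degree: the vectors annihilating the generator in one degree are
determined by those whose weight is dominant for the simple roots other than `α_i`. -/
theorem kills_induction {r : ℕ} {s : ℤ}
    (hbase : ∀ p q : Fin (size X n), kap (size X n) n p ≠ kap _ n q →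
      deg i (kap (size X n) n q - kap _ n p) = s →
      (∀ j ≠ i, pr 1 (kap (size X n) n q - kap _ n p) j ≤ 0) →
      Kills X n i m r (kap (size X n) n p - kap _ n q)) {b : Fin n → ℤ} (hb : deg i b = -s)
    (h : b ≠ 0 ∨ 1 ≤ r) : Kills X n i m r b := by
  obtain ⟨k, hk⟩ : ∃ k, k = (ht (-b)).toNat := ⟨_, rfl⟩
  induction k using Nat.strong_induction_on generalizing b with
  | _ k ih =>
  by_cases hb0 : b = 0
  · subst hb0
    exact kills_zero (h.resolve_left fun h => h rfl)
  by_cases hr : ∃ p q : Fin (size X n), kap (size X n) n p - kap _ n q = b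
  · obtain ⟨p, q, rfl⟩ := hr
    rcases le_total p q with hpq | hpq
    · exact kills_of_pos r (Qpos_kap hpq) hb0
    · have hQ := Qpos_kap (n := n) hpq
      have hQ0 := hQ.ht_pos (by rw [← neg_sub]; exact neg_ne_zero.2 hb0)
      by_cases hj : ∃ j ≠ i, 0 < pr 1 (kap (size X n) n q - kap _ n p) j
      · obtain ⟨j, hji, hj⟩ := hj
        set b := kap (size X n) n p - kap _ n q with hbd
        have hbn : kap (size X n) n q - kap _ n p = -b := by rw [hbd, neg_sub]
        rw [hbn] at hj hQ0
        have hj' : pr 1 b j < 0 := by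
          unfold pr at hj ⊢
          split_ifs at hj ⊢ <;> simp only [Pi.neg_apply, one_mul] at hj ⊢ <;> omega
        have h1 : ht (-(b + sr (slX X) j)) < ht (-b) := by
          have h2 := TriData.ht_sr_pos (D := tri X n) j
          have h3 : ht (-(b + sr (slX X) j)) = ht (-b) - ht (sr (slX X) j) := by
            rw [ht_neg, ht_neg, ht_add]; ring
          rw [h3]
          change 0 < ht (sr (slX X) j) at h2
          omega
        by_cases hb1 : b + sr (slX X) j = 0
        · rcases Nat.eq_zero_or_pos r with rfl | hr
          · rw [eq_neg_of_add_eq_zero_left hb1]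
            exact kills_other hji
          · exact kills_of_add hji hj' (by rw [hb1]; exact kills_zero hr)
        · refine kills_of_add hji hj' (ih _ ?_ ?_ (Or.inl hb1) rfl)
          · rw [hk]
            omega
          · rw [deg_add, hb, deg_sr hji, add_zero]
      · push Not at hj
        refine hbase p q (sub_ne_zero.1 hb0) ?_ hj
        rw [← neg_sub, deg_neg, hb, neg_neg]
  · push Not at hr
    intro x hx
    have : x = 0 := by
      ext p q
      by_contra hc
      exact hr p q (hx p q hc)
    rw [this, map_zero, zero_lie]

/-- Elements of degree zero other than those of the Cartan subalgebra annihilate the generator. -/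
theorem kills_of_deg_eq_zero {r : ℕ} {b : Fin n → ℤ} (hb : deg i b = 0) (h : b ≠ 0 ∨ 1 ≤ r) :
    Kills X n i m r b := by
  refine kills_induction (s := 0) (fun p q hpq h0 hj => ?_) (by simpa using hb) h
  rcases le_total p q with hle | hle
  · exact kills_of_pos r (Qpos_kap hle) (sub_ne_zero.2 hpq)
  · obtain ⟨j, h1, h2⟩ := (Qpos_kap (n := n) hle).exists_pr_pos (sub_ne_zero.2 hpq.symm)
    have hji : j ≠ i := by
      rintro rfl
      exact h1.ne' h0
    exact absurd h2 (not_lt.2 (hj j hji))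

theorem kap_sub_rev (p q : Fin (size X n)) :
    kap (size X n) n q.rev - kap _ n p.rev = kap (size X n) n p - kap _ n q := by
  rw [kap_rev, kap_rev]
  abel

/-- The weights of degree `1` that are antidominant for the simple roots other than `α_i` are `α_i`
and, in type `B`, the short weight `e_i`. -/
theorem eq_of_deg_one {p q : Fin (size X n)} (h : deg i (kap (size X n) n q - kap _ n p) = 1)
    (hj : ∀ j ≠ i, pr 1 (kap (size X n) n q - kap _ n p) j ≤ 0) :
    ∃ p' : Fin (size X n), kap (size X n) n q - kap _ n p = kap _ n (idx X n i) - kap _ n p' ∧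
      ((p' : ℕ) = i + 1 ∧ (i : ℕ) + 1 < n ∨ n ≤ (p' : ℕ) ∧ (p' : ℕ) + n < size X n) := by
  have key : ∀ p q : Fin (size X n), (q : ℕ) ≤ i → (i : ℕ) < p → (p : ℕ) + i + 1 < size X n →
      (∀ j ≠ i, pr 1 (kap (size X n) n q - kap _ n p) j ≤ 0) →
      q = idx X n i ∧ ((p : ℕ) = i + 1 ∧ (i : ℕ) + 1 < n ∨ n ≤ (p : ℕ) ∧ (p : ℕ) + n < size X n) := by
    intro p q h1 h2 h3 hj
    have hN := two_mul_le_size (X := X) (n := n)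
    have hi := i.2
    constructor
    · by_contra hc
      have hq : (q : ℕ) ≠ i := fun e => hc (Fin.ext e)
      have := hj ⟨q, by omega⟩ (fun e => hq (congrArg Fin.val e))
      simp only [pr, kap, Pi.sub_apply] at this
      rw [dif_pos (by omega)] at this
      split_ifs at this <;> omega
    · by_contra hc
      by_cases hp : (p : ℕ) < n
      · have := hj ⟨p - 1, by omega⟩ (fun e => by
          have := congrArg Fin.val e
          simp only at this
          omega)
        simp only [pr, kap, Pi.sub_apply] at this
        rw [dif_pos (by omega)] at this
        split_ifs at this <;> omega
      · have := hj ⟨size X n - 1 - p, by omega⟩ (fun e => by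
          have := congrArg Fin.val e
          simp only at this
          omega)
        simp only [pr, kap, Pi.sub_apply, one_mul] at this
        split_ifs at this <;> omega
  rw [deg_sub_kap] at h
  have hN := two_mul_le_size (X := X) (n := n)
  have hi := i.2
  by_cases hq : (q : ℕ) ≤ i
  · obtain ⟨rfl, h2⟩ := key p q hq (by split_ifs at h <;> omega) (by split_ifs at h <;> omega) hj
    exact ⟨p, rfl, h2⟩
  · have hq' := Fin.val_rev q
    have hp' := Fin.val_rev p
    obtain ⟨h1, h2⟩ := key q.rev p.rev (by split_ifs at h <;> omega) (by split_ifs at h <;> omega)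
      (by split_ifs at h <;> omega) (by rwa [kap_sub_rev])
    exact ⟨q.rev, by rw [← h1, kap_sub_rev], h2⟩

/-! #### Brackets of matrix units -/

theorem Qm_E_A (hX : X ≠ .D) (ε : ℕ) {p q : Fin (size X n)} (h : p ≠ q) :
    Qm X n ε (E p q) = E p q - ((-1 : ℂ) ^ (ε + p + q)) • E q.rev p.rev := by
  have key : ∀ (N : ℕ) (p q : Fin N), p ≠ q →
      projA N ε (E p q) = E p q - ((-1 : ℂ) ^ (ε + p + q)) • E q.rev p.rev := by
    intro N p q h
    rw [projA_of_trace (Matrix.trace_single_eq_of_ne _ _ _ h), flipMap_E, smul_smul, mul_neg,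
      neg_smul, ← pow_add, ← sub_eq_add_neg, add_assoc]
  cases X
  · exact key _ p q h
  · exact key _ p q h
  · exact absurd rfl hX

theorem Qm_E_D (ε : ℕ) (p q : Fin (2 * n + 2)) :
    Qm .D n ε (E p q) = E p q - E q.rev p.rev +
      (-1 : ℂ) ^ ε • (E (midSwap n p) (midSwap n q) - E (midSwap n q.rev) (midSwap n p.rev)) := by
  change projD n ε _ = _
  rw [projD_apply, skewMap_E, map_neg, swapMap_E, swapMap_E, sub_eq_add_neg, sub_eq_add_neg]

theorem Tt_lie_A (hX : X ≠ .D) (r s : ℕ) {a p c : Fin (size X n)} (h1 : p ≠ c) (h2 : c ≠ a)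
    (h3 : p ≠ c.rev) (h4 : p.rev ≠ a) :
    ⁅Tt X n r (E a p), Tt X n s (E p c)⁆ = Tt X n (r + s) (E a c) := by
  rw [Tt_lie, Qm_E_A hX s h1, lie_sub, lie_smul, lie_E, lie_E, if_pos rfl, if_neg h2, if_neg h3,
    if_neg h4]
  simp

theorem midSwap_of {p : Fin (2 * n + 2)} (h : (p : ℕ) ≠ n) (h' : (p : ℕ) ≠ n + 1) :
    midSwap n p = p := by
  refine Fin.ext ?_
  rw [midSwap_val, if_neg h, if_neg h']

theorem Tt_eq_zero_D_aux {r : ℕ} (hr : r % 2 = 1) {p q : Fin (2 * n + 2)} (h1 : (p : ℕ) ≠ n)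
    (h2 : (p : ℕ) ≠ n + 1) (h3 : (q : ℕ) ≠ n) (h4 : (q : ℕ) ≠ n + 1) : Tt .D n r (E p q) = 0 := by
  have hp := Fin.val_rev p
  have hq := Fin.val_rev q
  refine Tt_eq_zero ?_
  have hr' : (-1 : ℂ) ^ r = -1 := Odd.neg_one_pow (Nat.odd_iff.2 hr)
  rw [Qm_E_D, midSwap_of h1 h2, midSwap_of h3 h4, midSwap_of (by omega) (by omega),
    midSwap_of (by omega) (by omega), hr']
  simp

theorem Tt_lie_D_aux (r s : ℕ) {a p c : Fin (2 * n + 2)} (hp : (p : ℕ) = n) (hc : (c : ℕ) ≠ n)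
    (hc' : (c : ℕ) ≠ n + 1) (ha : (a : ℕ) ≠ n) (ha' : (a : ℕ) ≠ n + 1) (hac : c ≠ a) :
    ⁅Tt .D n r (E a p), Tt .D n s (E p c)⁆ = Tt .D n (r + s) (E a c) := by
  have hcr := Fin.val_rev c
  have hpr := Fin.val_rev p
  have e1 : midSwap n p = p.rev := Fin.ext (by rw [midSwap_val, if_pos hp]; omega)
  have e2 : midSwap n p.rev = p := by rw [← e1, midSwap_midSwap]
  have n1 : p ≠ c.rev := fun e => by have := congrArg Fin.val e; omega
  have n2 : p.rev ≠ a := fun e => by have := congrArg Fin.val e; omega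
  have n3 : p ≠ p.rev := fun e => by have := congrArg Fin.val e; omega
  have n4 : p ≠ a := fun e => by have := congrArg Fin.val e; omega
  rw [Tt_lie, Qm_E_D, e1, e2, midSwap_of hc hc', midSwap_of (by omega) (by omega), lie_add, lie_sub,
    lie_smul, lie_sub, lie_E, lie_E, lie_E, lie_E, if_pos rfl, if_neg hac, if_neg n1, if_neg n2,
    if_neg n3, if_neg n4]
  simp [hac, n1]

/-! #### Degrees one and two -/

theorem sr_of_succ {p : Fin (size X n)} (hp : (p : ℕ) = i + 1) :
    kap (size X n) n (idx X n i) - kap _ n p = sr (slX X) i := by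
  have : p = nxt X n i := Fin.ext hp
  rw [this, kap_idx_sub_nxt]

theorem kap_mid {p : Fin (size X n)} (h : n ≤ (p : ℕ)) (h' : (p : ℕ) + n < size X n) :
    kap (size X n) n p = 0 := by
  ext a
  have := a.2
  simp only [kap, Pi.zero_apply]
  rw [if_neg (by omega), if_neg (by omega), sub_zero]

theorem sr_of_last (h : ¬(i : ℕ) + 1 < n) {p : Fin (size X n)} (hp : n ≤ (p : ℕ))
    (hp' : (p : ℕ) + n < size X n) : kap (size X n) n (idx X n i) - kap _ n p = sr (slX X) i := by
  have hi := i.2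
  rw [kap_mid hp hp', ← kap_mid (p := nxt X n i) (by simp only []; omega)
    (by simp only []; omega), kap_idx_sub_nxt]

/-- Elements of degree `-1` annihilate the generator if those of weight `-α_i` do and, where it is a
different weight, those of the short weight `-e_i`. -/
theorem kills_deg_one {r : ℕ} (hr : Kills X n i m r (-sr (slX X) i))
    (hs : (i : ℕ) + 1 < n → ∀ p : Fin (size X n), n ≤ (p : ℕ) → (p : ℕ) + n < size X n →
      ⁅Tt X n r (E p (idx X n i)), kgen X n i m⁆ = 0)
    {b : Fin n → ℤ} (hb : deg i b = -1) : Kills X n i m r b := by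
  refine kills_induction (s := 1) (fun p q hpq h1 hj => ?_) hb (Or.inl ?_)
  · obtain ⟨p', h2, h3⟩ := eq_of_deg_one h1 hj
    rw [← neg_sub, h2]
    rcases h3 with ⟨h3, h4⟩ | ⟨h3, h4⟩
    · rwa [sr_of_succ h3]
    · by_cases hi : (i : ℕ) + 1 < n
      · refine kills_of_E (neg_sub _ _).symm ?_ (hs hi p' h3 h4)
        rw [← h2]
        exact neg_ne_zero.2 (sub_ne_zero.2 hpq.symm)
      · rwa [sr_of_last hi h3 h4]
  · rintro rfl
    simp [deg] at hb

theorem idx_val (a : Fin n) : (idx X n a : ℕ) = a := rfl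

/-- The step from `-α_i` to the short weight `-e_i` in type `A`. -/
theorem kills_short_A (hX : X ≠ .D) {r : ℕ} (hr : Kills X n i m r (-sr (slX X) i))
    (hi : (i : ℕ) + 1 < n) (p : Fin (size X n)) (hp : n ≤ (p : ℕ)) (hp' : (p : ℕ) + n < size X n) :
    ⁅Tt X n r (E p (idx X n i)), kgen X n i m⁆ = 0 := by
  have hiv := idx_val (X := X) i
  have hnv : (nxt X n i : ℕ) = i + 1 := rfl
  have v1 := Fin.val_rev (idx X n i)
  have v2 := Fin.val_rev (nxt X n i)
  have h1 : ⁅Tt X n 0 (E p (nxt X n i)), Tt X n r (E (nxt X n i) (idx X n i))⁆ =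
      Tt X n (0 + r) (E p (idx X n i)) :=
    Tt_lie_A hX 0 r (fun e => by have := congrArg Fin.val e; omega)
      (fun e => by have := congrArg Fin.val e; omega)
      (fun e => by have := congrArg Fin.val e; omega) (fun e => by have := congrArg Fin.val e; omega)
  rw [zero_add] at h1
  rw [← h1]
  refine kills_of_lie (kills_of_deg_eq_zero ?_ (Or.inl ?_) _ (E_mem_wtMat _ _)) (hr _ ?_)
  · rw [deg_sub_kap]
    split_ifs <;> omega
  · intro e
    have h2 := congrFun e ⟨i + 1, hi⟩
    simp only [Pi.sub_apply, kap, Pi.zero_apply] at h2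
    split_ifs at h2 <;> omega
  · exact E_mem_wtMat_of (by rw [← kap_idx_sub_nxt, neg_sub])

/-- In type `A` all elements `x ⊗ t ^ r` of degree `-1` with `r ≥ 1` annihilate the generator. -/
theorem kills_deg_one_A (hX : X ≠ .D) {r : ℕ} (hr : 1 ≤ r) {b : Fin n → ℤ} (hb : deg i b = -1) :
    Kills X n i m r b := by
  refine kills_of_le ?_ (kills_deg_one kills_one (kills_short_A hX kills_one) hb)
    (kills_deg_one kills_two (kills_short_A hX kills_two) hb) hr
  rintro rfl
  simp [deg] at hb

end Annihilation

section Annihilation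

variable {X : TwistedType} {n : ℕ} {i : Fin n} {m : ℕ}

/-! #### Degree two in type `A` -/

theorem exists_of_deg_two {r : ℕ} {b : Fin n → ℤ} (hb : deg i b = -2)
    (h : ∀ p q : Fin (size X n), kap _ n p - kap _ n q = b → (q : ℕ) ≤ i →
      size X n ≤ (p : ℕ) + i + 1 → ⁅Tt X n r (E p q), kgen X n i m⁆ = 0) :
    Kills X n i m r b := by
  intro x hx
  have h1 : x ∈ (LinearMap.ker ((LieModule.toEnd ℂ (gt X n) (KR X n i m) :
      gt X n →ₗ[ℂ] Module.End ℂ (KR X n i m)).flip (kgen X n i m))).comap (Tt X n r) := by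
    refine mem_of_E_mem _ fun p q hpq => ?_
    have h2 := hx p q hpq
    have h3 := deg_sub_kap (n := n) (i := i) p q
    have hN := two_mul_le_size (X := X) (n := n)
    have hi := i.2
    rw [h2, hb] at h3
    exact h p q h2 (by split_ifs at h3 <;> omega) (by split_ifs at h3 <;> omega)
  exact h1

/-- Except for the last node of type `A_{2n-1}`, an element of degree `-2` is the bracket of two
elements of degree `-1`. -/
theorem kills_deg_two_A_aux (hX : X ≠ .D) (hn : (i : ℕ) + 1 < n ∨ X = .AEven) {r : ℕ} (hr : 1 ≤ r)
    {b : Fin n → ℤ} (hb : deg i b = -2) : Kills X n i m (r + 1) b := by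
  refine exists_of_deg_two hb fun a c hac hc ha => ?_
  have hN := two_mul_le_size (X := X) (n := n)
  have hi := i.2
  have hN2 : 2 * (i : ℕ) + 2 < size X n := by
    rcases hn with hn | rfl
    · omega
    · simp only [size]; omega
  let p : Fin (size X n) := ⟨i + 1, by omega⟩
  have hp : (p : ℕ) = i + 1 := rfl
  have v1 := Fin.val_rev c
  have v2 := Fin.val_rev p
  rw [← Tt_lie_A hX r 1 (p := p) (fun e => by have := congrArg Fin.val e; omega)
      (fun e => by have := congrArg Fin.val e; omega)
      (fun e => by have := congrArg Fin.val e; omega) (fun e => by have := congrArg Fin.val e; omega)]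
  refine kills_of_lie (kills_deg_one_A hX hr ?_ _ (E_mem_wtMat _ _))
    (kills_deg_one_A hX le_rfl ?_ _ (E_mem_wtMat _ _))
  · rw [deg_sub_kap]
    split_ifs <;> omega
  · rw [deg_sub_kap]
    split_ifs <;> omega

theorem Tt_rev_A (hX : X ≠ .D) (r : ℕ) {p q : Fin (size X n)} (hpq : p ≠ q) :
    Tt X n r (E q.rev p.rev) = -((-1 : ℂ) ^ (r + p + q)) • Tt X n r (E p q) := by
  have h0 := neg_one_pow_mul_self (r + p + q)
  have hz : Tt X n r (E q.rev p.rev - -((-1 : ℂ) ^ (r + p + q)) • E p q) = 0 := by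
    refine Tt_eq_zero ?_
    have e1 : (-1 : ℂ) ^ (r + (q.rev : ℕ) + p.rev) = (-1) ^ (r + p + q) := by
      rw [add_assoc, add_assoc, pow_add, pow_add _ r, neg_one_pow_rev, add_comm (q : ℕ)]
    rw [map_sub, map_smul, Qm_E_A hX r hpq, Qm_E_A hX r (fun e => hpq (Fin.rev_injective e).symm),
      Fin.rev_rev, Fin.rev_rev, e1, smul_sub, smul_smul, neg_mul, h0]
    module
  rw [map_sub, map_smul, sub_eq_zero] at hz
  exact hz

/-- In type `A_{2n-1}` with `i = n` the weights of degree `2` that are antidominant for the other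
simple roots are `2 e_i` and `e_{i-1} + e_i`. -/
theorem eq_of_deg_two (hA : X = .AOdd) (hi1 : (i : ℕ) + 1 = n) {p q : Fin (size X n)}
    (h : deg i (kap (size X n) n q - kap _ n p) = 2)
    (hj : ∀ j ≠ i, pr 1 (kap (size X n) n q - kap _ n p) j ≤ 0) :
    ∃ c : Fin (size X n), (c : ℕ) ≤ i ∧ (i : ℕ) ≤ c + 1 ∧
      kap (size X n) n q - kap _ n p = kap _ n c - kap _ n (idx X n i).rev := by
  have hsz : size X n = 2 * n := by rw [hA]
  have key : ∀ p q : Fin (size X n), (q : ℕ) ≤ i → (q : ℕ) + p + 1 ≤ 2 * n → n ≤ (p : ℕ) →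
      (∀ j ≠ i, pr 1 (kap (size X n) n q - kap _ n p) j ≤ 0) → 2 * n = p + i + 1 ∧ i ≤ (q : ℕ) + 1 := by
    intro p q h1 h2 h3 hj
    have hp := p.2
    have h4 : 2 * n = p + i + 1 := by
      by_contra hc
      have := hj ⟨2 * n - 1 - p, by omega⟩ (fun e => by
        have := congrArg Fin.val e
        simp only at this
        omega)
      simp only [pr, kap, Pi.sub_apply] at this
      rw [dif_pos (by omega)] at this
      split_ifs at this <;> omega
    · refine ⟨h4, ?_⟩
      by_contra hc
      have := hj ⟨q, by omega⟩ (fun e => by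
        have := congrArg Fin.val e
        simp only at this
        omega)
      simp only [pr, kap, Pi.sub_apply] at this
      rw [dif_pos (by omega)] at this
      split_ifs at this <;> omega
  have hi := i.2
  have hq' := Fin.val_rev q
  have hp' := Fin.val_rev p
  have v1 := Fin.val_rev (idx X n i)
  have v2 := idx_val (X := X) i
  have hp := p.2
  have hq := q.2
  rw [deg_sub_kap] at h
  have hq1 : (q : ℕ) ≤ i := by split_ifs at h <;> omega
  have hp1 : 2 * n ≤ (p : ℕ) + i + 1 := by split_ifs at h <;> omega
  rcases le_total ((q : ℕ) + p + 1) (2 * n) with hle | hle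
  · obtain ⟨h1, h2⟩ := key p q hq1 hle (by omega) hj
    refine ⟨q, hq1, h2, ?_⟩
    congr 2
    exact Fin.ext (by omega)
  · obtain ⟨h1, h2⟩ := key q.rev p.rev (by omega) (by omega) (by omega) (by rwa [kap_sub_rev])
    refine ⟨p.rev, by omega, h2, ?_⟩
    have : (idx X n i).rev = q.rev := Fin.ext (by omega)
    rw [this, kap_sub_rev]

theorem kills_deg_two_of_base (hA : X = .AOdd) (hi1 : (i : ℕ) + 1 = n) {r : ℕ}
    (hr : Kills X n i m r (-sr (slX X) i))
    (hs : ∀ c : Fin (size X n), (c : ℕ) + 1 = i →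
      ⁅Tt X n r (E (idx X n i).rev c), kgen X n i m⁆ = 0)
    {b : Fin n → ℤ} (hb : deg i b = -2) : Kills X n i m r b := by
  have hsz : size X n = 2 * n := by rw [hA]
  refine kills_induction (s := 2) (fun p q hpq h1 hj => ?_) hb (Or.inl ?_)
  · obtain ⟨c, h2, h3, h4⟩ := eq_of_deg_two hA hi1 h1 hj
    rw [← neg_sub, h4]
    by_cases hc : (c : ℕ) = i
    · have hc' : c = idx X n i := Fin.ext hc
      have e1 : (idx X n i).rev = nxt X n i := Fin.ext (by
        have := Fin.val_rev (idx X n i)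
        rw [this, idx_val]
        simp only []
        omega)
      rw [hc', e1, kap_idx_sub_nxt]
      exact hr
    · refine kills_of_E (neg_sub _ _).symm ?_ (hs c (by omega))
      rw [← h4]
      exact neg_ne_zero.2 (sub_ne_zero.2 hpq.symm)
  · rintro rfl
    simp [deg] at hb

/-- For the last node of type `A_{2n-1}` the root `α_i` has degree two, and the relation for
`x⁻ ⊗ t²` generates all those of degree `-2` with `t²`. -/
theorem kills_deg_two_last_aux (hA : X = .AOdd) (hi1 : (i : ℕ) + 1 = n) {b : Fin n → ℤ}
    (hb : deg i b = -2) : Kills X n i m 2 b := by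
  have hX : X ≠ .D := by rw [hA]; simp
  have hsz : size X n = 2 * n := by rw [hA]
  have hi := i.2
  have v1 := Fin.val_rev (idx X n i)
  have v2 := idx_val (X := X) i
  simp only [hsz] at v1 v2
  set s := idx X n i with hs
  refine kills_deg_two_of_base hA hi1 kills_two (fun c hc => ?_) hb
  have v3 := Fin.val_rev c
  simp only [hsz] at v3
  have hcs : s ≠ c := fun e => by have := congrArg Fin.val e; omega
  have e1 : ⁅Tt X n 2 (E s.rev s), Tt X n 0 (E s c)⁆ = (2 : ℂ) • Tt X n 2 (E s.rev c) := by
    have n1 : c ≠ s.rev := fun e => by have := congrArg Fin.val e; omega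
    have n2 : s ≠ c.rev := fun e => by have := congrArg Fin.val e; omega
    have e2 : Tt X n 2 (E c.rev s) = -((-1 : ℂ) ^ (2 + (s.rev : ℕ) + c)) • Tt X n 2 (E s.rev c) := by
      have := Tt_rev_A (n := n) hX 2 n1.symm
      rwa [Fin.rev_rev] at this
    have e3 : (-1 : ℂ) ^ (2 + (s.rev : ℕ) + c) = 1 := Even.neg_one_pow (Nat.even_iff.2 (by omega))
    have e4 : (-1 : ℂ) ^ (0 + (s : ℕ) + c) = -1 := Odd.neg_one_pow (Nat.odd_iff.2 (by omega))
    rw [Tt_lie, Qm_E_A hX 0 hcs, lie_sub, lie_smul, lie_E, lie_E, if_pos rfl, if_neg n1,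
      if_neg n2, if_pos rfl, e4, map_sub, map_smul, map_sub, map_sub, e2, e3]
    simp only [map_zero]
    module
  have e2 : ⁅(2 : ℂ) • Tt X n 2 (E s.rev c), kgen X n i m⁆ = 0 := by
    rw [← e1]
    refine kills_of_lie (kills_two _ (E_mem_wtMat_of ?_)) (kills_of_deg_eq_zero ?_ (Or.inl ?_) _
      (E_mem_wtMat _ _))
    · have e1 : s.rev = nxt X n i := Fin.ext (by rw [v1]; simp only []; omega)
      rw [← kap_idx_sub_nxt, neg_sub, e1]
    · rw [deg_sub_kap]
      simp only [hsz]
      split_ifs <;> omega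
    · intro e
      have h2 := congrFun e i
      simp only [Pi.sub_apply, kap, Pi.zero_apply, hsz] at h2
      split_ifs at h2 <;> omega
  rw [smul_lie, smul_eq_zero] at e2
  exact e2.resolve_left two_ne_zero

/-- For the last node of type `A_{2n-1}` the elements of degree `-2` with `t³` come from those with
`t²` by means of the diagonal elements `h ⊗ t`; there are none for the long roots. -/
theorem kills_deg_two_last (hA : X = .AOdd) (hi1 : (i : ℕ) + 1 = n) {r : ℕ} (hr : 2 ≤ r)
    {b : Fin n → ℤ} (hb : deg i b = -2) : Kills X n i m r b := by
  have hX : X ≠ .D := by rw [hA]; simp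
  have hsz : size X n = 2 * n := by rw [hA]
  have hi := i.2
  have v1 := Fin.val_rev (idx X n i)
  have v2 := idx_val (X := X) i
  simp only [hsz] at v1 v2
  set s := idx X n i with hs
  refine kills_of_le (r := 2) ?_ (kills_deg_two_last_aux hA hi1 hb) ?_ hr
  · rintro rfl
    simp [deg] at hb
  · refine kills_deg_two_of_base hA hi1 (fun x hx => ?_) (fun c hc => ?_) hb
    · have e1 : kap (size X n) n s.rev - kap _ n s = -sr (slX X) i := by
        have e1 : s.rev = nxt X n i := Fin.ext (by rw [v1]; simp only []; omega)
        rw [e1, ← neg_sub, kap_idx_sub_nxt]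
      rw [← e1] at hx
      have hne : s.rev ≠ s := fun e => by have := congrArg Fin.val e; omega
      obtain ⟨c, hc⟩ := Qm_of_mem_wtMat 3 (fun e => by
        have h2 := congrFun e i
        simp only [kap, hsz] at h2
        split_ifs at h2 <;> omega) hx
      have e4 : (-1 : ℂ) ^ (3 + (s.rev : ℕ) + s) = 1 := Even.neg_one_pow (Nat.even_iff.2 (by omega))
      rw [Qm_E_A hX 3 hne, Fin.rev_rev, e4, one_smul, sub_self, smul_zero] at hc
      rw [Tt_eq_zero hc, zero_lie]
    · have v3 := Fin.val_rev c
      simp only [hsz] at v3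
      have n1 : s.rev ≠ c := fun e => by have := congrArg Fin.val e; omega
      have n2 : c.rev ≠ c := fun e => by have := congrArg Fin.val e; omega
      have n3 : s ≠ c := fun e => by have := congrArg Fin.val e; omega
      have e1 : ⁅Tt X n 1 (E c c), Tt X n 2 (E s.rev c)⁆ = -Tt X n 3 (E s.rev c) := by
        change _ = -Tt X n (1 + 2) (E s.rev c)
        rw [Tt_lie, Qm_E_A hX 2 n1, lie_sub, lie_smul, lie_E, lie_E, Fin.rev_rev, if_neg n1.symm,
          if_pos rfl, if_neg n2.symm, if_neg n3, sub_self, smul_zero, sub_zero, zero_sub, map_neg]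
      have e2 : ⁅-Tt X n 3 (E s.rev c), kgen X n i m⁆ = 0 := by
        rw [← e1]
        refine kills_of_lie (kills_zero le_rfl _ (E_mem_wtMat_of (sub_self _)))
          (kills_deg_two_last_aux hA hi1 ?_ _ (E_mem_wtMat _ _))
        rw [deg_sub_kap]
        simp only [hsz]
        split_ifs <;> omega
      rwa [neg_lie, neg_eq_zero] at e2

/-- In type `A` all elements `x ⊗ t ^ r` of degree `-2` with `r ≥ 2` annihilate the generator. -/
theorem kills_deg_two_A (hX : X ≠ .D) {r : ℕ} (hr : 2 ≤ r) {b : Fin n → ℤ} (hb : deg i b = -2) :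
    Kills X n i m r b := by
  by_cases hn : (i : ℕ) + 1 < n ∨ X = .AEven
  · obtain ⟨k, rfl⟩ := Nat.exists_eq_add_of_le' hr
    exact kills_deg_two_A_aux hX hn (by omega) hb
  · push Not at hn
    cases X
    · exact kills_deg_two_last rfl (by have := i.2; omega) hr hb
    · exact absurd rfl hn.2
    · exact absurd rfl hX

end Annihilation

section Annihilation

variable {X : TwistedType} {n : ℕ} {i : Fin n} {m : ℕ}

/-! #### Type `D` -/

/-- The odd eigenspace of the automorphism in type `D` consists of matrices supported on the middle
rows and columns. -/
theorem Tt_eq_zero_D (hX : X = .D) {r : ℕ} (hr : r % 2 = 1) {p q : Fin (size X n)}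
    (h1 : (p : ℕ) ≠ n) (h2 : (p : ℕ) ≠ n + 1) (h3 : (q : ℕ) ≠ n) (h4 : (q : ℕ) ≠ n + 1) :
    Tt X n r (E p q) = 0 := by
  subst hX
  exact Tt_eq_zero_D_aux hr h1 h2 h3 h4

theorem Tt_lie_D (hX : X = .D) (r s : ℕ) {a p c : Fin (size X n)} (hp : (p : ℕ) = n)
    (hc : (c : ℕ) ≠ n) (hc' : (c : ℕ) ≠ n + 1) (ha : (a : ℕ) ≠ n) (ha' : (a : ℕ) ≠ n + 1)
    (hac : c ≠ a) : ⁅Tt X n r (E a p), Tt X n s (E p c)⁆ = Tt X n (r + s) (E a c) := by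
  subst hX
  exact Tt_lie_D_aux r s hp hc hc' ha ha' hac

theorem Tt_lie_D_even (hX : X = .D) (r : ℕ) {a p c : Fin (size X n)} (hp : (p : ℕ) ≠ n)
    (hp' : (p : ℕ) ≠ n + 1) (hc : (c : ℕ) ≠ n) (hc' : (c : ℕ) ≠ n + 1) (hac : c ≠ a)
    (h1 : p ≠ c.rev) (h2 : p.rev ≠ a) :
    ⁅Tt X n r (E a p), Tt X n 2 (E p c)⁆ = (2 : ℂ) • Tt X n (r + 2) (E a c) := by
  subst hX
  have v1 := Fin.val_rev c
  have v2 := Fin.val_rev p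
  simp only [size] at v1 v2
  have h := Qm_E_D (n := n) 2 p c
  rw [midSwap_of hp hp', midSwap_of hc hc', midSwap_of (by omega) (by omega),
    midSwap_of (by omega) (by omega), neg_one_sq, one_smul] at h
  rw [Tt_lie]
  have h' : ⁅E a p, Qm .D n 2 (E p c)⁆ = (2 : ℂ) • E a c := by
    refine (congrArg _ h).trans ?_
    rw [lie_add, lie_sub, lie_E, lie_E, if_pos rfl, if_neg hac, if_neg h1, if_neg h2]
    module
  rw [h', map_smul]

theorem Tt_lie_D_diag (hX : X = .D) {p c : Fin (size X n)} (hp : (p : ℕ) = n) (hc : (c : ℕ) ≠ n)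
    (hc' : (c : ℕ) ≠ n + 1) :
    ⁅Tt X n 1 (E p p), Tt X n 2 (E p c)⁆ = (2 : ℂ) • Tt X n 3 (E p c) := by
  subst hX
  have v1 := Fin.val_rev c
  have v2 := Fin.val_rev p
  simp only [size] at v1 v2
  have e1 : midSwap n p = p.rev := Fin.ext (by rw [midSwap_val, if_pos hp]; simp only [size]; omega)
  have e2 : midSwap n p.rev = p := by rw [← e1, midSwap_midSwap]
  have n1 : p ≠ c.rev := fun e => by have := congrArg Fin.val e; omega
  have n2 : p.rev ≠ p := fun e => by have := congrArg Fin.val e; omega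
  have n3 : c ≠ p := fun e => by have := congrArg Fin.val e; omega
  have ec : midSwap n c = c := midSwap_of hc hc'
  have ec' : midSwap n c.rev = c.rev := midSwap_of (by omega) (by omega)
  have h := Qm_E_D (n := n) 2 p c
  rw [e1, e2, ec, ec', neg_one_sq, one_smul] at h
  have h' : ⁅E p p, Qm .D n 2 (E p c)⁆ = E p c + E c.rev p := by
    refine (congrArg _ h).trans ?_
    rw [lie_add, lie_sub, lie_sub, lie_E, lie_E, lie_E, lie_E, if_pos rfl, if_neg n3, if_neg n1,
      if_neg n2, if_neg n2.symm, if_neg n3, if_neg n1, if_pos rfl]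
    module
  have h2 : Tt .D n 3 (E c.rev p - E p c) = 0 := by
    refine Tt_eq_zero ?_
    have e3 : (-1 : ℂ) ^ 3 = -1 := by norm_num
    have h3 := Qm_E_D (n := n) 3 p c
    have h4 := Qm_E_D (n := n) 3 c.rev p
    rw [e1, e2, ec, ec', e3] at h3
    rw [Fin.rev_rev, e1, e2, ec', ec, e3] at h4
    rw [map_sub]
    refine (congrArg₂ _ h4 h3).trans ?_
    module
  rw [map_sub, sub_eq_zero] at h2
  rw [Tt_lie, h', map_add, h2, two_smul]

/-- In type `D`, odd powers of `t` and degree one involve only short roots. -/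
theorem kills_of_short_D (hX : X = .D) {r : ℕ} (hr : r % 2 = 1)
    (h : ∀ p q : Fin (size X n), (p : ℕ) = n → (q : ℕ) ≤ i → ⁅Tt X n r (E p q), kgen X n i m⁆ = 0)
    {b : Fin n → ℤ} (hb : deg i b = -1) : Kills X n i m r b := by
  intro x hx
  have hsz : size X n = 2 * n + 2 := by rw [hX]
  have hi := i.2
  have h0 : b ≠ 0 := by
    rintro rfl
    simp [deg] at hb
  have hP : ∃ p : Fin (size X n), (p : ℕ) = n := ⟨⟨n, by omega⟩, rfl⟩
  obtain ⟨o, ho⟩ := hP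
  have hko : kap (size X n) n o = 0 := kap_mid (by omega) (by omega)
  have h1 : x ∈ (LinearMap.ker ((LieModule.toEnd ℂ (gt X n) (KR X n i m) :
      gt X n →ₗ[ℂ] Module.End ℂ (KR X n i m)).flip (kgen X n i m))).comap (Tt X n r) := by
    refine mem_of_E_mem _ fun p q hpq => ?_
    have h2 := hx p q hpq
    have h3 := deg_sub_kap (n := n) (i := i) p q
    rw [h2, hb] at h3
    change ⁅Tt X n r (E p q), kgen X n i m⁆ = 0
    have v1 := Fin.val_rev p
    by_cases hp : (p : ℕ) = n ∨ (p : ℕ) = n + 1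
    · refine kills_of_E (p := o) (q := q) ?_ h0 (h o q ho (by split_ifs at h3 <;> omega)) _
        (E_mem_wtMat_of h2)
      rw [hko, ← kap_mid (p := p) (by omega) (by omega), h2]
    · by_cases hq : (q : ℕ) = n ∨ (q : ℕ) = n + 1
      · refine kills_of_E (p := o) (q := p.rev) ?_ h0
          (h o p.rev ho (by split_ifs at h3 <;> omega)) _ (E_mem_wtMat_of h2)
        rw [hko, kap_rev, ← h2, kap_mid (p := q) (by omega) (by omega)]
        abel
      · rw [Tt_eq_zero_D hX hr (by omega) (by omega) (by omega) (by omega), zero_lie]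
  exact h1

/-- In type `D` the elements `x ⊗ t` of degree `-1` annihilate the generator for the last node only;
this is why letters `x ⊗ t` for short roots are needed for the other nodes. -/
theorem kills_deg_one_D (hX : X = .D) {r : ℕ} (hr : 2 ≤ r ∨ (i : ℕ) + 1 = n ∧ 1 ≤ r)
    {b : Fin n → ℤ} (hb : deg i b = -1) : Kills X n i m r b := by
  have hsz : size X n = 2 * n + 2 := by rw [hX]
  have hi' := i.2
  have h0 : b ≠ 0 := by
    rintro rfl
    simp [deg] at hb
  by_cases hi : (i : ℕ) + 1 < n
  · have h2 : ∀ {b : Fin n → ℤ}, deg i b = -1 → Kills X n i m 2 b := by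
      refine kills_deg_one kills_two fun _ p hp hp' => ?_
      have hiv := idx_val (X := X) i
      have hnv : (nxt X n i : ℕ) = i + 1 := rfl
      have v1 := Fin.val_rev (idx X n i)
      have v2 := Fin.val_rev (nxt X n i)
      have h1 : ⁅Tt X n 0 (E p (nxt X n i)), Tt X n 2 (E (nxt X n i) (idx X n i))⁆ =
          (2 : ℂ) • Tt X n 2 (E p (idx X n i)) :=
        Tt_lie_D_even hX 0 (by omega) (by omega) (by omega) (by omega)
          (fun e => by have := congrArg Fin.val e; omega)
          (fun e => by have := congrArg Fin.val e; omega)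
          (fun e => by have := congrArg Fin.val e; omega)
      have h3 : ⁅(2 : ℂ) • Tt X n 2 (E p (idx X n i)), kgen X n i m⁆ = 0 := by
        rw [← h1]
        refine kills_of_lie (kills_of_deg_eq_zero ?_ (Or.inl ?_) _ (E_mem_wtMat _ _))
          (kills_two _ ?_)
        · rw [deg_sub_kap]
          split_ifs <;> omega
        · intro e
          have h2 := congrFun e ⟨i + 1, hi⟩
          simp only [Pi.sub_apply, kap, Pi.zero_apply] at h2
          split_ifs at h2 <;> omega
        · exact E_mem_wtMat_of (by rw [← kap_idx_sub_nxt, neg_sub])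
      rw [smul_lie, smul_eq_zero] at h3
      exact h3.resolve_left two_ne_zero
    refine kills_of_le h0 (h2 hb) (kills_of_short_D hX rfl (fun p q hp hq => ?_) hb)
      (hr.resolve_right (by omega))
    have h3 : ⁅(2 : ℂ) • Tt X n 3 (E p q), kgen X n i m⁆ = 0 := by
      rw [← Tt_lie_D_diag hX hp (by omega) (by omega)]
      refine kills_of_lie (kills_zero le_rfl _ (E_mem_wtMat_of (sub_self _)))
        (h2 ?_ _ (E_mem_wtMat _ _))
      rw [deg_sub_kap]
      split_ifs <;> omega
    rw [smul_lie, smul_eq_zero] at h3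
    exact h3.resolve_left two_ne_zero
  · exact kills_of_le h0 (kills_deg_one kills_one (fun h => absurd h hi) hb)
      (kills_deg_one kills_two (fun h => absurd h hi) hb) (by omega)

/-- In type `D` the elements of degree `-2` are brackets of elements of degree `-1` for short roots,
so that, except for the last node, those with `t²` need not annihilate the generator. -/
theorem kills_deg_two_D (hX : X = .D) {r : ℕ} (hr : r % 2 = 1 ∨ 4 ≤ r ∨ (i : ℕ) + 1 = n ∧ 2 ≤ r)
    {b : Fin n → ℤ} (hb : deg i b = -2) : Kills X n i m r b := by
  have hsz : size X n = 2 * n + 2 := by rw [hX]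
  have hi := i.2
  refine exists_of_deg_two hb fun a c hac hc ha => ?_
  by_cases hodd : r % 2 = 1
  · rw [Tt_eq_zero_D hX hodd (by omega) (by omega) (by omega) (by omega), zero_lie]
  · obtain ⟨p, hp⟩ : ∃ p : Fin (size X n), (p : ℕ) = n := ⟨⟨n, by omega⟩, rfl⟩
    obtain ⟨s, t, hs, ht, rfl⟩ : ∃ s t, (2 ≤ s ∨ (i : ℕ) + 1 = n ∧ 1 ≤ s) ∧
        (2 ≤ t ∨ (i : ℕ) + 1 = n ∧ 1 ≤ t) ∧ r = s + t := by
      by_cases h4 : 4 ≤ r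
      · exact ⟨r - 2, 2, by omega, by omega, by omega⟩
      · exact ⟨r - 1, 1, by omega, by omega, by omega⟩
    rw [← Tt_lie_D hX s t hp (by omega) (by omega) (by omega) (by omega)
      (fun e => by have := congrArg Fin.val e; omega)]
    refine kills_of_lie (kills_deg_one_D hX hs ?_ _ (E_mem_wtMat _ _))
      (kills_deg_one_D hX ht ?_ _ (E_mem_wtMat _ _))
    · rw [deg_sub_kap]
      split_ifs <;> omega
    · rw [deg_sub_kap]
      split_ifs <;> omega

end Annihilation

/-! ### Spanning sets of Kirillov–Reshetikhin modules -/

section Spanning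

variable {X : TwistedType} {n : ℕ} {i : Fin n} {m : ℕ}

theorem lie_f_eq (p : (tri X n).P) (x : KR X n i m) :
    ⁅(tri X n).f p, x⁆ = ⁅constHom (sigma X n) ((tri X n).f p), x⁆ := rfl

/-- If the letters `z` and the vectors `x ⊗ 1` with `x ∈ 𝔫₀⁻` span a complement of the elements
acting on the generator by scalars, then the words in `z` generate the module under `𝔫₀⁻`. -/
theorem eq_top_of_letters (z : ℕ × ℕ → gt X n)
    (hzf : ∀ p x, ⁅constHom (sigma X n) ((tri X n).f p), z x⁆ ∈ Submodule.span ℂ (Set.range z))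
    (hgen : ∀ r, 1 ≤ r → ∀ p q : Fin (size X n), Tt X n r (E p q) ∈ Submodule.span ℂ (Set.range z) ∨
      ⁅Tt X n r (E p q), kgen X n i m⁆ = 0)
    (T : Submodule ℂ (KR X n i m)) (hT : ∀ p, ∀ x ∈ T, ⁅(tri X n).f p, x⁆ ∈ T)
    (hwd : ∀ L, wd (fun x => LieModule.toEnd ℂ (gt X n) (KR X n i m) (z x)) (kgen X n i m) L ∈ T) :
    T = ⊤ := by
  let v := kgen X n i m
  let Z := fun x => LieModule.toEnd ℂ (gt X n) (KR X n i m) (z x)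
  let C : Submodule ℂ (gt X n) := (Submodule.span ℂ (Set.range (tri X n).f)).map
    (constHom (sigma X n) : g0 X n →ₗ[ℂ] gt X n) ⊔ Submodule.span ℂ (Set.range z)
  let B : Submodule ℂ (gt X n) :=
    { carrier := {x | ∃ c : ℂ, ⁅x, v⁆ = c • v}
      add_mem' := by
        rintro x y ⟨c, hc⟩ ⟨d, hd⟩
        exact ⟨c + d, by rw [add_lie, hc, hd, add_smul]⟩
      zero_mem' := ⟨0, by simp⟩
      smul_mem' := by
        rintro a x ⟨c, hc⟩
        exact ⟨a * c, by rw [smul_lie, hc, smul_smul]⟩ }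
  have hB0 : ∀ x, ⁅x, v⁆ = 0 → x ∈ B := fun x hx => ⟨0, by rw [hx, zero_smul]⟩
  have hCB : C ⊔ B = ⊤ := by
    rw [eq_top_iff, ← span_Tt, Submodule.span_le]
    rintro _ ⟨r, x, rfl⟩
    rcases Nat.eq_zero_or_pos r with rfl | hr
    · rw [Tt_zero]
      have h1 : Q0 X n x ∈ Submodule.span ℂ (Set.range (tri X n).f) ⊔
          (Submodule.span ℂ (Set.range (tri X n).e) ⊔ Submodule.span ℂ (Set.range (tri X n).H)) := by
        rw [(tri X n).span_top]
        trivial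
      have h2 : Submodule.span ℂ (Set.range (tri X n).f) ⊔
          (Submodule.span ℂ (Set.range (tri X n).e) ⊔ Submodule.span ℂ (Set.range (tri X n).H)) ≤
          (C ⊔ B).comap (constHom (sigma X n) : g0 X n →ₗ[ℂ] gt X n) := by
        refine sup_le ?_ (sup_le ?_ ?_)
        · intro w hw
          exact Submodule.mem_sup_left (Submodule.mem_sup_left ⟨w, hw, rfl⟩)
        · rw [Submodule.span_le]
          rintro _ ⟨p, rfl⟩
          exact Submodule.mem_sup_right (hB0 _ (kgen_mem_Sing.2 p))
        · rw [Submodule.span_le]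
          rintro _ ⟨a, rfl⟩
          exact Submodule.mem_sup_right ⟨_, kgen_mem_wt a⟩
      exact h2 h1
    · have h1 : x ∈ (C ⊔ B).comap (Tt X n r) := by
        refine mem_of_E_mem _ fun p q _ => ?_
        rcases hgen r hr p q with h | h
        · exact Submodule.mem_sup_left (Submodule.mem_sup_right h)
        · exact Submodule.mem_sup_right (hB0 _ h)
      exact h1
  let S : Submodule ℂ (KR X n i m) :=
    Submodule.span ℂ {x | ∃ L d, (tri X n).Word (wd Z v L) d x}
  have hz : ∀ y ∈ Submodule.span ℂ (Set.range z), ∀ (L : List (ℕ × ℕ)) d x,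
      (tri X n).Word (wd Z v L) d x → ⁅y, x⁆ ∈ S := by
    intro y hy L d x hx
    induction hx generalizing y with
    | base =>
      induction hy using Submodule.span_induction with
      | mem y hy =>
        obtain ⟨a, rfl⟩ := hy
        refine Submodule.subset_span ⟨a :: L, 0, ?_⟩
        have h1 : ⁅z a, wd Z v L⁆ = wd Z v (a :: L) := (wd_cons Z v a L).symm
        rw [h1]
        exact TriData.Word.base
      | zero => rw [zero_lie]; exact zero_mem _
      | add a b _ _ ha hb => rw [add_lie]; exact add_mem ha hb
      | smul c a _ ha => rw [smul_lie]; exact Submodule.smul_mem _ _ ha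
    | step p d x hx ih =>
      have h1 : ⁅constHom (sigma X n) ((tri X n).f p), y⁆ ∈ Submodule.span ℂ (Set.range z) := by
        clear ih
        induction hy using Submodule.span_induction with
        | mem y hy => obtain ⟨a, rfl⟩ := hy; exact hzf p a
        | zero => rw [lie_zero]; exact zero_mem _
        | add a b _ _ ha hb => rw [lie_add]; exact add_mem ha hb
        | smul c a _ ha => rw [lie_smul]; exact Submodule.smul_mem _ _ ha
      rw [lie_f_eq, leibniz_lie, ← lie_skew, neg_lie]
      refine add_mem (neg_mem (ih _ h1)) ?_
      have h2 := ih _ hy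
      generalize ⁅y, x⁆ = u at h2 ⊢
      induction h2 using Submodule.span_induction with
      | mem u hu =>
        obtain ⟨L', d', hu⟩ := hu
        exact Submodule.subset_span ⟨L', _, hu.step p⟩
      | zero => rw [lie_zero]; exact zero_mem _
      | add a b _ _ ha hb => rw [lie_add]; exact add_mem ha hb
      | smul c a _ ha => rw [lie_smul]; exact Submodule.smul_mem _ _ ha
  have hS : ∀ c ∈ C, ∀ x ∈ S, ⁅c, x⁆ ∈ S := by
    intro c hc x hx
    obtain ⟨_, ⟨w, hw, rfl⟩, y, hy, rfl⟩ := Submodule.mem_sup.1 hc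
    rw [add_lie]
    refine add_mem ?_ ?_
    · clear hc
      change ⁅w, x⁆ ∈ S
      induction hw using Submodule.span_induction with
      | mem w hw =>
        obtain ⟨p, rfl⟩ := hw
        induction hx using Submodule.span_induction with
        | mem u hu =>
          obtain ⟨L', d', hu⟩ := hu
          exact Submodule.subset_span ⟨L', _, hu.step p⟩
        | zero => rw [lie_zero]; exact zero_mem _
        | add a b _ _ ha hb => rw [lie_add]; exact add_mem ha hb
        | smul c a _ ha => rw [lie_smul]; exact Submodule.smul_mem _ _ ha
      | zero => rw [zero_lie]; exact zero_mem _
      | add a b _ _ ha hb => rw [add_lie]; exact add_mem ha hb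
      | smul c a _ ha => rw [smul_lie]; exact Submodule.smul_mem _ _ ha
    · induction hx using Submodule.span_induction with
      | mem u hu =>
        obtain ⟨L', d', hu⟩ := hu
        exact hz y hy L' d' u hu
      | zero => rw [lie_zero]; exact zero_mem _
      | add a b _ _ ha hb => rw [lie_add]; exact add_mem ha hb
      | smul c a _ ha => rw [lie_smul]; exact Submodule.smul_mem _ _ ha
  have h1 := lieSpan_le_of_words C B hCB v (fun b hb => hb) S
    (Submodule.subset_span ⟨[], 0, TriData.Word.base⟩) hS
  rw [lieSpan_kgen] at h1
  rw [eq_top_iff]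
  refine h1.trans (Submodule.span_le.2 ?_)
  rintro x ⟨L, d, hx⟩
  induction hx with
  | base => exact hwd L
  | step p d x _ ih => exact hT p x ih

/-! ### Letters -/

/-- The coordinate with number `a`. -/
def co (X : TwistedType) (n : ℕ) (i : Fin n) (a : ℕ) : Fin (size X n) :=
  if h : a < size X n then ⟨a, h⟩ else idx X n i

theorem co_val {a : ℕ} (h : a ≤ i) : (co X n i a : ℕ) = a := by
  have := two_mul_le_size (X := X) (n := n)
  have := i.2
  rw [co, dif_pos (by omega)]

theorem co_self (p : Fin (size X n)) : co X n i p = p := by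
  rw [co, dif_pos p.2]

/-- The lowering operators acting on the letters. -/
def lowering (X : TwistedType) (n : ℕ) (i : Fin n) (c d : ℕ) : gt X n :=
  (-(cc X : ℂ)⁻¹) • Tt X n 0 (E (co X n i c) (co X n i d))

theorem lowering_kgen {c d : ℕ} (hdc : d < c) (hc : c ≤ i) :
    ⁅lowering X n i c d, kgen X n i m⁆ = 0 := by
  have h1 := co_val (X := X) hc
  have h2 := co_val (X := X) (hdc.le.trans hc)
  have hN := two_mul_le_size (X := X) (n := n)
  have hi := i.2
  rw [lowering, smul_lie, kills_of_deg_eq_zero ?_ (Or.inl ?_) _ (E_mem_wtMat _ _), smul_zero]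
  · rw [deg_sub_kap]
    split_ifs <;> omega
  · intro e
    have h2 := congrFun e ⟨c, by omega⟩
    simp only [Pi.sub_apply, kap, Pi.zero_apply] at h2
    split_ifs at h2 <;> omega

theorem lowering_mem {c d : ℕ} (hdc : d < c) (hc : c ≤ i) (T : Submodule ℂ (KR X n i m))
    (hT : ∀ p, ∀ x ∈ T, ⁅(tri X n).f p, x⁆ ∈ T) (x : KR X n i m) (hx : x ∈ T) :
    ⁅lowering X n i c d, x⁆ ∈ T := by
  have h1 := co_val (X := X) hc
  have h2 := co_val (X := X) (hdc.le.trans hc)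
  have hN := two_mul_le_size (X := X) (n := n)
  have hi := i.2
  rw [lowering, smul_lie, Tt_zero]
  refine Submodule.smul_mem _ _ (hT ⟨(co X n i d, co X n i c), ?_, fun e => ?_⟩ x hx)
  · change (co X n i d : ℕ) < co X n i c
    omega
  · have h2 := congrFun e ⟨c, by omega⟩
    simp only [kap] at h2
    split_ifs at h2 <;> omega

theorem Tt_E_of_kap_sub_eq (r : ℕ) {p q p' q' : Fin (size X n)}
    (hpq : kap (size X n) n p ≠ kap _ n q)
    (h : kap (size X n) n p - kap _ n q = kap _ n p' - kap _ n q') :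
    ∃ c : ℂ, Tt X n r (E p q) = c • Tt X n r (E p' q') := by
  obtain ⟨c, hc⟩ := Qm_E_of_kap_sub_eq r hpq h
  refine ⟨c, ?_⟩
  have h2 := Tt_Qm r (E p q)
  rw [hc, map_smul, Tt_Qm, smul_comm] at h2
  exact (smul_right_injective _ two_cc_ne_zero h2).symm

/-- The bracket of a negative root vector with a letter has a smaller degree. -/
theorem lie_f_Tt_mem {z : ℕ × ℕ → gt X n} {r : ℕ} {s : ℤ}
    (h : ∀ p q : Fin (size X n), deg i (kap (size X n) n p - kap _ n q) ≤ s →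
      Tt X n r (E p q) ∈ Submodule.span ℂ (Set.range z)) (k : (tri X n).P)
    {b : Fin n → ℤ} (hb : deg i b ≤ s) {x : Mat X n} (hx : x ∈ wtMat (size X n) n b) :
    ⁅constHom (sigma X n) ((tri X n).f k), Tt X n r x⁆ ∈ Submodule.span ℂ (Set.range z) := by
  rw [constHom_lie_Tt]
  have h1 := lie_mem_wtMat (Qm_mem_wtMat 0 (E_mem_wtMat k.1.2 k.1.1)) hx
  have h2 : ⁅((tri X n).f k).1.1, x⁆ ∈ (Submodule.span ℂ (Set.range z)).comap (Tt X n r) := by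
    refine mem_of_E_mem _ fun p q hpq => h p q ?_
    rw [h1 p q hpq, deg_add]
    have h3 : 0 ≤ deg i (kap (size X n) n k.1.1 - kap _ n k.1.2) := (tri X n).rt_nonneg k i
    rw [← neg_sub, deg_neg]
    omega
  exact h2

end Spanning

section Letters

variable {X : TwistedType} {n : ℕ} {i : Fin n} {m : ℕ}

/-- The coordinate vector `e_a` for `a ≤ i`. -/
def unitVec (n : ℕ) (i : Fin n) (a : ℕ) : Fin n → ℤ := fun x => if (x : ℕ) = a ∧ a ≤ i then 1 else 0

theorem kap_co {a : ℕ} (ha : a ≤ i) : kap (size X n) n (co X n i a) = unitVec n i a := by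
  have h1 := co_val (X := X) ha
  have hN := two_mul_le_size (X := X) (n := n)
  have hi := i.2
  ext x
  have hx := x.2
  simp only [kap, unitVec]
  split_ifs <;> omega

/-- A letter `z a b` has weight `-(e_a + e_b)`. -/
def HasLetterWeights (z : ℕ × ℕ → gt X n) (i : Fin n) : Prop :=
  ∀ x, ∃ r, ∃ y ∈ wtMat (size X n) n (-(unitVec n i x.1 + unitVec n i x.2)), z x = Tt X n r y

theorem wd_mem_wt {z : ℕ × ℕ → gt X n} (hz : HasLetterWeights z i) (L : List (ℕ × ℕ)) :
    wd (fun x => LieModule.toEnd ℂ (gt X n) (KR X n i m) (z x)) (kgen X n i m) L ∈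
      (tri X n).wt (KR X n i m) (ev X (m • om n ((i : ℕ) + 1)) -
        cst (L.map fun x => unitVec n i x.1 + unitVec n i x.2).sum) := by
  induction L with
  | nil => simpa using kgen_mem_wt
  | cons x L ih =>
    rw [wd_cons]
    obtain ⟨r, y, hy, hx⟩ := hz x
    have h1 := lie_Tt_mem_wt ih hy r
    rw [← hx, cst_neg, ← sub_eq_add_neg, sub_sub, ← cst_add] at h1
    rw [List.map_cons, List.sum_cons, add_comm (unitVec n i x.1 + unitVec n i x.2)]
    exact h1

/-- The depth of the monomial in the diagonal letters. -/
theorem sum_symWord (k : ℕ → ℕ) (b : ℕ) (x : Fin n) :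
    ((symWord k b).map fun x => unitVec n i x.1 + unitVec n i x.2).sum x =
      if (x : ℕ) < b ∧ (x : ℕ) ≤ i then 2 * (k x : ℤ) else 0 := by
  induction b with
  | zero => simp [symWord]
  | succ b ih =>
    rw [symWord, List.map_append, List.sum_append, List.map_replicate, List.sum_replicate,
      Pi.add_apply, ih, Pi.smul_apply, Pi.add_apply, unitVec]
    by_cases hx : (x : ℕ) = b
    · subst hx
      by_cases hi : (x : ℕ) ≤ i
      · simp [hi]; ring
      · simp [hi]
    · rw [if_neg (fun h => hx h.1)]
      have : (x : ℕ) < b + 1 ↔ (x : ℕ) < b := by omega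
      simp [this]

/-- The depth of the monomial in the letters of an antidiagonal of pairs, at the coordinate `x`. -/
def altDepth (k : ℕ → ℕ) (b x : ℕ) : ℕ :=
  if x < b then (if (b - x) % 2 = 1 ∧ x ≠ 0 then k x + k (x - 1) else k x) else 0

theorem sum_altWord (k : ℕ → ℕ) (x : Fin n) : ∀ b : ℕ, b ≤ (i : ℕ) + 1 →
    ((altWord ((i : ℕ) + 1) k b).map fun x => unitVec n i x.1 + unitVec n i x.2).sum x =
      altDepth k b x
  | 0, _ => by simp [altWord, altDepth]
  | 1, _ => by
    simp only [altWord, List.map_replicate, List.sum_replicate, Pi.smul_apply, Pi.add_apply,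
      unitVec, altDepth]
    by_cases hx : (x : ℕ) = 0
    · simp [hx]
    · simp [hx]
  | b + 2, hb => by
    have ih := sum_altWord k x b (by omega)
    simp only [altWord, List.map_append, List.sum_append, List.map_replicate, List.sum_replicate,
      Pi.smul_apply, Pi.add_apply, ih, unitVec, altDepth]
    by_cases h1 : (x : ℕ) = b + 1
    · have e1 : b + 2 - (x : ℕ) = 1 := by omega
      have e2 : ((x : ℕ) = b + 1 ∧ b + 1 ≤ (i : ℕ)) := ⟨h1, by omega⟩
      have e3 : ¬((x : ℕ) = b ∧ b ≤ (i : ℕ)) := by omega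
      have e4 : ¬((x : ℕ) = (i : ℕ) + 1 ∧ (i : ℕ) + 1 ≤ (i : ℕ)) := by omega
      rw [if_pos e2, if_neg e3, if_neg e4, if_neg (by omega : ¬(x : ℕ) < b), if_pos (by omega),
        if_pos (by omega), h1]
      push_cast
      simp
      ring
    · have e2 : ¬((x : ℕ) = b + 1 ∧ b + 1 ≤ (i : ℕ)) := by omega
      have e4 : ¬((x : ℕ) = (i : ℕ) + 1 ∧ (i : ℕ) + 1 ≤ (i : ℕ)) := by omega
      rw [if_neg e2, if_neg e4]
      by_cases h2 : (x : ℕ) = b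
      · have e3 : ((x : ℕ) = b ∧ b ≤ (i : ℕ)) := ⟨h2, by omega⟩
        rw [if_pos e3, if_neg (by omega : ¬(x : ℕ) < b), if_pos (by omega), if_neg (by omega), h2]
        simp
      · have e3 : ¬((x : ℕ) = b ∧ b ≤ (i : ℕ)) := by omega
        rw [if_neg e3]
        by_cases h3 : (x : ℕ) < b
        · have e5 : ((b + 2 - (x : ℕ)) % 2 = 1 ∧ (x : ℕ) ≠ 0) ↔ ((b - (x : ℕ)) % 2 = 1 ∧ (x : ℕ) ≠ 0) := by
            omega
          rw [if_pos h3, if_pos (by omega : (x : ℕ) < b + 2), if_congr e5 rfl rfl]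
          simp
        · rw [if_neg h3, if_neg (by omega)]
          simp

/-! #### Type `A` -/

/-- The matrices of the letters in type `A`: multiples of `E_{b' a}`, where `b'` is opposite to
`b`. -/
def matA (X : TwistedType) (n : ℕ) (i : Fin n) (a b : ℕ) : Mat X n :=
  if a ≤ i ∧ b ≤ i then (-1 : ℂ) ^ b • E (co X n i b).rev (co X n i a) else 0

/-- The letters in type `A`, of the form `x ⊗ t`. -/
def lettersA (X : TwistedType) (n : ℕ) (i : Fin n) (x : ℕ × ℕ) : gt X n :=
  Tt X n 1 (matA X n i x.1 x.2)

theorem matA_mem (a b : ℕ) :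
    matA X n i a b ∈ wtMat (size X n) n (-(unitVec n i a + unitVec n i b)) := by
  by_cases h : a ≤ (i : ℕ) ∧ b ≤ (i : ℕ)
  · rw [matA, if_pos h]
    refine Submodule.smul_mem _ _ (E_mem_wtMat_of ?_)
    rw [kap_rev, kap_co h.1, kap_co h.2]
    abel
  · rw [matA, if_neg h]
    exact zero_mem _

theorem lettersA_weights : HasLetterWeights (lettersA X n i) i := fun x =>
  ⟨1, matA X n i x.1 x.2, matA_mem _ _, rfl⟩

theorem co_eq_iff {a b : ℕ} (ha : a ≤ i) (hb : b ≤ i) : co X n i a = co X n i b ↔ a = b := by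
  rw [Fin.ext_iff, co_val ha, co_val hb]

theorem lettersA_mem (p q : Fin (size X n))
    (h : deg i (kap (size X n) n p - kap _ n q) ≤ -2) :
    Tt X n 1 (E p q) ∈ Submodule.span ℂ (Set.range (lettersA X n i)) := by
  rw [deg_sub_kap] at h
  have hN := two_mul_le_size (X := X) (n := n)
  have hi := i.2
  have v := Fin.val_rev p
  have hq : (q : ℕ) ≤ i := by split_ifs at h <;> omega
  have hp : (p.rev : ℕ) ≤ i := by split_ifs at h <;> omega
  have h1 : lettersA X n i (q, p.rev) = (-1 : ℂ) ^ (p.rev : ℕ) • Tt X n 1 (E p q) := by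
    rw [lettersA, matA, if_pos ⟨hq, hp⟩, co_self, co_self, Fin.rev_rev, map_smul]
  have h2 : Tt X n 1 (E p q) = (-1 : ℂ) ^ (p.rev : ℕ) • lettersA X n i (q, p.rev) := by
    rw [h1, smul_smul, neg_one_pow_mul_self, one_smul]
  rw [h2]
  exact Submodule.smul_mem _ _ (Submodule.subset_span ⟨_, rfl⟩)

/-- The letters in type `A` form a symmetric matrix if the size is odd and an antisymmetric one if
it is even. -/
theorem lettersA_swap (hX : X ≠ .D) (a b : ℕ) :
    lettersA X n i (a, b) = (-(-1 : ℂ) ^ size X n) • lettersA X n i (b, a) := by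
  by_cases h : a ≤ (i : ℕ) ∧ b ≤ (i : ℕ)
  · have ha := co_val (X := X) h.1
    have hb := co_val (X := X) h.2
    have hN := two_mul_le_size (X := X) (n := n)
    have hi := i.2
    have v := Fin.val_rev (co X n i a)
    have hne : (co X n i a).rev ≠ co X n i b := fun e => by
      have := congrArg Fin.val e
      omega
    have h1 := Tt_rev_A hX 1 hne
    rw [Fin.rev_rev] at h1
    rw [lettersA, lettersA, matA, matA, if_pos h, if_pos h.symm, map_smul, map_smul, h1, smul_smul,
      smul_smul]
    congr 1
    rw [v, ha, hb]
    have e1 : (-1 : ℂ) ^ (1 + (size X n - (a + 1)) + b) * (-1) ^ a = (-1) ^ b * (-1) ^ size X n := by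
      rw [← pow_add, ← pow_add]
      congr 1
      omega
    have e2 := neg_one_pow_mul_self a
    have e3 := neg_one_pow_mul_self b
    linear_combination (-(-1 : ℂ) ^ a * (-1) ^ b) * e1 +
      ((-1 : ℂ) ^ b * (-1) ^ (1 + (size X n - (a + 1)) + b)) * e2 - ((-1 : ℂ) ^ a * (-1) ^ size X n) * e3
  · rw [lettersA, lettersA, matA, matA, if_neg h, if_neg (fun h' => h h'.symm), map_zero, smul_zero]

theorem smul_ite_sub_ite {W : Type} [AddCommGroup W] [Module ℂ W] (A B : W) {P Q : Prop}
    [Decidable P] [Decidable Q] (β γ δ : ℂ) (h : Q → β * γ = 1) :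
    (-1 : ℂ) • β • (-(if P then A else 0) - (γ * δ) • (if Q then B else 0)) =
      (if P then β • A else 0) + (if Q then δ • B else 0) := by
  by_cases hQ : Q
  · have e : β * (γ * δ) = δ := by rw [← mul_assoc, h hQ, one_mul]
    rw [if_pos hQ, if_pos hQ, smul_sub, smul_smul β, e]
    split_ifs <;> module
  · rw [if_neg hQ, if_neg hQ]
    split_ifs <;> module

theorem lie_matA (hX : X ≠ .D) {c d : ℕ} (hdc : d < c) (hc : c ≤ i) (a b : ℕ) :
    (-1 : ℂ) • ⁅Qm X n 0 (E (co X n i c) (co X n i d)), matA X n i a b⁆ =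
      (if a = c then matA X n i d b else 0) + (if b = c then matA X n i a d else 0) := by
  have hd : d ≤ (i : ℕ) := by omega
  have vc := co_val (X := X) hc
  have vd := co_val (X := X) hd
  by_cases h : a ≤ (i : ℕ) ∧ b ≤ (i : ℕ)
  · have va := co_val (X := X) h.1
    have vb := co_val (X := X) h.2
    have hN := two_mul_le_size (X := X) (n := n)
    have hi := i.2
    have rb := Fin.val_rev (co X n i b)
    have rd := Fin.val_rev (co X n i d)
    have n1 : co X n i d ≠ (co X n i b).rev := fun e => by have := congrArg Fin.val e; omega
    have n2 : co X n i a ≠ (co X n i d).rev := fun e => by have := congrArg Fin.val e; omega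
    have n3 : co X n i c ≠ co X n i d := fun e => by have := congrArg Fin.val e; omega
    have e1 : matA X n i a b = (-1 : ℂ) ^ b • E (co X n i b).rev (co X n i a) := if_pos h
    have e2 : matA X n i d b = (-1 : ℂ) ^ b • E (co X n i b).rev (co X n i d) := if_pos ⟨hd, h.2⟩
    have e3 : matA X n i a d = (-1 : ℂ) ^ d • E (co X n i d).rev (co X n i a) := if_pos ⟨h.1, hd⟩
    have h3 : (co X n i c).rev = (co X n i b).rev ↔ b = c := by
      rw [Fin.rev_inj, eq_comm, co_eq_iff h.2 hc]
    rw [e1, e2, e3, lie_smul, Qm_E_A hX 0 n3, sub_lie, smul_lie, lie_E, lie_E, if_neg n1, if_neg n2,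
      zero_sub, sub_zero, vc, vd, zero_add, pow_add]
    simp only [h3, co_eq_iff h.1 hc]
    exact smul_ite_sub_ite _ _ _ _ _ fun hb => by rw [hb, neg_one_pow_mul_self]
  · have h0 : matA X n i a b = 0 := if_neg h
    rw [h0, lie_zero, smul_zero]
    by_cases ha : a = c
    · have hb : ¬b ≤ (i : ℕ) := by omega
      have e1 : matA X n i d b = 0 := if_neg fun h' => hb h'.2
      rw [e1, if_neg (by omega : b ≠ c), if_pos ha, add_zero]
    · by_cases hb : b = c
      · have e1 : matA X n i a d = 0 := if_neg fun h' => h ⟨h'.1, by omega⟩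
        rw [e1, if_neg ha, if_pos hb, add_zero]
      · rw [if_neg ha, if_neg hb, add_zero]

theorem lowering_lettersA (hX : X ≠ .D) {c d : ℕ} (hdc : d < c) (hc : c ≤ i) (a b : ℕ) :
    ⁅lowering X n i c d, lettersA X n i (a, b)⁆ =
      Tt X n 1 ((if a = c then matA X n i d b else 0) + (if b = c then matA X n i a d else 0)) := by
  have hcc : cc X = 1 := by cases X <;> simp_all [cc]
  rw [← lie_matA hX hdc hc, lowering, lettersA, smul_lie, Tt_lie', hcc, map_smul, zero_add,
    Nat.cast_one, inv_one]

/-- In type `A` an element `x ⊗ t ^ r` with `r ≥ 1` is a combination of letters or annihilates the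
generator. -/
theorem Tt_E_or_A (hX : X ≠ .D) (r : ℕ) (hr : 1 ≤ r) (p q : Fin (size X n)) :
    Tt X n r (E p q) ∈ Submodule.span ℂ (Set.range (lettersA X n i)) ∨
      ⁅Tt X n r (E p q), kgen X n i m⁆ = 0 := by
  by_cases h0 : 0 < deg i (kap (size X n) n p - kap _ n q)
  · right
    have hpq : p ≤ q := by
      by_contra hc
      have h1 : 0 ≤ deg i (kap (size X n) n q - kap _ n p) := Qpos_kap (not_le.1 hc).le i
      rw [← neg_sub, deg_neg] at h1
      omega
    refine kills_of_pos r (Qpos_kap hpq) (fun e => ?_) _ (E_mem_wtMat _ _)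
    rw [e] at h0
    simp [deg] at h0
  · by_cases h1 : deg i (kap (size X n) n p - kap _ n q) = 0
    · exact Or.inr (kills_of_deg_eq_zero h1 (Or.inr hr) _ (E_mem_wtMat _ _))
    · by_cases h2 : deg i (kap (size X n) n p - kap _ n q) = -1
      · exact Or.inr (kills_deg_one_A hX hr h2 _ (E_mem_wtMat _ _))
      · by_cases hr2 : 2 ≤ r
        · refine Or.inr (kills_deg_two_A hX hr2 ?_ _ (E_mem_wtMat _ _))
          rw [deg_sub_kap] at *
          split_ifs at * <;> omega
        · obtain rfl : r = 1 := by omega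
          exact Or.inl (lettersA_mem p q (by omega))

theorem deg_unitVec {a : ℕ} (ha : a ≤ i) : deg i (unitVec n i a) = 1 := by
  have h := sum_Iic_ite i a (1 : ℤ)
  rw [if_pos ha] at h
  simp only [deg, unitVec, ha, and_true]
  exact h

theorem lie_f_lettersA (p : (tri X n).P) (x : ℕ × ℕ) :
    ⁅constHom (sigma X n) ((tri X n).f p), lettersA X n i x⁆ ∈
      Submodule.span ℂ (Set.range (lettersA X n i)) := by
  by_cases h : x.1 ≤ (i : ℕ) ∧ x.2 ≤ (i : ℕ)
  · refine lie_f_Tt_mem (s := -2) lettersA_mem p ?_ (matA_mem x.1 x.2)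
    rw [deg_neg, deg_add, deg_unitVec h.1, deg_unitVec h.2]
    norm_num
  · rw [lettersA, matA, if_neg h, map_zero, lie_zero]
    exact zero_mem _

theorem eq_zero_of_deg_lt {b : Fin n → ℤ} (hb : deg i b < -2) {x : Mat X n}
    (hx : x ∈ wtMat (size X n) n b) : x = 0 := by
  ext p q
  by_contra hc
  have h1 := deg_sub_kap (n := n) (i := i) p q
  rw [hx p q hc] at h1
  split_ifs at h1 <;> omega

theorem lettersA_lie (x y : ℕ × ℕ) : ⁅lettersA X n i x, lettersA X n i y⁆ = 0 := by
  by_cases hx : x.1 ≤ (i : ℕ) ∧ x.2 ≤ (i : ℕ)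
  · by_cases hy : y.1 ≤ (i : ℕ) ∧ y.2 ≤ (i : ℕ)
    · rw [lettersA, lettersA, Tt_lie, eq_zero_of_deg_lt (i := i) ?_ (lie_mem_wtMat (matA_mem _ _)
        (Qm_mem_wtMat 1 (matA_mem _ _))), map_zero]
      rw [deg_add, deg_neg, deg_add, deg_neg, deg_add, deg_unitVec hx.1, deg_unitVec hx.2,
        deg_unitVec hy.1, deg_unitVec hy.2]
      norm_num
    · rw [lettersA, lettersA, matA, matA, if_neg hy, map_zero, lie_zero]
  · rw [lettersA, matA, if_neg hx, map_zero, zero_lie]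

end Letters

section LettersD

variable {X : TwistedType} {n : ℕ} {i : Fin n} {m : ℕ}

/-! #### Type `D` -/

/-- The matrices of the letters in type `D`: up to a sign, `E_{b' a}`, where `b'` is opposite to
`b`, and, if one of the two indices is the additional index `i + 1`, the unit `E_{o a}` with `o` a
middle coordinate. -/
def matD (X : TwistedType) (n : ℕ) (i : Fin n) (a b : ℕ) : Mat X n :=
  if a ≤ i ∧ b ≤ i then -E (co X n i b).rev (co X n i a)
  else if a ≤ i ∧ b = i + 1 then E (co X n i n) (co X n i a)
  else if b ≤ i ∧ a = i + 1 then -E (co X n i n) (co X n i b) else 0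

/-- The letters in type `D`. Long roots come with `t ^ 2` and short roots with `t`. -/
def lettersD (X : TwistedType) (n : ℕ) (i : Fin n) (x : ℕ × ℕ) : gt X n :=
  Tt X n (if x.1 ≤ i ∧ x.2 ≤ i then 2 else 1) (matD X n i x.1 x.2)

theorem matD_long {a b : ℕ} (ha : a ≤ i) (hb : b ≤ i) :
    matD X n i a b = -E (co X n i b).rev (co X n i a) := if_pos ⟨ha, hb⟩

theorem matD_right {a : ℕ} (ha : a ≤ i) :
    matD X n i a (i + 1) = E (co X n i n) (co X n i a) := by
  rw [matD, if_neg (by omega), if_pos ⟨ha, rfl⟩]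

theorem matD_left {b : ℕ} (hb : b ≤ i) :
    matD X n i (i + 1) b = -E (co X n i n) (co X n i b) := by
  rw [matD, if_neg (by omega), if_neg (by omega), if_pos ⟨hb, rfl⟩]

theorem matD_eq_zero {a b : ℕ} (h : (i : ℕ) < a ∧ (i : ℕ) < b ∨ (i : ℕ) + 1 < a ∨ (i : ℕ) + 1 < b) :
    matD X n i a b = 0 := by
  rw [matD, if_neg (by omega), if_neg (by omega), if_neg (by omega)]

theorem matD_cases (i : Fin n) (a b : ℕ) : (a ≤ (i : ℕ) ∧ b ≤ (i : ℕ)) ∨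
    (a ≤ (i : ℕ) ∧ b = i + 1) ∨ (b ≤ (i : ℕ) ∧ a = i + 1) ∨
    ((i : ℕ) < a ∧ (i : ℕ) < b ∨ (i : ℕ) + 1 < a ∨ (i : ℕ) + 1 < b) := by
  omega

theorem lettersD_long {a b : ℕ} (ha : a ≤ i) (hb : b ≤ i) :
    lettersD X n i (a, b) = Tt X n 2 (-E (co X n i b).rev (co X n i a)) := by
  rw [lettersD, matD_long ha hb, if_pos ⟨ha, hb⟩]

theorem lettersD_right {a : ℕ} (ha : a ≤ i) :
    lettersD X n i (a, i + 1) = Tt X n 1 (E (co X n i n) (co X n i a)) := by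
  rw [lettersD, matD_right ha, if_neg (by omega)]

theorem lettersD_left {b : ℕ} (hb : b ≤ i) :
    lettersD X n i (i + 1, b) = Tt X n 1 (-E (co X n i n) (co X n i b)) := by
  rw [lettersD, matD_left hb, if_neg (by omega)]

theorem lettersD_eq_zero {a b : ℕ}
    (h : (i : ℕ) < a ∧ (i : ℕ) < b ∨ (i : ℕ) + 1 < a ∨ (i : ℕ) + 1 < b) :
    lettersD X n i (a, b) = 0 := by
  rw [lettersD, matD_eq_zero h, map_zero]

theorem co_mid (hX : X = .D) (i : Fin n) : (co X n i n : ℕ) = n := by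
  subst hX
  rw [co, dif_pos (by simp only [size]; omega)]

theorem kap_co_mid (hX : X = .D) : kap (size X n) n (co X n i n) = 0 := by
  have h1 := co_mid hX i
  have hsz : size X n = 2 * n + 2 := by rw [hX]
  exact kap_mid (by omega) (by omega)

theorem matD_mem (hX : X = .D) (a b : ℕ) :
    matD X n i a b ∈ wtMat (size X n) n (-(unitVec n i a + unitVec n i b)) := by
  have h0 : unitVec n i (i + 1) = 0 := by
    ext x
    rw [unitVec, if_neg (by omega)]
    rfl
  rcases matD_cases i a b with h | ⟨h, rfl⟩ | ⟨h, rfl⟩ | h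
  · rw [matD_long h.1 h.2]
    refine neg_mem (E_mem_wtMat_of ?_)
    rw [kap_rev, kap_co h.1, kap_co h.2]
    abel
  · rw [matD_right h]
    refine E_mem_wtMat_of ?_
    rw [kap_co_mid hX, kap_co h, h0]
    abel
  · rw [matD_left h]
    refine neg_mem (E_mem_wtMat_of ?_)
    rw [kap_co_mid hX, kap_co h, h0]
    abel
  · rw [matD_eq_zero h]
    exact zero_mem _

theorem lettersD_weights (hX : X = .D) : HasLetterWeights (lettersD X n i) i := fun x =>
  ⟨_, matD X n i x.1 x.2, matD_mem hX _ _, rfl⟩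

theorem Tt_rev_D (hX : X = .D) (r : ℕ) (p q : Fin (size X n)) :
    Tt X n r (E q.rev p.rev) = -Tt X n r (E p q) := by
  subst hX
  rw [eq_neg_iff_add_eq_zero, ← map_add]
  refine Tt_eq_zero ?_
  rw [map_add]
  have h1 := Qm_E_D (n := n) r p q
  have h2 := Qm_E_D (n := n) r q.rev p.rev
  rw [Fin.rev_rev, Fin.rev_rev] at h2
  refine (congrArg₂ _ h2 h1).trans ?_
  module

/-- The letters in type `D` form an antisymmetric matrix. -/
theorem lettersD_swap (hX : X = .D) (a b : ℕ) :
    lettersD X n i (a, b) = -lettersD X n i (b, a) := by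
  rcases matD_cases i a b with h | ⟨h, rfl⟩ | ⟨h, rfl⟩ | h
  · have h1 := Tt_rev_D hX 2 (co X n i b).rev (co X n i a)
    rw [Fin.rev_rev] at h1
    rw [lettersD_long h.1 h.2, lettersD_long h.2 h.1, map_neg, map_neg, h1, neg_neg]
  · rw [lettersD_right h, lettersD_left h, map_neg, neg_neg]
  · rw [lettersD_right h, lettersD_left h, map_neg]
  · rw [lettersD_eq_zero h, lettersD_eq_zero (by omega), neg_zero]

theorem Qm_zero_E_D (hX : X = .D) {p q : Fin (size X n)} (hp : (p : ℕ) ≠ n)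
    (hp' : (p : ℕ) ≠ n + 1) (hq : (q : ℕ) ≠ n) (hq' : (q : ℕ) ≠ n + 1) :
    Qm X n 0 (E p q) = (2 : ℂ) • (E p q - E q.rev p.rev) := by
  subst hX
  have v1 := Fin.val_rev p
  have v2 := Fin.val_rev q
  simp only [size] at v1 v2
  refine (Qm_E_D (n := n) 0 p q).trans ?_
  rw [midSwap_of hp hp', midSwap_of hq hq', midSwap_of (by omega) (by omega),
    midSwap_of (by omega) (by omega), pow_zero, one_smul, two_smul]

theorem lie_matD (hX : X = .D) {c d : ℕ} (hdc : d < c) (hc : c ≤ i) (a b : ℕ) :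
    (-(2 : ℂ)⁻¹) • ⁅Qm X n 0 (E (co X n i c) (co X n i d)), matD X n i a b⁆ =
      (if a = c then matD X n i d b else 0) + (if b = c then matD X n i a d else 0) := by
  have hd : d ≤ (i : ℕ) := by omega
  have vc := co_val (X := X) hc
  have vd := co_val (X := X) hd
  have vo := co_mid hX i
  have hsz : size X n = 2 * n + 2 := by rw [hX]
  have hi := i.2
  have rd := Fin.val_rev (co X n i d)
  have rc := Fin.val_rev (co X n i c)
  have n5 : co X n i d ≠ co X n i n := fun e => by have := congrArg Fin.val e; omega
  have n6 : (co X n i c).rev ≠ co X n i n := fun e => by have := congrArg Fin.val e; omega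
  rw [Qm_zero_E_D hX (by omega) (by omega) (by omega) (by omega), smul_lie, smul_smul,
    show -(2 : ℂ)⁻¹ * 2 = -1 by norm_num, sub_lie]
  rcases matD_cases i a b with h | ⟨h, rfl⟩ | ⟨h, rfl⟩ | h
  · have va := co_val (X := X) h.1
    have vb := co_val (X := X) h.2
    have rb := Fin.val_rev (co X n i b)
    have n1 : co X n i d ≠ (co X n i b).rev := fun e => by have := congrArg Fin.val e; omega
    have n2 : co X n i a ≠ (co X n i d).rev := fun e => by have := congrArg Fin.val e; omega
    have h3 : (co X n i c).rev = (co X n i b).rev ↔ b = c := by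
      rw [Fin.rev_inj, eq_comm, co_eq_iff h.2 hc]
    rw [matD_long h.1 h.2, matD_long hd h.2, matD_long h.1 hd, lie_neg, lie_neg, lie_E, lie_E,
      if_neg n1, if_neg n2]
    simp only [h3, co_eq_iff h.1 hc]
    split_ifs <;> module
  · have va := co_val (X := X) h
    have n2 : co X n i a ≠ (co X n i d).rev := fun e => by have := congrArg Fin.val e; omega
    rw [matD_right h, matD_right hd, lie_E, lie_E, if_neg n5, if_neg n6, if_neg n2,
      if_neg (by omega : (i : ℕ) + 1 ≠ c)]
    simp only [co_eq_iff h hc]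
    split_ifs <;> module
  · have vb := co_val (X := X) h
    have n2 : co X n i b ≠ (co X n i d).rev := fun e => by have := congrArg Fin.val e; omega
    rw [matD_left h, matD_left hd, lie_neg, lie_neg, lie_E, lie_E, if_neg n5, if_neg n6, if_neg n2,
      if_neg (by omega : (i : ℕ) + 1 ≠ c)]
    simp only [co_eq_iff h hc]
    split_ifs <;> module
  · have e1 : a = c → matD X n i d b = 0 := fun e => matD_eq_zero (by omega)
    have e2 : b = c → matD X n i a d = 0 := fun e => matD_eq_zero (by omega)
    rw [matD_eq_zero h, lie_zero, lie_zero, sub_zero, smul_zero]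
    split_ifs with h1 h2 h2
    · rw [e1 h1, e2 h2, add_zero]
    · rw [e1 h1, add_zero]
    · rw [e2 h2, add_zero]
    · rw [add_zero]

theorem map_ite_add_ite {V W : Type} [AddCommGroup V] [Module ℂ V] [AddCommGroup W] [Module ℂ W]
    (f : V →ₗ[ℂ] W) (P Q : Prop) [Decidable P] [Decidable Q] (A B : V) {A' B' : W}
    (hA : P → f A = A') (hB : Q → f B = B') :
    f ((if P then A else 0) + (if Q then B else 0)) =
      (if P then A' else 0) + (if Q then B' else 0) := by
  rw [map_add]
  congr 1
  · split_ifs with h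
    · exact hA h
    · exact map_zero f
  · split_ifs with h
    · exact hB h
    · exact map_zero f

theorem lowering_lettersD (hX : X = .D) {c d : ℕ} (hdc : d < c) (hc : c ≤ i) (a b : ℕ) :
    ⁅lowering X n i c d, lettersD X n i (a, b)⁆ =
      (if a = c then lettersD X n i (d, b) else 0) + (if b = c then lettersD X n i (a, d) else 0) := by
  have hcc : cc X = 2 := by rw [hX]; rfl
  rw [lowering, lettersD, smul_lie, Tt_lie', hcc, zero_add, ← map_smul, Nat.cast_ofNat,
    lie_matD hX hdc hc]
  refine map_ite_add_ite _ _ _ _ _ (fun h => ?_) fun h => ?_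
  · have e : (a ≤ (i : ℕ) ∧ b ≤ (i : ℕ)) ↔ (d ≤ (i : ℕ) ∧ b ≤ (i : ℕ)) := by omega
    simp only [lettersD, e]
  · have e : (a ≤ (i : ℕ) ∧ b ≤ (i : ℕ)) ↔ (a ≤ (i : ℕ) ∧ d ≤ (i : ℕ)) := by omega
    simp only [lettersD, e]

theorem lettersD_mem_two (hX : X = .D) (p q : Fin (size X n))
    (h : deg i (kap (size X n) n p - kap _ n q) ≤ -2) :
    Tt X n 2 (E p q) ∈ Submodule.span ℂ (Set.range (lettersD X n i)) := by
  rw [deg_sub_kap] at h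
  have hsz : size X n = 2 * n + 2 := by rw [hX]
  have hi := i.2
  have v := Fin.val_rev p
  have hq : (q : ℕ) ≤ i := by split_ifs at h <;> omega
  have hp : (p.rev : ℕ) ≤ i := by split_ifs at h <;> omega
  have h1 : Tt X n 2 (E p q) = -lettersD X n i (q, p.rev) := by
    rw [lettersD_long hq hp, co_self, co_self, Fin.rev_rev, map_neg, neg_neg]
  rw [h1]
  exact neg_mem (Submodule.subset_span ⟨_, rfl⟩)

theorem lettersD_mem_one (hX : X = .D) (p q : Fin (size X n))
    (h : deg i (kap (size X n) n p - kap _ n q) ≤ -1) :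
    Tt X n 1 (E p q) ∈ Submodule.span ℂ (Set.range (lettersD X n i)) := by
  have h' := h
  rw [deg_sub_kap] at h
  have hsz : size X n = 2 * n + 2 := by rw [hX]
  have hi := i.2
  have hne : kap (size X n) n p ≠ kap _ n q := fun e => by
    rw [e, sub_self] at h'
    simp [deg] at h'
  have vp := Fin.val_rev p
  -- Odd powers of `t` occur only with short roots, for which one index is a middle one.
  have key : ∀ c : Fin (size X n), (c : ℕ) ≤ i →
      kap (size X n) n p - kap _ n q = -kap (size X n) n c →
      Tt X n 1 (E p q) ∈ Submodule.span ℂ (Set.range (lettersD X n i)) := by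
    intro c hc e
    obtain ⟨s, hs⟩ := Tt_E_of_kap_sub_eq 1 (p' := co X n i n) (q' := c) hne
      (by rw [kap_co_mid hX, e, zero_sub])
    rw [hs]
    have h1 : Tt X n 1 (E (co X n i n) c) = lettersD X n i (c, i + 1) := by
      rw [lettersD_right hc, co_self]
    rw [h1]
    exact Submodule.smul_mem _ _ (Submodule.subset_span ⟨_, rfl⟩)
  by_cases hp : (p : ℕ) = n ∨ (p : ℕ) = n + 1
  · refine key q (by split_ifs at h <;> omega) ?_
    rw [kap_mid (p := p) (by omega) (by omega), zero_sub]
  · by_cases hq : (q : ℕ) = n ∨ (q : ℕ) = n + 1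
    · refine key p.rev (by split_ifs at h <;> omega) ?_
      rw [kap_mid (p := q) (by omega) (by omega), kap_rev, neg_neg, sub_zero]
    · rw [Tt_eq_zero_D hX rfl (by omega) (by omega) (by omega) (by omega)]
      exact zero_mem _

theorem lie_f_lettersD (hX : X = .D) (p : (tri X n).P) (x : ℕ × ℕ) :
    ⁅constHom (sigma X n) ((tri X n).f p), lettersD X n i x⁆ ∈
      Submodule.span ℂ (Set.range (lettersD X n i)) := by
  obtain ⟨a, b⟩ := x
  have h0 : unitVec n i (i + 1) = 0 := by
    ext x
    rw [unitVec, if_neg (by omega)]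
    rfl
  rcases matD_cases i a b with h | ⟨h, rfl⟩ | ⟨h, rfl⟩ | h
  · rw [lettersD_long h.1 h.2, ← matD_long h.1 h.2]
    refine lie_f_Tt_mem (s := -2) (lettersD_mem_two hX) p ?_ (matD_mem hX _ _)
    rw [deg_neg, deg_add, deg_unitVec h.1, deg_unitVec h.2]
    norm_num
  · rw [lettersD_right h, ← matD_right h]
    refine lie_f_Tt_mem (s := -1) (lettersD_mem_one hX) p ?_ (matD_mem hX _ _)
    rw [deg_neg, h0, add_zero, deg_unitVec h]
  · rw [lettersD_left h, ← matD_left h]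
    refine lie_f_Tt_mem (s := -1) (lettersD_mem_one hX) p ?_ (matD_mem hX _ _)
    rw [deg_neg, h0, zero_add, deg_unitVec h]
  · rw [lettersD_eq_zero h, lie_zero]
    exact zero_mem _

theorem kills_E_of_deg_nonneg (r : ℕ) (hr : 1 ≤ r) (p q : Fin (size X n))
    (h : 0 ≤ deg i (kap (size X n) n p - kap _ n q)) : ⁅Tt X n r (E p q), kgen X n i m⁆ = 0 := by
  by_cases h0 : deg i (kap (size X n) n p - kap _ n q) = 0
  · exact kills_of_deg_eq_zero h0 (Or.inr hr) _ (E_mem_wtMat _ _)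
  · have hpq : p ≤ q := by
      by_contra hc
      have h1 : 0 ≤ deg i (kap (size X n) n q - kap _ n p) := Qpos_kap (not_le.1 hc).le i
      rw [← neg_sub, deg_neg] at h1
      omega
    refine kills_of_pos r (Qpos_kap hpq) (fun e => ?_) _ (E_mem_wtMat _ _)
    rw [e] at h0
    simp [deg] at h0

theorem neg_two_le_deg (p q : Fin (size X n)) :
    -2 ≤ deg i (kap (size X n) n p - kap _ n q) := by
  rw [deg_sub_kap]
  split_ifs <;> omega

/-- In type `D` an element `x ⊗ t ^ r` with `r ≥ 1` is a combination of letters or annihilates the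
generator. -/
theorem Tt_E_or_D (hX : X = .D) (r : ℕ) (hr : 1 ≤ r) (p q : Fin (size X n)) :
    Tt X n r (E p q) ∈ Submodule.span ℂ (Set.range (lettersD X n i)) ∨
      ⁅Tt X n r (E p q), kgen X n i m⁆ = 0 := by
  by_cases h0 : 0 ≤ deg i (kap (size X n) n p - kap _ n q)
  · exact Or.inr (kills_E_of_deg_nonneg r hr p q h0)
  · by_cases h1 : r = 1
    · subst h1
      exact Or.inl (lettersD_mem_one hX p q (by omega))
    · by_cases h2 : deg i (kap (size X n) n p - kap _ n q) = -1
      · exact Or.inr (kills_deg_one_D hX (Or.inl (by omega)) h2 _ (E_mem_wtMat _ _))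
      · have h3 := neg_two_le_deg (i := i) p q
        by_cases h4 : r = 2
        · subst h4
          exact Or.inl (lettersD_mem_two hX p q (by omega))
        · exact Or.inr (kills_deg_two_D hX (by omega) (by omega) _ (E_mem_wtMat _ _))

theorem Tt_E_lie_last_D (hX : X = .D) (hi : (i : ℕ) + 1 = n) (r : ℕ) (hr : 1 ≤ r)
    (p q : Fin (size X n)) : ⁅Tt X n r (E p q), kgen X n i m⁆ = 0 := by
  by_cases h0 : 0 ≤ deg i (kap (size X n) n p - kap _ n q)
  · exact kills_E_of_deg_nonneg r hr p q h0
  · by_cases h2 : deg i (kap (size X n) n p - kap _ n q) = -1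
    · exact kills_deg_one_D hX (Or.inr ⟨hi, hr⟩) h2 _ (E_mem_wtMat _ _)
    · have h3 := neg_two_le_deg (i := i) p q
      exact kills_deg_two_D hX (by omega) (by omega) _ (E_mem_wtMat _ _)

/-- The commutator of two letters for short roots is a combination of letters for long roots; all
other commutators of letters vanish. -/
theorem lettersD_lie (hX : X = .D) (x y : ℕ × ℕ) :
    ⁅lettersD X n i x, lettersD X n i y⁆ ∈ Submodule.span ℂ (Set.range (lettersD X n i)) := by
  have h0 : unitVec n i (i + 1) = 0 := by
    ext x
    rw [unitVec, if_neg (by omega)]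
    rfl
  have key : ∀ x : ℕ × ℕ, (∃ u ∈ wtMat (size X n) n (-(unitVec n i x.1 + unitVec n i x.2)),
      deg i (-(unitVec n i x.1 + unitVec n i x.2)) = -2 ∧ lettersD X n i x = Tt X n 2 u) ∨
      (∃ u ∈ wtMat (size X n) n (-(unitVec n i x.1 + unitVec n i x.2)),
      deg i (-(unitVec n i x.1 + unitVec n i x.2)) = -1 ∧ lettersD X n i x = Tt X n 1 u) ∨
      lettersD X n i x = 0 := by
    rintro ⟨a, b⟩
    rcases matD_cases i a b with h | ⟨h, rfl⟩ | ⟨h, rfl⟩ | h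
    · refine Or.inl ⟨_, matD_mem hX a b, ?_, ?_⟩
      · rw [deg_neg, deg_add, deg_unitVec h.1, deg_unitVec h.2]
        norm_num
      · rw [lettersD_long h.1 h.2, ← matD_long h.1 h.2]
    · refine Or.inr (Or.inl ⟨_, matD_mem hX a _, ?_, ?_⟩)
      · rw [deg_neg, h0, add_zero, deg_unitVec h]
      · rw [lettersD_right h, ← matD_right h]
    · refine Or.inr (Or.inl ⟨_, matD_mem hX _ b, ?_, ?_⟩)
      · rw [deg_neg, h0, zero_add, deg_unitVec h]
      · rw [lettersD_left h, ← matD_left h]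
    · exact Or.inr (Or.inr (lettersD_eq_zero h))
  have hlow : ∀ (r s : ℕ) (b c : Fin n → ℤ) (u w : Mat X n), u ∈ wtMat (size X n) n b →
      w ∈ wtMat (size X n) n c → deg i b + deg i c < -2 → ⁅Tt X n r u, Tt X n s w⁆ = 0 := by
    intro r s b c u w hu hw h
    rw [Tt_lie, eq_zero_of_deg_lt (i := i) ?_ (lie_mem_wtMat hu (Qm_mem_wtMat s hw)), map_zero]
    rwa [deg_add]
  rcases key x with ⟨u, hu, du, ex⟩ | ⟨u, hu, du, ex⟩ | ex
  · rcases key y with ⟨w, hw, dw, ey⟩ | ⟨w, hw, dw, ey⟩ | ey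
    · rw [ex, ey, hlow _ _ _ _ _ _ hu hw (by omega)]
      exact zero_mem _
    · rw [ex, ey, hlow _ _ _ _ _ _ hu hw (by omega)]
      exact zero_mem _
    · rw [ey, lie_zero]
      exact zero_mem _
  · rcases key y with ⟨w, hw, dw, ey⟩ | ⟨w, hw, dw, ey⟩ | ey
    · rw [ex, ey, hlow _ _ _ _ _ _ hu hw (by omega)]
      exact zero_mem _
    · rw [ex, ey, Tt_lie]
      have h1 := lie_mem_wtMat hu (Qm_mem_wtMat 1 hw)
      have h2 : ⁅u, Qm X n 1 w⁆ ∈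
          (Submodule.span ℂ (Set.range (lettersD X n i))).comap (Tt X n (1 + 1)) := by
        refine mem_of_E_mem _ fun p q hpq => lettersD_mem_two hX p q ?_
        rw [h1 p q hpq, deg_add]
        omega
      exact h2
    · rw [ey, lie_zero]
      exact zero_mem _
  · rw [ex, zero_lie]
    exact zero_mem _

end LettersD

/-! ### Membership in the sets `P₀⁺(i, m)^σ` -/

section DomSet

variable {X : TwistedType} {n : ℕ} {i : Fin n} {m : ℕ}

theorem domSet_of_lt (h : m < period X n i) : domSet X n i m = {m • om n ((i : ℕ) + 1)} := by
  rw [domSet, if_neg (by omega), if_neg (by omega)]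

theorem add_mem_domSet {a b : Weight n} (ha : a ∈ topSet X n i) (hb : b ∈ domSet X n i m) :
    a + b ∈ domSet X n i (m + period X n i) := by
  have hp := period_pos X n i
  rcases Nat.eq_zero_or_pos m with rfl | hm
  · rw [domSet_of_lt hp, zero_smul, Set.mem_singleton_iff] at hb
    rw [hb, add_zero, domSet, if_neg (by omega), if_pos (by omega)]
    exact ha
  · rw [domSet, if_pos (by omega), Nat.add_sub_cancel]
    exact ⟨a, ha, b, hb, rfl⟩

theorem topSet_finite : (topSet X n i).Finite := by
  have h1 : ∀ (s B : ℕ), {μ : Weight n | ∃ j : ℕ, j ≤ B ∧ μ = s • om n j}.Finite := by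
    intro s B
    refine ((Set.finite_Iic B).image fun j => s • om n j).subset ?_
    rintro _ ⟨j, hj, rfl⟩
    exact ⟨j, hj, rfl⟩
  cases X
  · refine (h1 1 (i + 1)).subset ?_
    rintro _ ⟨j, hj, -, rfl⟩
    exact ⟨j, hj, (one_smul _ _).symm⟩
  · simp only [topSet]
    split_ifs with h
    · refine ((Set.finite_singleton (4 • om n n)).union (h1 2 n)).subset ?_
      rintro _ (rfl | ⟨j, hj, rfl⟩)
      · exact Or.inl rfl
      · exact Or.inr ⟨j, hj.le, rfl⟩
    · exact h1 2 _
  · simp only [topSet]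
    split_ifs with h
    · exact Set.finite_singleton _
    · refine (h1 1 (i + 1)).subset ?_
      rintro _ ⟨j, hj, rfl⟩
      exact ⟨j, hj, (one_smul _ _).symm⟩

theorem domSet_finite (X : TwistedType) (n : ℕ) (i : Fin n) (m : ℕ) :
    (domSet X n i m).Finite := by
  induction m using Nat.strong_induction_on with
  | _ m ih =>
  have hp := period_pos X n i
  rw [domSet]
  split_ifs with h1 h2
  · refine (Set.Finite.image2 (fun a b => a + b) (topSet_finite (X := X) (i := i))
      (ih (m - period X n i) (by omega))).subset ?_
    rintro _ ⟨a, ha, b, hb, rfl⟩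
    exact ⟨a, ha, b, hb, rfl⟩
  · exact topSet_finite
  · exact Set.finite_singleton _

/-- Membership in `P₀⁺(i, m)^σ` by induction on `m`, splitting off an element of
`P₀⁺(i, d_i^σ)^σ` in every step. -/
theorem mem_domSet_of_step (P : ℕ → Weight n → Prop)
    (hbase : ∀ m μ, m < period X n i → P m μ → μ = m • om n ((i : ℕ) + 1))
    (hstep : ∀ m μ, P (m + period X n i) μ → ∃ a ∈ topSet X n i, ∃ b, P m b ∧ μ = a + b)
    {μ : Weight n} (h : P m μ) : μ ∈ domSet X n i m := by
  induction m using Nat.strong_induction_on generalizing μ with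
  | _ m ih =>
  have hp := period_pos X n i
  by_cases hm : m < period X n i
  · rw [domSet_of_lt hm]
    exact hbase m μ hm h
  · have e : m = (m - period X n i) + period X n i := by omega
    rw [e] at h ⊢
    obtain ⟨a, ha, b, hb, rfl⟩ := hstep _ _ h
    exact add_mem_domSet ha (ih _ (by omega) hb)

theorem om_zero : om n 0 = 0 := by
  ext x
  simp [om]

theorem om_succ (j x : Fin n) : om n ((j : ℕ) + 1) x = if x = j then 1 else 0 := by
  simp [om, Fin.ext_iff]

theorem exists_sub_om {μ : Weight n} {j : Fin n} {s : ℕ} (h : s ≤ μ j) :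
    ∃ b : Weight n, μ = s • om n ((j : ℕ) + 1) + b ∧ (∀ x, x ≠ j → b x = μ x) ∧ b j + s = μ j ∧
      ∑ x, b x + s = ∑ x, μ x := by
  have e : ∀ x, μ x = (s • om n ((j : ℕ) + 1)) x + (μ x - if x = j then s else 0) := by
    intro x
    rw [Pi.smul_apply, om_succ, smul_eq_mul]
    split_ifs with hx
    · subst hx
      omega
    · omega
  refine ⟨fun x => μ x - if x = j then s else 0, funext e, fun x hx => by simp [hx],
    by simpa using by omega, ?_⟩
  rw [Finset.sum_congr rfl fun x _ => e x, Finset.sum_add_distrib, add_comm]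
  congr 1
  simp [om_succ]

theorem eq_smul_om {μ : Weight n} {s : ℕ} (hi : μ i = s) (h : ∀ x, x ≠ i → μ x = 0) :
    μ = s • om n ((i : ℕ) + 1) := by
  ext x
  rw [Pi.smul_apply, om_succ, smul_eq_mul]
  split_ifs with hx
  · rw [hx, hi, mul_one]
  · rw [h x hx, mul_zero]

theorem le_sum (μ : Weight n) (x : Fin n) : μ x ≤ ∑ x, μ x :=
  Finset.single_le_sum (f := μ) (fun _ _ => Nat.zero_le _) (Finset.mem_univ x)

theorem le_sum_two (μ : Weight n) {x : Fin n} (hx : x ≠ i) : μ x + μ i ≤ ∑ x, μ x := by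
  rw [← Finset.sum_pair (f := μ) hx]
  exact Finset.sum_le_sum_of_subset (Finset.subset_univ _)

theorem sum_eq_self {μ : Weight n} (h : ∀ x, x ≠ i → μ x = 0) : ∑ x, μ x = μ i :=
  Finset.sum_eq_single i (fun x _ hx => h x hx) fun h => absurd (Finset.mem_univ i) h

theorem mem_domSet_AOdd (hX : X = .AOdd) {μ : Weight n} (h1 : ∀ x : Fin n, (i : ℕ) < x → μ x = 0)
    (h2 : ∀ x : Fin n, (x : ℕ) % 2 ≠ (i : ℕ) % 2 → μ x = 0) (h3 : ∑ x, μ x ≤ m)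
    (h4 : (i : ℕ) % 2 = 0 → ∑ x, μ x = m) : μ ∈ domSet X n i m := by
  subst hX
  refine mem_domSet_of_step (fun m μ => (∀ x : Fin n, (i : ℕ) < x → μ x = 0) ∧
    (∀ x : Fin n, (x : ℕ) % 2 ≠ (i : ℕ) % 2 → μ x = 0) ∧ ∑ x, μ x ≤ m ∧
    ((i : ℕ) % 2 = 0 → ∑ x, μ x = m)) ?_ ?_ ⟨h1, h2, h3, h4⟩
  · rintro m μ hm ⟨-, -, h3, -⟩
    obtain rfl : m = 0 := by simpa [period] using hm
    ext x
    have := le_sum μ x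
    simp only [zero_smul, Pi.zero_apply]
    omega
  · rintro m μ ⟨h1, h2, h3, h4⟩
    by_cases h : ∃ j, μ j ≠ 0
    · obtain ⟨j, hj⟩ := h
      obtain ⟨b, hb, hb1, hb2, hb3⟩ := exists_sub_om (s := 1) (j := j) (Nat.one_le_iff_ne_zero.2 hj)
      have hle : ∀ x, b x ≤ μ x := fun x => by
        by_cases hx : x = j
        · subst hx; omega
        · exact (hb1 x hx).le
      have hj1 : (j : ℕ) ≤ i := by
        by_contra hc
        exact hj (h1 j (by omega))
      have hj2 : (j : ℕ) % 2 = (i : ℕ) % 2 := by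
        by_contra hc
        exact hj (h2 j hc)
      simp only [period] at h3 h4
      exact ⟨om n (j + 1), ⟨j + 1, by omega, by omega, rfl⟩, b,
        ⟨fun x hx => by have := hle x; have := h1 x hx; omega,
          fun x hx => by have := hle x; have := h2 x hx; omega, by omega,
          fun hi => by have := h4 hi; omega⟩, by rw [hb, one_smul]⟩
    · push Not at h
      have hs : ∑ x, μ x = 0 := Finset.sum_eq_zero fun x _ => h x
      simp only [period, hs] at h4
      refine ⟨0, ⟨0, by omega, by omega, om_zero.symm⟩, μ, ⟨h1, h2, by omega, by omega⟩,
        (zero_add _).symm⟩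

theorem mem_domSet_D (hX : X = .D) (hi : (i : ℕ) + 1 < n) {μ : Weight n}
    (h1 : ∀ x : Fin n, (i : ℕ) < x → μ x = 0) (h3 : ∑ x, μ x ≤ m) : μ ∈ domSet X n i m := by
  subst hX
  have htop : topSet .D n i = {μ | ∃ j : ℕ, j ≤ (i : ℕ) + 1 ∧ μ = om n j} := if_neg (by omega)
  refine mem_domSet_of_step (fun m μ => (∀ x : Fin n, (i : ℕ) < x → μ x = 0) ∧ ∑ x, μ x ≤ m)
    ?_ ?_ ⟨h1, h3⟩
  · rintro m μ hm ⟨-, h3⟩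
    obtain rfl : m = 0 := by simpa [period] using hm
    ext x
    have := le_sum μ x
    simp only [zero_smul, Pi.zero_apply]
    omega
  · rintro m μ ⟨h1, h3⟩
    rw [htop]
    by_cases h : ∃ j, μ j ≠ 0
    · obtain ⟨j, hj⟩ := h
      obtain ⟨b, hb, hb1, hb2, hb3⟩ := exists_sub_om (s := 1) (j := j) (Nat.one_le_iff_ne_zero.2 hj)
      have hle : ∀ x, b x ≤ μ x := fun x => by
        by_cases hx : x = j
        · subst hx; omega
        · exact (hb1 x hx).le
      have hj1 : (j : ℕ) ≤ i := by
        by_contra hc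
        exact hj (h1 j (by omega))
      simp only [period] at h3
      exact ⟨om n (j + 1), ⟨j + 1, by omega, rfl⟩, b,
        ⟨fun x hx => by have := hle x; have := h1 x hx; omega, by omega⟩, by rw [hb, one_smul]⟩
    · push Not at h
      have hs : ∑ x, μ x = 0 := Finset.sum_eq_zero fun x _ => h x
      exact ⟨0, ⟨0, by omega, om_zero.symm⟩, μ, ⟨h1, by omega⟩, (zero_add _).symm⟩

theorem smul_om_mem_domSet_D (hX : X = .D) (hi : (i : ℕ) + 1 = n) :
    m • om n ((i : ℕ) + 1) ∈ domSet X n i m := by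
  subst hX
  have htop : topSet .D n i = {om n n} := if_pos hi
  refine mem_domSet_of_step (fun m μ => μ = m • om n ((i : ℕ) + 1)) (fun m μ _ h => h) ?_ rfl
  rintro m μ rfl
  rw [htop]
  exact ⟨_, rfl, _, rfl, by rw [hi, add_smul, add_comm]; simp [period]⟩

theorem mem_domSet_AEven (hX : X = .AEven) (hi : (i : ℕ) + 1 < n) {μ : Weight n}
    (h1 : ∀ x : Fin n, (i : ℕ) < x → μ x = 0) (h2 : ∀ x : Fin n, x ≠ i → μ x % 2 = 0)
    (h3 : μ i % 2 = m % 2) (h4 : ∑ x, μ x ≤ m) : μ ∈ domSet X n i m := by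
  subst hX
  have htop : topSet .AEven n i = {μ | ∃ j : ℕ, j ≤ (i : ℕ) + 1 ∧ μ = 2 • om n j} :=
    if_neg (by omega)
  have hper : period .AEven n i = 2 := if_neg (by omega)
  refine mem_domSet_of_step (fun m μ => (∀ x : Fin n, (i : ℕ) < x → μ x = 0) ∧
    (∀ x : Fin n, x ≠ i → μ x % 2 = 0) ∧ μ i % 2 = m % 2 ∧ ∑ x, μ x ≤ m) ?_ ?_ ⟨h1, h2, h3, h4⟩
  · rintro m μ hm ⟨h1, h2, h3, h4⟩
    rw [hper] at hm
    refine eq_smul_om ?_ fun x hx => ?_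
    · have := le_sum μ i
      omega
    · have := le_sum μ x
      have := h2 x hx
      omega
  · rintro m μ ⟨h1, h2, h3, h4⟩
    rw [hper] at h3 h4
    rw [htop]
    by_cases h : ∃ j, 2 ≤ μ j
    · obtain ⟨j, hj⟩ := h
      obtain ⟨b, hb, hb1, hb2, hb3⟩ := exists_sub_om (s := 2) (j := j) hj
      have hle : ∀ x, b x % 2 = μ x % 2 ∧ b x ≤ μ x := fun x => by
        by_cases hx : x = j
        · subst hx; omega
        · rw [hb1 x hx]; omega
      have hj1 : (j : ℕ) ≤ i := by
        by_contra hc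
        have := h1 j (by omega)
        omega
      exact ⟨2 • om n (j + 1), ⟨j + 1, by omega, rfl⟩, b,
        ⟨fun x hx => by have := hle x; have := h1 x hx; omega,
          fun x hx => by have := hle x; have := h2 x hx; omega,
          by have := hle i; omega, by omega⟩, hb⟩
    · push Not at h
      have h0 : ∀ x, x ≠ i → μ x = 0 := fun x hx => by
        have := h x
        have := h2 x hx
        omega
      have hs := sum_eq_self h0
      have := h i
      exact ⟨0, ⟨0, by omega, by rw [om_zero, smul_zero]⟩, μ, ⟨h1, h2, by omega, by omega⟩,
        (zero_add _).symm⟩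

theorem mem_domSet_AEven_last (hX : X = .AEven) (hi : (i : ℕ) + 1 = n) {μ : Weight n}
    (h2 : ∀ x : Fin n, x ≠ i → μ x % 2 = 0) (h3 : μ i % 4 = m % 4)
    (h4 : 2 * ∑ x, μ x ≤ m + μ i) : μ ∈ domSet X n i m := by
  subst hX
  have htop : topSet .AEven n i = {μ | μ = 4 • om n n ∨ ∃ j : ℕ, j < n ∧ μ = 2 • om n j} :=
    if_pos hi
  have hper : period .AEven n i = 4 := if_pos hi
  refine mem_domSet_of_step (fun m μ => (∀ x : Fin n, x ≠ i → μ x % 2 = 0) ∧ μ i % 4 = m % 4 ∧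
    2 * ∑ x, μ x ≤ m + μ i) ?_ ?_ ⟨h2, h3, h4⟩
  · rintro m μ hm ⟨h2, h3, h4⟩
    rw [hper] at hm
    refine eq_smul_om ?_ fun x hx => ?_
    · have := le_sum μ i
      omega
    · have := le_sum_two μ hx
      have := h2 x hx
      omega
  · rintro m μ ⟨h2, h3, h4⟩
    rw [hper] at h3 h4
    rw [htop]
    by_cases h : ∃ j, j ≠ i ∧ μ j ≠ 0
    · obtain ⟨j, hji, hj⟩ := h
      have hj2 := h2 j hji
      obtain ⟨b, hb, hb1, hb2, hb3⟩ := exists_sub_om (μ := μ) (s := 2) (j := j) (by omega)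
      have hj1 : (j : ℕ) < i := by
        have := Fin.val_ne_of_ne hji
        have := j.2
        omega
      have hbi := hb1 i hji.symm
      refine ⟨2 • om n (j + 1), Or.inr ⟨j + 1, by omega, rfl⟩, b, ⟨fun x hx => ?_, by omega,
        by omega⟩, hb⟩
      by_cases hxj : x = j
      · subst hxj; omega
      · rw [hb1 x hxj]; exact h2 x hx
    · push Not at h
      have hs := sum_eq_self h
      by_cases h5 : 4 ≤ μ i
      · obtain ⟨b, hb, hb1, hb2, hb3⟩ := exists_sub_om (μ := μ) (s := 4) (j := i) h5
        exact ⟨4 • om n (i + 1), Or.inl (by rw [hi]), b,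
          ⟨fun x hx => by rw [hb1 x hx]; exact h2 x hx, by omega, by omega⟩, hb⟩
      · exact ⟨0, Or.inr ⟨0, by omega, by rw [om_zero, smul_zero]⟩, μ, ⟨h2, by omega, by omega⟩,
          (zero_add _).symm⟩

end DomSet

/-! ### Words in letters span -/

section Words

variable {X : TwistedType} {n : ℕ} {i : Fin n} {m : ℕ}

/-- The properties of a family of letters that make certain words in them span: together with `𝔫₀⁻`
and the elements that act on the generator by scalars they span the Lie algebra, their span is
closed under brackets and stable under `𝔫₀⁻`, and the lowering operators act on their indices. -/
structure LetterSystem (X : TwistedType) (n : ℕ) (i : Fin n) (m : ℕ) (z : ℕ × ℕ → gt X n) : Prop where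
  weights : HasLetterWeights z i
  lie_mem : ∀ x y, ⁅z x, z y⁆ ∈ Submodule.span ℂ (Set.range z)
  lowering_lie : ∀ c d, d < c → c < (i : ℕ) + 1 → ∀ a b, ⁅lowering X n i c d, z (a, b)⁆ =
    (if a = c then z (d, b) else 0) + (if b = c then z (a, d) else 0)
  lie_f_mem : ∀ p x, ⁅constHom (sigma X n) ((tri X n).f p), z x⁆ ∈ Submodule.span ℂ (Set.range z)
  gen : ∀ r, 1 ≤ r → ∀ p q : Fin (size X n), Tt X n r (E p q) ∈ Submodule.span ℂ (Set.range z) ∨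
    ⁅Tt X n r (E p q), kgen X n i m⁆ = 0

theorem letterSystemA (hX : X ≠ .D) : LetterSystem X n i m (lettersA X n i) where
  weights := lettersA_weights
  lie_mem x y := by
    rw [lettersA_lie]
    exact zero_mem _
  lowering_lie c d hdc hc a b := by
    rw [lowering_lettersA hX hdc (Nat.lt_succ_iff.1 hc)]
    exact map_ite_add_ite _ _ _ _ _ (fun _ => rfl) fun _ => rfl
  lie_f_mem := lie_f_lettersA
  gen := Tt_E_or_A hX

theorem letterSystemD (hX : X = .D) : LetterSystem X n i m (lettersD X n i) where
  weights := lettersD_weights hX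
  lie_mem := lettersD_lie hX
  lowering_lie _ _ hdc hc := lowering_lettersD hX hdc (Nat.lt_succ_iff.1 hc)
  lie_f_mem := lie_f_lettersD hX
  gen := Tt_E_or_D hX

/-- The action of a letter. -/
abbrev opZ (m : ℕ) (z : ℕ × ℕ → gt X n) (x : ℕ × ℕ) : Module.End ℂ (KR X n i m) :=
  LieModule.toEnd ℂ (gt X n) (KR X n i m) (z x)

/-- The action of a lowering operator. -/
abbrev opF (X : TwistedType) (n : ℕ) (i : Fin n) (m : ℕ) (c d : ℕ) : Module.End ℂ (KR X n i m) :=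
  LieModule.toEnd ℂ (gt X n) (KR X n i m) (lowering X n i c d)

variable {z : ℕ × ℕ → gt X n}

theorem LetterSystem.opZ_comm (hz : LetterSystem X n i m z) (a b c d : ℕ) :
    opZ (i := i) m z (a, b) * opZ m z (c, d) - opZ m z (c, d) * opZ m z (a, b) ∈
      Submodule.span ℂ (Set.range fun x : ℕ × ℕ => opZ (i := i) m z (x.1, x.2)) := by
  have h1 : ∀ y ∈ Submodule.span ℂ (Set.range z), LieModule.toEnd ℂ (gt X n) (KR X n i m) y ∈
      Submodule.span ℂ (Set.range fun x : ℕ × ℕ => opZ (i := i) m z (x.1, x.2)) := by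
    intro y hy
    induction hy using Submodule.span_induction with
    | mem y hy => obtain ⟨x, rfl⟩ := hy; exact Submodule.subset_span ⟨x, rfl⟩
    | zero => rw [map_zero]; exact zero_mem _
    | add a b _ _ ha hb => rw [map_add]; exact add_mem ha hb
    | smul c a _ ha => rw [map_smul]; exact Submodule.smul_mem _ _ ha
  have h2 := h1 _ (hz.lie_mem (a, b) (c, d))
  rw [LieHom.map_lie, LieRing.of_associative_ring_bracket] at h2
  exact h2

theorem LetterSystem.opF_comm (hz : LetterSystem X n i m z) (c d : ℕ) (hdc : d < c)
    (hc : c < (i : ℕ) + 1) (a b : ℕ) :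
    opF X n i m c d * opZ m z (a, b) - opZ m z (a, b) * opF X n i m c d =
      (if a = c then opZ m z (d, b) else 0) + (if b = c then opZ m z (a, d) else 0) := by
  rw [← LieRing.of_associative_ring_bracket, ← LieHom.map_lie, hz.lowering_lie c d hdc hc]
  exact map_ite_add_ite (LieModule.toEnd ℂ (gt X n) (KR X n i m) :
    gt X n →ₗ[ℂ] Module.End ℂ (KR X n i m)) _ _ _ _
    (fun _ => rfl) fun _ => rfl

/-- If every subspace that is stable under the lowering operators and contains certain words
contains all words, then these words generate the module under `𝔫₀⁻`. -/
theorem LetterSystem.span_eq_top (hz : LetterSystem X n i m z) {K : Type} (s : K → List (ℕ × ℕ))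
    (h : ∀ T : Submodule ℂ (KR X n i m),
      (∀ c d, d < c → c < (i : ℕ) + 1 → ∀ x ∈ T, opF X n i m c d x ∈ T) →
      (∀ k, wd (fun x : ℕ × ℕ => opZ m z (x.1, x.2)) (kgen X n i m) (s k) ∈ T) →
      ∀ L, wd (fun x : ℕ × ℕ => opZ m z (x.1, x.2)) (kgen X n i m) L ∈ T) :
    Submodule.span ℂ {x | ∃ k d, (tri X n).Word (wd (opZ m z) (kgen X n i m) (s k)) d x} = ⊤ := by
  have hT : ∀ p, ∀ x ∈ Submodule.span ℂ
      {x | ∃ k d, (tri X n).Word (wd (opZ m z) (kgen X n i m) (s k)) d x},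
      ⁅(tri X n).f p, x⁆ ∈ Submodule.span ℂ
        {x | ∃ k d, (tri X n).Word (wd (opZ m z) (kgen X n i m) (s k)) d x} := by
    intro p x hx
    induction hx using Submodule.span_induction with
    | mem x hx =>
      obtain ⟨k, d, hx⟩ := hx
      exact Submodule.subset_span ⟨k, _, hx.step p⟩
    | zero => rw [lie_zero]; exact zero_mem _
    | add a b _ _ ha hb => rw [lie_add]; exact add_mem ha hb
    | smul c a _ ha => rw [lie_smul]; exact Submodule.smul_mem _ _ ha
  refine eq_top_of_letters z hz.lie_f_mem hz.gen _ hT (h _ (fun c d hdc hc x hx => ?_) fun k => ?_)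
  · exact lowering_mem hdc (Nat.lt_succ_iff.1 hc) _ hT x hx
  · exact Submodule.subset_span ⟨k, 0, TriData.Word.base⟩

/-- The exponents of the monomials that are needed. -/
abbrev Exponents (i : Fin n) : Type := {k : ℕ → ℕ // ∀ b, (i : ℕ) < b → k b = 0}

theorem symWord_congr {k k' : ℕ → ℕ} : ∀ {b : ℕ}, (∀ x < b, k x = k' x) →
    symWord k b = symWord k' b
  | 0, _ => rfl
  | b + 1, h => by
    rw [symWord, symWord, h b (by omega), symWord_congr fun x hx => h x (by omega)]

theorem altWord_congr {B : ℕ} {k k' : ℕ → ℕ} : ∀ {b : ℕ}, (∀ x < b, k x = k' x) →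
    altWord B k b = altWord B k' b
  | 0, _ => rfl
  | 1, h => by rw [altWord, altWord, h 0 (by omega)]
  | b + 2, h => by
    rw [altWord, altWord, h b (by omega), h (b + 1) (by omega),
      altWord_congr fun x hx => h x (by omega)]

/-- The exponents that agree with `k` up to `i`. -/
def truncExp (i : Fin n) (k : ℕ → ℕ) : Exponents i :=
  ⟨fun b => if b < (i : ℕ) + 1 then k b else 0, fun b hb => if_neg (by omega)⟩

theorem truncExp_apply (i : Fin n) (k : ℕ → ℕ) : ∀ x < (i : ℕ) + 1, (truncExp i k).1 x = k x :=
  fun _ hx => if_pos hx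

theorem LetterSystem.span_sym (hz : LetterSystem X n i m z) (hs : ∀ a b, z (a, b) = z (b, a))
    (h0 : ∀ a b, (i : ℕ) + 1 ≤ b → z (a, b) = 0) :
    Submodule.span ℂ {x | ∃ (k : Exponents i) (d : _), (tri X n).Word
      (wd (opZ m z) (kgen X n i m) (symWord k.1 (i + 1))) d x} = ⊤ := by
  refine hz.span_eq_top (fun k : Exponents i => symWord k.1 (i + 1)) fun T hT hk => ?_
  refine wd_mem_of_sym (Z := fun a b => opZ m z (a, b)) (F := opF X n i m) (B := i + 1)
    (fun a b => ?_) (fun a b hb => ?_) hz.opZ_comm (fun c d hdc hc => ?_) hz.opF_comm T hT fun k => ?_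
  · rw [opZ, opZ, hs]
  · rw [opZ, h0 a b hb, map_zero]
  · exact lowering_kgen hdc (Nat.lt_succ_iff.1 hc)
  · rw [← symWord_congr (truncExp_apply i k)]
    exact hk _

theorem LetterSystem.span_alt (hz : LetterSystem X n i m z) (hs : ∀ a b, z (a, b) = -z (b, a))
    (h0 : ∀ a b, (i : ℕ) + 1 < b → z (a, b) = 0) :
    Submodule.span ℂ {x | ∃ (k : Exponents i) (d : _), (tri X n).Word
      (wd (opZ m z) (kgen X n i m) (altWord (i + 1) k.1 (i + 1))) d x} = ⊤ := by
  refine hz.span_eq_top (fun k : Exponents i => altWord (i + 1) k.1 (i + 1)) fun T hT hk => ?_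
  refine wd_mem_of_alt (Z := fun a b => opZ m z (a, b)) (F := opF X n i m) (B := i + 1)
    (fun a b => ?_) (fun a b hb => ?_) hz.opZ_comm (fun c d hdc hc => ?_) hz.opF_comm T hT fun k => ?_
  · rw [opZ, opZ, hs, map_neg]
  · rw [opZ, h0 a b hb, map_zero]
  · exact lowering_kgen hdc (Nat.lt_succ_iff.1 hc)
  · rw [← altWord_congr (truncExp_apply i k)]
    exact hk _

theorem wd_eq_zero_of_mem {M G : Type} [AddCommGroup M] [Module ℂ M] {Z : G → Module.End ℂ M} {v : M}
    {x : G} (hx : Z x = 0) {L : List G} (h : x ∈ L) : wd Z v L = 0 := by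
  induction L with
  | nil => simp at h
  | cons y L ih =>
    rw [wd_cons]
    rcases List.mem_cons.1 h with rfl | h
    · rw [hx]
      rfl
    · rw [ih h, map_zero]

theorem mem_altWord {B : ℕ} {k : ℕ → ℕ} {x : ℕ} (hk : k x ≠ 0) : ∀ {b : ℕ}, x < b →
    (b - x) % 2 = 1 → (x, B) ∈ altWord B k b
  | 0, h, _ => absurd h (by omega)
  | 1, h, _ => by
    obtain rfl : x = 0 := by omega
    rw [altWord]
    exact List.mem_replicate.2 ⟨hk, rfl⟩
  | b + 2, h, h' => by
    rw [altWord, List.mem_append, List.mem_append]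
    by_cases hx : x = b + 1
    · subst hx
      exact Or.inr (Or.inl (List.mem_replicate.2 ⟨hk, rfl⟩))
    · exact Or.inr (Or.inr (mem_altWord hk (by omega) (by omega)))

/-! ### Weights of the generating words -/

/-- The depth of the monomials in the diagonal letters. -/
def symDepth (i : Fin n) (k : Exponents i) (x : Fin n) : ℤ := ((2 * k.1 x : ℕ) : ℤ)

theorem sum_symWord_eq (k : Exponents i) :
    ((symWord k.1 (i + 1)).map fun x => unitVec n i x.1 + unitVec n i x.2).sum = symDepth i k := by
  ext x
  rw [sum_symWord, symDepth]
  split_ifs with h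
  · push_cast
    rfl
  · rw [k.2 x (by omega)]
    rfl

theorem sum_altWord_eq (k : Exponents i) :
    ((altWord (i + 1) k.1 (i + 1)).map fun x => unitVec n i x.1 + unitVec n i x.2).sum =
      fun x : Fin n => (altDepth k.1 (i + 1) x : ℤ) := by
  ext x
  exact sum_altWord k.1 x _ le_rfl

theorem symDepth_injective : Function.Injective (symDepth i) := by
  intro k k' h
  ext x
  by_cases hx : x < n
  · have := congrFun h ⟨x, hx⟩
    simp only [symDepth] at this
    omega
  · have := i.2
    rw [k.2 x (by omega), k'.2 x (by omega)]

theorem altDepth_injective :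
    Function.Injective fun (k : Exponents i) (x : Fin n) => (altDepth k.1 (i + 1) x : ℤ) := by
  intro k k' h
  ext x
  have hi := i.2
  induction x using Nat.strong_induction_on with
  | _ x ih =>
  by_cases hx : (i : ℕ) < x
  · rw [k.2 x hx, k'.2 x hx]
  · have h1 := congrFun h ⟨x, by omega⟩
    simp only [altDepth, Nat.cast_inj, if_pos (by omega : x < (i : ℕ) + 1)] at h1
    split_ifs at h1 with h2
    · have := ih (x - 1) (by omega)
      omega
    · exact h1

theorem Qpos_natCast (D : ℕ → ℕ) : Qpos fun x : Fin n => (D x : ℤ) := fun _ =>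
  Finset.sum_nonneg fun _ _ => Int.natCast_nonneg _

/-- The coefficients of a weight of the form `m ω_i - D`. -/
theorem coeff_of_depth {μ : Weight n} {D : ℕ → ℕ} (hD : ∀ x, (i : ℕ) < x → D x = 0)
    (h : ev X μ = ev X (m • om n ((i : ℕ) + 1)) - cst fun x : Fin n => (D x : ℤ)) :
    (∀ j : Fin n, (j : ℕ) < i → μ j + D j = D (j + 1)) ∧
      μ i + (if (i : ℕ) + 1 < n then 1 else clX X) * D i = m ∧ ∀ j : Fin n, (i : ℕ) < j → μ j = 0 := by
  have key : ∀ j, (μ j : ℤ) = (if j = i then (m : ℤ) else 0) -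
      (if (j : ℕ) + 1 < n then (D j : ℤ) - D (j + 1) else clX X * D j) := by
    intro j
    have h1 := pr_ev (X := X) μ j
    have h2 := pr_kgen (X := X) (m := m) (i := i) j
    rw [h] at h1
    unfold pr at h1 h2
    rw [← Int.cast_inj (α := ℂ)]
    by_cases hj : (j : ℕ) + 1 < n
    · rw [dif_pos hj] at h1 h2
      simp only [Pi.sub_apply, cst] at h1
      rw [if_pos hj]
      push_cast at h1 ⊢
      rw [← h1, ← h2]
      ring
    · rw [dif_neg hj] at h1 h2
      simp only [Pi.sub_apply, cst] at h1
      rw [if_neg hj]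
      push_cast at h1 ⊢
      rw [← h1, ← h2]
      ring
  have hi := i.2
  refine ⟨fun j hj => ?_, ?_, fun j hj => ?_⟩
  · have h1 := key j
    rw [if_neg (fun e => by rw [e] at hj; omega), if_pos (by omega)] at h1
    omega
  · have h1 := key i
    rw [if_pos rfl, hD (i + 1) (by omega)] at h1
    split_ifs at h1 ⊢ with h2
    · omega
    · zify
      linarith
  · have h1 := key j
    rw [if_neg (fun e => by rw [e] at hj; omega), hD j hj, hD (j + 1) (by omega)] at h1
    split_ifs at h1 <;> simp at h1 <;> exact h1

theorem sum_of_telescope {μ : Weight n} {D : ℕ → ℕ} (h1 : ∀ j : Fin n, (j : ℕ) < i → μ j + D j = D (j + 1))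
    (h2 : ∀ j : Fin n, (i : ℕ) < j → μ j = 0) : ∑ j, μ j + D 0 = μ i + D i := by
  let f : ℕ → ℕ := fun x => if h : x < n then μ ⟨x, h⟩ else 0
  have hi := i.2
  have e1 : ∑ j, μ j = ∑ x ∈ Finset.range n, f x := by
    rw [← Fin.sum_univ_eq_sum_range]
    refine Finset.sum_congr rfl fun j _ => ?_
    simp [f]
  have e2 : ∑ x ∈ Finset.range n, f x = ∑ x ∈ Finset.range ((i : ℕ) + 1), f x := by
    refine (Finset.sum_subset (Finset.range_subset_range.2 (by omega)) fun x hx hx' => ?_).symm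
    rw [Finset.mem_range] at hx hx'
    simp only [f, dif_pos hx]
    exact h2 ⟨x, hx⟩ (by simp only; omega)
  have e3 : ∀ y ≤ (i : ℕ), ∑ x ∈ Finset.range y, f x + D 0 = D y := by
    intro y hy
    induction y with
    | zero => simp
    | succ y ih =>
      have h3 := h1 ⟨y, by omega⟩ (by simp only; omega)
      have h4 := ih (by omega)
      have h5 : f y = μ ⟨y, by omega⟩ := dif_pos (by omega)
      simp only at h3
      rw [Finset.sum_range_succ, h5]
      omega
  have h6 : f i = μ i := dif_pos i.2
  rw [e1, e2, Finset.sum_range_succ, h6]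
  have := e3 i le_rfl
  omega

/-! ### The decomposition -/

/-- If the module is generated under `𝔫₀⁻` by weight vectors of different weights and these
weights, as far as they are dominant, lie in `P₀⁺(i, m)^σ`, then the module is a direct sum of
pairwise non-isomorphic modules `V(μ)` with `μ` in this set. -/
theorem decomposition_of_span {K : Type} (w : K → KR X n i m) (d : K → Fin n → ℤ)
    (hd : Function.Injective d) (hq : ∀ k, Qpos (d k))
    (hw : ∀ k, w k ∈ (tri X n).wt (KR X n i m) (ev X (m • om n ((i : ℕ) + 1)) - cst (d k)))
    (hspan : Submodule.span ℂ {x | ∃ k d, (tri X n).Word (w k) d x} = ⊤)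
    (hdom : ∀ k μ, w k ≠ 0 → ev X μ = ev X (m • om n ((i : ℕ) + 1)) - cst (d k) →
      μ ∈ domSet X n i m) :
    (∃ mult : domSet X n i m → ℕ, (∀ μ, mult μ = 0 ∨ mult μ = 1) ∧
      Nonempty (KR X n i m ≃ₗ⁅ℂ, g0 X n⁆ ⨁ p : (Σ μ : domSet X n i m, Fin (mult μ)), V X n p.1)) ∧
    FiniteDimensional ℂ (KR X n i m) := by
  classical
  -- A multiplicity is `1` if there is a nonzero singular vector of the corresponding weight.
  have hM : (tri X n).Adm (KR X n i m) (ev X (m • om n ((i : ℕ) + 1))) := by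
    refine ⟨?_, KR_nil⟩
    rw [eq_top_iff, ← hspan, Submodule.span_le]
    rintro x ⟨k, d', hx⟩
    refine Submodule.subset_span ⟨d k + d', (hq k).add hx.nonneg, ?_⟩
    have := hx.mem_wt (hw k)
    rwa [sub_sub, ← cst_add] at this
  have huniq := fun {l : Fin n → ℂ} {u u' : KR X n i m} => TriData.Sing.unique hM w
    (fun k => ev X (m • om n ((i : ℕ) + 1)) - cst (d k))
    (fun k k' h => hd (cst_injective (sub_right_injective h))) hw hspan (l := l) (u := u) (u' := u')
  let mult : domSet X n i m → ℕ := fun μ =>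
    if ∃ u ∈ (tri X n).Sing (KR X n i m) (ev X μ.1), u ≠ 0 then 1 else 0
  have hmult : ∀ μ, mult μ = 0 ∨ mult μ = 1 := fun μ => by
    simp only [mult]
    split_ifs <;> simp
  have hle : ∀ μ, mult μ ≤ 1 := fun μ => by
    rcases hmult μ with h | h <;> omega
  let J := Σ μ : domSet X n i m, Fin (mult μ)
  have hex : ∀ j : J, ∃ φ : V X n j.1 →ₗ⁅ℂ,g0 X n⁆ KR X n i m, φ (vgen X n j.1) ≠ 0 := by
    rintro ⟨μ, a⟩
    have h1 : ∃ u ∈ (tri X n).Sing (KR X n i m) (ev X μ.1), u ≠ 0 := by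
      by_contra hc
      have h2 : mult μ = 0 := if_neg hc
      have := a.2
      omega
    obtain ⟨u, hu, hu0⟩ := h1
    obtain ⟨φ, hφ⟩ := exists_hom_V μ.1 hu hu0 fun j => KR_nil j u
    exact ⟨φ, hφ ▸ hu0⟩
  choose φ hφ using hex
  have hbij : Function.Bijective (TriData.directSumHom φ) := by
    refine TriData.bijective_directSumHom hM (fun j : J => ev X j.1.1) ?_ (fun j => V_adm _)
      (fun j => vgen X n j.1.1) (fun j => vgen_mem_Sing _) (fun j => lieSpan_vgen _) φ hφ ?_
    · rintro ⟨μ, a⟩ ⟨ν, b⟩ h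
      obtain rfl : μ = ν := Subtype.ext (ev_injective h)
      have h1 := hle μ
      have h2 : a = b := Fin.ext (by omega)
      rw [h2]
    · intro l u hu hu0
      obtain ⟨μ, rfl⟩ := exists_weight_of_dom (TriData.Sing.dom hM hu hu0)
      obtain ⟨k, hk, hk0, -⟩ := huniq hu hu hu0
      have hμ := hdom k μ hk0 hk.symm
      have h1 : 0 < mult ⟨μ, hμ⟩ := by
        have h2 : mult ⟨μ, hμ⟩ = 1 := if_pos ⟨u, hu, hu0⟩
        omega
      let j : J := ⟨⟨μ, hμ⟩, ⟨0, h1⟩⟩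
      have h2 : φ j (vgen X n μ) ∈ (tri X n).Sing (KR X n i m) (ev X μ) :=
        ⟨TriData.map_mem_wt _ (vgen_mem_Sing μ).1, fun p => by
          rw [← LieModuleHom.map_lie, (vgen_mem_Sing μ).2, map_zero]⟩
      obtain ⟨-, -, -, c, hc⟩ := huniq h2 hu (hφ j)
      exact ⟨j, c, hc⟩
  let e := LinearEquiv.ofBijective
    (TriData.directSumHom φ : (⨁ j : J, V X n j.1) →ₗ[ℂ] KR X n i m) hbij
  let e' : (⨁ j : J, V X n j.1) ≃ₗ⁅ℂ,g0 X n⁆ KR X n i m :=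
    { TriData.directSumHom φ with
      invFun := e.symm
      left_inv := e.left_inv
      right_inv := e.right_inv }
  refine ⟨⟨mult, hmult, ⟨e'.symm⟩⟩, ?_⟩
  have : Finite (domSet X n i m) := (domSet_finite X n i m).to_subtype
  have : Fintype J := Fintype.ofFinite J
  have : ∀ j : J, FiniteDimensional ℂ (V X n j.1) := fun j => V_finiteDimensional _
  have : FiniteDimensional ℂ (⨁ j : J, V X n j.1) :=
    Module.Finite.equiv (DirectSum.linearEquivFunOnFintype ℂ J fun j => V X n j.1).symm
  exact Module.Finite.equiv e

end Words

/-! ### The three families -/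

section Types

variable {X : TwistedType} {n : ℕ} {i : Fin n} {m : ℕ}

/-- The module `KR^σ(m ω_i)` is finite-dimensional and a direct sum of modules `V(μ)` with
`μ ∈ P₀⁺(i, m)^σ` and multiplicities at most one. -/
abbrev HasDecomposition (X : TwistedType) (n : ℕ) (i : Fin n) (m : ℕ) : Prop :=
  (∃ mult : domSet X n i m → ℕ, (∀ μ, mult μ = 0 ∨ mult μ = 1) ∧
      Nonempty (KR X n i m ≃ₗ⁅ℂ, g0 X n⁆ ⨁ p : (Σ μ : domSet X n i m, Fin (mult μ)), V X n p.1)) ∧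
    FiniteDimensional ℂ (KR X n i m)

theorem lettersA_eq_zero {a b : ℕ} (h : (i : ℕ) < a ∨ (i : ℕ) < b) : lettersA X n i (a, b) = 0 := by
  rw [lettersA, matA, if_neg (by omega), map_zero]

theorem altDepth_eq_zero {k : ℕ → ℕ} {b x : ℕ} (h : b ≤ x) : altDepth k b x = 0 := if_neg (by omega)

theorem altDepth_of_even {k : ℕ → ℕ} {b x : ℕ} (hx : x < b) (h : (b - x) % 2 = 0) :
    altDepth k b x = k x := by
  rw [altDepth, if_pos hx, if_neg (by omega)]

theorem altDepth_of_odd {k : ℕ → ℕ} {b x : ℕ} (hx : x < b) (h : (b - x) % 2 = 1) (h0 : k x = 0) :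
    altDepth k b x = if x = 0 then 0 else k (x - 1) := by
  rw [altDepth, if_pos hx]
  by_cases hx0 : x = 0
  · subst hx0
    simpa using h0
  · rw [if_pos ⟨h, hx0⟩, if_neg hx0, h0, zero_add]

theorem decomposition_of_alt {z : ℕ × ℕ → gt X n} (hz : LetterSystem X n i m z)
    (hs : ∀ a b, z (a, b) = -z (b, a)) (h0 : ∀ a b, (i : ℕ) + 1 < b → z (a, b) = 0)
    (hdom : ∀ (k : Exponents i) (μ : Weight n),
      wd (opZ m z) (kgen X n i m) (altWord (i + 1) k.1 (i + 1)) ≠ 0 →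
      ev X μ = ev X (m • om n ((i : ℕ) + 1)) -
        cst (fun x : Fin n => (altDepth k.1 (i + 1) x : ℤ)) → μ ∈ domSet X n i m) :
    HasDecomposition X n i m := by
  refine decomposition_of_span
    (fun k : Exponents i => wd (opZ m z) (kgen X n i m) (altWord (i + 1) k.1 (i + 1)))
    _ altDepth_injective (fun k => Qpos_natCast _) (fun k => ?_) (hz.span_alt hs h0) hdom
  rw [← sum_altWord_eq]
  exact wd_mem_wt hz.weights _

/-- In type `A_{2n-1}` the letters form an antisymmetric matrix. The exponent of a letter with the
indices `x`, `x + 1` occurs at both coordinates, so that every second coefficient of the weight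
vanishes. -/
theorem decomposition_AOdd (hX : X = .AOdd) : HasDecomposition X n i m := by
  have hz : LetterSystem X n i m (lettersA X n i) := letterSystemA (by rw [hX]; simp)
  have hcl : clX X = 1 := by rw [hX]; rfl
  have hsize : size X n = 2 * n := by rw [hX]
  refine decomposition_of_alt hz (fun a b => ?_)
    (fun a b hb => lettersA_eq_zero (Or.inr (by omega))) fun k μ hk hμ => ?_
  · have h1 : -(-1 : ℂ) ^ size X n = -1 := by rw [hsize, pow_mul]; norm_num
    rw [lettersA_swap (by rw [hX]; simp), h1, neg_one_smul]
  -- The letters with an index `i + 1` vanish, so their exponents are zero.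
  have hk0 : ∀ x < (i : ℕ) + 1, ((i : ℕ) + 1 - x) % 2 = 1 → k.1 x = 0 := by
    intro x hx hx'
    by_contra hc
    refine hk (wd_eq_zero_of_mem (x := (x, (i : ℕ) + 1)) ?_ (mem_altWord hc hx hx'))
    rw [opZ, lettersA_eq_zero (Or.inr (by omega)), map_zero]
  have hi := i.2
  obtain ⟨h1, h2, h3⟩ := coeff_of_depth (D := altDepth k.1 (i + 1))
    (fun x hx => altDepth_eq_zero (by omega)) hμ
  have hsum := sum_of_telescope (D := altDepth k.1 (i + 1)) h1 h3
  have h2' : μ i + altDepth k.1 (i + 1) i = m := by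
    rw [hcl, ite_self, one_mul] at h2
    exact h2
  refine mem_domSet_AOdd hX h3 (fun x hx => ?_) (by omega) fun h => ?_
  · rcases lt_trichotomy (x : ℕ) i with hxi | hxi | hxi
    · have h4 := h1 x hxi
      rw [altDepth_of_even (x := x) (by omega) (by omega),
        altDepth_of_odd (x := x + 1) (by omega) (by omega) (hk0 _ (by omega) (by omega)),
        if_neg (by omega), Nat.add_sub_cancel] at h4
      omega
    · omega
    · exact h3 x hxi
  · rw [altDepth_of_odd (x := 0) (by omega) (by omega) (hk0 _ (by omega) (by omega)),
      if_pos rfl] at hsum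
    omega

/-- In type `A_{2n}` the letters form a symmetric matrix, and the depth of a monomial in the diagonal
letters is twice its exponent. -/
theorem decomposition_AEven (hX : X = .AEven) : HasDecomposition X n i m := by
  have hz : LetterSystem X n i m (lettersA X n i) := letterSystemA (by rw [hX]; simp)
  have hcl : clX X = 2 := by rw [hX]; rfl
  have hsize : size X n = 2 * n + 1 := by rw [hX]
  have hs : ∀ a b, lettersA X n i (a, b) = lettersA X n i (b, a) := by
    intro a b
    have h1 : -(-1 : ℂ) ^ size X n = 1 := by rw [hsize, pow_succ, pow_mul]; norm_num
    rw [lettersA_swap (by rw [hX]; simp), h1, one_smul]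
  refine decomposition_of_span
    (fun k : Exponents i => wd (opZ m (lettersA X n i)) (kgen X n i m) (symWord k.1 (i + 1)))
    _ symDepth_injective (fun k => Qpos_natCast fun x => 2 * k.1 x) (fun k => ?_)
    (hz.span_sym hs fun a b hb => lettersA_eq_zero (Or.inr (by omega))) fun k μ _ hμ => ?_
  · rw [← sum_symWord_eq]
    exact wd_mem_wt hz.weights _
  have hi := i.2
  obtain ⟨h1, h2, h3⟩ := coeff_of_depth (D := fun x => 2 * k.1 x)
    (fun x hx => by simp only [k.2 x hx, mul_zero]) hμ
  have hsum := sum_of_telescope (D := fun x => 2 * k.1 x) h1 h3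
  have heven : ∀ x : Fin n, x ≠ i → μ x % 2 = 0 := by
    intro x hx
    have hne := Fin.val_ne_of_ne hx
    rcases lt_trichotomy (x : ℕ) i with hxi | hxi | hxi
    · have h4 := h1 x hxi
      omega
    · exact absurd hxi hne
    · rw [h3 x hxi]
  by_cases hin : (i : ℕ) + 1 < n
  · rw [if_pos hin] at h2
    exact mem_domSet_AEven hX hin h3 heven (by omega) (by omega)
  · rw [if_neg hin, hcl] at h2
    exact mem_domSet_AEven_last hX (by omega) heven (by omega) (by omega)

/-- In type `D_{n+1}` the letters form an antisymmetric matrix with an additional row and column for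
the short roots. -/
theorem decomposition_D (hX : X = .D) : HasDecomposition X n i m := by
  have hi := i.2
  by_cases hin : (i : ℕ) + 1 < n
  · refine decomposition_of_alt (letterSystemD hX) (lettersD_swap hX)
      (fun a b hb => lettersD_eq_zero (by omega)) fun k μ _ hμ => ?_
    obtain ⟨h1, h2, h3⟩ := coeff_of_depth (D := altDepth k.1 (i + 1))
      (fun x hx => altDepth_eq_zero (by omega)) hμ
    have hsum := sum_of_telescope (D := altDepth k.1 (i + 1)) h1 h3
    rw [if_pos hin] at h2
    exact mem_domSet_D hX hin h3 (by omega)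
  · -- For the last node the positive powers of `t` annihilate the generator.
    refine decomposition_of_span (K := Unit) (fun _ => kgen X n i m) (fun _ => 0)
      (fun _ _ _ => rfl) (fun _ => Qpos_zero) (fun _ => ?_) ?_ fun _ μ _ hμ => ?_
    · rw [cst_zero, sub_zero]
      exact kgen_mem_wt
    · have hT : ∀ p, ∀ x ∈ Submodule.span ℂ
          {x | ∃ (_ : Unit) (d : _), (tri X n).Word (kgen X n i m) d x},
          ⁅(tri X n).f p, x⁆ ∈ Submodule.span ℂ
            {x | ∃ (_ : Unit) (d : _), (tri X n).Word (kgen X n i m) d x} := by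
        intro p x hx
        induction hx using Submodule.span_induction with
        | mem x hx =>
          obtain ⟨k, d, hx⟩ := hx
          exact Submodule.subset_span ⟨k, _, hx.step p⟩
        | zero => rw [lie_zero]; exact zero_mem _
        | add a b _ _ ha hb => rw [lie_add]; exact add_mem ha hb
        | smul c a _ ha => rw [lie_smul]; exact Submodule.smul_mem _ _ ha
      refine eq_top_of_letters (fun _ => 0) (fun p x => ?_)
        (fun r hr p q => Or.inr (Tt_E_lie_last_D hX (by omega) r hr p q)) _ hT fun L => ?_
      · rw [lie_zero]
        exact zero_mem _
      · cases L with
        | nil => exact Submodule.subset_span ⟨(), 0, TriData.Word.base⟩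
        | cons x L =>
          rw [wd_cons, map_zero]
          exact zero_mem _
    · rw [cst_zero, sub_zero] at hμ
      rw [ev_injective hμ]
      exact smul_om_mem_domSet_D hX (by omega)

end Types

end TwistedKR

end

theorem proposition3p6 (X : TwistedKR.TwistedType) (n : ℕ) (hn : X.minRank ≤ n)
    (i : Fin n) (m : ℕ) :
    (∃ mult : TwistedKR.domSet X n i m → ℕ, (∀ μ, mult μ = 0 ∨ mult μ = 1) ∧
      Nonempty (TwistedKR.KR X n i m ≃ₗ⁅ℂ, TwistedKR.g0 X n⁆
        ⨁ p : (Σ μ : TwistedKR.domSet X n i m, Fin (mult μ)), TwistedKR.V X n p.1)) ∧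
    FiniteDimensional ℂ (TwistedKR.KR X n i m) := by
  rcases hX : X with _ | _ | _
  · exact hX ▸ TwistedKR.decomposition_AOdd hX
  · exact hX ▸ TwistedKR.decomposition_AEven hX
  · exact hX ▸ TwistedKR.decomposition_D hX
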